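/- **Theorem (pathwise uniqueness for the stochastic Landau–Lifshitz–Bloch equation).** Let $d\in\{1,2\}$, let $D\subset\mathbb R^d$ be a bounded domain (open, connected) with $C^2$ boundary, let $T>0$, let $\kappa_1,\kappa_2,\gamma,\mu>0$, and let $h_k:D\to\mathbb R^3$ ($k\ge 1$) satisfy $\sum_k\|h_k\|_{W^{1,\infty}(D)}^2<\infty$. Write $\mathbb L^2=L^2(D;\mathbb R^3)$, $\mathbb H^j=H^j(D;\mathbb R^3)$, $\mathbb L^4=L^4(D;\mathbb R^3)$, and $G_k(v)=\gamma\, v\times h_k+\kappa_1 h_k$ for $v\in\mathbb L^2$. Let $u_0\in\mathbb H^1$. Let $(\Omega,\mathcal F,\mathbb F,\mathbb P)$ be a filtered probability space satisfying the usual conditions and let $W=(W_k)_{k\ge1}$ be a sequence of independent real-valued $\mathbb F$-Wiener processes (adapted, with $(W_k(t)-W_k(s))_k$ independent of $\mathcal F_s$ for $s\le t$). Stratonovich integrals are understood in Itô form, $$\int_0^t G_k(u)\circ dW_k=\tfrac12\int_0^t G_k'(u)[G_k(u)]\,ds+\int_0^t G_k(u)\,dW_k ,$$ where $G_k'$ is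 the Fréchet derivative on $\mathbb L^2$, and series of such integrals converge in probability at each time. A *weak martingale solution* on this basis with initial datum $u_0$ is a progressively measurable process $u:[0,T]\times\Omega\to\mathbb H^1\cap\mathbb L^4$ such that $\mathbb P$-a.s. $u\in L^\infty(0,T;\mathbb H^1)$ and, for every $\varphi\in C_c^\infty(D;\mathbb R^3)$ and every $t\in[0,T]$, $\mathbb P$-a.s. $$\begin{aligned}\langle u(t),\varphi\rangle=\langle u_0,\varphi\rangle&-\kappa_1\int_0^t\langle\nabla u,\nabla\varphi\rangle ds-\gamma\int_0^t\langle u\times\nabla u,\nabla\varphi\rangle ds\\&-\kappa_2\int_0^t\langle(1+\mu|u|^2)u,\varphi\rangle ds+\sum_{k}\int_0^t\langle G_k(u),\varphi\rangle\circ dW_k .\end{aligned}$$ Let $u_1,u_2$ be two weak martingale solutions on the same basis $(\Omega,\mathcal F,\mathbb F,\mathbb P,W)$, with initial datum $u_0$, such that for $i=1,2$: (a) $u_i(0)=u_0$ $\mathbb P$-a.s.; (b) $\mathbb P$-a.s. the path of $u_i$ lies in $L^\infty(0,T;\mathbb H^1)\cap L^2(0,T;\mathbb H^2)$ and, for a.e.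 $t\in[0,T]$, $u_i(t)$ satisfies the homogeneous Neumann boundary condition, in the weak form $\langle\nabla u_i(t),\nabla\psi\rangle=-\langle\Delta u_i(t),\psi\rangle$ for all $\psi\in\mathbb H^1$; (c) for every $t\in[0,T]$, $\mathbb P$-a.s., in $\mathbb L^2$, $$u_i(t)=u_i(0)+\kappa_1\int_0^t\Delta u_i\,ds+\gamma\int_0^t u_i\times\Delta u_i\,ds-\kappa_2\int_0^t(1+\mu|u_i|^2)u_i\,ds+\sum_{k}\int_0^t G_k(u_i)\circ dW_k .$$ Then $u_1$ and $u_2$ coincide: for $\mathbb P$-a.e. $\omega$, $u_1(\cdot,\omega)=u_2(\cdot,\omega)$ as elements of $L^\infty(0,T;\mathbb H^1)\cap L^2(0,T;\mathbb H^2)$ (that is, for a.e. $t\in[0,T]$); for every $t\in[0,T]$, $u_1(t)=u_2(t)$ $\mathbb P$-a.s.; and if, in addition, almost all paths of $u_1$ and $u_2$ are continuous from $[0,T]$ to $\mathbb L^2$, then for $\mathbb P$-a.e. $\omega$, $u_1(t,\omega)=u_2(t,\omega)$ for all $t\in[0,T]$. -/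

import Mathlib

open MeasureTheory ProbabilityTheory Filter Topology TopologicalSpace
open scoped NNReal ENNReal Distributions RealInnerProductSpace

noncomputable section

namespace SLLB

/-! ### Function spaces on a domain of `ℝ^d` -/

/-- The physical space `ℝ^d`. -/
abbrev Space (d : ℕ) : Type := EuclideanSpace ℝ (Fin d)

/-- The space `ℝ³` of spin values, with the Euclidean norm. -/
abbrev Spin : Type := EuclideanSpace ℝ (Fin 3)

/-- The vector product of `ℝ³`. -/
def cross (a b : Spin) : Spin := WithLp.toLp 2 (crossProduct a.ofLp b.ofLp)

/-- The `i`-th coordinate vector of `ℝ^d`. -/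
def coordVec {d : ℕ} (i : Fin d) : Space d := EuclideanSpace.single i 1

/-- `D` has a `C²` boundary: near each of its boundary points, for a suitable direction `e`, the set
`D` is the part of the space lying above the graph of a `C²` function of the coordinates orthogonal
to `e` (the function `g` is only evaluated at points of the hyperplane orthogonal to `e`).
For bounded `D`, whose boundary is compact, this is automatically uniform. -/
def HasC2Boundary {d : ℕ} (D : Set (Space d)) : Prop :=
  ∀ x₀ ∈ frontier D, ∃ r : ℝ, 0 < r ∧ ∃ e : Space d, ‖e‖ = 1 ∧ ∃ g : Space d → ℝ,
    ContDiff ℝ 2 g ∧ ∀ x ∈ Metric.ball x₀ r, (x ∈ D ↔ g (x - ⟪e, x⟫ • e) < ⟪e, x⟫)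

section Spaces

variable {d : ℕ} (D : Opens (Space d))

/-- Lebesgue measure on `D`. -/
abbrev volOn : Measure (Space d) := volume.restrict (D : Set (Space d))

/-- The Hilbert space `𝕃² = L²(D; ℝ³)`. -/
abbrev L2 : Type := Lp Spin 2 (volOn D)

/-- The element of `𝕃²` given by a square integrable function (and `0` for other functions). -/
def toL2 (f : Space d → Spin) : L2 D :=
  open Classical in if h : MemLp f 2 (volOn D) then h.toLp f else 0

/-- `g` is the weak partial derivative `∂f/∂x_i` on `D`, for locally integrable `f` and `g`. -/
def IsWeakPartial (i : Fin d) (f g : Space d → Spin) : Prop :=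
  LocallyIntegrableOn f (D : Set (Space d)) ∧ LocallyIntegrableOn g (D : Set (Space d)) ∧
    ∀ φ : 𝓓(D, ℝ), ∫ x in (D : Set (Space d)), (fderiv ℝ φ x (coordVec i)) • f x
      = -∫ x in (D : Set (Space d)), φ x • g x

/-- The norm of `W^{1,∞}(D; ℝ³)`; it is `∞` for functions outside of this space. The infima are over
the weak partial derivatives, which are unique up to null sets when they exist. -/
def w1InftyNorm (f : Space d → Spin) : ℝ≥0∞ :=
  eLpNorm f ∞ (volOn D) +
    ∑ i : Fin d, ⨅ (g : Space d → Spin) (_ : IsWeakPartial D i f g), eLpNorm g ∞ (volOn D)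

variable {D}

/-- Membership in `ℍ¹ = H¹(D; ℝ³)`. -/
def MemH1 (f : L2 D) : Prop := ∀ i : Fin d, ∃ g : L2 D, IsWeakPartial D i f g

/-- The weak partial derivative `∂f/∂x_i` as an element of `𝕃²` (and `0` if there is none). -/
def weakPartial (i : Fin d) (f : L2 D) : L2 D :=
  open Classical in if h : ∃ g : L2 D, IsWeakPartial D i f g then h.choose else 0

/-- Membership in `ℍ² = H²(D; ℝ³)`. -/
def MemH2 (f : L2 D) : Prop := MemH1 f ∧ ∀ i : Fin d, MemH1 (weakPartial i f)

/-- The norm of `ℍ¹`, on the elements of `ℍ¹`. -/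
def h1Norm (f : L2 D) : ℝ := √(‖f‖ ^ 2 + ∑ i : Fin d, ‖weakPartial i f‖ ^ 2)

/-- The norm of `ℍ²`, on the elements of `ℍ²`. -/
def h2Norm (f : L2 D) : ℝ :=
  √(‖f‖ ^ 2 + ∑ i : Fin d, ‖weakPartial i f‖ ^ 2
    + ∑ i : Fin d, ∑ j : Fin d, ‖weakPartial j (weakPartial i f)‖ ^ 2)

/-- The Laplacian `Δf`, for `f ∈ ℍ²`. -/
def laplacian (f : L2 D) : L2 D := ∑ i : Fin d, weakPartial i (weakPartial i f)

/-- The homogeneous Neumann boundary condition `∂f/∂n = 0` on `∂D`, for `f ∈ ℍ²`, in the usual weak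
form: Green's formula `⟨∇f, ∇ψ⟩ = -⟨Δf, ψ⟩` without boundary term, for every `ψ ∈ ℍ¹`. -/
def SatisfiesNeumann (f : L2 D) : Prop :=
  ∀ ψ : L2 D, MemH1 ψ →
    ∑ i : Fin d, ⟪weakPartial i f, weakPartial i ψ⟫ = -⟪laplacian f, ψ⟫

/-- The pointwise vector product `f × g`. -/
def crossL2 (f g : L2 D) : L2 D := toL2 D (fun x => cross (f x) (g x))

/-- The function `(1 + μ|f|²) f`. -/
def dampingL2 (μ : ℝ) (f : L2 D) : L2 D := toL2 D (fun x => (1 + μ * ‖f x‖ ^ 2) • f x)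

/-- The noise coefficient `G(f) = γ f × η + κ₁ η`, for a given field `η`. -/
def noiseL2 (γ κ₁ : ℝ) (η : Space d → Spin) (f : L2 D) : L2 D :=
  toL2 D (fun x => γ • cross (f x) (η x) + κ₁ • η x)

/-- `⟨∇f, ∇φ⟩_{𝕃²}` for a test function `φ`. -/
def gradPairing (f : L2 D) (φ : 𝓓(D, Spin)) : ℝ :=
  ∑ i : Fin d, ∫ x in (D : Set (Space d)), ⟪weakPartial i f x, fderiv ℝ φ x (coordVec i)⟫

/-- `⟨f × ∇f, ∇φ⟩_{𝕃²}` for a test function `φ`. -/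
def crossGradPairing (f : L2 D) (φ : 𝓓(D, Spin)) : ℝ :=
  ∑ i : Fin d, ∫ x in (D : Set (Space d)),
    ⟪cross (f x) (weakPartial i f x), fderiv ℝ φ x (coordVec i)⟫

end Spaces

/-! ### Stochastic bases and stochastic integrals -/

/-- Lebesgue measure on the time axis `[0, ∞)`. -/
def leb : Measure ℝ≥0 := Measure.comap NNReal.toReal volume

section Stochastic

variable {Ω : Type*} [mΩ : MeasurableSpace Ω]

/-- The usual conditions on `(Ω, 𝓕, P)`: right-continuity and completeness. -/
def UsualConditions (P : Measure Ω) (𝓕 : Filtration ℝ≥0 mΩ) : Prop :=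
  𝓕.IsRightContinuous ∧ ∀ s : Set Ω, P s = 0 → MeasurableSet[𝓕 0] s

/-- `W = (W_k)` is a sequence of independent real-valued Wiener processes with respect to the
filtration `𝓕`: it is adapted, and its increments after time `s` are independent of `𝓕 s`. -/
structure IsWienerSequence (P : Measure Ω) (𝓕 : Filtration ℝ≥0 mΩ)
    (W : ℕ → ℝ≥0 → Ω → ℝ) : Prop where
  brownian : ∀ k, IsBrownianReal (W k) P
  indep : iIndepFun (fun k ω t => W k t ω) P
  adapted : ∀ k, StronglyAdapted 𝓕 (W k)
  indep_increments : ∀ s t : ℝ≥0, s ≤ t →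
    Indep (MeasurableSpace.comap (fun ω k => W k t ω - W k s ω) MeasurableSpace.pi) (𝓕 s) P

/-- Simple processes `∑_{i < n} ξ_i 1_{(t_i, t_{i+1}]}` with `ξ_i` bounded and
`𝓕 (t_i)`-measurable. -/
structure SimpleProcess (𝓕 : Filtration ℝ≥0 mΩ) (H : Type*) [NormedAddCommGroup H] where
  /-- The number of steps. -/
  n : ℕ
  /-- The partition points. -/
  time : ℕ → ℝ≥0
  /-- The values of the process. -/
  ξ : ℕ → Ω → H
  mono : Monotone time
  meas : ∀ i, StronglyMeasurable[𝓕 (time i)] (ξ i)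
  bdd : ∃ C : ℝ, ∀ i ω, ‖ξ i ω‖ ≤ C

variable {𝓕 : Filtration ℝ≥0 mΩ} {H : Type*} [NormedAddCommGroup H] [NormedSpace ℝ H]

/-- The value of a simple process at time `s`. -/
def SimpleProcess.val (S : SimpleProcess 𝓕 H) (s : ℝ≥0) (ω : Ω) : H :=
  ∑ i ∈ Finset.range S.n, (Set.Ioc (S.time i) (S.time (i + 1))).indicator (fun _ => S.ξ i ω) s

/-- The elementary stochastic integral `∑_{i < n} (B(t_{i+1} ∧ t) - B(t_i ∧ t)) ξ_i`. -/
def SimpleProcess.integral (S : SimpleProcess 𝓕 H) (B : ℝ≥0 → Ω → ℝ) (t : ℝ≥0) (ω : Ω) : H :=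
  ∑ i ∈ Finset.range S.n,
    (B (min (S.time (i + 1)) t) ω - B (min (S.time i) t) ω) • S.ξ i ω

/-- `I(t) = ∫₀ᵗ a(s) dB(s)` for `t ∈ [0, T]`, Itô's integral: there are simple processes `S_n` with
`∫₀ᵀ ‖S_n(s) - a(s)‖² ds → 0` in probability whose elementary integrals up to time `t` converge in
probability to `I(t)`, for each `t ∈ [0, T]`. -/
def IsItoIntegral (P : Measure Ω) (𝓕 : Filtration ℝ≥0 mΩ) (T : ℝ≥0) (B : ℝ≥0 → Ω → ℝ)
    (a I : ℝ≥0 → Ω → H) : Prop :=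
  ∃ S : ℕ → SimpleProcess 𝓕 H,
    (∀ ε : ℝ≥0∞, 0 < ε → Tendsto
      (fun n => P {ω | ε ≤ ∫⁻ s in Set.Icc 0 T, ‖(S n).val s ω - a s ω‖ₑ ^ 2 ∂leb}) atTop (𝓝 0)) ∧
    ∀ t ≤ T, TendstoInMeasure P (fun n => (S n).integral B t) atTop (I t)

/-- The correction term `½ G'(v)[G(v)]` in the Itô form
`G(v) ∘ dB = ½ G'(v)[G(v)] dt + G(v) dB` of a Stratonovich differential. -/
def stratonovichCorrection (G : H → H) (v : H) : H := (1 / 2 : ℝ) • fderiv ℝ G v (G v)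

/-- `N(t) = ∑_k ∫₀ᵗ ℓ(G_k(u(s))) ∘ dW_k(s)` for `t ∈ [0, T]`, where `ℓ` is a bounded linear map. Each
Stratonovich integral is `∫₀ᵗ ℓ(½ G_k'(u)[G_k(u)]) ds + ∫₀ᵗ ℓ(G_k(u)) dW_k`, and the series
converges in probability. -/
def IsStratonovichSum {F : Type*} [NormedAddCommGroup F] [NormedSpace ℝ F]
    (P : Measure Ω) (𝓕 : Filtration ℝ≥0 mΩ) (T : ℝ≥0) (W : ℕ → ℝ≥0 → Ω → ℝ)
    (G : ℕ → H → H) (ℓ : H →L[ℝ] F) (u : ℝ≥0 → Ω → H) (N : ℝ≥0 → Ω → F) : Prop :=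
  ∃ I : ℕ → ℝ≥0 → Ω → F,
    (∀ k, IsItoIntegral P 𝓕 T (W k) (fun s ω => ℓ (G k (u s ω))) (I k)) ∧
    ∀ t ≤ T, TendstoInMeasure P
      (fun n ω => ∑ k ∈ Finset.range n,
        ((∫ s in Set.Icc 0 t, ℓ (stratonovichCorrection (G k) (u s ω)) ∂leb) + I k t ω))
      atTop (N t)

/-! ### The stochastic Landau–Lifshitz–Bloch equation -/

variable {d : ℕ} {D : Opens (Space d)}

/-- `u` is a weak martingale solution, on `[0, T]` and on the given stochastic basis, of
`du = (κ₁ Δu + γ u × Δu - κ₂ (1 + μ|u|²) u) dt + ∑_k (γ u × h_k + κ₁ h_k) ∘ dW_k`, `u(0) = u₀`.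
Only the values `u(t)` with `t ≤ T` matter. -/
structure IsWeakMartingaleSolution (T : ℝ≥0) (κ₁ κ₂ γ μ : ℝ) (h : ℕ → Space d → Spin)
    (u₀ : L2 D) (P : Measure Ω) (𝓕 : Filtration ℝ≥0 mΩ) (W : ℕ → ℝ≥0 → Ω → ℝ)
    (u : ℝ≥0 → Ω → L2 D) : Prop where
  usual : UsualConditions P 𝓕
  wiener : IsWienerSequence P 𝓕 W
  progressive : IsStronglyProgressive 𝓕 (fun t => u (min t T))
  mem : ∀ t ≤ T, ∀ ω, MemH1 (u t ω) ∧ MemLp (u t ω) 4 (volOn D)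
  bdd : ∀ᵐ ω ∂P, ∃ C : ℝ, ∀ᵐ t ∂(leb.restrict (Set.Icc 0 T)), h1Norm (u t ω) ≤ C
  weak_eq : ∀ φ : 𝓓(D, Spin), ∃ N : ℝ≥0 → Ω → ℝ,
    IsStratonovichSum P 𝓕 T W (fun k => noiseL2 γ κ₁ (h k)) (innerSL ℝ (toL2 D φ)) u N ∧
    ∀ t ≤ T, ∀ᵐ ω ∂P,
      ⟪toL2 D φ, u t ω⟫ = ⟪toL2 D φ, u₀⟫
        - κ₁ * (∫ s in Set.Icc 0 t, gradPairing (u s ω) φ ∂leb)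
        - γ * (∫ s in Set.Icc 0 t, crossGradPairing (u s ω) φ ∂leb)
        - κ₂ * (∫ s in Set.Icc 0 t, ⟪toL2 D φ, dampingL2 μ (u s ω)⟫ ∂leb)
        + N t ω

/-- Almost all paths of `u` lie in `L^∞(0, T; ℍ¹) ∩ L²(0, T; ℍ²)`. -/
def HasStrongPaths (T : ℝ≥0) (P : Measure Ω) (u : ℝ≥0 → Ω → L2 D) : Prop :=
  ∀ᵐ ω ∂P,
    (∃ C : ℝ, ∀ᵐ t ∂(leb.restrict (Set.Icc 0 T)), MemH1 (u t ω) ∧ h1Norm (u t ω) ≤ C) ∧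
    (∀ᵐ t ∂(leb.restrict (Set.Icc 0 T)), MemH2 (u t ω)) ∧
    ∫⁻ t in Set.Icc 0 T, ENNReal.ofReal (h2Norm (u t ω)) ^ 2 ∂leb < ∞

/-- For almost all `ω` and almost all `t ∈ [0, T]`, the homogeneous Neumann boundary condition. -/
def HasNeumannPaths (T : ℝ≥0) (P : Measure Ω) (u : ℝ≥0 → Ω → L2 D) : Prop :=
  ∀ᵐ ω ∂P, ∀ᵐ t ∂(leb.restrict (Set.Icc 0 T)), SatisfiesNeumann (u t ω)

/-- The equation in integrated form, as an identity in `𝕃²`. -/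
def SatisfiesStrongEquation (T : ℝ≥0) (κ₁ κ₂ γ μ : ℝ) (h : ℕ → Space d → Spin)
    (P : Measure Ω) (𝓕 : Filtration ℝ≥0 mΩ) (W : ℕ → ℝ≥0 → Ω → ℝ)
    (u : ℝ≥0 → Ω → L2 D) : Prop :=
  ∃ N : ℝ≥0 → Ω → L2 D,
    IsStratonovichSum P 𝓕 T W (fun k => noiseL2 γ κ₁ (h k)) (ContinuousLinearMap.id ℝ (L2 D)) u N ∧
    ∀ t ≤ T, ∀ᵐ ω ∂P,
      u t ω = u 0 ω
        + κ₁ • (∫ s in Set.Icc 0 t, laplacian (u s ω) ∂leb)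
        + γ • (∫ s in Set.Icc 0 t, crossL2 (u s ω) (laplacian (u s ω)) ∂leb)
        - κ₂ • (∫ s in Set.Icc 0 t, dampingL2 μ (u s ω) ∂leb)
        + N t ω

end Stochastic

end SLLB

end

open SLLB

set_option linter.unusedSectionVars false


/-! Let `w = u₁ - u₂`. The additive part of the noise drops out of the difference, so `w` solves an
equation with noise `∑ R_k w dW_k`, where `R_k v = γ v × h_k` is a bounded skew-symmetric operator
and `∑ ‖R_k‖² < ∞`. Skew-symmetry acts twice. The martingale part of `d‖w‖²` is `2∑⟨w, R_k w⟩ dW_k =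
0`. The Stratonovich correction contributes `⟨w, ∑ R_k² w⟩ = -∑‖R_k w‖²`, which cancels the Itô
correction exactly. Only the deterministic drift is left, so that pathwise `‖w(t)‖² ≤ ∫₀ᵗ g ‖w‖²`
with a random `g` integrable in time, and a Gronwall argument gives `w = 0`
(`IsSkewNoiseEquation.eq_zero`).

The rate `g` comes from `exists_inner_drift_le`. The damping is monotone, the Laplacian dissipates
`∑‖∂ᵢw‖²`, and in the gyroscopic term `w × Δu₁` is orthogonal to `w`, while `v × Δw` (with `v = u₂`)
becomes `-∑⟨∂ᵢw, w × ∂ᵢv⟩` after integration by parts with the Neumann condition. This last term is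
absorbed by means of the Ladyzhenskaya type inequality `‖f × g‖² ≤ C (‖f‖² + 2∑‖f‖‖∂ᵢf‖)(‖g‖² +
2∑‖g‖‖∂ᵢg‖)` of dimensions one and two. The resulting `g` is quadratic in the `ℍ²` norm of `u₂` on
paths bounded in `ℍ¹`, hence integrable.

The energy inequality `IsSkewNoiseEquation.norm_sq_le` replaces Itô's formula. The equation is known
only at each fixed time almost surely, without continuity of paths, and the stochastic integral is
known only as a limit in probability of elementary integrals. Therefore `‖w(τ)‖²` is expanded as a
telescoping sum over a uniform grid. Over each cell the noise increment is compared with the one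
whose coefficient is frozen and truncated at the left end. The frozen increment is orthogonal to the
left value, its squares converge by a fourth moment computation
(`IsBddAdapted.measure_quadVar_error_le`), and all remainders vanish by a Lenglart inequality,
proved for discrete integrals by stopping and transferred to Itô integrals by approximation
(`HasSimpleApprox.measure_sum_sq_ge_le`).

The Sobolev inequalities rest on one tool: a weakly differentiable function satisfies a weighted
fundamental theorem of calculus on almost every segment contained in `D` (`WeakDeriv.ae_segment`).
It yields the product rule through difference quotients. Together with the local cones provided by
the boundary regularity, it yields the embedding of `W^{2,1}` into `L^∞` and the bound of `∫|φψ|` by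
`W^{1,1}` norms. -/

namespace SLLB

/-! ### Wiener increments: moments and independence of the past. -/

section Increments

variable {Ω : Type*} [mΩ : MeasurableSpace Ω] {P : Measure Ω} {𝓕 : Filtration ℝ≥0 mΩ}
  {W : ℕ → ℝ≥0 → Ω → ℝ}

theorem IsWienerSequence.hasLaw_incr (hW : IsWienerSequence P 𝓕 W) (k : ℕ) {s t : ℝ≥0}
    (hst : s ≤ t) :
    HasLaw (fun ω => W k t ω - W k s ω) (gaussianReal 0 (t - s)) P := by
  have h := (hW.brownian k).hasLaw_sub t s
  have e : nndist (t : ℝ) (s : ℝ) = t - s := by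
    have hst' : (s : ℝ) ≤ t := hst
    ext
    rw [coe_nndist, Real.dist_eq, abs_of_nonneg (sub_nonneg.2 hst'), NNReal.coe_sub hst]
  have h' : HasLaw (W k t - W k s) (gaussianReal 0 (nndist (t : ℝ) (s : ℝ))) P := h
  rw [e] at h'
  exact h'

theorem IsWienerSequence.memLp_incr (hW : IsWienerSequence P 𝓕 W) (k : ℕ) {s t : ℝ≥0}
    (hst : s ≤ t) (p : ℝ≥0∞) (hp : p ≠ ∞ := by simp) :
    MemLp (fun ω => W k t ω - W k s ω) p P := by
  lift p to ℝ≥0 using hp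
  have h := hW.hasLaw_incr k hst
  have h2 : MemLp id p (gaussianReal 0 (t - s)) := memLp_id_gaussianReal p
  rw [← h.map_eq] at h2
  exact (memLp_map_measure_iff aestronglyMeasurable_id h.aemeasurable).1 h2

theorem IsWienerSequence.integral_incr (hW : IsWienerSequence P 𝓕 W) (k : ℕ) {s t : ℝ≥0}
    (hst : s ≤ t) : ∫ ω, (W k t ω - W k s ω) ∂P = 0 := by
  rw [(hW.hasLaw_incr k hst).integral_eq, integral_id_gaussianReal]

theorem IsWienerSequence.integral_incr_sq (hW : IsWienerSequence P 𝓕 W) (k : ℕ) {s t : ℝ≥0}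
    (hst : s ≤ t) : ∫ ω, (W k t ω - W k s ω) ^ 2 ∂P = t - s := by
  have h := hW.hasLaw_incr k hst
  have h1 : ∫ ω, (W k t ω - W k s ω) ^ 2 ∂P = ∫ x, x ^ 2 ∂(gaussianReal 0 (t - s)) := by
    have := h.integral_comp (f := fun x : ℝ => x ^ 2) (by fun_prop)
    simpa using this
  have h2 : Var[id; gaussianReal 0 (t - s)] = (t - s : ℝ≥0) := by
    simp
  rw [variance_of_integral_eq_zero (by fun_prop) (by simp)] at h2
  rw [h1, ← NNReal.coe_sub hst, ← h2]
  rfl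

/-- The fourth moment of the standard normal distribution. -/
noncomputable def fourthMoment : ℝ := ∫ x, x ^ 4 ∂(gaussianReal 0 1)

/-- Brownian scaling. The constant is not evaluated: only the square of the length of the interval
matters later. -/
theorem IsWienerSequence.integral_incr_pow_four (hW : IsWienerSequence P 𝓕 W) (k : ℕ)
    {s t : ℝ≥0} (hst : s ≤ t) :
    ∫ ω, (W k t ω - W k s ω) ^ 4 ∂P = fourthMoment * (t - s) ^ 2 := by
  have h := hW.hasLaw_incr k hst
  have h1 : ∫ ω, (W k t ω - W k s ω) ^ 4 ∂P = ∫ x, x ^ 4 ∂(gaussianReal 0 (t - s)) := by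
    have := h.integral_comp (f := fun x : ℝ => x ^ 4) (by fun_prop)
    simpa using this
  have h2 : gaussianReal 0 (t - s) = (gaussianReal 0 1).map (fun x => √(t - s : ℝ≥0) * x) := by
    rw [gaussianReal_map_const_mul]
    congr 1
    · simp
    · ext; simp
  rw [h1, h2, integral_map (by fun_prop) (by fun_prop), fourthMoment, mul_comm,
    ← integral_const_mul]
  congr 1 with x
  rw [mul_pow, ← NNReal.coe_sub hst]
  have : √(t - s : ℝ≥0) ^ 4 = ((t - s : ℝ≥0) : ℝ) ^ 2 := by
    rw [show 4 = 2 * 2 by norm_num, pow_mul, Real.sq_sqrt (NNReal.coe_nonneg _)]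
  rw [this]

theorem IsWienerSequence.integral_incr_mul_incr [IsProbabilityMeasure P]
    (hW : IsWienerSequence P 𝓕 W) {k l : ℕ} (hkl : k ≠ l) {s t : ℝ≥0} (hst : s ≤ t) :
    ∫ ω, (W k t ω - W k s ω) * (W l t ω - W l s ω) ∂P = 0 := by
  have hi : IndepFun (fun ω => W k t ω - W k s ω) (fun ω => W l t ω - W l s ω) P :=
    (hW.indep.indepFun hkl).comp (φ := fun f : ℝ≥0 → ℝ => f t - f s)
      (ψ := fun f : ℝ≥0 → ℝ => f t - f s) (by fun_prop) (by fun_prop)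
  have := hi.integral_mul_eq_mul_integral (hW.memLp_incr k hst 2).aestronglyMeasurable
    (hW.memLp_incr l hst 2).aestronglyMeasurable
  simp only [Pi.mul_apply] at this
  rw [this, hW.integral_incr k hst, zero_mul]

/-- The function `Φ` sees the whole sequence of increments at once. This is what products of
increments of two different Wiener processes require. -/
theorem IsWienerSequence.indepFun_incr (hW : IsWienerSequence P 𝓕 W) {s t : ℝ≥0} (hst : s ≤ t)
    {Y : Ω → ℝ} (hY : StronglyMeasurable[𝓕 s] Y) {Φ : (ℕ → ℝ) → ℝ} (hΦ : Measurable Φ) :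
    IndepFun Y (fun ω => Φ (fun k => W k t ω - W k s ω)) P := by
  have h := (hW.indep_increments s t hst).symm
  rw [IndepFun_iff_Indep]
  refine indep_of_indep_of_le_left (indep_of_indep_of_le_right h ?_) ?_
  · rw [show (fun ω => Φ (fun k => W k t ω - W k s ω)) =
      Φ ∘ (fun ω k => W k t ω - W k s ω) from rfl, ← MeasurableSpace.comap_comp]
    exact MeasurableSpace.comap_mono hΦ.comap_le
  · exact hY.measurable.comap_le

/-- Factorisation by independence. No integrability is needed, because the formula for independent
factors also respects the convention that non-integrable functions have integral zero. -/
theorem IsWienerSequence.integral_mul_incr (hW : IsWienerSequence P 𝓕 W) {s t : ℝ≥0}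
    (hst : s ≤ t) {Y : Ω → ℝ} (hY : StronglyMeasurable[𝓕 s] Y) {Φ : (ℕ → ℝ) → ℝ}
    (hΦ : Measurable Φ) :
    ∫ ω, Y ω * Φ (fun k => W k t ω - W k s ω) ∂P
      = (∫ ω, Y ω ∂P) * ∫ ω, Φ (fun k => W k t ω - W k s ω) ∂P := by
  have hm : Measurable (fun ω k => W k t ω - W k s ω) := by
    refine measurable_pi_lambda _ fun k => ?_
    exact (((hW.adapted k t).mono (𝓕.le t)).measurable).sub
      (((hW.adapted k s).mono (𝓕.le s)).measurable)
  exact (hW.indepFun_incr hst hY hΦ).integral_mul_eq_mul_integral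
    ((hY.mono (𝓕.le s)).aestronglyMeasurable) (hΦ.comp hm).aestronglyMeasurable

theorem IsWienerSequence.integrable_mul_incr (hW : IsWienerSequence P 𝓕 W) {s t : ℝ≥0}
    (hst : s ≤ t) {Y : Ω → ℝ} (hY : StronglyMeasurable[𝓕 s] Y) (hYi : Integrable Y P)
    {Φ : (ℕ → ℝ) → ℝ} (hΦ : Measurable Φ)
    (hΦi : Integrable (fun ω => Φ (fun k => W k t ω - W k s ω)) P) :
    Integrable (fun ω => Y ω * Φ (fun k => W k t ω - W k s ω)) P :=
  (hW.indepFun_incr hst hY hΦ).integrable_mul hYi hΦi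

theorem IsWienerSequence.measurable_incr (hW : IsWienerSequence P 𝓕 W) (k : ℕ) {s t u : ℝ≥0}
    (hs : s ≤ u) (ht : t ≤ u) : StronglyMeasurable[𝓕 u] (fun ω => W k t ω - W k s ω) :=
  ((hW.adapted k t).mono (𝓕.mono ht)).sub ((hW.adapted k s).mono (𝓕.mono hs))

end Increments

end SLLB

/-! ### Discrete stochastic integrals: isometry and a Lenglart inequality. -/

namespace SLLB

section Arrays

variable {Ω : Type*} [mΩ : MeasurableSpace Ω] {P : Measure Ω} {𝓕 : Filtration ℝ≥0 mΩ}
  {W : ℕ → ℝ≥0 → Ω → ℝ} {H : Type*} [NormedAddCommGroup H] [InnerProductSpace ℝ H]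

/-- The discrete stochastic integral `∑_{l<m} ∑_{k<K} (W_k(s_{l+1}) - W_k(s_l)) ξ_{k,l}`. -/
def discreteIntegral (W : ℕ → ℝ≥0 → Ω → ℝ) (s : ℕ → ℝ≥0) (K : ℕ) (ξ : ℕ → ℕ → Ω → H)
    (m : ℕ) (ω : Ω) : H :=
  ∑ l ∈ Finset.range m, ∑ k ∈ Finset.range K, (W k (s (l + 1)) ω - W k (s l) ω) • ξ k l ω

theorem discreteIntegral_succ (s : ℕ → ℝ≥0) (K : ℕ) (ξ : ℕ → ℕ → Ω → H) (m : ℕ) (ω : Ω) :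
    discreteIntegral W s K ξ (m + 1) ω = discreteIntegral W s K ξ m ω
      + ∑ k ∈ Finset.range K, (W k (s (m + 1)) ω - W k (s m) ω) • ξ k m ω := by
  simp [discreteIntegral, Finset.sum_range_succ]

/-- `ξ` is an array of bounded random variables, `ξ_{k,l}` being known at time `s_l`. -/
structure IsBddAdapted (𝓕 : Filtration ℝ≥0 mΩ) (s : ℕ → ℝ≥0) (N K : ℕ)
    (ξ : ℕ → ℕ → Ω → H) : Prop where
  meas : ∀ k < K, ∀ l < N, StronglyMeasurable[𝓕 (s l)] (ξ k l)
  bdd : ∀ k < K, ∀ l < N, ∃ C : ℝ, ∀ ω, ‖ξ k l ω‖ ≤ C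

variable {s : ℕ → ℝ≥0} {N K : ℕ} {ξ : ℕ → ℕ → Ω → H}

theorem IsBddAdapted.memLp [IsFiniteMeasure P] (hξ : IsBddAdapted 𝓕 s N K ξ) {k l : ℕ}
    (hk : k < K) (hl : l < N) (p : ℝ≥0∞) : MemLp (ξ k l) p P := by
  obtain ⟨C, hC⟩ := hξ.bdd k hk l hl
  exact MemLp.of_bound ((hξ.meas k hk l hl).mono (𝓕.le _)).aestronglyMeasurable C
    (Eventually.of_forall hC)

theorem IsBddAdapted.memLp_step (hξ : IsBddAdapted 𝓕 s N K ξ)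
    (hW : IsWienerSequence P 𝓕 W) (hs : Monotone s) {l : ℕ} (hl : l < N) :
    MemLp (fun ω => ∑ k ∈ Finset.range K, (W k (s (l + 1)) ω - W k (s l) ω) • ξ k l ω) 2 P := by
  refine memLp_finsetSum _ fun k hk => ?_
  have hk := Finset.mem_range.1 hk
  obtain ⟨C, hC⟩ := hξ.bdd k hk l hl
  have h1 : MemLp (fun ω => W k (s (l + 1)) ω - W k (s l) ω) 2 P :=
    hW.memLp_incr k (hs (Nat.le_succ l)) 2
  refine MemLp.of_le_mul (c := C) h1
    (h1.aestronglyMeasurable.smul ((hξ.meas k hk l hl).mono (𝓕.le _)).aestronglyMeasurable) ?_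
  refine Eventually.of_forall fun ω => ?_
  rw [norm_smul, mul_comm]
  exact mul_le_mul_of_nonneg_right (hC ω) (norm_nonneg _)

theorem IsBddAdapted.stronglyMeasurable_step (hξ : IsBddAdapted 𝓕 s N K ξ)
    (hW : IsWienerSequence P 𝓕 W) (hs : Monotone s) {l : ℕ} (hl : l < N) :
    StronglyMeasurable[𝓕 (s (l + 1))]
      (fun ω => ∑ k ∈ Finset.range K, (W k (s (l + 1)) ω - W k (s l) ω) • ξ k l ω) := by
  refine Finset.stronglyMeasurable_fun_sum _ fun k hk => ?_
  have hk := Finset.mem_range.1 hk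
  exact (hW.measurable_incr k (hs (Nat.le_succ l)) le_rfl).smul
    ((hξ.meas k hk l hl).mono (𝓕.mono (hs (Nat.le_succ l))))

theorem IsBddAdapted.memLp_discreteIntegral (hξ : IsBddAdapted 𝓕 s N K ξ)
    (hW : IsWienerSequence P 𝓕 W) (hs : Monotone s) {m : ℕ} (hm : m ≤ N) :
    MemLp (discreteIntegral W s K ξ m) 2 P :=
  memLp_finsetSum _ fun _ hl =>
    hξ.memLp_step hW hs (lt_of_lt_of_le (Finset.mem_range.1 hl) hm)

theorem IsBddAdapted.stronglyMeasurable_discreteIntegral (hξ : IsBddAdapted 𝓕 s N K ξ)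
    (hW : IsWienerSequence P 𝓕 W) (hs : Monotone s) {m : ℕ} (hm : m ≤ N) :
    StronglyMeasurable[𝓕 (s m)] (discreteIntegral W s K ξ m) := by
  refine Finset.stronglyMeasurable_fun_sum _ fun l hl => ?_
  have hl := Finset.mem_range.1 hl
  exact (hξ.stronglyMeasurable_step hW hs (hl.trans_le hm)).mono (𝓕.mono (hs hl))

theorem integrable_inner_of_memLp {f g : Ω → H} (hf : MemLp f 2 P) (hg : MemLp g 2 P) :
    Integrable (fun ω => ⟪f ω, g ω⟫) P := by
  refine ((hf.integrable_norm_pow two_ne_zero).add (hg.integrable_norm_pow two_ne_zero)).mono'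
    (hf.aestronglyMeasurable.inner hg.aestronglyMeasurable)
    (Eventually.of_forall fun ω => ?_)
  have := norm_inner_le_norm (𝕜 := ℝ) (f ω) (g ω)
  simp only [Pi.add_apply]
  nlinarith [sq_nonneg (‖f ω‖ - ‖g ω‖), sq_nonneg (‖f ω‖), sq_nonneg (‖g ω‖)]

/-- The martingale property: the increments of the step have mean zero and are independent of
everything known at its left end, in particular of `Y` and of the coefficients. -/
theorem IsBddAdapted.integral_inner_step [IsProbabilityMeasure P] (hξ : IsBddAdapted 𝓕 s N K ξ)
    (hW : IsWienerSequence P 𝓕 W) (hs : Monotone s) {l : ℕ} (hl : l < N) {Y : Ω → H}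
    (hY : StronglyMeasurable[𝓕 (s l)] Y) (hY2 : MemLp Y 2 P) :
    ∫ ω, ⟪Y ω, ∑ k ∈ Finset.range K, (W k (s (l + 1)) ω - W k (s l) ω) • ξ k l ω⟫ ∂P = 0 := by
  have hsl := hs (Nat.le_succ l)
  simp_rw [inner_sum, real_inner_smul_right]
  rw [integral_finsetSum]
  · refine Finset.sum_eq_zero fun k hk => ?_
    have hk := Finset.mem_range.1 hk
    have := hW.integral_mul_incr hsl (hY.inner (hξ.meas k hk l hl)) (measurable_pi_apply k)
    simp_rw [mul_comm] at this ⊢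
    rw [this, hW.integral_incr k hsl, mul_zero]
  · intro k hk
    have hk := Finset.mem_range.1 hk
    have := hW.integrable_mul_incr hsl (hY.inner (hξ.meas k hk l hl))
      (integrable_inner_of_memLp hY2 (hξ.memLp hk hl 2)) (measurable_pi_apply k)
      ((hW.memLp_incr k hsl 1).integrable (by simp))
    simp_rw [mul_comm] at this ⊢
    exact this

/-- In the expanded square, the mixed terms `k ≠ k'` vanish by independence of the Wiener processes,
and the diagonal ones give the length of the step. -/
theorem IsBddAdapted.integral_norm_sq_step [IsProbabilityMeasure P]
    (hξ : IsBddAdapted 𝓕 s N K ξ) (hW : IsWienerSequence P 𝓕 W) (hs : Monotone s) {l : ℕ}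
    (hl : l < N) :
    ∫ ω, ‖∑ k ∈ Finset.range K, (W k (s (l + 1)) ω - W k (s l) ω) • ξ k l ω‖ ^ 2 ∂P
      = ∫ ω, (s (l + 1) - s l : ℝ) * ∑ k ∈ Finset.range K, ‖ξ k l ω‖ ^ 2 ∂P := by
  have hsl := hs (Nat.le_succ l)
  have hmul : ∀ k < K, ∀ k' < K,
      (Integrable (fun ω => ⟪ξ k l ω, ξ k' l ω⟫ *
        ((W k (s (l + 1)) ω - W k (s l) ω) * (W k' (s (l + 1)) ω - W k' (s l) ω))) P) ∧
      ∫ ω, ⟪ξ k l ω, ξ k' l ω⟫ *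
        ((W k (s (l + 1)) ω - W k (s l) ω) * (W k' (s (l + 1)) ω - W k' (s l) ω)) ∂P
        = if k = k' then ∫ ω, (s (l + 1) - s l : ℝ) * ‖ξ k l ω‖ ^ 2 ∂P else 0 := by
    intro k hk k' hk'
    have hm : Measurable (fun x : ℕ → ℝ => x k * x k') := by fun_prop
    have hy := (hξ.meas k hk l hl).inner (𝕜 := ℝ) (hξ.meas k' hk' l hl)
    refine ⟨hW.integrable_mul_incr hsl hy
      (integrable_inner_of_memLp (hξ.memLp hk hl 2) (hξ.memLp hk' hl 2)) hm
      (MemLp.integrable_mul (hW.memLp_incr k hsl 2) (hW.memLp_incr k' hsl 2)), ?_⟩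
    rw [hW.integral_mul_incr hsl hy hm]
    split_ifs with h
    · subst h
      have := hW.integral_incr_sq k hsl
      simp_rw [← pow_two, this, real_inner_self_eq_norm_sq, integral_const_mul]
      ring
    · rw [hW.integral_incr_mul_incr h hsl, mul_zero]
  have hexp : ∀ ω, ‖∑ k ∈ Finset.range K, (W k (s (l + 1)) ω - W k (s l) ω) • ξ k l ω‖ ^ 2
      = ∑ k ∈ Finset.range K, ∑ k' ∈ Finset.range K, ⟪ξ k l ω, ξ k' l ω⟫ *
        ((W k (s (l + 1)) ω - W k (s l) ω) * (W k' (s (l + 1)) ω - W k' (s l) ω)) := by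
    intro ω
    rw [← real_inner_self_eq_norm_sq, sum_inner]
    refine Finset.sum_congr rfl fun k _ => ?_
    rw [inner_sum]
    refine Finset.sum_congr rfl fun k' _ => ?_
    rw [real_inner_smul_left, real_inner_smul_right]
    ring
  simp_rw [hexp, Finset.mul_sum]
  rw [integral_finsetSum _ fun k hk => integrable_finsetSum _ fun k' hk' =>
      (hmul k (Finset.mem_range.1 hk) k' (Finset.mem_range.1 hk')).1,
    integral_finsetSum _ fun k hk =>
      (((hξ.memLp (Finset.mem_range.1 hk) hl 2).integrable_norm_pow two_ne_zero).const_mul _)]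
  refine Finset.sum_congr rfl fun k hk => ?_
  rw [integral_finsetSum _ fun k' hk' =>
      (hmul k (Finset.mem_range.1 hk) k' (Finset.mem_range.1 hk')).1,
    Finset.sum_congr rfl fun k' hk' =>
      (hmul k (Finset.mem_range.1 hk) k' (Finset.mem_range.1 hk')).2]
  rw [Finset.sum_ite_eq, if_pos hk]

/-- Itô's isometry for discrete stochastic integrals. -/
theorem IsBddAdapted.integral_norm_sq_sub [IsProbabilityMeasure P]
    (hξ : IsBddAdapted 𝓕 s N K ξ) (hW : IsWienerSequence P 𝓕 W) (hs : Monotone s) {i j : ℕ}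
    (hij : i ≤ j) (hj : j ≤ N) :
    ∫ ω, ‖discreteIntegral W s K ξ j ω - discreteIntegral W s K ξ i ω‖ ^ 2 ∂P
      = ∫ ω, ∑ l ∈ Finset.Ico i j,
          (s (l + 1) - s l : ℝ) * ∑ k ∈ Finset.range K, ‖ξ k l ω‖ ^ 2 ∂P := by
  have hint : ∀ l < N, Integrable
      (fun ω => (s (l + 1) - s l : ℝ) * ∑ k ∈ Finset.range K, ‖ξ k l ω‖ ^ 2) P := fun l hl =>
    (integrable_finsetSum _ fun k hk =>
      (hξ.memLp (Finset.mem_range.1 hk) hl 2).integrable_norm_pow two_ne_zero).const_mul _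
  induction j, hij using Nat.le_induction with
  | base => simp
  | succ j hij ih =>
    have hjN : j < N := hj
    specialize ih hjN.le
    have hY : MemLp (fun ω => discreteIntegral W s K ξ j ω - discreteIntegral W s K ξ i ω) 2 P :=
      (hξ.memLp_discreteIntegral hW hs hjN.le).sub
        (hξ.memLp_discreteIntegral hW hs (hij.trans hjN.le))
    have hYm : StronglyMeasurable[𝓕 (s j)]
        (fun ω => discreteIntegral W s K ξ j ω - discreteIntegral W s K ξ i ω) :=
      (hξ.stronglyMeasurable_discreteIntegral hW hs hjN.le).sub
        ((hξ.stronglyMeasurable_discreteIntegral hW hs (hij.trans hjN.le)).mono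
          (𝓕.mono (hs hij)))
    have hd := hξ.memLp_step hW hs hjN
    have e : ∀ ω, ‖discreteIntegral W s K ξ (j + 1) ω - discreteIntegral W s K ξ i ω‖ ^ 2
        = ‖discreteIntegral W s K ξ j ω - discreteIntegral W s K ξ i ω‖ ^ 2
          + 2 * ⟪discreteIntegral W s K ξ j ω - discreteIntegral W s K ξ i ω,
            ∑ k ∈ Finset.range K, (W k (s (j + 1)) ω - W k (s j) ω) • ξ k j ω⟫
          + ‖∑ k ∈ Finset.range K, (W k (s (j + 1)) ω - W k (s j) ω) • ξ k j ω‖ ^ 2 := by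
      intro ω
      rw [discreteIntegral_succ, add_sub_right_comm, norm_add_sq_real]
    simp_rw [e]
    rw [integral_add _ (hd.integrable_norm_pow two_ne_zero), integral_add
      (hY.integrable_norm_pow two_ne_zero) ((integrable_inner_of_memLp hY hd).const_mul 2),
      integral_const_mul, hξ.integral_inner_step hW hs hjN hYm hY, ih,
      hξ.integral_norm_sq_step hW hs hjN, mul_zero, add_zero, ← integral_add]
    · simp_rw [Finset.sum_Ico_succ_top hij]
    · exact integrable_finsetSum _ fun l hl =>
        hint l ((Finset.mem_Ico.1 hl).2.trans hjN)
    · exact hint j hjN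
    · exact (hY.integrable_norm_pow two_ne_zero).add ((integrable_inner_of_memLp hY hd).const_mul 2)

/-- Since the terms are nonnegative, the kept ones form an initial segment, and their sum is itself
a partial sum that does not exceed `δ`. -/
theorem sum_truncated_le {A : ℕ → ℝ} (hA : ∀ l, 0 ≤ A l) {δ : ℝ} (hδ : 0 ≤ δ) (N : ℕ) :
    ∑ l ∈ Finset.range N, (if ∑ i ∈ Finset.range (l + 1), A i ≤ δ then A l else 0) ≤ δ := by
  -- The bound by the full partial sum is carried along: it is what closes the case in which the
  -- last term is kept.
  have key : ∀ N, ∑ l ∈ Finset.range N,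
      (if ∑ i ∈ Finset.range (l + 1), A i ≤ δ then A l else 0)
        ≤ min δ (∑ i ∈ Finset.range N, A i) := by
    intro N
    induction N with
    | zero => simpa using hδ
    | succ N ih =>
      rw [Finset.sum_range_succ]
      have h1 := (le_min_iff.1 ih).1
      have h2 := (le_min_iff.1 ih).2
      have h3 := hA N
      have h4 := Finset.sum_range_succ A N
      split_ifs with h <;> refine le_min ?_ ?_ <;> linarith
  exact (le_min_iff.1 (key N)).1

/-- The quadratic sum `∑_{l<N} (s_{l+1} - s_l) ∑_{k<K} ‖ξ_{k,l}‖²`. -/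
def quadSum (s : ℕ → ℝ≥0) (K : ℕ) (ξ : ℕ → ℕ → Ω → H) (N : ℕ) (ω : Ω) : ℝ :=
  ∑ l ∈ Finset.range N, (s (l + 1) - s l : ℝ) * ∑ k ∈ Finset.range K, ‖ξ k l ω‖ ^ 2

open Classical in
/-- The array `ξ` stopped when its quadratic sum exceeds `δ`. -/
noncomputable def stoppedArray (s : ℕ → ℝ≥0) (K : ℕ) (ξ : ℕ → ℕ → Ω → H) (δ : ℝ) (k l : ℕ) (ω : Ω) : H :=
  if quadSum s K ξ (l + 1) ω ≤ δ then ξ k l ω else 0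

theorem quadSum_mono (hs : Monotone s) (ω : Ω) : Monotone fun m => quadSum s K ξ m ω := by
  refine monotone_nat_of_le_succ fun m => ?_
  simp only [quadSum]
  rw [Finset.sum_range_succ]
  have : (0 : ℝ) ≤ s (m + 1) - s m := sub_nonneg.2 (hs (Nat.le_succ m))
  have h2 : 0 ≤ ∑ k ∈ Finset.range K, ‖ξ k m ω‖ ^ 2 := by positivity
  have := mul_nonneg this h2
  linarith

/-- Predictability: the sum up to `l + 1` involves only coefficients of index at most `l`, all known
at time `s_l`. Hence the stopping rule may include the current term, and the stopped sum has no
overshoot over `δ`. -/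
theorem IsBddAdapted.stronglyMeasurable_quadSum (hξ : IsBddAdapted 𝓕 s N K ξ) (hs : Monotone s)
    {l : ℕ} (hl : l < N) : StronglyMeasurable[𝓕 (s l)] (quadSum s K ξ (l + 1)) := by
  refine Finset.stronglyMeasurable_fun_sum _ fun i hi => ?_
  have hi := Nat.lt_succ_iff.1 (Finset.mem_range.1 hi)
  refine StronglyMeasurable.const_mul ?_ _
  refine Finset.stronglyMeasurable_fun_sum _ fun k hk => ?_
  exact ((hξ.meas k (Finset.mem_range.1 hk) i (hi.trans_lt hl)).mono (𝓕.mono (hs hi))).norm.pow 2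

theorem IsBddAdapted.stoppedArray (hξ : IsBddAdapted 𝓕 s N K ξ) (hs : Monotone s) (δ : ℝ) :
    IsBddAdapted 𝓕 s N K (stoppedArray s K ξ δ) where
  meas k hk l hl := by
    refine StronglyMeasurable.ite ?_ (hξ.meas k hk l hl) stronglyMeasurable_const
    exact measurableSet_le (hξ.stronglyMeasurable_quadSum hs hl).measurable measurable_const
  bdd k hk l hl := by
    obtain ⟨C, hC⟩ := hξ.bdd k hk l hl
    refine ⟨C, fun ω => ?_⟩
    unfold SLLB.stoppedArray
    split_ifs
    · exact hC ω
    · simpa using (norm_nonneg _).trans (hC ω)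

theorem quadSum_stoppedArray_le (hs : Monotone s) {δ : ℝ} (hδ : 0 ≤ δ) (ω : Ω) :
    quadSum s K (stoppedArray s K ξ δ) N ω ≤ δ := by
  refine le_trans (le_of_eq ?_) (sum_truncated_le
    (A := fun l => (s (l + 1) - s l : ℝ) * ∑ k ∈ Finset.range K, ‖ξ k l ω‖ ^ 2) (fun l => ?_)
      hδ N)
  · refine Finset.sum_congr rfl fun l _ => ?_
    unfold stoppedArray quadSum
    split_ifs <;> simp
  · have : (0 : ℝ) ≤ s (l + 1) - s l := sub_nonneg.2 (hs (Nat.le_succ l))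
    positivity

theorem discreteIntegral_stoppedArray (hs : Monotone s) {δ : ℝ} {ω : Ω}
    (h : quadSum s K ξ N ω ≤ δ) {m : ℕ} (hm : m ≤ N) :
    discreteIntegral W s K (stoppedArray s K ξ δ) m ω = discreteIntegral W s K ξ m ω := by
  refine Finset.sum_congr rfl fun l hl => Finset.sum_congr rfl fun k _ => ?_
  have : quadSum s K ξ (l + 1) ω ≤ δ :=
    (quadSum_mono hs ω (Nat.succ_le_of_lt ((Finset.mem_range.1 hl).trans_le hm))).trans h
  unfold stoppedArray
  rw [if_pos this]

theorem sum_sum_Ico {M : Type*} [AddCommMonoid M] (f : ℕ → M) {j : ℕ → ℕ} (hj : Monotone j)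
    {a b : ℕ} (hab : a ≤ b) :
    ∑ p ∈ Finset.Ico a b, ∑ l ∈ Finset.Ico (j p) (j (p + 1)), f l
      = ∑ l ∈ Finset.Ico (j a) (j b), f l := by
  induction b, hab using Nat.le_induction with
  | base => simp
  | succ b hab ih =>
    rw [Finset.sum_Ico_succ_top hab, ih, Finset.sum_Ico_consecutive _ (hj hab)
      (hj (Nat.le_succ b))]

/-- A version of Lenglart's inequality: the increments of a discrete stochastic integral are
controlled in probability by its quadratic sum. -/
theorem IsBddAdapted.measure_sum_sq_ge_le [IsProbabilityMeasure P]
    (hξ : IsBddAdapted 𝓕 s N K ξ) (hW : IsWienerSequence P 𝓕 W) (hs : Monotone s)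
    {j : ℕ → ℕ} (hj : Monotone j) {q : ℕ} (hjq : j q ≤ N) {δ lam : ℝ} (hδ : 0 ≤ δ)
    (hlam : 0 < lam) :
    P {ω | lam ≤ ∑ p ∈ Finset.range q,
        ‖discreteIntegral W s K ξ (j (p + 1)) ω - discreteIntegral W s K ξ (j p) ω‖ ^ 2}
      ≤ P {ω | δ < quadSum s K ξ N ω} + ENNReal.ofReal (δ / lam) := by
  -- Where the quadratic sum is at most `δ`, stopping changes nothing. For the stopped array the
  -- expectation is at most `δ`, so Markov's inequality applies.
  set η := SLLB.stoppedArray s K ξ δ with hη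
  have hηa : IsBddAdapted 𝓕 s N K η := hξ.stoppedArray hs δ
  set F : Ω → ℝ := fun ω => ∑ p ∈ Finset.range q,
    ‖discreteIntegral W s K η (j (p + 1)) ω - discreteIntegral W s K η (j p) ω‖ ^ 2 with hF
  have hjN : ∀ p ≤ q, j p ≤ N := fun p hp => (hj hp).trans hjq
  have hsub : {ω | lam ≤ ∑ p ∈ Finset.range q,
        ‖discreteIntegral W s K ξ (j (p + 1)) ω - discreteIntegral W s K ξ (j p) ω‖ ^ 2}
      ⊆ {ω | δ < quadSum s K ξ N ω} ∪ {ω | lam ≤ F ω} := by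
    intro ω hω
    by_cases h : δ < quadSum s K ξ N ω
    · exact Or.inl h
    · refine Or.inr ?_
      have h := not_lt.1 h
      refine le_trans (show lam ≤ _ from hω) (le_of_eq ?_)
      refine Finset.sum_congr rfl fun p hp => ?_
      have hp := Finset.mem_range.1 hp
      rw [hη, discreteIntegral_stoppedArray hs h (hjN _ hp),
        discreteIntegral_stoppedArray hs h (hjN _ hp.le)]
  refine (measure_mono hsub).trans ((measure_union_le _ _).trans (add_le_add le_rfl ?_))
  have hsq : ∀ p < q, Integrable (fun ω =>
      ‖discreteIntegral W s K η (j (p + 1)) ω - discreteIntegral W s K η (j p) ω‖ ^ 2) P :=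
    fun p hp => (((hηa.memLp_discreteIntegral hW hs (hjN _ hp)).sub
      (hηa.memLp_discreteIntegral hW hs (hjN _ hp.le))).integrable_norm_pow two_ne_zero)
  have hFi : Integrable F P := integrable_finsetSum _ fun p hp => hsq p (Finset.mem_range.1 hp)
  have hF0 : ∀ ω, 0 ≤ F ω := fun ω => by simp only [hF]; positivity
  -- The isometry on each block turns the expectation of the squared increments into that of a part
  -- of the stopped quadratic sum.
  have hEF : ∫ ω, F ω ∂P ≤ δ := by
    simp only [hF]
    rw [integral_finsetSum _ fun p hp => hsq p (Finset.mem_range.1 hp)]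
    have hint : ∀ l < N, Integrable
        (fun ω => (s (l + 1) - s l : ℝ) * ∑ k ∈ Finset.range K, ‖η k l ω‖ ^ 2) P := fun l hl =>
      (integrable_finsetSum _ fun k hk =>
        (hηa.memLp (Finset.mem_range.1 hk) hl 2).integrable_norm_pow two_ne_zero).const_mul _
    have e : ∀ p ∈ Finset.range q, ∫ ω,
        ‖discreteIntegral W s K η (j (p + 1)) ω - discreteIntegral W s K η (j p) ω‖ ^ 2 ∂P
        = ∑ l ∈ Finset.Ico (j p) (j (p + 1)),
          ∫ ω, (s (l + 1) - s l : ℝ) * ∑ k ∈ Finset.range K, ‖η k l ω‖ ^ 2 ∂P := by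
      intro p hp
      have hp := Finset.mem_range.1 hp
      rw [hηa.integral_norm_sq_sub hW hs (hj (Nat.le_succ p)) (hjN _ hp),
        integral_finsetSum _ fun l hl => hint l ((Finset.mem_Ico.1 hl).2.trans_le (hjN _ hp))]
    rw [Finset.sum_congr rfl e, Finset.range_eq_Ico, sum_sum_Ico _ hj (Nat.zero_le q), ← integral_finsetSum _ fun l hl =>
      hint l ((Finset.mem_Ico.1 hl).2.trans_le hjq)]
    have hle : ∀ ω, ∑ l ∈ Finset.Ico (j 0) (j q),
        (s (l + 1) - s l : ℝ) * ∑ k ∈ Finset.range K, ‖η k l ω‖ ^ 2 ≤ δ := by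
      intro ω
      refine le_trans ?_ (quadSum_stoppedArray_le (N := N) (ξ := ξ) (K := K) hs hδ ω)
      refine Finset.sum_le_sum_of_subset_of_nonneg ?_ fun l _ _ => ?_
      · intro l hl
        exact Finset.mem_range.2 ((Finset.mem_Ico.1 hl).2.trans_le hjq)
      · have : (0 : ℝ) ≤ s (l + 1) - s l := sub_nonneg.2 (hs (Nat.le_succ l))
        positivity
    refine (integral_mono (integrable_finsetSum _ fun l hl =>
      hint l ((Finset.mem_Ico.1 hl).2.trans_le hjq)) (integrable_const δ) hle).trans ?_
    simp
  have hmk := mul_meas_ge_le_integral_of_nonneg (Eventually.of_forall hF0) hFi lam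
  rw [← ENNReal.ofReal_toReal (measure_ne_top P {ω | lam ≤ F ω})]
  refine ENNReal.ofReal_le_ofReal ?_
  rw [le_div_iff₀ hlam, mul_comm]
  exact hmk.trans hEF

end Arrays

end SLLB

/-! ### Lebesgue measure on the time axis and common refinements of partitions. -/

namespace SLLB

section TimeAxis

theorem leb_apply (s : Set ℝ≥0) : leb s = volume (NNReal.toReal '' s) := by
  have h : MeasurableEmbedding NNReal.toReal := MeasurableEmbedding.subtype_coe measurableSet_Ici
  exact h.comap_apply _ _

theorem image_toReal_Ioc (a b : ℝ≥0) : NNReal.toReal '' Set.Ioc a b = Set.Ioc (a : ℝ) b := by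
  ext x
  constructor
  · rintro ⟨y, hy, rfl⟩
    exact ⟨hy.1, hy.2⟩
  · rintro ⟨h1, h2⟩
    exact ⟨⟨x, a.2.trans h1.le⟩, ⟨h1, h2⟩, rfl⟩

theorem leb_Ioc (a b : ℝ≥0) : leb (Set.Ioc a b) = ENNReal.ofReal (b - a) := by
  rw [leb_apply, image_toReal_Ioc, Real.volume_Ioc]

theorem leb_singleton (a : ℝ≥0) : leb {a} = 0 := by
  rw [leb_apply]; simp

instance : NullSingletonClass leb := ⟨leb_singleton⟩

theorem leb_Icc (a b : ℝ≥0) : leb (Set.Icc a b) = ENNReal.ofReal (b - a) := by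
  rw [← leb_Ioc]
  exact (measure_congr Ioc_ae_eq_Icc).symm

instance isFiniteMeasure_leb_Icc (a b : ℝ≥0) : IsFiniteMeasure (leb.restrict (Set.Icc a b)) :=
  ⟨by rw [Measure.restrict_apply_univ, leb_Icc]; exact ENNReal.ofReal_lt_top⟩

instance : SigmaFinite leb := by
  refine ⟨⟨⟨fun n => Set.Icc 0 (n : ℝ≥0), fun _ => trivial, fun n => ?_, ?_⟩⟩⟩
  · rw [leb_Icc]; exact ENNReal.ofReal_lt_top
  · refine Set.eq_univ_of_forall fun x => ?_
    obtain ⟨n, hn⟩ := exists_nat_ge x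
    exact Set.mem_iUnion.2 ⟨n, zero_le, hn⟩

theorem lintegral_Ioc_sum {g : ℝ≥0 → ℝ≥0∞} {s : ℕ → ℝ≥0} (hs : Monotone s) {i j : ℕ}
    (hij : i ≤ j) :
    ∑ l ∈ Finset.Ico i j, ∫⁻ τ in Set.Ioc (s l) (s (l + 1)), g τ ∂leb
      = ∫⁻ τ in Set.Ioc (s i) (s j), g τ ∂leb := by
  induction j, hij using Nat.le_induction with
  | base => simp
  | succ j hij ih =>
    rw [Finset.sum_Ico_succ_top hij, ih, ← lintegral_union measurableSet_Ioc
      (Set.Ioc_disjoint_Ioc_of_le le_rfl), Set.Ioc_union_Ioc_eq_Ioc (hs hij) (hs (Nat.le_succ j))]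

theorem setIntegral_Ioc_sum {E : Type*} [NormedAddCommGroup E] [NormedSpace ℝ E]
    {g : ℝ≥0 → E} {s : ℕ → ℝ≥0} (hs : Monotone s)
    {i j : ℕ} (hij : i ≤ j) (hg : IntegrableOn g (Set.Ioc (s i) (s j)) leb) :
    ∑ l ∈ Finset.Ico i j, ∫ τ in Set.Ioc (s l) (s (l + 1)), g τ ∂leb
      = ∫ τ in Set.Ioc (s i) (s j), g τ ∂leb := by
  induction j, hij using Nat.le_induction with
  | base => simp
  | succ j hij ih =>
    have h1 : IntegrableOn g (Set.Ioc (s i) (s j)) leb :=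
      hg.mono_set (Set.Ioc_subset_Ioc_right (hs (Nat.le_succ j)))
    have h2 : IntegrableOn g (Set.Ioc (s j) (s (j + 1))) leb :=
      hg.mono_set (Set.Ioc_subset_Ioc_left (hs hij))
    rw [Finset.sum_Ico_succ_top hij, ih h1, ← setIntegral_union
      (Set.Ioc_disjoint_Ioc_of_le le_rfl) measurableSet_Ioc h1 h2,
      Set.Ioc_union_Ioc_eq_Ioc (hs hij) (hs (Nat.le_succ j))]

/-- Refining a finite partition so that no point of a given finite set lies in the interior of one
of the cells. -/
theorem exists_refinement (F : Finset ℝ≥0) {t : ℕ → ℝ≥0} (ht : Monotone t) (q : ℕ) :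
    ∃ (s : ℕ → ℝ≥0) (N : ℕ) (j : ℕ → ℕ), Monotone s ∧ Monotone j ∧ j 0 = 0 ∧ j q = N ∧
      (∀ p ≤ q, s (j p) = t p) ∧ ∀ f ∈ F, ∀ l < N, f ≤ s l ∨ s (l + 1) ≤ f := by
  classical
  -- All relevant points inside `[t 0, t q]`, enumerated in increasing order. The grid is constant
  -- after its last index, and `j p` is the position of `t p`.
  set A : Finset ℝ≥0 := ((Finset.range (q + 1)).image t ∪ F).filter
    (fun x => t 0 ≤ x ∧ x ≤ t q) with hA
  have htA : ∀ p ≤ q, t p ∈ A := fun p hp => Finset.mem_filter.2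
    ⟨Finset.mem_union_left _ (Finset.mem_image_of_mem _ (Finset.mem_range.2 (Nat.lt_succ_of_le hp))),
      ht (Nat.zero_le p), ht hp⟩
  have hpos : 0 < A.card := Finset.card_pos.2 ⟨t 0, htA 0 (Nat.zero_le q)⟩
  obtain ⟨N, hN⟩ : ∃ N, A.card = N + 1 := ⟨A.card - 1, by omega⟩
  let e : Fin (N + 1) ≃o A := A.orderIsoOfFin hN
  let s : ℕ → ℝ≥0 := fun l => (e ⟨min l N, by omega⟩ : ℝ≥0)
  let j : ℕ → ℕ := fun p => (e.symm ⟨t (min p q), htA _ (min_le_right _ _)⟩ : Fin (N + 1))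
  have hsm : Monotone s := fun a b hab => by
    have : (⟨min a N, by omega⟩ : Fin (N + 1)) ≤ ⟨min b N, by omega⟩ :=
      Fin.mk_le_mk.2 (min_le_min_right N hab)
    exact e.monotone this
  have hsj : ∀ p ≤ q, s (j p) = t p := fun p hp => by
    have h1 : (⟨min (j p) N, by omega⟩ : Fin (N + 1))
        = e.symm ⟨t (min p q), htA _ (min_le_right _ _)⟩ := by
      ext
      have := (e.symm ⟨t (min p q), htA _ (min_le_right _ _)⟩ : Fin (N + 1)).2
      change min (j p) N = j p
      have hj : j p < N + 1 := this
      omega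
    change (e _ : ℝ≥0) = _
    rw [h1, e.apply_symm_apply]
    simp [min_eq_left hp]
  have hmem : ∀ a : A, ∃ l ≤ N, (a : ℝ≥0) = s l := fun a => by
    refine ⟨(e.symm a : Fin (N + 1)), Nat.lt_succ_iff.1 (e.symm a).2, ?_⟩
    change _ = (e _ : ℝ≥0)
    have : (⟨min ((e.symm a : Fin (N + 1)) : ℕ) N, by omega⟩ : Fin (N + 1)) = e.symm a := by
      ext
      have := (e.symm a).2
      simp only
      omega
    rw [this, e.apply_symm_apply]
  have hj0 : j 0 = 0 := by
    have h1 : e.symm ⟨t (min 0 q), htA _ (min_le_right _ _)⟩ ≤ 0 := by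
      rw [OrderIso.symm_apply_le]
      rw [← Subtype.coe_le_coe]
      simpa using (Finset.mem_filter.1 (e 0).2).2.1
    have : e.symm ⟨t (min 0 q), htA _ (min_le_right _ _)⟩ = 0 := le_antisymm h1 (Fin.zero_le _)
    change ((e.symm _ : Fin (N + 1)) : ℕ) = 0
    rw [this]; rfl
  have hjq : j q = N := by
    have h1 : Fin.last N ≤ e.symm ⟨t (min q q), htA _ (min_le_right _ _)⟩ := by
      rw [OrderIso.le_symm_apply]
      rw [← Subtype.coe_le_coe]
      simpa using (Finset.mem_filter.1 (e (Fin.last N)).2).2.2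
    have : e.symm ⟨t (min q q), htA _ (min_le_right _ _)⟩ = Fin.last N :=
      le_antisymm (Fin.le_last _) h1
    change ((e.symm _ : Fin (N + 1)) : ℕ) = N
    rw [this]; rfl
  refine ⟨s, N, j, hsm, fun a b hab => ?_, hj0, hjq, hsj, fun f hf l hl => ?_⟩
  · exact e.symm.monotone (Subtype.coe_le_coe.1 (ht (min_le_min_right q hab)))
  · have hs0 : t 0 ≤ s l := by
      rw [← hsj 0 (Nat.zero_le q), hj0]; exact hsm (Nat.zero_le l)
    have hsN : s (l + 1) ≤ t q := by
      rw [← hsj q le_rfl, hjq]; exact hsm hl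
    by_cases h0 : t 0 ≤ f
    · by_cases hq : f ≤ t q
      · obtain ⟨m, hm, hfm⟩ := hmem ⟨f, Finset.mem_filter.2 ⟨Finset.mem_union_right _ hf, h0, hq⟩⟩
        simp only at hfm
        rw [hfm]
        rcases le_or_gt m l with h | h
        · exact Or.inl (hsm h)
        · exact Or.inr (hsm h)
      · exact Or.inr (hsN.trans (not_le.1 hq).le)
    · exact Or.inl ((not_le.1 h0).le.trans hs0)

end TimeAxis

/-! ### Simple processes on cells without interior partition points. -/

namespace SimpleProcess

variable {Ω : Type*} [mΩ : MeasurableSpace Ω] {𝓕 : Filtration ℝ≥0 mΩ}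
  {H : Type*} [NormedAddCommGroup H] [NormedSpace ℝ H] (S : SimpleProcess 𝓕 H)

/-- Simple processes are left-continuous and change only at their partition points, so each
indicator is constant on such a cell. -/
theorem val_eq_of_mem_Ioc {c c' : ℝ≥0} (h : ∀ i ≤ S.n, S.time i ≤ c ∨ c' ≤ S.time i) {τ : ℝ≥0}
    (hτ : τ ∈ Set.Ioc c c') (ω : Ω) : S.val τ ω = S.val c' ω := by
  refine Finset.sum_congr rfl fun i hi => ?_
  have hi := Finset.mem_range.1 hi
  have e : τ ∈ Set.Ioc (S.time i) (S.time (i + 1)) ↔ c' ∈ Set.Ioc (S.time i) (S.time (i + 1)) := by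
    obtain ⟨h1, h2⟩ := hτ
    constructor
    · rintro ⟨h3, h4⟩
      refine ⟨h3.trans_le h2, (h (i + 1) hi).resolve_left fun h5 => ?_⟩
      exact absurd (h4.trans h5) (not_le.2 h1)
    · rintro ⟨h3, h4⟩
      exact ⟨((h i hi.le).resolve_right (not_le.2 h3)).trans_lt h1, h2.trans h4⟩
  by_cases hc : τ ∈ Set.Ioc (S.time i) (S.time (i + 1))
  · rw [Set.indicator_of_mem hc, Set.indicator_of_mem (e.1 hc)]
  · rw [Set.indicator_of_notMem hc, Set.indicator_of_notMem (mt e.2 hc)]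

/-- If the summand of index `i` is active on the cell, then its starting time is at most `c`, and so
its coefficient is known at time `c`. -/
theorem stronglyMeasurable_val {c c' : ℝ≥0} (h : ∀ i ≤ S.n, S.time i ≤ c ∨ c' ≤ S.time i) :
    StronglyMeasurable[𝓕 c] (S.val c') := by
  refine Finset.stronglyMeasurable_fun_sum _ fun i hi => ?_
  have hi := Finset.mem_range.1 hi
  by_cases hc : c' ∈ Set.Ioc (S.time i) (S.time (i + 1))
  · simp_rw [Set.indicator_of_mem hc]
    exact (S.meas i).mono (𝓕.mono ((h i hi.le).resolve_right (not_le.2 hc.1)))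
  · simp_rw [Set.indicator_of_notMem hc]
    exact stronglyMeasurable_const

theorem exists_norm_val_le : ∃ C : ℝ, ∀ τ ω, ‖S.val τ ω‖ ≤ C := by
  obtain ⟨C, hC⟩ := S.bdd
  refine ⟨∑ i ∈ Finset.range S.n, C, fun τ ω => ?_⟩
  refine (norm_sum_le _ _).trans (Finset.sum_le_sum fun i _ => ?_)
  exact (norm_indicator_le_norm_self _ _).trans (hC i ω)

theorem integral_sub {c c' : ℝ≥0} (hcc : c ≤ c')
    (h : ∀ i ≤ S.n, S.time i ≤ c ∨ c' ≤ S.time i) (B : ℝ≥0 → Ω → ℝ) (ω : Ω) :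
    S.integral B c' ω - S.integral B c ω = (B c' ω - B c ω) • S.val c' ω := by
  rcases hcc.eq_or_lt with rfl | hlt
  · simp
  unfold integral val
  rw [← Finset.sum_sub_distrib, Finset.smul_sum]
  refine Finset.sum_congr rfl fun i hi => ?_
  have hi := Finset.mem_range.1 hi
  have hm := S.mono (Nat.le_succ i)
  have hind : ∀ {τ a b : ℝ≥0} {x : H}, ¬ (a < τ ∧ τ ≤ b) →
      (Set.Ioc a b).indicator (fun _ => x) τ = 0 := fun h =>
    Set.indicator_of_notMem (show _ ∉ Set.Ioc _ _ from h) _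
  have hind' : ∀ {τ a b : ℝ≥0} {x : H}, a < τ ∧ τ ≤ b →
      (Set.Ioc a b).indicator (fun _ => x) τ = x := fun h =>
    Set.indicator_of_mem (show _ ∈ Set.Ioc _ _ from h) _
  rcases h i hi.le with h1 | h1
  · rcases h (i + 1) hi with h2 | h2
    · rw [hind (fun hc => absurd (hc.2.trans h2) (not_le.2 hlt)),
        min_eq_left h2, min_eq_left (h2.trans hcc), min_eq_left h1, min_eq_left (h1.trans hcc)]
      simp
    · rw [hind' ⟨h1.trans_lt hlt, h2⟩,
        min_eq_right h2, min_eq_right (hcc.trans h2), min_eq_left h1, min_eq_left (h1.trans hcc),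
        ← sub_smul]
      congr 1
      ring
  · have h2 : c' ≤ S.time (i + 1) := h1.trans hm
    rw [hind (fun hc => absurd hc.1 (not_lt.2 h1)),
      min_eq_right h2, min_eq_right (hcc.trans h2), min_eq_right h1, min_eq_right (hcc.trans h1)]
    simp

theorem stronglyMeasurable_val_time (ω : Ω) : StronglyMeasurable (fun τ => S.val τ ω) := by
  refine Finset.stronglyMeasurable_fun_sum _ fun i _ => ?_
  exact stronglyMeasurable_const.indicator measurableSet_Ioc

end SimpleProcess

end SLLB

/-! ### Itô integrals as simultaneous limits of elementary integrals. -/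

namespace SLLB

theorem sum_Ico_telescope {M : Type*} [AddCommGroup M] (f : ℕ → M) {a b : ℕ} (hab : a ≤ b) :
    ∑ l ∈ Finset.Ico a b, (f (l + 1) - f l) = f b - f a := by
  induction b, hab using Nat.le_induction with
  | base => simp
  | succ b hab ih => rw [Finset.sum_Ico_succ_top hab, ih]; abel

section Ito

variable {Ω : Type*} [mΩ : MeasurableSpace Ω] {P : Measure Ω} {𝓕 : Filtration ℝ≥0 mΩ}
  {W : ℕ → ℝ≥0 → Ω → ℝ} {H E : Type*} [NormedAddCommGroup H] [InnerProductSpace ℝ H]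
  [NormedAddCommGroup E] [InnerProductSpace ℝ E]

/-- `M(t) = ∑_k ∫₀ᵗ a_k dW_k`, in the form of simultaneous approximability, at finitely many times,
by the integrals of differences of simple processes. -/
def HasSimpleApprox (P : Measure Ω) (𝓕 : Filtration ℝ≥0 mΩ) (T : ℝ≥0) (W : ℕ → ℝ≥0 → Ω → ℝ)
    (a : ℕ → ℝ≥0 → Ω → H) (M : ℝ≥0 → Ω → H) : Prop :=
  ∀ F : Finset ℝ≥0, (∀ t ∈ F, t ≤ T) → ∀ ε : ℝ, 0 < ε → ∀ n₀ : ℕ, ∃ n ≥ n₀,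
    ∃ S₁ S₂ : ℕ → SimpleProcess 𝓕 H,
      P {ω | ENNReal.ofReal ε ≤ ∑ k ∈ Finset.range n, ∫⁻ s in Set.Icc 0 T,
        ‖(S₁ k).val s ω - (S₂ k).val s ω - a k s ω‖ₑ ^ 2 ∂leb} ≤ ENNReal.ofReal ε ∧
      ∀ t ∈ F, P {ω | ε ≤ ‖∑ k ∈ Finset.range n,
        ((S₁ k).integral (W k) t ω - (S₂ k).integral (W k) t ω) - M t ω‖} ≤ ENNReal.ofReal ε

theorem enorm_add_sq_le (x y : H) : ‖x + y‖ₑ ^ 2 ≤ 2 * ‖x‖ₑ ^ 2 + 2 * ‖y‖ₑ ^ 2 := by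
  have h : ‖x + y‖ ^ 2 ≤ 2 * ‖x‖ ^ 2 + 2 * ‖y‖ ^ 2 := by
    nlinarith [norm_add_le x y, norm_nonneg (x + y), sq_nonneg (‖x‖ - ‖y‖)]
  have h2 := ENNReal.ofReal_le_ofReal h
  rw [ENNReal.ofReal_add (by positivity) (by positivity), ENNReal.ofReal_mul (by norm_num),
    ENNReal.ofReal_mul (by norm_num), ENNReal.ofReal_pow (norm_nonneg _),
    ENNReal.ofReal_pow (norm_nonneg _), ENNReal.ofReal_pow (norm_nonneg _)] at h2
  simpa using h2

theorem measure_exists_lt_le {ι : Type*} (s : Finset ι) (A : ι → Set Ω) {c : ℝ}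
    (h : ∀ i ∈ s, P (A i) ≤ ENNReal.ofReal c) :
    P {ω | ∃ i ∈ s, ω ∈ A i} ≤ ENNReal.ofReal (s.card * c) := by
  have : {ω | ∃ i ∈ s, ω ∈ A i} = ⋃ i ∈ s, A i := by ext; simp
  rw [this]
  refine (measure_biUnion_finset_le s A).trans ((Finset.sum_le_sum h).trans ?_)
  rw [Finset.sum_const, nsmul_eq_mul, ENNReal.ofReal_mul (by positivity), ENNReal.ofReal_natCast]

/-- First `n` is chosen so that the partial sum of the series is close to `M` at the finitely many
given times, and then, for each of the `n` terms, simple processes with a tolerance depending on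
`n`. The two families are kept separate because their partitions differ and their difference is not
directly a simple process. -/
theorem hasSimpleApprox_of_isItoIntegral {T : ℝ≥0} {a₁ a₂ I₁ I₂ : ℕ → ℝ≥0 → Ω → H}
    {M : ℝ≥0 → Ω → H} (h₁ : ∀ k, IsItoIntegral P 𝓕 T (W k) (a₁ k) (I₁ k))
    (h₂ : ∀ k, IsItoIntegral P 𝓕 T (W k) (a₂ k) (I₂ k))
    (hM : ∀ t ≤ T, TendstoInMeasure P
      (fun n ω => ∑ k ∈ Finset.range n, (I₁ k t ω - I₂ k t ω)) atTop (M t))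
    (ha₁ : ∀ k ω, AEStronglyMeasurable (fun s => a₁ k s ω) (leb.restrict (Set.Icc 0 T))) :
    HasSimpleApprox P 𝓕 T W (fun k s ω => a₁ k s ω - a₂ k s ω) M := by
  intro F hF ε hε n₀
  choose S₁ hS₁ hI₁ using h₁
  choose S₂ hS₂ hI₂ using h₂
  obtain ⟨n, hn₀, hn⟩ : ∃ n ≥ n₀, ∀ t ∈ F, P {ω | ENNReal.ofReal (ε / 2) ≤
      edist (∑ k ∈ Finset.range n, (I₁ k t ω - I₂ k t ω)) (M t ω)} ≤ ENNReal.ofReal (ε / 2) := by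
    have h1 : ∀ᶠ n in atTop, ∀ t ∈ F, P {ω | ENNReal.ofReal (ε / 2) ≤
        edist (∑ k ∈ Finset.range n, (I₁ k t ω - I₂ k t ω)) (M t ω)} ≤ ENNReal.ofReal (ε / 2) := by
      rw [Filter.eventually_all_finset]
      intro t ht
      exact (hM t (hF t ht) (ENNReal.ofReal (ε / 2)) (by simpa using hε)).eventually_le_const
        (by simpa using hε)
    obtain ⟨n, h2, h3⟩ := (h1.and (eventually_ge_atTop n₀)).exists
    exact ⟨n, h3, h2⟩
  -- There are two integrals for each of the `n` noise terms, and squaring a sum costs another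
  -- factor two: `4nδ < ε`. For the integrals the total is `2nδ ≤ ε / 2`, the other half being the
  -- tail of the series.
  set δ : ℝ := ε / (4 * (n + 1)) with hδ
  have hδ0 : 0 < δ := by positivity
  have hδn : 4 * (n * δ) ≤ ε := by
    rw [hδ]; field_simp; linarith
  have hδ' : (0 : ℝ≥0∞) < ENNReal.ofReal δ := by simpa using hδ0
  have hex : ∀ {S : ℕ → ℕ → SimpleProcess 𝓕 H} {a I : ℕ → ℝ≥0 → Ω → H}
      (_ : ∀ k, ∀ ε : ℝ≥0∞, 0 < ε → Tendsto (fun n => P {ω | ε ≤ ∫⁻ s in Set.Icc 0 T,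
        ‖(S k n).val s ω - a k s ω‖ₑ ^ 2 ∂leb}) atTop (𝓝 0))
      (_ : ∀ k, ∀ t ≤ T, TendstoInMeasure P (fun n => (S k n).integral (W k) t) atTop (I k t)) (k),
      ∃ m, P {ω | ENNReal.ofReal δ ≤ ∫⁻ s in Set.Icc 0 T,
        ‖(S k m).val s ω - a k s ω‖ₑ ^ 2 ∂leb} ≤ ENNReal.ofReal δ ∧
        ∀ t ∈ F, P {ω | ENNReal.ofReal δ ≤ edist ((S k m).integral (W k) t ω) (I k t ω)}
          ≤ ENNReal.ofReal δ := by
    intro S a I hS hI k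
    have h1 := (hS k _ hδ').eventually_le_const hδ'
    have h2 : ∀ᶠ m in atTop, ∀ t ∈ F, P {ω | ENNReal.ofReal δ ≤
        edist ((S k m).integral (W k) t ω) (I k t ω)} ≤ ENNReal.ofReal δ := by
      rw [Filter.eventually_all_finset]
      intro t ht
      exact (hI k t (hF t ht) _ hδ').eventually_le_const hδ'
    exact (h1.and h2).exists
  choose m₁ hm₁ using hex hS₁ hI₁
  choose m₂ hm₂ using hex hS₂ hI₂
  refine ⟨n, hn₀, fun k => S₁ k (m₁ k), fun k => S₂ k (m₂ k), ?_, fun t ht => ?_⟩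
  · have hsub : {ω | ENNReal.ofReal ε ≤ ∑ k ∈ Finset.range n, ∫⁻ s in Set.Icc 0 T,
        ‖(S₁ k (m₁ k)).val s ω - (S₂ k (m₂ k)).val s ω - (a₁ k s ω - a₂ k s ω)‖ₑ ^ 2 ∂leb}
        ⊆ {ω | ∃ k ∈ Finset.range n, ω ∈ {ω | ENNReal.ofReal δ ≤ ∫⁻ s in Set.Icc 0 T,
            ‖(S₁ k (m₁ k)).val s ω - a₁ k s ω‖ₑ ^ 2 ∂leb}} ∪
          {ω | ∃ k ∈ Finset.range n, ω ∈ {ω | ENNReal.ofReal δ ≤ ∫⁻ s in Set.Icc 0 T,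
            ‖(S₂ k (m₂ k)).val s ω - a₂ k s ω‖ₑ ^ 2 ∂leb}} := by
      intro ω hω
      by_contra hcon
      simp only [Set.mem_union, Set.mem_ofPred_eq, not_or, not_exists, not_and, not_le] at hcon
      obtain ⟨hc1, hc2⟩ := hcon
      have hb : ∀ k ∈ Finset.range n, ∫⁻ s in Set.Icc 0 T,
          ‖(S₁ k (m₁ k)).val s ω - (S₂ k (m₂ k)).val s ω - (a₁ k s ω - a₂ k s ω)‖ₑ ^ 2 ∂leb
            < 4 * ENNReal.ofReal δ := by
        intro k hk
        have hle : ∀ s, ‖(S₁ k (m₁ k)).val s ω - (S₂ k (m₂ k)).val s ω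
            - (a₁ k s ω - a₂ k s ω)‖ₑ ^ 2 ≤ 2 * ‖(S₁ k (m₁ k)).val s ω - a₁ k s ω‖ₑ ^ 2
              + 2 * ‖(S₂ k (m₂ k)).val s ω - a₂ k s ω‖ₑ ^ 2 := by
          intro s
          have := enorm_add_sq_le ((S₁ k (m₁ k)).val s ω - a₁ k s ω)
            (-((S₂ k (m₂ k)).val s ω - a₂ k s ω))
          rw [enorm_neg] at this
          convert this using 3
          abel
        have hmeas : AEMeasurable (fun s => 2 * ‖(S₁ k (m₁ k)).val s ω - a₁ k s ω‖ₑ ^ 2)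
            (leb.restrict (Set.Icc 0 T)) :=
          ((((S₁ k (m₁ k)).stronglyMeasurable_val_time ω).aestronglyMeasurable.sub
            (ha₁ k ω)).enorm.pow_const 2).const_mul 2
        refine (lintegral_mono hle).trans_lt ?_
        rw [lintegral_add_left' hmeas, lintegral_const_mul' _ _ (by simp),
          lintegral_const_mul' _ _ (by simp)]
        have e : 4 * ENNReal.ofReal δ = 2 * ENNReal.ofReal δ + 2 * ENNReal.ofReal δ := by ring
        rw [e]
        exact ENNReal.add_lt_add (ENNReal.mul_lt_mul_right (by simp) (by simp) (hc1 k hk))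
          (ENNReal.mul_lt_mul_right (by simp) (by simp) (hc2 k hk))
      have hω' : ENNReal.ofReal ε ≤ _ := hω
      have h3 : ENNReal.ofReal ε ≤ ENNReal.ofReal (4 * (n * δ)) := by
        refine hω'.trans ((Finset.sum_le_sum fun k hk => (hb k hk).le).trans ?_)
        rw [Finset.sum_const, Finset.card_range, nsmul_eq_mul, ENNReal.ofReal_mul (by norm_num),
          ENNReal.ofReal_mul (by positivity), ENNReal.ofReal_natCast]
        norm_num
        rw [← mul_assoc, ← mul_assoc, mul_comm (n : ℝ≥0∞) 4]
      have h4 : ε ≤ 4 * (n * δ) := (ENNReal.ofReal_le_ofReal_iff (by positivity)).1 h3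
      rw [hδ] at h4
      field_simp at h4
      linarith
    refine (measure_mono hsub).trans ((measure_union_le _ _).trans ((add_le_add
      (measure_exists_lt_le _ _ fun k _ => (hm₁ k).1)
      (measure_exists_lt_le _ _ fun k _ => (hm₂ k).1)).trans ?_))
    rw [Finset.card_range, ← ENNReal.ofReal_add (by positivity) (by positivity)]
    refine ENNReal.ofReal_le_ofReal ?_
    nlinarith [mul_nonneg (Nat.cast_nonneg (α := ℝ) n) hδ0.le]
  · have hsub : {ω | ε ≤ ‖∑ k ∈ Finset.range n, ((S₁ k (m₁ k)).integral (W k) t ω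
          - (S₂ k (m₂ k)).integral (W k) t ω) - M t ω‖}
        ⊆ ({ω | ∃ k ∈ Finset.range n, ω ∈ {ω | ENNReal.ofReal δ ≤
            edist ((S₁ k (m₁ k)).integral (W k) t ω) (I₁ k t ω)}} ∪
          {ω | ∃ k ∈ Finset.range n, ω ∈ {ω | ENNReal.ofReal δ ≤
            edist ((S₂ k (m₂ k)).integral (W k) t ω) (I₂ k t ω)}}) ∪
          {ω | ENNReal.ofReal (ε / 2) ≤
            edist (∑ k ∈ Finset.range n, (I₁ k t ω - I₂ k t ω)) (M t ω)} := by
      intro ω hω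
      by_contra hcon
      simp only [Set.mem_union, Set.mem_ofPred_eq, not_or, not_exists, not_and, not_le, edist_dist,
        ENNReal.ofReal_lt_ofReal_iff hδ0, ENNReal.ofReal_lt_ofReal_iff (half_pos hε),
        dist_eq_norm] at hcon
      obtain ⟨⟨hc1, hc2⟩, hc3⟩ := hcon
      have hω' : ε ≤ ‖_‖ := hω
      have e : ∑ k ∈ Finset.range n, ((S₁ k (m₁ k)).integral (W k) t ω
          - (S₂ k (m₂ k)).integral (W k) t ω) - M t ω
          = ∑ k ∈ Finset.range n, (((S₁ k (m₁ k)).integral (W k) t ω - I₁ k t ω)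
            - ((S₂ k (m₂ k)).integral (W k) t ω - I₂ k t ω))
            + (∑ k ∈ Finset.range n, (I₁ k t ω - I₂ k t ω) - M t ω) := by
        rw [← add_sub_assoc, ← Finset.sum_add_distrib]
        congr 1
        exact Finset.sum_congr rfl fun k _ => by abel
      rw [e] at hω'
      have h1 := norm_add_le (∑ k ∈ Finset.range n, (((S₁ k (m₁ k)).integral (W k) t ω - I₁ k t ω)
            - ((S₂ k (m₂ k)).integral (W k) t ω - I₂ k t ω)))
            (∑ k ∈ Finset.range n, (I₁ k t ω - I₂ k t ω) - M t ω)
      have h2 : ‖∑ k ∈ Finset.range n, (((S₁ k (m₁ k)).integral (W k) t ω - I₁ k t ω)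
            - ((S₂ k (m₂ k)).integral (W k) t ω - I₂ k t ω))‖ ≤ n * (2 * δ) := by
        refine (norm_sum_le_of_le _ (n := fun _ => 2 * δ) fun k hk => ?_).trans (by simp)
        have := norm_sub_le ((S₁ k (m₁ k)).integral (W k) t ω - I₁ k t ω)
          ((S₂ k (m₂ k)).integral (W k) t ω - I₂ k t ω)
        linarith [hc1 k hk, hc2 k hk]
      linarith
    refine (measure_mono hsub).trans ((measure_union_le _ _).trans ((add_le_add
      ((measure_union_le _ _).trans (add_le_add
      (measure_exists_lt_le _ _ fun k _ => (hm₁ k).2 t ht)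
      (measure_exists_lt_le _ _ fun k _ => (hm₂ k).2 t ht))) (hn t ht)).trans ?_))
    rw [Finset.card_range, ← ENNReal.ofReal_add (by positivity) (by positivity),
      ← ENNReal.ofReal_add (by positivity) (by positivity)]
    refine ENNReal.ofReal_le_ofReal ?_
    linarith

end Ito

end SLLB

/-! ### Lenglart's inequality for series of Itô integrals. -/

namespace SLLB

section Lenglart

variable {Ω : Type*} [mΩ : MeasurableSpace Ω] {P : Measure Ω} {𝓕 : Filtration ℝ≥0 mΩ}
  {W : ℕ → ℝ≥0 → Ω → ℝ} {H E : Type*} [NormedAddCommGroup H] [InnerProductSpace ℝ H]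
  [NormedAddCommGroup E] [InnerProductSpace ℝ E]

/-- The index of the cell `[j p, j (p+1))` containing `l`. -/
def cellIndex (j : ℕ → ℕ) (q l : ℕ) : ℕ := Nat.findGreatest (fun p => j p ≤ l) q

theorem cellIndex_eq {j : ℕ → ℕ} (hj : Monotone j) {q l p : ℕ} (hp : p < q)
    (hl : l ∈ Finset.Ico (j p) (j (p + 1))) : cellIndex j q l = p := by
  rw [Finset.mem_Ico] at hl
  rw [cellIndex, Nat.findGreatest_eq_iff]
  exact ⟨hp.le, fun _ => hl.1, fun n hn _ => not_le.2 (hl.2.trans_le (hj hn))⟩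

theorem cellIndex_spec {j : ℕ → ℕ} {q l : ℕ} (h0 : j 0 = 0) (hl : l < j q) :
    cellIndex j q l < q ∧ l ∈ Finset.Ico (j (cellIndex j q l)) (j (cellIndex j q l + 1)) := by
  have h1 : j (cellIndex j q l) ≤ l :=
    Nat.findGreatest_spec (P := fun p => j p ≤ l) (Nat.zero_le q) (by rw [h0]; exact Nat.zero_le l)
  have h2 : cellIndex j q l ≤ q := Nat.findGreatest_le q
  have h3 : cellIndex j q l < q := lt_of_le_of_ne h2 fun h => by rw [h] at h1; omega
  refine ⟨h3, Finset.mem_Ico.2 ⟨h1, ?_⟩⟩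
  by_contra hcon
  have := Nat.le_findGreatest (P := fun p => j p ≤ l) (Nat.succ_le_of_lt h3) (not_lt.1 hcon)
  exact absurd this (by simp [cellIndex])

open Classical in
/-- The extension by zero of the first `K` rows of an array. -/
noncomputable def truncRows (K : ℕ) (η : ℕ → ℕ → Ω → H) (k p : ℕ) (ω : Ω) : H :=
  if k < K then η k p ω else 0

/-- The array on a fine grid given by weighted differences of simple processes and of a coarse
array. -/
noncomputable def fineArray (S₁ S₂ : ℕ → SimpleProcess 𝓕 H) (η : ℕ → ℕ → Ω → H) (V : ℕ → Ω → H →L[ℝ] E)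
    (s : ℕ → ℝ≥0) (j : ℕ → ℕ) (q k l : ℕ) (ω : Ω) : E :=
  V (cellIndex j q l) ω
    ((S₁ k).val (s (l + 1)) ω - (S₂ k).val (s (l + 1)) ω - η k (cellIndex j q l) ω)

/-- The weighted squared distance of the integrands `a` and of the step processes given by `η`. -/
noncomputable def weightedError (a : ℕ → ℝ≥0 → Ω → H) (η : ℕ → ℕ → Ω → H) (V : ℕ → Ω → H →L[ℝ] E)
    (t : ℕ → ℝ≥0) (q : ℕ) (ω : Ω) : ℝ≥0∞ :=
  ∑' k, ∑ p ∈ Finset.range q, ∫⁻ τ in Set.Ioc (t p) (t (p + 1)),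
    (‖V p ω‖ₑ * ‖a k τ ω - η k p ω‖ₑ) ^ 2 ∂leb

variable {S₁ S₂ : ℕ → SimpleProcess 𝓕 H} {η : ℕ → ℕ → Ω → H} {V : ℕ → Ω → H →L[ℝ] E}
  {s t : ℕ → ℝ≥0} {j : ℕ → ℕ} {q n N : ℕ} {R : ℝ}

/-- The weight and the coarse coefficient are known at the left end of the coarse cell. The simple
processes are known at the left end of the fine cell, because the fine grid contains the relevant
partition points. -/
theorem isBddAdapted_fineArray (hs : Monotone s) (h0 : j 0 = 0) (hq : j q = N)
    (hsj : ∀ p ≤ q, s (j p) = t p)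
    (h₁ : ∀ k < n, ∀ i ≤ (S₁ k).n, ∀ l < N, (S₁ k).time i ≤ s l ∨ s (l + 1) ≤ (S₁ k).time i)
    (h₂ : ∀ k < n, ∀ i ≤ (S₂ k).n, ∀ l < N, (S₂ k).time i ≤ s l ∨ s (l + 1) ≤ (S₂ k).time i)
    (hη : IsBddAdapted 𝓕 t q n η) (hV : ∀ p < q, StronglyMeasurable[𝓕 (t p)] (V p))
    (hVR : ∀ p < q, ∀ ω, ‖V p ω‖ ≤ R) :
    IsBddAdapted 𝓕 s N n (fineArray S₁ S₂ η V s j q) where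
  meas k hk l hl := by
    obtain ⟨hp, hlp⟩ := cellIndex_spec h0 (hq ▸ hl)
    have hle : t (cellIndex j q l) ≤ s l := by
      rw [← hsj _ hp.le]; exact hs (Finset.mem_Ico.1 hlp).1
    have hx : StronglyMeasurable[𝓕 (s l)] fun ω => (S₁ k).val (s (l + 1)) ω
        - (S₂ k).val (s (l + 1)) ω - η k (cellIndex j q l) ω :=
      (((S₁ k).stronglyMeasurable_val fun i hi => h₁ k hk i hi l hl).sub
        ((S₂ k).stronglyMeasurable_val fun i hi => h₂ k hk i hi l hl)).sub
        ((hη.meas k hk _ hp).mono (𝓕.mono hle))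
    exact (isBoundedBilinearMap_apply (𝕜 := ℝ)).continuous.comp_stronglyMeasurable
      (((hV _ hp).mono (𝓕.mono hle)).prodMk hx)
  bdd k hk l hl := by
    obtain ⟨hp, hlp⟩ := cellIndex_spec h0 (hq ▸ hl)
    obtain ⟨C₁, hC₁⟩ := (S₁ k).exists_norm_val_le
    obtain ⟨C₂, hC₂⟩ := (S₂ k).exists_norm_val_le
    obtain ⟨C₃, hC₃⟩ := hη.bdd k hk _ hp
    refine ⟨R * (C₁ + C₂ + C₃), fun ω => ((V _ ω).le_opNorm _).trans ?_⟩
    have hR : 0 ≤ R := (norm_nonneg _).trans (hVR _ hp ω)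
    refine mul_le_mul (hVR _ hp ω) ?_ (norm_nonneg _) hR
    exact (norm_sub_le _ _).trans (add_le_add ((norm_sub_le _ _).trans
      (add_le_add (hC₁ _ _) (hC₂ _ _))) (hC₃ ω))

/-- Inside a coarse cell the weight and `η` are constant, and each fine increment is a difference of
elementary integrals. The sum over the fine cells telescopes. -/
theorem discreteIntegral_fineArray (hs : Monotone s) (hj : Monotone j) (hq : j q = N)
    (hsj : ∀ p ≤ q, s (j p) = t p)
    (h₁ : ∀ k < n, ∀ i ≤ (S₁ k).n, ∀ l < N, (S₁ k).time i ≤ s l ∨ s (l + 1) ≤ (S₁ k).time i)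
    (h₂ : ∀ k < n, ∀ i ≤ (S₂ k).n, ∀ l < N, (S₂ k).time i ≤ s l ∨ s (l + 1) ≤ (S₂ k).time i)
    {a b : ℕ} (hab : a ≤ b) (hb : b ≤ q) (ω : Ω) :
    discreteIntegral W s n (fineArray S₁ S₂ η V s j q) (j b) ω
        - discreteIntegral W s n (fineArray S₁ S₂ η V s j q) (j a) ω
      = ∑ p ∈ Finset.Ico a b, V p ω
        (∑ k ∈ Finset.range n, ((S₁ k).integral (W k) (t (p + 1)) ω
            - (S₂ k).integral (W k) (t (p + 1)) ω)
          - ∑ k ∈ Finset.range n, ((S₁ k).integral (W k) (t p) ω - (S₂ k).integral (W k) (t p) ω)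
          - ∑ k ∈ Finset.range n, (W k (t (p + 1)) ω - W k (t p) ω) • η k p ω) := by
  unfold discreteIntegral
  rw [← Finset.sum_Ico_eq_sub _ (hj hab), ← sum_sum_Ico _ hj hab]
  refine Finset.sum_congr rfl fun p hp => ?_
  have hpq : p < q := (Finset.mem_Ico.1 hp).2.trans_le hb
  rw [Finset.sum_comm, ← Finset.sum_sub_distrib, ← Finset.sum_sub_distrib, map_sum]
  refine Finset.sum_congr rfl fun k hk => ?_
  have hk := Finset.mem_range.1 hk
  have hlt : ∀ l ∈ Finset.Ico (j p) (j (p + 1)), l < N := fun l hl =>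
    (Finset.mem_Ico.1 hl).2.trans_le (hq ▸ hj hpq)
  have e : ∀ l ∈ Finset.Ico (j p) (j (p + 1)),
      (W k (s (l + 1)) ω - W k (s l) ω) • fineArray S₁ S₂ η V s j q k l ω
      = V p ω (((S₁ k).integral (W k) (s (l + 1)) ω - (S₁ k).integral (W k) (s l) ω)
        - ((S₂ k).integral (W k) (s (l + 1)) ω - (S₂ k).integral (W k) (s l) ω)
        - (W k (s (l + 1)) ω - W k (s l) ω) • η k p ω) := by
    intro l hl
    rw [(S₁ k).integral_sub (hs (Nat.le_succ l)) (fun i hi => h₁ k hk i hi l (hlt l hl)),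
      (S₂ k).integral_sub (hs (Nat.le_succ l)) (fun i hi => h₂ k hk i hi l (hlt l hl)),
      ← smul_sub, ← smul_sub, map_smul, fineArray, cellIndex_eq hj hpq hl]
  rw [Finset.sum_congr rfl e, ← map_sum, Finset.sum_sub_distrib, Finset.sum_sub_distrib,
    ← Finset.sum_smul, sum_Ico_telescope (fun l => (S₁ k).integral (W k) (s l) ω)
      (hj (Nat.le_succ p)), sum_Ico_telescope (fun l => (S₂ k).integral (W k) (s l) ω)
      (hj (Nat.le_succ p)), sum_Ico_telescope (fun l => W k (s l) ω) (hj (Nat.le_succ p)),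
    hsj p hpq.le, hsj (p + 1) hpq]
  congr 1
  abel

theorem ofReal_quadSum (hs : Monotone s) (ξ : ℕ → ℕ → Ω → E) (ω : Ω) :
    ENNReal.ofReal (quadSum s n ξ N ω) = ∑ k ∈ Finset.range n, ∑ l ∈ Finset.range N,
      ∫⁻ _ in Set.Ioc (s l) (s (l + 1)), ‖ξ k l ω‖ₑ ^ 2 ∂leb := by
  unfold quadSum
  simp_rw [Finset.mul_sum]
  rw [Finset.sum_comm]
  have h0 : ∀ l, (0 : ℝ) ≤ s (l + 1) - s l := fun l => sub_nonneg.2 (hs (Nat.le_succ l))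
  rw [ENNReal.ofReal_sum_of_nonneg fun k _ => Finset.sum_nonneg fun l _ =>
    mul_nonneg (h0 l) (sq_nonneg _)]
  refine Finset.sum_congr rfl fun k _ => ?_
  rw [ENNReal.ofReal_sum_of_nonneg fun l _ => mul_nonneg (h0 l) (sq_nonneg _)]
  refine Finset.sum_congr rfl fun l _ => ?_
  rw [setLIntegral_const, leb_Ioc, ENNReal.ofReal_mul (h0 l), ENNReal.ofReal_pow (norm_nonneg _),
    ofReal_norm, mul_comm]

/-- Split `S₁ - S₂ - η = (S₁ - S₂ - a) + (a - η)`. In the first part the weight is replaced by its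
crude bound `R`, which is harmless since the approximation can be improved after `R` is fixed. In
the second part the weight itself must be kept, because later `R` grows along the sequence of grids.
-/
theorem ofReal_quadSum_fineArray_le {T : ℝ≥0} {a : ℕ → ℝ≥0 → Ω → H} (hs : Monotone s)
    (ht : Monotone t) (hj : Monotone j) (h0 : j 0 = 0) (hq : j q = N)
    (hsj : ∀ p ≤ q, s (j p) = t p) (htT : t q ≤ T)
    (h₁ : ∀ k < n, ∀ i ≤ (S₁ k).n, ∀ l < N, (S₁ k).time i ≤ s l ∨ s (l + 1) ≤ (S₁ k).time i)
    (h₂ : ∀ k < n, ∀ i ≤ (S₂ k).n, ∀ l < N, (S₂ k).time i ≤ s l ∨ s (l + 1) ≤ (S₂ k).time i)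
    (hVR : ∀ p < q, ∀ ω, ‖V p ω‖ ≤ R)
    (ha : ∀ k ω, AEStronglyMeasurable (fun s => a k s ω) (leb.restrict (Set.Icc 0 T))) (ω : Ω) :
    ENNReal.ofReal (quadSum s n (fineArray S₁ S₂ η V s j q) N ω)
      ≤ 2 * ENNReal.ofReal R ^ 2 * (∑ k ∈ Finset.range n, ∫⁻ τ in Set.Icc 0 T,
        ‖(S₁ k).val τ ω - (S₂ k).val τ ω - a k τ ω‖ₑ ^ 2 ∂leb)
        + 2 * weightedError a η V t q ω := by
  rw [ofReal_quadSum hs]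
  have key : ∀ k ∈ Finset.range n, ∑ l ∈ Finset.range N,
      ∫⁻ _ in Set.Ioc (s l) (s (l + 1)), ‖fineArray S₁ S₂ η V s j q k l ω‖ₑ ^ 2 ∂leb
      ≤ 2 * ENNReal.ofReal R ^ 2 * (∫⁻ τ in Set.Icc 0 T,
        ‖(S₁ k).val τ ω - (S₂ k).val τ ω - a k τ ω‖ₑ ^ 2 ∂leb)
        + 2 * ∑ p ∈ Finset.range q, ∫⁻ τ in Set.Ioc (t p) (t (p + 1)),
          (‖V p ω‖ₑ * ‖a k τ ω - η k p ω‖ₑ) ^ 2 ∂leb := by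
    intro k hk
    have hk := Finset.mem_range.1 hk
    set f : ℝ≥0 → ℝ≥0∞ := fun τ => 2 * ENNReal.ofReal R ^ 2 *
      ‖(S₁ k).val τ ω - (S₂ k).val τ ω - a k τ ω‖ₑ ^ 2 with hf
    have hfm : AEMeasurable f (leb.restrict (Set.Icc 0 T)) :=
      (((((S₁ k).stronglyMeasurable_val_time ω).aestronglyMeasurable.sub
        ((S₂ k).stronglyMeasurable_val_time ω).aestronglyMeasurable).sub
        (ha k ω)).enorm.pow_const 2).const_mul _
    have hcell : ∀ p < q, ∀ l ∈ Finset.Ico (j p) (j (p + 1)),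
        ∫⁻ _ in Set.Ioc (s l) (s (l + 1)), ‖fineArray S₁ S₂ η V s j q k l ω‖ₑ ^ 2 ∂leb
        ≤ ∫⁻ τ in Set.Ioc (s l) (s (l + 1)), f τ ∂leb
          + ∫⁻ τ in Set.Ioc (s l) (s (l + 1)), 2 * (‖V p ω‖ₑ * ‖a k τ ω - η k p ω‖ₑ) ^ 2 ∂leb := by
      intro p hp l hl
      have hlN : l < N := (Finset.mem_Ico.1 hl).2.trans_le (hq ▸ hj hp)
      have hsub : Set.Ioc (s l) (s (l + 1)) ⊆ Set.Icc 0 T := fun x hx =>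
        ⟨zero_le, hx.2.trans ((hs (hlN : l + 1 ≤ N)).trans (by
          rw [← hq, hsj q le_rfl]; exact htT))⟩
      rw [← lintegral_add_left' (hfm.mono_measure (Measure.restrict_mono hsub le_rfl))]
      refine setLIntegral_mono' measurableSet_Ioc fun τ hτ => ?_
      rw [fineArray, cellIndex_eq hj hp hl,
        ← (S₁ k).val_eq_of_mem_Ioc (fun i hi => h₁ k hk i hi l hlN) hτ,
        ← (S₂ k).val_eq_of_mem_Ioc (fun i hi => h₂ k hk i hi l hlN) hτ]
      have hVe : ‖V p ω‖ₑ ≤ ENNReal.ofReal R := by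
        rw [← ofReal_norm]; exact ENNReal.ofReal_le_ofReal (hVR p hp ω)
      have e : (S₁ k).val τ ω - (S₂ k).val τ ω - η k p ω
          = ((S₁ k).val τ ω - (S₂ k).val τ ω - a k τ ω) + (a k τ ω - η k p ω) := by abel
      calc ‖V p ω ((S₁ k).val τ ω - (S₂ k).val τ ω - η k p ω)‖ₑ ^ 2
          ≤ (‖V p ω‖ₑ * ‖(S₁ k).val τ ω - (S₂ k).val τ ω - η k p ω‖ₑ) ^ 2 := by
            gcongr
            exact (V p ω).le_opENorm _
        _ ≤ ‖V p ω‖ₑ ^ 2 * (2 * ‖(S₁ k).val τ ω - (S₂ k).val τ ω - a k τ ω‖ₑ ^ 2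
              + 2 * ‖a k τ ω - η k p ω‖ₑ ^ 2) := by
            rw [mul_pow, e]
            gcongr
            exact enorm_add_sq_le _ _
        _ = ‖V p ω‖ₑ ^ 2 * (2 * ‖(S₁ k).val τ ω - (S₂ k).val τ ω - a k τ ω‖ₑ ^ 2)
              + 2 * (‖V p ω‖ₑ * ‖a k τ ω - η k p ω‖ₑ) ^ 2 := by ring
        _ ≤ ENNReal.ofReal R ^ 2 * (2 * ‖(S₁ k).val τ ω - (S₂ k).val τ ω - a k τ ω‖ₑ ^ 2)
              + 2 * (‖V p ω‖ₑ * ‖a k τ ω - η k p ω‖ₑ) ^ 2 := by gcongr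
        _ = _ := by rw [hf]; ring
    have hsum : ∀ p ∈ Finset.Ico 0 q, ∑ l ∈ Finset.Ico (j p) (j (p + 1)),
        ∫⁻ _ in Set.Ioc (s l) (s (l + 1)), ‖fineArray S₁ S₂ η V s j q k l ω‖ₑ ^ 2 ∂leb
        ≤ ∫⁻ τ in Set.Ioc (t p) (t (p + 1)), f τ ∂leb
          + ∫⁻ τ in Set.Ioc (t p) (t (p + 1)), 2 * (‖V p ω‖ₑ * ‖a k τ ω - η k p ω‖ₑ) ^ 2 ∂leb := by
      intro p hp
      have hp := (Finset.mem_Ico.1 hp).2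
      refine (Finset.sum_le_sum (hcell p hp)).trans ?_
      rw [Finset.sum_add_distrib, lintegral_Ioc_sum hs (hj (Nat.le_succ p)),
        lintegral_Ioc_sum hs (hj (Nat.le_succ p)), hsj p hp.le, hsj (p + 1) hp]
    have hN : ∑ l ∈ Finset.range N,
        ∫⁻ _ in Set.Ioc (s l) (s (l + 1)), ‖fineArray S₁ S₂ η V s j q k l ω‖ₑ ^ 2 ∂leb
        = ∑ p ∈ Finset.Ico 0 q, ∑ l ∈ Finset.Ico (j p) (j (p + 1)),
          ∫⁻ _ in Set.Ioc (s l) (s (l + 1)), ‖fineArray S₁ S₂ η V s j q k l ω‖ₑ ^ 2 ∂leb := by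
      rw [sum_sum_Ico (fun l => ∫⁻ _ in Set.Ioc (s l) (s (l + 1)),
        ‖fineArray S₁ S₂ η V s j q k l ω‖ₑ ^ 2 ∂leb) hj (Nat.zero_le q), h0, hq,
        Finset.range_eq_Ico]
    rw [hN]
    refine (Finset.sum_le_sum hsum).trans ?_
    rw [Finset.sum_add_distrib, lintegral_Ioc_sum ht (Nat.zero_le q), Finset.mul_sum,
      Finset.range_eq_Ico]
    refine add_le_add ?_ (le_of_eq (Finset.sum_congr rfl fun p _ => ?_))
    · rw [← lintegral_const_mul' _ _ (by finiteness)]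
      exact lintegral_mono_set fun x hx => ⟨zero_le, hx.2.trans htT⟩
    · rw [lintegral_const_mul' _ _ (by simp)]
  refine (Finset.sum_le_sum key).trans ?_
  rw [Finset.sum_add_distrib, ← Finset.mul_sum, ← Finset.mul_sum]
  gcongr
  exact ENNReal.sum_le_tsum _

end Lenglart

end SLLB

namespace SLLB

section Lenglart

variable {Ω : Type*} [mΩ : MeasurableSpace Ω] {P : Measure Ω} {𝓕 : Filtration ℝ≥0 mΩ}
  {W : ℕ → ℝ≥0 → Ω → ℝ} {H E : Type*} [NormedAddCommGroup H] [InnerProductSpace ℝ H]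
  [NormedAddCommGroup E] [InnerProductSpace ℝ E]

theorem sum_norm_sum_Ico_sq_le {x : ℕ → E} {B : ℝ} (hB : 0 ≤ B) {q : ℕ}
    (hx : ∀ p < q, ‖x p‖ ≤ B) {r : ℕ → ℕ} (hr : Monotone r) {q' : ℕ} (hrq : r q' ≤ q) :
    ∑ p' ∈ Finset.range q', ‖∑ p ∈ Finset.Ico (r p') (r (p' + 1)), x p‖ ^ 2 ≤ (q * B) ^ 2 := by
  have h1 : ∑ p' ∈ Finset.range q', ‖∑ p ∈ Finset.Ico (r p') (r (p' + 1)), x p‖ ≤ q * B := by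
    refine (Finset.sum_le_sum fun p' _ => norm_sum_le _ _).trans ?_
    rw [Finset.range_eq_Ico, sum_sum_Ico _ hr (Nat.zero_le _)]
    refine (Finset.sum_le_card_nsmul _ _ B fun p hp =>
      hx p ((Finset.mem_Ico.1 hp).2.trans_le hrq)).trans ?_
    rw [nsmul_eq_mul, Nat.card_Ico]
    refine mul_le_mul_of_nonneg_right ?_ hB
    exact_mod_cast (Nat.sub_le _ _).trans hrq
  refine le_trans ?_ (pow_le_pow_left₀ (Finset.sum_nonneg fun _ _ => norm_nonneg _) h1 2)
  exact Finset.sum_sq_le_sq_sum_of_nonneg fun _ _ => norm_nonneg _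

theorem sum_norm_sq_le_of_sub {q : ℕ} (x y : ℕ → E) :
    ∑ p ∈ Finset.range q, ‖x p‖ ^ 2
      ≤ 2 * ∑ p ∈ Finset.range q, ‖y p‖ ^ 2 + 2 * ∑ p ∈ Finset.range q, ‖x p - y p‖ ^ 2 := by
  rw [Finset.mul_sum, Finset.mul_sum, ← Finset.sum_add_distrib]
  refine Finset.sum_le_sum fun p _ => ?_
  have h := norm_add_le (y p) (x p - y p)
  rw [add_sub_cancel] at h
  nlinarith [sq_nonneg (‖y p‖ - ‖x p - y p‖), norm_nonneg (x p)]

/-- Lenglart's inequality for (series of) Itô integrals: the weighted increments of the difference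
of the integral of `a` and the integral of a step process `η`. -/
theorem HasSimpleApprox.measure_sum_sq_ge_le [IsProbabilityMeasure P] {T : ℝ≥0}
    {a : ℕ → ℝ≥0 → Ω → H} {M : ℝ≥0 → Ω → H} (hM : HasSimpleApprox P 𝓕 T W a M)
    (hW : IsWienerSequence P 𝓕 W)
    (ha : ∀ k ω, AEStronglyMeasurable (fun s => a k s ω) (leb.restrict (Set.Icc 0 T)))
    {t : ℕ → ℝ≥0} (ht : Monotone t) {q : ℕ} (htT : t q ≤ T) {K : ℕ} {η : ℕ → ℕ → Ω → H}
    (hη : IsBddAdapted 𝓕 t q K η) {V : ℕ → Ω → H →L[ℝ] E}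
    (hV : ∀ p < q, StronglyMeasurable[𝓕 (t p)] (V p)) {R : ℝ} (hR : 0 ≤ R)
    (hVR : ∀ p < q, ∀ ω, ‖V p ω‖ ≤ R) {r : ℕ → ℕ} (hr : Monotone r) {q' : ℕ} (hrq : r q' ≤ q)
    {δ lam : ℝ} (hδ : 0 < δ) (hlam : 0 < lam) :
    P {ω | 4 * lam ≤ ∑ p' ∈ Finset.range q', ‖∑ p ∈ Finset.Ico (r p') (r (p' + 1)),
        V p ω (M (t (p + 1)) ω - M (t p) ω
          - ∑ k ∈ Finset.range K, (W k (t (p + 1)) ω - W k (t p) ω) • η k p ω)‖ ^ 2}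
      ≤ P {ω | ENNReal.ofReal δ ≤ weightedError a (truncRows K η) V t q ω}
        + ENNReal.ofReal (4 * δ / lam) := by
  classical
  -- The approximation by simple processes enters only through errors that can be made arbitrarily
  -- small for the given grid, weights and coefficients.
  refine ENNReal.le_of_forall_pos_le_add fun ε₀ hε₀ _ => ?_
  -- Three demands: the exceptional sets of the approximation (one for the integrands and `q + 1`
  -- for the grid times) have total probability below `ε₀`, the quadratic error `R²ε` is below `δ`,
  -- and replacing `M` by its approximation changes the sum of squares by a quantity below `lam`.
  obtain ⟨ε, hε, hε1, hε2, hε3⟩ : ∃ ε : ℝ, 0 < ε ∧ (q + 2) * ε < ε₀ ∧ R ^ 2 * ε < δ ∧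
      (q * (R * (2 * ε))) ^ 2 < lam := by
    have h1 : Tendsto (fun ε : ℝ => (q + 2) * ε) (𝓝[>] 0) (𝓝 0) := by
      have : Tendsto (fun ε : ℝ => (q + 2) * ε) (𝓝 0) (𝓝 ((q + 2) * 0)) :=
        Continuous.tendsto (by fun_prop) 0
      rw [mul_zero] at this
      exact this.mono_left nhdsWithin_le_nhds
    have h2 : Tendsto (fun ε : ℝ => R ^ 2 * ε) (𝓝[>] 0) (𝓝 0) := by
      have : Tendsto (fun ε : ℝ => R ^ 2 * ε) (𝓝 0) (𝓝 (R ^ 2 * 0)) :=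
        Continuous.tendsto (by fun_prop) 0
      rw [mul_zero] at this
      exact this.mono_left nhdsWithin_le_nhds
    have h3 : Tendsto (fun ε : ℝ => (q * (R * (2 * ε))) ^ 2) (𝓝[>] 0) (𝓝 0) := by
      have : Tendsto (fun ε : ℝ => (q * (R * (2 * ε))) ^ 2) (𝓝 0)
        (𝓝 ((q * (R * (2 * 0))) ^ 2)) := Continuous.tendsto (by fun_prop) 0
      rw [show ((q : ℝ) * (R * (2 * 0))) ^ 2 = 0 by ring] at this
      exact this.mono_left nhdsWithin_le_nhds
    obtain ⟨ε, ⟨⟨⟨h4, h5⟩, h6⟩, h7⟩⟩ := (((h1.eventually_lt_const (u := (ε₀ : ℝ)) hε₀).and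
      (h2.eventually_lt_const hδ)).and (h3.eventually_lt_const hlam)).and
      (self_mem_nhdsWithin (a := (0 : ℝ)) (s := Set.Ioi 0)) |>.exists
    exact ⟨ε, h7, h4, h5, h6⟩
  obtain ⟨n, hnK, S₁, S₂, hS, hSM⟩ := hM ((Finset.range (q + 1)).image t) (by
    intro x hx
    obtain ⟨p, hp, rfl⟩ := Finset.mem_image.1 hx
    exact (ht (Nat.lt_succ_iff.1 (Finset.mem_range.1 hp))).trans htT) ε hε K
  -- The fine grid absorbs all partition points of the simple processes in the range of `t`, so that
  -- everything becomes a discrete integral.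
  obtain ⟨s, N, j, hs, hj, h0, hq, hsj, hF⟩ := exists_refinement
    ((Finset.range n).biUnion fun k => (Finset.range ((S₁ k).n + 1)).image (S₁ k).time ∪
      (Finset.range ((S₂ k).n + 1)).image (S₂ k).time) ht q
  have h₁ : ∀ k < n, ∀ i ≤ (S₁ k).n, ∀ l < N,
      (S₁ k).time i ≤ s l ∨ s (l + 1) ≤ (S₁ k).time i := fun k hk i hi l hl =>
    hF _ (Finset.mem_biUnion.2 ⟨k, Finset.mem_range.2 hk, Finset.mem_union_left _
      (Finset.mem_image_of_mem _ (Finset.mem_range.2 (Nat.lt_succ_of_le hi)))⟩) l hl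
  have h₂ : ∀ k < n, ∀ i ≤ (S₂ k).n, ∀ l < N,
      (S₂ k).time i ≤ s l ∨ s (l + 1) ≤ (S₂ k).time i := fun k hk i hi l hl =>
    hF _ (Finset.mem_biUnion.2 ⟨k, Finset.mem_range.2 hk, Finset.mem_union_right _
      (Finset.mem_image_of_mem _ (Finset.mem_range.2 (Nat.lt_succ_of_le hi)))⟩) l hl
  -- The approximation uses `n ≥ K` Wiener processes. The step process is padded with zero rows,
  -- which do not change its integral.
  set η' := truncRows K η with hη'
  have hη'a : IsBddAdapted 𝓕 t q n η' := by
    refine ⟨fun k _ p hp => ?_, fun k _ p hp => ?_⟩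
    · by_cases h : k < K
      · have e : η' k p = η k p := by ext ω; simp [hη', truncRows, h]
        rw [e]; exact hη.meas k h p hp
      · have e : η' k p = fun _ => 0 := by ext ω; simp [hη', truncRows, h]
        rw [e]; exact stronglyMeasurable_const
    · by_cases h : k < K
      · simpa only [hη', truncRows, if_pos h] using hη.bdd k h p hp
      · exact ⟨0, fun ω => by simp [hη', truncRows, if_neg h]⟩
  have hηsum : ∀ p ω, ∑ k ∈ Finset.range n, (W k (t (p + 1)) ω - W k (t p) ω) • η' k p ω
      = ∑ k ∈ Finset.range K, (W k (t (p + 1)) ω - W k (t p) ω) • η k p ω := by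
    intro p ω
    rw [← Finset.sum_subset (Finset.range_subset_range.2 hnK) (fun k _ hk => by
      rw [Finset.mem_range, not_lt] at hk
      simp [hη', truncRows, not_lt.2 hk])]
    refine Finset.sum_congr rfl fun k hk => ?_
    simp [hη', truncRows, Finset.mem_range.1 hk]
  set ξ := fineArray S₁ S₂ η' V s j q with hξ
  have hξa : IsBddAdapted 𝓕 s N n ξ :=
    isBddAdapted_fineArray hs h0 hq hsj h₁ h₂ hη'a hV hVR
  -- The discrete inequality at level `4δ`: off the exceptional sets the quadratic sum is at most
  -- `2R²ε + 2δ < 4δ`.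
  have hlen := hξa.measure_sum_sq_ge_le hW hs (hj.comp hr) (q := q')
    ((hj hrq).trans hq.le) (δ := 4 * δ) (by positivity) hlam
  set Mn : ℝ≥0 → Ω → H := fun t ω => ∑ k ∈ Finset.range n,
    ((S₁ k).integral (W k) t ω - (S₂ k).integral (W k) t ω) with hMn
  set A : Set Ω := {ω | ENNReal.ofReal δ ≤ weightedError a η' V t q ω}
  set B₁ : Set Ω := {ω | ENNReal.ofReal ε ≤ ∑ k ∈ Finset.range n, ∫⁻ s in Set.Icc 0 T,
        ‖(S₁ k).val s ω - (S₂ k).val s ω - a k s ω‖ₑ ^ 2 ∂leb}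
  set B₂ : Set Ω := {ω | ∃ p ∈ Finset.range (q + 1), ω ∈ {ω | ε ≤ ‖Mn (t p) ω - M (t p) ω‖}}
  set C : Set Ω := {ω | lam ≤ ∑ p ∈ Finset.range q',
    ‖discreteIntegral W s n ξ ((j ∘ r) (p + 1)) ω - discreteIntegral W s n ξ ((j ∘ r) p) ω‖ ^ 2}
  have hB₂ : P B₂ ≤ ENNReal.ofReal ((q + 1) * ε) := by
    have := measure_exists_lt_le (P := P) (Finset.range (q + 1))
      (fun p => {ω | ε ≤ ‖Mn (t p) ω - M (t p) ω‖}) (c := ε)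
      (fun p hp => hSM (t p) (Finset.mem_image_of_mem _ hp))
    rw [Finset.card_range, Nat.cast_succ] at this
    exact this
  have hC : P C ≤ P A + P B₁ + ENNReal.ofReal (4 * δ / lam) := by
    refine hlen.trans (add_le_add ((measure_mono ?_).trans (measure_union_le A B₁)) le_rfl)
    intro ω hω
    by_contra hcon
    simp only [Set.mem_union, not_or] at hcon
    have hA : weightedError a η' V t q ω < ENNReal.ofReal δ := not_le.1 hcon.1
    have hB : ∑ k ∈ Finset.range n, ∫⁻ s in Set.Icc 0 T,
        ‖(S₁ k).val s ω - (S₂ k).val s ω - a k s ω‖ₑ ^ 2 ∂leb < ENNReal.ofReal ε :=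
      not_le.1 hcon.2
    have hω : 4 * δ < quadSum s n ξ N ω := hω
    have hle := ofReal_quadSum_fineArray_le (R := R) (η := η') hs ht hj h0 hq hsj htT h₁ h₂
      hVR ha ω
    have h4 : ENNReal.ofReal (4 * δ) < ENNReal.ofReal (quadSum s n ξ N ω) :=
      (ENNReal.ofReal_lt_ofReal_iff (by linarith)).2 hω
    have h5 : 2 * ENNReal.ofReal R ^ 2 * (∑ k ∈ Finset.range n, ∫⁻ τ in Set.Icc 0 T,
        ‖(S₁ k).val τ ω - (S₂ k).val τ ω - a k τ ω‖ₑ ^ 2 ∂leb)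
        + 2 * weightedError a η' V t q ω ≤ ENNReal.ofReal (4 * δ) := by
      calc _ ≤ 2 * ENNReal.ofReal R ^ 2 * ENNReal.ofReal ε + 2 * ENNReal.ofReal δ := by
            gcongr
        _ = ENNReal.ofReal (2 * (R ^ 2 * ε) + 2 * δ) := by
            rw [ENNReal.ofReal_add (by positivity) (by positivity),
              ENNReal.ofReal_mul (by norm_num), ENNReal.ofReal_mul (by positivity),
              ENNReal.ofReal_mul (by norm_num), ENNReal.ofReal_pow hR]
            norm_num
            ring
        _ ≤ _ := ENNReal.ofReal_le_ofReal (by linarith)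
    exact absurd (h4.trans_le (hle.trans h5)) (lt_irrefl _)
  have hsub : {ω | 4 * lam ≤ ∑ p' ∈ Finset.range q', ‖∑ p ∈ Finset.Ico (r p') (r (p' + 1)),
        V p ω (M (t (p + 1)) ω - M (t p) ω
          - ∑ k ∈ Finset.range K, (W k (t (p + 1)) ω - W k (t p) ω) • η k p ω)‖ ^ 2} ⊆ C ∪ B₂ := by
    intro ω hω
    by_contra hcon
    simp only [Set.mem_union, not_or] at hcon
    have hCn : ∑ p ∈ Finset.range q', ‖discreteIntegral W s n ξ ((j ∘ r) (p + 1)) ω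
      - discreteIntegral W s n ξ ((j ∘ r) p) ω‖ ^ 2 < lam := not_le.1 hcon.1
    have hBn : ∀ p ≤ q, ‖Mn (t p) ω - M (t p) ω‖ < ε := by
      intro p hp
      by_contra h
      exact hcon.2 ⟨p, Finset.mem_range.2 (Nat.lt_succ_of_le hp), not_lt.1 h⟩
    have hω : 4 * lam ≤ _ := hω
    have e : ∀ p' ∈ Finset.range q', discreteIntegral W s n ξ ((j ∘ r) (p' + 1)) ω
        - discreteIntegral W s n ξ ((j ∘ r) p') ω
        = ∑ p ∈ Finset.Ico (r p') (r (p' + 1)), V p ω (Mn (t (p + 1)) ω - Mn (t p) ω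
          - ∑ k ∈ Finset.range K, (W k (t (p + 1)) ω - W k (t p) ω) • η k p ω) := by
      intro p' hp'
      have hp' := Finset.mem_range.1 hp'
      simp_rw [← hηsum]
      exact discreteIntegral_fineArray hs hj hq hsj h₁ h₂ (hr (Nat.le_succ p'))
        ((hr hp').trans hrq) ω
    rw [Finset.sum_congr rfl fun p' hp' => by rw [e p' hp']] at hCn
    have hdiff := sum_norm_sum_Ico_sq_le (q := q) (x := fun p => V p ω (M (t (p + 1)) ω - M (t p) ω
          - ∑ k ∈ Finset.range K, (W k (t (p + 1)) ω - W k (t p) ω) • η k p ω)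
        - V p ω (Mn (t (p + 1)) ω - Mn (t p) ω
          - ∑ k ∈ Finset.range K, (W k (t (p + 1)) ω - W k (t p) ω) • η k p ω))
      (B := R * (2 * ε)) (by positivity) (fun p hp => by
        rw [← map_sub]
        refine ((V p ω).le_opNorm _).trans (mul_le_mul (hVR p hp ω) ?_ (norm_nonneg _) hR)
        have e2 : M (t (p + 1)) ω - M (t p) ω
          - ∑ k ∈ Finset.range K, (W k (t (p + 1)) ω - W k (t p) ω) • η k p ω
          - (Mn (t (p + 1)) ω - Mn (t p) ω
          - ∑ k ∈ Finset.range K, (W k (t (p + 1)) ω - W k (t p) ω) • η k p ω)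
          = (Mn (t p) ω - M (t p) ω) - (Mn (t (p + 1)) ω - M (t (p + 1)) ω) := by abel
        rw [e2]
        have := norm_sub_le (Mn (t p) ω - M (t p) ω) (Mn (t (p + 1)) ω - M (t (p + 1)) ω)
        linarith [hBn p hp.le, hBn (p + 1) hp]) hr hrq
    -- `‖x‖² ≤ 2‖y‖² + 2‖x - y‖²` with both sums below `lam`. This is the origin of the factor four
    -- in front of `lam`.
    have h3 := sum_norm_sq_le_of_sub (q := q') (fun p' => ∑ p ∈ Finset.Ico (r p') (r (p' + 1)),
        V p ω (M (t (p + 1)) ω - M (t p) ω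
          - ∑ k ∈ Finset.range K, (W k (t (p + 1)) ω - W k (t p) ω) • η k p ω))
      (fun p' => ∑ p ∈ Finset.Ico (r p') (r (p' + 1)), V p ω (Mn (t (p + 1)) ω - Mn (t p) ω
          - ∑ k ∈ Finset.range K, (W k (t (p + 1)) ω - W k (t p) ω) • η k p ω))
    simp_rw [← Finset.sum_sub_distrib] at h3
    linarith
  calc P _ ≤ P C + P B₂ := (measure_mono hsub).trans (measure_union_le _ _)
    _ ≤ (P A + ENNReal.ofReal ε + ENNReal.ofReal (4 * δ / lam)) + ENNReal.ofReal ((q + 1) * ε) :=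
        add_le_add (hC.trans (by gcongr)) hB₂
    _ = P A + ENNReal.ofReal (4 * δ / lam) + ENNReal.ofReal ((q + 2) * ε) := by
        rw [show (q + 2 : ℝ) * ε = ε + (q + 1) * ε by ring,
          ENNReal.ofReal_add hε.le (by positivity)]
        ring
    _ ≤ P A + ENNReal.ofReal (4 * δ / lam) + ε₀ := by
        gcongr
        rw [← ENNReal.ofReal_coe_nnreal]
        exact ENNReal.ofReal_le_ofReal hε1.le

/-- If the weighted errors tend to zero in probability, so do the weighted increments. -/
theorem tendsto_measure_of_weightedError [IsProbabilityMeasure P] {T : ℝ≥0}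
    {a : ℕ → ℝ≥0 → Ω → H} {M : ℝ≥0 → Ω → H} (hM : HasSimpleApprox P 𝓕 T W a M)
    (hW : IsWienerSequence P 𝓕 W)
    (ha : ∀ k ω, AEStronglyMeasurable (fun s => a k s ω) (leb.restrict (Set.Icc 0 T)))
    {t : ℕ → ℕ → ℝ≥0} (ht : ∀ n, Monotone (t n)) {q : ℕ → ℕ} (htT : ∀ n, t n (q n) ≤ T)
    {K : ℕ → ℕ} {η : ℕ → ℕ → ℕ → Ω → H}
    (hη : ∀ n, IsBddAdapted 𝓕 (t n) (q n) (K n) (η n)) {V : ℕ → ℕ → Ω → H →L[ℝ] E}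
    (hV : ∀ n, ∀ p < q n, StronglyMeasurable[𝓕 (t n p)] (V n p)) {R : ℕ → ℝ} (hR : ∀ n, 0 ≤ R n)
    (hVR : ∀ n, ∀ p < q n, ∀ ω, ‖V n p ω‖ ≤ R n) {r : ℕ → ℕ → ℕ} (hr : ∀ n, Monotone (r n))
    {q' : ℕ → ℕ} (hrq : ∀ n, r n (q' n) ≤ q n)
    (herr : ∀ δ : ℝ, 0 < δ → Tendsto (fun n => P {ω | ENNReal.ofReal δ ≤
      weightedError a (truncRows (K n) (η n)) (V n) (t n) (q n) ω}) atTop (𝓝 0))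
    {lam : ℝ} (hlam : 0 < lam) :
    Tendsto (fun n => P {ω | lam ≤ ∑ p' ∈ Finset.range (q' n),
      ‖∑ p ∈ Finset.Ico (r n p') (r n (p' + 1)), V n p ω (M (t n (p + 1)) ω - M (t n p) ω
        - ∑ k ∈ Finset.range (K n), (W k (t n (p + 1)) ω - W k (t n p) ω) • η n k p ω)‖ ^ 2})
      atTop (𝓝 0) := by
  rw [ENNReal.tendsto_nhds_zero]
  intro ε hε
  obtain ⟨c, hc0, hcε⟩ : ∃ c : ℝ, 0 < c ∧ ENNReal.ofReal c < ε / 2 := by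
    obtain ⟨c, hc, hc2⟩ := ENNReal.lt_iff_exists_nnreal_btwn.1 (ENNReal.half_pos hε.ne')
    exact ⟨c, by exact_mod_cast hc, by simpa using hc2⟩
  -- Chosen so that the second term of Lenglart's inequality at level `lam / 4` equals `c`.
  set δ : ℝ := c * (lam / 4) / 4 with hδ
  have hδ0 : 0 < δ := by positivity
  filter_upwards [(herr δ hδ0).eventually_le_const (ENNReal.half_pos hε.ne')] with n hn
  have h := hM.measure_sum_sq_ge_le hW ha (ht n) (htT n) (hη n) (hV n) (hR n) (hVR n) (hr n)
    (hrq n) hδ0 (show 0 < lam / 4 by positivity)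
  rw [show 4 * (lam / 4) = lam by ring] at h
  refine h.trans ?_
  have e : 4 * δ / (lam / 4) = c := by rw [hδ]; field_simp
  rw [e]
  calc _ ≤ ε / 2 + ε / 2 := add_le_add hn hcε.le
    _ = ε := ENNReal.add_halves ε

end Lenglart

end SLLB

/-! ### Quadratic variation of discrete stochastic integrals. -/

namespace SLLB

section QuadraticVariation

variable {Ω : Type*} [mΩ : MeasurableSpace Ω] {P : Measure Ω} {𝓕 : Filtration ℝ≥0 mΩ}
  {W : ℕ → ℝ≥0 → Ω → ℝ} {H : Type*} [NormedAddCommGroup H] [InnerProductSpace ℝ H]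

/-- The centred product `x_k x_l - δ_{kl} v`. -/
noncomputable def centredProd (k l : ℕ) (v : ℝ) (x : ℕ → ℝ) : ℝ :=
  x k * x l - if k = l then v else 0

theorem measurable_centredProd (k l : ℕ) (v : ℝ) : Measurable (centredProd k l v) := by
  unfold centredProd; fun_prop

theorem centredProd_sq_le (k l : ℕ) (v : ℝ) (x : ℕ → ℝ) :
    centredProd k l v x ^ 2 ≤ x k ^ 4 + x l ^ 4 + 2 * v ^ 2 := by
  have h1 : (x k * x l) ^ 2 ≤ (x k ^ 4 + x l ^ 4) / 2 := by
    nlinarith [sq_nonneg (x k ^ 2 - x l ^ 2)]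
  unfold centredProd
  split_ifs
  · nlinarith [sq_nonneg (x k * x l + v)]
  · nlinarith [sq_nonneg (x k * x l), sq_nonneg v]

namespace IsWienerSequence

theorem integrable_incr_pow_four (hW : IsWienerSequence P 𝓕 W) (k : ℕ) {s t : ℝ≥0}
    (hst : s ≤ t) : Integrable (fun ω => (W k t ω - W k s ω) ^ 4) P := by
  have := (hW.memLp_incr k hst 4).integrable_norm_pow (by norm_num)
  refine this.congr (Eventually.of_forall fun ω => ?_)
  simp only [Real.norm_eq_abs]
  exact Even.pow_abs (by decide) _

theorem integrable_centredProd [IsProbabilityMeasure P] (hW : IsWienerSequence P 𝓕 W) (k l : ℕ)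
    {s t : ℝ≥0} (hst : s ≤ t) :
    Integrable (fun ω => centredProd k l (t - s) fun k => W k t ω - W k s ω) P :=
  (MemLp.integrable_mul (hW.memLp_incr k hst 2) (hW.memLp_incr l hst 2)).sub (integrable_const _)

theorem integral_centredProd [IsProbabilityMeasure P] (hW : IsWienerSequence P 𝓕 W) (k l : ℕ)
    {s t : ℝ≥0} (hst : s ≤ t) :
    ∫ ω, centredProd k l (t - s) (fun k => W k t ω - W k s ω) ∂P = 0 := by
  have hi : Integrable (fun ω => (W k t ω - W k s ω) * (W l t ω - W l s ω)) P :=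
    MemLp.integrable_mul (hW.memLp_incr k hst 2) (hW.memLp_incr l hst 2)
  simp only [centredProd]
  rw [integral_sub hi (integrable_const _)]
  split_ifs with h
  · subst h
    simp_rw [← pow_two]
    rw [hW.integral_incr_sq k hst]
    simp
  · rw [hW.integral_incr_mul_incr h hst]; simp

theorem integrable_centredProd_sq [IsProbabilityMeasure P] (hW : IsWienerSequence P 𝓕 W)
    (k l : ℕ) {s t : ℝ≥0} (hst : s ≤ t) :
    Integrable (fun ω => centredProd k l (t - s) (fun k => W k t ω - W k s ω) ^ 2) P := by
  refine (((hW.integrable_incr_pow_four k hst).add (hW.integrable_incr_pow_four l hst)).add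
    (integrable_const (2 * (t - s : ℝ) ^ 2))).mono'
    ((hW.integrable_centredProd k l hst).aestronglyMeasurable.pow 2)
    (Eventually.of_forall fun ω => ?_)
  rw [Real.norm_of_nonneg (sq_nonneg _)]
  exact centredProd_sq_le k l _ _

theorem integral_centredProd_sq_le [IsProbabilityMeasure P] (hW : IsWienerSequence P 𝓕 W)
    (k l : ℕ) {s t : ℝ≥0} (hst : s ≤ t) :
    ∫ ω, centredProd k l (t - s) (fun k => W k t ω - W k s ω) ^ 2 ∂P
      ≤ (2 * fourthMoment + 2) * (t - s) ^ 2 := by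
  have h4k := hW.integrable_incr_pow_four k hst
  have h4l := hW.integrable_incr_pow_four l hst
  refine (integral_mono (hW.integrable_centredProd_sq k l hst)
    ((h4k.add h4l).add (integrable_const (2 * (t - s : ℝ) ^ 2)))
    fun ω => centredProd_sq_le k l _ _).trans (le_of_eq ?_)
  have h4 : Integrable (fun ω => (W k t ω - W k s ω) ^ 4 + (W l t ω - W l s ω) ^ 4) P :=
    h4k.add h4l
  simp only [Pi.add_apply]
  rw [integral_add h4 (integrable_const _), integral_add h4k h4l, hW.integral_incr_pow_four k hst,
    hW.integral_incr_pow_four l hst]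
  simp
  ring

theorem fourthMoment_nonneg : 0 ≤ fourthMoment :=
  integral_nonneg fun x => by positivity

/-- The second moment of a sum of martingale differences `c_p (ΔW_k ΔW_l - δ_{kl} Δt)`. -/
theorem integral_sum_centredProd_sq_le [IsProbabilityMeasure P] (hW : IsWienerSequence P 𝓕 W)
    (k l : ℕ) {t : ℕ → ℝ≥0} (ht : Monotone t) {c : ℕ → Ω → ℝ} {q : ℕ}
    (hc : ∀ p < q, StronglyMeasurable[𝓕 (t p)] (c p)) {C : ℝ} (hC : ∀ p < q, ∀ ω, |c p ω| ≤ C) :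
    ∀ m ≤ q, StronglyMeasurable[𝓕 (t m)] (fun ω => ∑ p ∈ Finset.range m, c p ω *
        centredProd k l (t (p + 1) - t p) (fun k => W k (t (p + 1)) ω - W k (t p) ω)) ∧
      MemLp (fun ω => ∑ p ∈ Finset.range m, c p ω *
        centredProd k l (t (p + 1) - t p) (fun k => W k (t (p + 1)) ω - W k (t p) ω)) 2 P ∧
      ∫ ω, (∑ p ∈ Finset.range m, c p ω *
        centredProd k l (t (p + 1) - t p) (fun k => W k (t (p + 1)) ω - W k (t p) ω)) ^ 2 ∂P
      ≤ ∑ p ∈ Finset.range m, C ^ 2 * ((2 * fourthMoment + 2) * (t (p + 1) - t p : ℝ) ^ 2) := by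
  intro m
  induction m with
  | zero =>
    intro _
    simp only [Finset.range_zero, Finset.sum_empty]
    refine ⟨stronglyMeasurable_const, MemLp.zero, by simp⟩
  | succ m ih =>
    intro hm
    have hmq : m < q := hm
    obtain ⟨ih1, ih2, ih3⟩ := ih hmq.le
    have htm := ht (Nat.le_succ m)
    set B : Ω → ℝ := fun ω => centredProd k l (t (m + 1) - t m)
      (fun k => W k (t (m + 1)) ω - W k (t m) ω) with hB
    set S : Ω → ℝ := fun ω => ∑ p ∈ Finset.range m, c p ω *
      centredProd k l (t (p + 1) - t p) (fun k => W k (t (p + 1)) ω - W k (t p) ω) with hS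
    have hBi : Integrable B P := hW.integrable_centredProd k l htm
    have hBsq : Integrable (fun ω => B ω ^ 2) P := hW.integrable_centredProd_sq k l htm
    have hB2 : MemLp B 2 P := (memLp_two_iff_integrable_sq hBi.aestronglyMeasurable).2 hBsq
    have hcm := hc m hmq
    have hcm' : StronglyMeasurable (c m) := hcm.mono (𝓕.le _)
    have hcB : MemLp (fun ω => c m ω * B ω) 2 P :=
      MemLp.of_le_mul (c := C) hB2 (hcm'.aestronglyMeasurable.mul hBi.aestronglyMeasurable)
        (Eventually.of_forall fun ω => by
          rw [norm_mul]
          exact mul_le_mul_of_nonneg_right (hC m hmq ω) (norm_nonneg _))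
    have hBm : StronglyMeasurable[𝓕 (t (m + 1))] B := by
      have h1 := hW.measurable_incr k htm (le_refl (t (m + 1)))
      have h2 := hW.measurable_incr l htm (le_refl (t (m + 1)))
      exact (h1.mul h2).sub stronglyMeasurable_const
    have e : ∀ ω, ∑ p ∈ Finset.range (m + 1), c p ω *
        centredProd k l (t (p + 1) - t p) (fun k => W k (t (p + 1)) ω - W k (t p) ω)
        = S ω + c m ω * B ω := fun ω => Finset.sum_range_succ _ _
    simp_rw [e]
    refine ⟨(ih1.mono (𝓕.mono htm)).add ((hcm.mono (𝓕.mono htm)).mul hBm), ih2.add hcB, ?_⟩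
    have hcS : Integrable (fun ω => c m ω * S ω) P :=
      Integrable.mono' ((ih2.integrable (by norm_num)).norm.const_mul C)
        (hcm'.aestronglyMeasurable.mul ih2.aestronglyMeasurable)
        (Eventually.of_forall fun ω => by
          rw [norm_mul]
          exact mul_le_mul_of_nonneg_right (hC m hmq ω) (norm_nonneg _))
    have hcross : Integrable (fun ω => (c m ω * S ω) * B ω) P :=
      hW.integrable_mul_incr htm (hcm.mul ih1) hcS (measurable_centredProd k l _) hBi
    -- Martingale differences are orthogonal: `c_m S` is known at time `t_m`, and the centred
    -- product over the next cell has mean zero and is independent of that past.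
    have hcross0 : ∫ ω, (c m ω * S ω) * B ω ∂P = 0 := by
      have h1 := hW.integral_mul_incr htm (hcm.mul ih1)
        (measurable_centredProd k l (t (m + 1) - t m))
      rw [hW.integral_centredProd k l htm, mul_zero] at h1
      exact h1
    have e2 : ∀ ω, (S ω + c m ω * B ω) ^ 2
        = S ω ^ 2 + (2 * ((c m ω * S ω) * B ω) + (c m ω * B ω) ^ 2) := fun ω => by ring
    simp_rw [e2]
    have hi : Integrable (fun ω => 2 * ((c m ω * S ω) * B ω) + (c m ω * B ω) ^ 2) P :=
      (hcross.const_mul 2).add hcB.integrable_sq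
    rw [integral_add ih2.integrable_sq hi, integral_add (hcross.const_mul 2) hcB.integrable_sq, integral_const_mul, hcross0,
      mul_zero, zero_add, Finset.sum_range_succ]
    refine add_le_add ih3 ?_
    calc ∫ ω, (c m ω * B ω) ^ 2 ∂P ≤ ∫ ω, C ^ 2 * B ω ^ 2 ∂P := by
          refine integral_mono hcB.integrable_sq (hBsq.const_mul _) fun ω => ?_
          simp only [mul_pow]
          refine mul_le_mul_of_nonneg_right ?_ (sq_nonneg _)
          rw [← sq_abs]
          exact pow_le_pow_left₀ (abs_nonneg _) (hC m hmq ω) 2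
      _ ≤ _ := by
          rw [integral_const_mul]
          exact mul_le_mul_of_nonneg_left (hW.integral_centredProd_sq_le k l htm) (sq_nonneg _)

end IsWienerSequence

/-- The quadratic variation of a discrete stochastic integral with respect to finitely many
Wiener processes. -/
theorem IsBddAdapted.measure_quadVar_error_le [IsProbabilityMeasure P] {t : ℕ → ℝ≥0} {q K : ℕ}
    {ξ : ℕ → ℕ → Ω → H} (hξ : IsBddAdapted 𝓕 t q K ξ) (hW : IsWienerSequence P 𝓕 W)
    (ht : Monotone t) {C : ℝ} (hC : ∀ k < K, ∀ p < q, ∀ ω, ‖ξ k p ω‖ ^ 2 ≤ C) {h : ℝ}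
    (hh : ∀ p < q, (t (p + 1) - t p : ℝ) ≤ h) {ε : ℝ} (hε : 0 < ε) :
    P {ω | ε ≤ |∑ p ∈ Finset.range q,
        (‖∑ k ∈ Finset.range K, (W k (t (p + 1)) ω - W k (t p) ω) • ξ k p ω‖ ^ 2
          - (t (p + 1) - t p) * ∑ k ∈ Finset.range K, ‖ξ k p ω‖ ^ 2)|}
      ≤ ENNReal.ofReal (K ^ 4 * C ^ 2 * (2 * fourthMoment + 2) * (h * (t q - t 0)) / ε ^ 2) := by
  set c : ℕ → ℕ → ℕ → Ω → ℝ := fun k l p ω => ⟪ξ k p ω, ξ l p ω⟫ with hc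
  set F : ℕ → ℕ → Ω → ℝ := fun k l ω => ∑ p ∈ Finset.range q, c k l p ω *
    centredProd k l (t (p + 1) - t p) (fun k => W k (t (p + 1)) ω - W k (t p) ω) with hF
  -- Expanding the square produces `∑_{k,l} ⟨ξ_k, ξ_l⟩ (ΔW_k ΔW_l - δ_{kl} Δt)`, a sum of martingale
  -- differences for each pair `(k, l)`.
  have hexp : ∀ ω, ∑ p ∈ Finset.range q,
        (‖∑ k ∈ Finset.range K, (W k (t (p + 1)) ω - W k (t p) ω) • ξ k p ω‖ ^ 2
          - (t (p + 1) - t p) * ∑ k ∈ Finset.range K, ‖ξ k p ω‖ ^ 2)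
      = ∑ k ∈ Finset.range K, ∑ l ∈ Finset.range K, F k l ω := by
    intro ω
    simp only [hF]
    rw [Finset.sum_congr rfl fun k _ => Finset.sum_comm, Finset.sum_comm]
    refine Finset.sum_congr rfl fun p _ => ?_
    rw [← real_inner_self_eq_norm_sq, sum_inner, Finset.mul_sum, ← Finset.sum_sub_distrib]
    refine Finset.sum_congr rfl fun k hk => ?_
    rw [inner_sum]
    have : (t (p + 1) - t p : ℝ) * ‖ξ k p ω‖ ^ 2
        = ∑ l ∈ Finset.range K, c k l p ω * (if k = l then (t (p + 1) - t p : ℝ) else 0) := by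
      simp only [mul_ite, mul_zero]
      rw [Finset.sum_ite_eq, if_pos hk, hc]
      simp only
      rw [real_inner_self_eq_norm_sq, mul_comm]
    rw [this, ← Finset.sum_sub_distrib]
    refine Finset.sum_congr rfl fun l _ => ?_
    rw [real_inner_smul_left, real_inner_smul_right]
    simp only [hc, centredProd]
    ring
  simp_rw [hexp]
  set Q : ℝ := C ^ 2 * ((2 * fourthMoment + 2) * (h * (t q - t 0))) with hQ
  have hFkl : ∀ k < K, ∀ l < K, MemLp (F k l) 2 P ∧ ∫ ω, F k l ω ^ 2 ∂P ≤ Q := by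
    intro k hk l hl
    obtain ⟨-, h2, h3⟩ := hW.integral_sum_centredProd_sq_le k l ht (c := c k l) (C := C)
      (fun p hp => (hξ.meas k hk p hp).inner (hξ.meas l hl p hp)) (fun p hp ω => by
        have h1 := abs_real_inner_le_norm (ξ k p ω) (ξ l p ω)
        nlinarith [hC k hk p hp ω, hC l hl p hp ω, sq_nonneg (‖ξ k p ω‖ - ‖ξ l p ω‖)]) q le_rfl
    refine ⟨h2, h3.trans ?_⟩
    rw [← Finset.mul_sum, ← Finset.mul_sum, hQ]
    have hm := IsWienerSequence.fourthMoment_nonneg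
    refine mul_le_mul_of_nonneg_left (mul_le_mul_of_nonneg_left ?_ (by linarith)) (sq_nonneg _)
    have htel : ∑ p ∈ Finset.range q, (t (p + 1) - t p : ℝ) = t q - t 0 := by
      rw [Finset.range_eq_Ico, sum_Ico_telescope (fun p => (t p : ℝ)) (Nat.zero_le q)]
    rw [← htel, Finset.mul_sum]
    refine Finset.sum_le_sum fun p hp => ?_
    rw [pow_two]
    exact mul_le_mul_of_nonneg_right (hh p (Finset.mem_range.1 hp))
      (sub_nonneg.2 (ht (Nat.le_succ p)))
  have hG : MemLp (fun ω => ∑ k ∈ Finset.range K, ∑ l ∈ Finset.range K, F k l ω) 2 P :=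
    memLp_finsetSum _ fun k hk => memLp_finsetSum _ fun l hl =>
      (hFkl k (Finset.mem_range.1 hk) l (Finset.mem_range.1 hl)).1
  -- Cauchy–Schwarz over the `K²` pairs costs `K²`, and summing the `K²` bounds costs another `K²`.
  -- The resulting power has to be beaten later by the mesh of the grid.
  have hGle : ∫ ω, (∑ k ∈ Finset.range K, ∑ l ∈ Finset.range K, F k l ω) ^ 2 ∂P
      ≤ K ^ 4 * Q := by
    have hint : ∀ k ∈ Finset.range K, ∀ l ∈ Finset.range K,
        Integrable (fun ω => F k l ω ^ 2) P := fun k hk l hl =>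
      (hFkl k (Finset.mem_range.1 hk) l (Finset.mem_range.1 hl)).1.integrable_sq
    have hint2 : Integrable (fun ω => ∑ k ∈ Finset.range K, ∑ l ∈ Finset.range K, F k l ω ^ 2) P :=
      integrable_finsetSum _ fun k hk => integrable_finsetSum _ fun l hl => hint k hk l hl
    calc _ ≤ ∫ ω, (K : ℝ) ^ 2 * ∑ k ∈ Finset.range K, ∑ l ∈ Finset.range K, F k l ω ^ 2 ∂P := by
          refine integral_mono hG.integrable_sq (hint2.const_mul _) fun ω => ?_
          have h1 := sq_sum_le_card_mul_sum_sq (s := Finset.range K)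
            (f := fun k => ∑ l ∈ Finset.range K, F k l ω)
          have h2 : ∀ k ∈ Finset.range K, (∑ l ∈ Finset.range K, F k l ω) ^ 2
              ≤ K * ∑ l ∈ Finset.range K, F k l ω ^ 2 := fun k _ => by
            simpa using sq_sum_le_card_mul_sum_sq (s := Finset.range K) (f := fun l => F k l ω)
          rw [Finset.card_range] at h1
          refine h1.trans ?_
          rw [pow_two, mul_assoc]
          refine mul_le_mul_of_nonneg_left ?_ (Nat.cast_nonneg _)
          rw [Finset.mul_sum]
          exact Finset.sum_le_sum h2
      _ ≤ (K : ℝ) ^ 2 * (K * (K * Q)) := by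
          rw [integral_const_mul, integral_finsetSum _ fun k hk =>
            integrable_finsetSum _ fun l hl => hint k hk l hl]
          refine mul_le_mul_of_nonneg_left ?_ (sq_nonneg _)
          refine (Finset.sum_le_card_nsmul _ _ (K * Q) fun k hk => ?_).trans (by simp)
          rw [integral_finsetSum _ fun l hl => hint k hk l hl]
          refine (Finset.sum_le_card_nsmul _ _ Q fun l hl => ?_).trans (by simp)
          exact (hFkl k (Finset.mem_range.1 hk) l (Finset.mem_range.1 hl)).2
      _ = _ := by ring
  have hmk := mul_meas_ge_le_integral_of_nonneg (Eventually.of_forall fun ω => sq_nonneg _)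
    hG.integrable_sq (ε ^ 2)
  have hset : {ω | ε ≤ |∑ k ∈ Finset.range K, ∑ l ∈ Finset.range K, F k l ω|}
      = {ω | ε ^ 2 ≤ (∑ k ∈ Finset.range K, ∑ l ∈ Finset.range K, F k l ω) ^ 2} := by
    ext ω
    change ε ≤ |_| ↔ ε ^ 2 ≤ _ ^ 2
    rw [sq_le_sq, abs_of_pos hε]
  rw [hset, ← ENNReal.ofReal_toReal (measure_ne_top P _)]
  refine ENNReal.ofReal_le_ofReal ?_
  rw [le_div_iff₀ (by positivity), mul_comm]
  refine hmk.trans (hGle.trans (le_of_eq ?_))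
  rw [hQ]; ring

end QuadraticVariation

end SLLB

/-! ### Equations with skew-symmetric linear noise, and continuity in probability. -/

namespace SLLB

section Preliminaries

variable {Ω : Type*} [mΩ : MeasurableSpace Ω] {P : Measure Ω}

theorem tendsto_measure_ge_of_tendsto_ae [IsFiniteMeasure P] {g : ℕ → Ω → ℝ≥0∞}
    (hg : ∀ n, AEMeasurable (g n) P)
    (h : ∀ᵐ ω ∂P, Tendsto (fun n => g n ω) atTop (𝓝 0)) {δ : ℝ≥0∞} (hδ : 0 < δ) :
    Tendsto (fun n => P {ω | δ ≤ g n ω}) atTop (𝓝 0) := by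
  have hmeas : ∀ n, NullMeasurableSet {ω | δ ≤ g n ω} P := fun n =>
    nullMeasurableSet_le aemeasurable_const (hg n)
  have e : ∀ n, P {ω | δ ≤ g n ω} = ∫⁻ ω, {ω | δ ≤ g n ω}.indicator (fun _ => 1) ω ∂P := fun n => by
    rw [lintegral_indicator_const₀ (hmeas n), one_mul]
  simp_rw [e]
  have := tendsto_lintegral_of_dominated_convergence' (μ := P)
    (F := fun n ω => {ω | δ ≤ g n ω}.indicator (fun _ => (1 : ℝ≥0∞)) ω) (f := fun _ => 0)
    (fun _ => 1) (fun n => aemeasurable_const.indicator₀ (hmeas n))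
    (fun n => Eventually.of_forall fun ω => Set.indicator_le_self' (by simp) ω)
    (by simp) (by
      filter_upwards [h] with ω hω
      refine tendsto_const_nhds.congr' ?_
      filter_upwards [hω.eventually_lt_const hδ] with n hn
      rw [Set.indicator_of_notMem]
      exact not_le.2 hn)
  simpa using this

theorem tendstoInMeasure_add {E : Type*} [NormedAddCommGroup E] {f f' : ℕ → Ω → E} {g g' : Ω → E}
    (h : TendstoInMeasure P f atTop g) (h' : TendstoInMeasure P f' atTop g') :
    TendstoInMeasure P (fun n ω => f n ω + f' n ω) atTop (fun ω => g ω + g' ω) := by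
  rw [tendstoInMeasure_iff_norm] at h h' ⊢
  intro ε hε
  have := (h (ε / 2) (half_pos hε)).add (h' (ε / 2) (half_pos hε))
  rw [add_zero] at this
  refine tendsto_of_tendsto_of_tendsto_of_le_of_le tendsto_const_nhds this (fun _ => zero_le)
    fun n => ?_
  refine (measure_mono fun ω hω => ?_).trans (measure_union_le _ _)
  by_contra hcon
  simp only [Set.mem_union, Set.mem_ofPred_eq, not_or, not_le] at hcon
  have hω : ε ≤ ‖f n ω + f' n ω - (g ω + g' ω)‖ := hω
  have e : f n ω + f' n ω - (g ω + g' ω) = (f n ω - g ω) + (f' n ω - g' ω) := by abel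
  rw [e] at hω
  linarith [norm_add_le (f n ω - g ω) (f' n ω - g' ω)]

theorem tendsto_setIntegral_Icc {E : Type*} [NormedAddCommGroup E] [NormedSpace ℝ E]
    {T : ℝ≥0} {f : ℝ≥0 → E} (hf : IntegrableOn f (Set.Icc 0 T) leb) {u : ℕ → ℝ≥0}
    (hu : ∀ m, u m ≤ T) {s : ℝ≥0} (hs : s ≤ T) (hus : Tendsto u atTop (𝓝 s)) :
    Tendsto (fun m => ∫ r in Set.Icc 0 (u m), f r ∂leb) atTop
      (𝓝 (∫ r in Set.Icc 0 s, f r ∂leb)) := by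
  have e : ∀ v ≤ T, ∫ r in Set.Icc 0 v, f r ∂leb
      = ∫ r in Set.Icc 0 T, (Set.Icc 0 v).indicator f r ∂leb := fun v hv => by
    rw [setIntegral_indicator measurableSet_Icc,
      Set.inter_eq_self_of_subset_right (Set.Icc_subset_Icc_right hv)]
  rw [e s hs]
  simp_rw [fun m => e (u m) (hu m)]
  refine tendsto_integral_of_dominated_convergence (fun r => ‖f r‖)
    (fun m => hf.aestronglyMeasurable.indicator measurableSet_Icc) hf.norm
    (fun m => Eventually.of_forall fun r => norm_indicator_le_norm_self _ _) ?_
  have hne : ∀ᵐ r ∂(leb.restrict (Set.Icc 0 T)), r ≠ s := by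
    refine ae_restrict_of_ae ?_
    rw [ae_iff]
    simp
  filter_upwards [hne] with r hr
  refine tendsto_const_nhds.congr' ?_
  rcases lt_or_gt_of_ne hr with h | h
  · filter_upwards [hus.eventually_const_lt h] with m hm
    rw [Set.indicator_of_mem (show r ∈ Set.Icc 0 s from ⟨zero_le, h.le⟩),
      Set.indicator_of_mem (show r ∈ Set.Icc 0 (u m) from ⟨zero_le, hm.le⟩)]
  · filter_upwards [hus.eventually_lt_const h] with m hm
    rw [Set.indicator_of_notMem (show r ∉ Set.Icc 0 s from fun hc => absurd hc.2 (not_le.2 h)),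
      Set.indicator_of_notMem (show r ∉ Set.Icc 0 (u m) from fun hc => absurd hc.2 (not_le.2 hm))]

end Preliminaries

variable {Ω : Type*} [mΩ : MeasurableSpace Ω] {P : Measure Ω} {𝓕 : Filtration ℝ≥0 mΩ}
  {W : ℕ → ℝ≥0 → Ω → ℝ} {H : Type*} [NormedAddCommGroup H] [InnerProductSpace ℝ H]

/-- `M t` is a limit in probability of measurable elementary integrals, obtained with the tolerances
`1 / (m + 1)`. -/
theorem HasSimpleApprox.aestronglyMeasurable {T : ℝ≥0} {a : ℕ → ℝ≥0 → Ω → H}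
    {M : ℝ≥0 → Ω → H} (hM : HasSimpleApprox P 𝓕 T W a M) (hW : IsWienerSequence P 𝓕 W)
    {t : ℝ≥0} (ht : t ≤ T) : AEStronglyMeasurable (M t) P := by
  have h := fun m : ℕ => hM {t} (by simpa using ht) (1 / (m + 1)) (by positivity) 0
  choose n hn S₁ S₂ hS hSM using h
  have hmeas : ∀ (S : SimpleProcess 𝓕 H) k, StronglyMeasurable (S.integral (W k) t) := by
    intro S k
    refine Finset.stronglyMeasurable_fun_sum _ fun i _ => ?_
    have hWm : ∀ u, StronglyMeasurable (W k u) := fun u => (hW.adapted k u).mono (𝓕.le u)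
    exact ((hWm _).sub (hWm _)).smul ((S.meas i).mono (𝓕.le _))
  refine TendstoInMeasure.aestronglyMeasurable (u := atTop) (f := fun m ω =>
    ∑ k ∈ Finset.range (n m), ((S₁ m k).integral (W k) t ω - (S₂ m k).integral (W k) t ω))
    (fun m => (Finset.stronglyMeasurable_fun_sum _ fun k _ =>
      (hmeas _ _).sub (hmeas _ _)).aestronglyMeasurable) ?_
  rw [tendstoInMeasure_iff_norm]
  intro ε hε
  have hlim : Tendsto (fun m : ℕ => ENNReal.ofReal (1 / (m + 1 : ℝ))) atTop (𝓝 0) := by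
    have := ENNReal.tendsto_ofReal (tendsto_one_div_add_atTop_nhds_zero_nat (𝕜 := ℝ))
    simpa using this
  refine tendsto_of_tendsto_of_tendsto_of_le_of_le' tendsto_const_nhds hlim
    (Eventually.of_forall fun _ => zero_le) ?_
  filter_upwards [(tendsto_one_div_add_atTop_nhds_zero_nat (𝕜 := ℝ)).eventually_lt_const hε]
    with m hm
  refine le_trans (measure_mono fun ω hω => ?_) (hSM m t (by simp))
  exact le_trans hm.le hω

/-- `X(t) = ∫₀ᵗ b ds + M(t)`, where `M(t) = ∑_k ∫₀ᵗ R_k X dW_k` with skew-symmetric operators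
`R_k`, and the paths of `X` are essentially bounded. -/
structure IsSkewNoiseEquation (P : Measure Ω) (𝓕 : Filtration ℝ≥0 mΩ) (T : ℝ≥0)
    (W : ℕ → ℝ≥0 → Ω → ℝ) (R : ℕ → H →L[ℝ] H) (b X M : ℝ≥0 → Ω → H) : Prop where
  wiener : IsWienerSequence P 𝓕 W
  summable : Summable fun k => ‖R k‖ ^ 2
  skew : ∀ k v, ⟪v, R k v⟫ = 0
  progressive : IsStronglyProgressive 𝓕 X
  approx : HasSimpleApprox P 𝓕 T W (fun k s ω => R k (X s ω)) M
  drift : ∀ᵐ ω ∂P, IntegrableOn (fun s => b s ω) (Set.Icc 0 T) leb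
  init : ∀ᵐ ω ∂P, X 0 ω = 0
  eq : ∀ t ≤ T, ∀ᵐ ω ∂P, X t ω = ∫ s in Set.Icc 0 t, b s ω ∂leb + M t ω
  bdd : ∀ᵐ ω ∂P, ∃ C : ℝ, ∀ᵐ s ∂(leb.restrict (Set.Icc 0 T)), ‖X s ω‖ ≤ C

/-- The part of the squared Hilbert–Schmidt type norm of `R` that belongs to the indices `≥ K`. -/
noncomputable def tailSum (R : ℕ → H →L[ℝ] H) (K : ℕ) : ℝ≥0∞ := ∑' k, ‖R (k + K)‖ₑ ^ 2

namespace IsSkewNoiseEquation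

variable {T : ℝ≥0} {R : ℕ → H →L[ℝ] H} {b X M : ℝ≥0 → Ω → H}

theorem tailSum_zero_lt_top (h : IsSkewNoiseEquation P 𝓕 T W R b X M) : tailSum R 0 < ∞ := by
  have := h.summable.tsum_ofReal_lt_top
  refine lt_of_eq_of_lt (tsum_congr fun k => ?_) this
  rw [ENNReal.ofReal_pow (norm_nonneg _), ofReal_norm]
  rfl

theorem tendsto_tailSum (h : IsSkewNoiseEquation P 𝓕 T W R b X M) :
    Tendsto (tailSum R) atTop (𝓝 0) :=
  ENNReal.tendsto_sum_nat_add (fun k => ‖R k‖ₑ ^ 2) h.tailSum_zero_lt_top.ne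

theorem stronglyMeasurable_prod (h : IsSkewNoiseEquation P 𝓕 T W R b X M) :
    StronglyMeasurable fun p : ℝ≥0 × Ω => X (min p.1 T) p.2 := by
  have h1 := h.progressive T
  have h2 : StronglyMeasurable fun p : Set.Iic T × Ω => X p.1 p.2 :=
    h1.mono (sup_le_sup le_rfl (MeasurableSpace.comap_mono (𝓕.le T)))
  exact h2.comp_measurable (g := fun p : ℝ≥0 × Ω => 
    ((⟨min p.1 T, Set.mem_Iic.2 (min_le_right _ _)⟩ : Set.Iic T), p.2))
    ((Measurable.subtype_mk (by fun_prop)).prodMk measurable_snd)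

theorem stronglyMeasurable_path (h : IsSkewNoiseEquation P 𝓕 T W R b X M) (ω : Ω) :
    StronglyMeasurable fun s => X (min s T) ω :=
  h.stronglyMeasurable_prod.comp_measurable (g := fun s => (s, ω)) (by fun_prop)

theorem aestronglyMeasurable_path (h : IsSkewNoiseEquation P 𝓕 T W R b X M) (ω : Ω) :
    AEStronglyMeasurable (fun s => X s ω) (leb.restrict (Set.Icc 0 T)) := by
  refine (h.stronglyMeasurable_path ω).aestronglyMeasurable.congr ?_
  filter_upwards [ae_restrict_mem measurableSet_Icc] with s hs
  rw [min_eq_left hs.2]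

theorem aestronglyMeasurable_noise (h : IsSkewNoiseEquation P 𝓕 T W R b X M) (k : ℕ) (ω : Ω) :
    AEStronglyMeasurable (fun s => R k (X s ω)) (leb.restrict (Set.Icc 0 T)) :=
  (R k).continuous.comp_aestronglyMeasurable (h.aestronglyMeasurable_path ω)

theorem stronglyMeasurable_eval (h : IsSkewNoiseEquation P 𝓕 T W R b X M) (t : ℝ≥0) :
    StronglyMeasurable (X t) := (h.progressive.stronglyAdapted t).mono (𝓕.le t)

/-- The error made in replacing `X` by a step process in the first `K` noise terms and by zero in
the others. -/
theorem weightedError_le {E : Type*} [NormedAddCommGroup E] [InnerProductSpace ℝ E]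
    (R : ℕ → H →L[ℝ] H) (X : ℝ≥0 → Ω → H) (Y : ℕ → Ω → H)
    (V : ℕ → Ω → H →L[ℝ] E) (t : ℕ → ℝ≥0) (q K : ℕ) (ω : Ω) :
    weightedError (fun k s ω => R k (X s ω)) (truncRows K fun k p ω => R k (Y p ω)) V t q ω
      ≤ tailSum R 0 * ∑ p ∈ Finset.range q, ∫⁻ τ in Set.Ioc (t p) (t (p + 1)),
          (‖V p ω‖ₑ * ‖X τ ω - Y p ω‖ₑ) ^ 2 ∂leb
        + tailSum R K * ∑ p ∈ Finset.range q, ∫⁻ τ in Set.Ioc (t p) (t (p + 1)),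
          (‖V p ω‖ₑ * ‖X τ ω‖ₑ) ^ 2 ∂leb := by
  unfold weightedError
  set A := ∑ p ∈ Finset.range q, ∫⁻ τ in Set.Ioc (t p) (t (p + 1)),
          (‖V p ω‖ₑ * ‖X τ ω - Y p ω‖ₑ) ^ 2 ∂leb with hA
  set B := ∑ p ∈ Finset.range q, ∫⁻ τ in Set.Ioc (t p) (t (p + 1)),
          (‖V p ω‖ₑ * ‖X τ ω‖ₑ) ^ 2 ∂leb with hB
  have hpull : ∀ k (f : ℕ → ℝ≥0 → H), ∑ p ∈ Finset.range q, ∫⁻ τ in Set.Ioc (t p) (t (p + 1)),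
      (‖V p ω‖ₑ * ‖R k (f p τ)‖ₑ) ^ 2 ∂leb ≤ ‖R k‖ₑ ^ 2 * ∑ p ∈ Finset.range q,
        ∫⁻ τ in Set.Ioc (t p) (t (p + 1)), (‖V p ω‖ₑ * ‖f p τ‖ₑ) ^ 2 ∂leb := by
    intro k f
    rw [Finset.mul_sum]
    refine Finset.sum_le_sum fun p _ => ?_
    rw [← lintegral_const_mul' _ _ (by finiteness)]
    refine lintegral_mono fun τ => ?_
    calc _ ≤ (‖V p ω‖ₑ * (‖R k‖ₑ * ‖f p τ‖ₑ)) ^ 2 := by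
          gcongr
          exact (R k).le_opENorm _
      _ = _ := by ring
  have hle : ∀ k, ∑ p ∈ Finset.range q, ∫⁻ τ in Set.Ioc (t p) (t (p + 1)),
      (‖V p ω‖ₑ * ‖R k (X τ ω) - truncRows K (fun k p ω => R k (Y p ω)) k p ω‖ₑ) ^ 2 ∂leb
      -- For the first `K` noises the error is that of the step process. The others are not
      -- discretised at all, so the whole coefficient counts as error.
      ≤ ‖R k‖ₑ ^ 2 * A + (if k < K then 0 else ‖R k‖ₑ ^ 2) * B := by
    intro k
    by_cases hk : k < K
    · simp only [truncRows, if_pos hk, zero_mul, add_zero, ← map_sub]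
      exact hpull k fun p τ => X τ ω - Y p ω
    · simp only [truncRows, if_neg hk, sub_zero]
      exact (hpull k fun p τ => X τ ω).trans le_add_self
  refine (ENNReal.tsum_le_tsum hle).trans ?_
  rw [ENNReal.tsum_add, ENNReal.tsum_mul_right, ENNReal.tsum_mul_right]
  refine le_of_eq ?_
  congr 2
  rw [tailSum, ← ENNReal.summable.sum_add_tsum_nat_add' (k := K)]
  rw [Finset.sum_eq_zero fun k hk => by rw [if_pos (Finset.mem_range.1 hk)], zero_add]
  refine tsum_congr fun k => ?_
  rw [if_neg (by omega)]

theorem measurable_lintegral (h : IsSkewNoiseEquation P 𝓕 T W R b X M) {s t : ℝ≥0}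
    (ht : t ≤ T) :
    Measurable fun ω => ∫⁻ τ in Set.Ioc s t, ‖X τ ω‖ₑ ^ 2 ∂leb := by
  have e : (fun ω => ∫⁻ τ in Set.Ioc s t, ‖X τ ω‖ₑ ^ 2 ∂leb)
      = fun ω => ∫⁻ τ in Set.Ioc s t, ‖X (min τ T) ω‖ₑ ^ 2 ∂leb := by
    ext ω
    refine setLIntegral_congr_fun measurableSet_Ioc fun τ hτ => ?_
    rw [min_eq_left (hτ.2.trans ht)]
  rw [e]
  exact (h.stronglyMeasurable_prod.enorm.pow_const 2).lintegral_prod_left'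

theorem lintegral_sq_lt_top (h : IsSkewNoiseEquation P 𝓕 T W R b X M) :
    ∀ᵐ ω ∂P, ∫⁻ τ in Set.Icc 0 T, ‖X τ ω‖ₑ ^ 2 ∂leb < ∞ := by
  filter_upwards [h.bdd] with ω ⟨C, hC⟩
  calc ∫⁻ τ in Set.Icc 0 T, ‖X τ ω‖ₑ ^ 2 ∂leb ≤ ∫⁻ τ in Set.Icc 0 T, ENNReal.ofReal C ^ 2 ∂leb := by
        refine lintegral_mono_ae ?_
        filter_upwards [hC] with s hs
        gcongr
        rw [← ofReal_norm]
        exact ENNReal.ofReal_le_ofReal hs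
    _ < ∞ := by
        rw [setLIntegral_const, leb_Icc]
        finiteness

/-- `X` is continuous in probability. -/
theorem tendstoInMeasure (h : IsSkewNoiseEquation P 𝓕 T W R b X M) [IsProbabilityMeasure P]
    {u : ℕ → ℝ≥0} (hu : ∀ m, u m ≤ T) {s : ℝ≥0} (hs : s ≤ T) (hus : Tendsto u atTop (𝓝 s)) :
    TendstoInMeasure P (fun m => X (u m)) atTop (X s) := by
  have hMm : ∀ t ≤ T, AEStronglyMeasurable (M t) P := fun t ht =>
    h.approx.aestronglyMeasurable h.wiener ht
  -- `X - M` is almost surely the primitive of an integrable drift, so it converges pathwise along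
  -- the given times. Only the martingale part needs an estimate in probability.
  have hD : TendstoInMeasure P (fun m ω => X (u m) ω - M (u m) ω) atTop
      (fun ω => X s ω - M s ω) := by
    refine tendstoInMeasure_of_tendsto_ae (fun m =>
      (h.stronglyMeasurable_eval _).aestronglyMeasurable.sub (hMm _ (hu m))) ?_
    filter_upwards [ae_all_iff.2 fun m => h.eq (u m) (hu m), h.eq s hs, h.drift] with ω h1 h2 h3
    simp_rw [h1, h2, add_sub_cancel_right]
    exact tendsto_setIntegral_Icc h3 hu hs hus
  have hMt : TendstoInMeasure P (fun m => M (u m)) atTop (M s) := by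
    rw [tendstoInMeasure_iff_norm]
    intro ε hε
    -- A grid with one cell, between `u m` and `s` in increasing order. Comparison with the zero
    -- step process (`K = 0`) makes the error the energy of `X` over this shrinking cell.
    set t : ℕ → ℕ → ℝ≥0 := fun m p => if p = 0 then min (u m) s else max (u m) s with ht
    have htm : ∀ m, Monotone (t m) := fun m => by
      refine monotone_nat_of_le_succ fun p => ?_
      simp only [ht]
      rcases Nat.eq_zero_or_pos p with rfl | hp
      · simp
      · rw [if_neg hp.ne', if_neg (by omega)]
    have ht1 : ∀ m, t m 1 ≤ T := fun m => by simp [ht, hu m, hs]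
    have herr : ∀ δ : ℝ, 0 < δ → Tendsto (fun m => P {ω | ENNReal.ofReal δ ≤
        weightedError (fun k s ω => R k (X s ω)) (truncRows 0 fun k p ω => R k ((0 : H)))
          (fun _ _ => ContinuousLinearMap.id ℝ H) (t m) 1 ω}) atTop (𝓝 0) := by
      intro δ hδ
      have hlim := tendsto_measure_ge_of_tendsto_ae (P := P) (g := fun m ω => (2 * tailSum R 0) *
        ∫⁻ τ in Set.Ioc (t m 0) (t m 1), ‖X τ ω‖ₑ ^ 2 ∂leb)
        (fun m => ((h.measurable_lintegral (ht1 m)).const_mul _).aemeasurable) (by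
          filter_upwards [h.lintegral_sq_lt_top] with ω hω
          have hint : ∀ m, ∫⁻ τ in Set.Ioc (t m 0) (t m 1), ‖X τ ω‖ₑ ^ 2 ∂leb
              = ∫⁻ τ in Set.Ioc (t m 0) (t m 1), ‖X τ ω‖ₑ ^ 2 ∂(leb.restrict (Set.Icc 0 T)) := by
            intro m
            rw [Measure.restrict_restrict measurableSet_Ioc, Set.inter_eq_self_of_subset_left]
            exact fun x hx => ⟨zero_le, hx.2.trans (ht1 m)⟩
          simp_rw [hint]
          have h0 : Tendsto (fun m => (leb.restrict (Set.Icc 0 T)) (Set.Ioc (t m 0) (t m 1)))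
              atTop (𝓝 0) := by
            have h1 : Tendsto (fun m => ENNReal.ofReal ((t m 1 : ℝ) - t m 0)) atTop (𝓝 0) := by
              have h2 : Tendsto (fun m => ((t m 1 : ℝ) - t m 0)) atTop (𝓝 ((s : ℝ) - s)) := by
                refine Tendsto.sub ?_ ?_
                · have : Tendsto (fun m => max (u m) s) atTop (𝓝 (max s s)) :=
                    hus.max tendsto_const_nhds
                  rw [max_self] at this
                  simpa [ht, Function.comp_def] using (NNReal.continuous_coe.tendsto _).comp this
                · have : Tendsto (fun m => min (u m) s) atTop (𝓝 (min s s)) :=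
                    hus.min tendsto_const_nhds
                  rw [min_self] at this
                  simpa [ht, Function.comp_def] using (NNReal.continuous_coe.tendsto _).comp this
              rw [sub_self] at h2
              simpa using ENNReal.tendsto_ofReal h2
            refine tendsto_of_tendsto_of_tendsto_of_le_of_le tendsto_const_nhds h1
              (fun _ => zero_le) fun m => ?_
            rw [← leb_Ioc]
            exact Measure.restrict_apply_le _ _
          have h3 := tendsto_setLIntegral_zero (μ := leb.restrict (Set.Icc 0 T)) hω.ne h0
          have h4 := ENNReal.Tendsto.const_mul h3 (Or.inr (ENNReal.mul_lt_top (by simp : (2 : ℝ≥0∞) < ∞) h.tailSum_zero_lt_top).ne)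
          simpa using h4) (show 0 < ENNReal.ofReal δ by simpa using hδ)
      refine tendsto_of_tendsto_of_tendsto_of_le_of_le tendsto_const_nhds hlim
        (fun _ => zero_le) fun m => measure_mono fun ω hω => ?_
      refine le_trans (show ENNReal.ofReal δ ≤ _ from hω) ?_
      refine (weightedError_le R X (fun _ _ => (0 : H)) _ (t m) 1 0 ω).trans ?_
      simp only [Finset.range_one, Finset.sum_singleton, sub_zero, zero_add]
      rw [← two_mul, ← mul_assoc]
      gcongr with τ
      rw [← one_mul ‖X τ ω‖ₑ, ← mul_assoc]
      gcongr
      rw [mul_one, ← ofReal_norm, ← ENNReal.ofReal_one]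
      exact ENNReal.ofReal_le_ofReal ContinuousLinearMap.norm_id_le
    have hmain := tendsto_measure_of_weightedError h.approx h.wiener
      (fun k ω => h.aestronglyMeasurable_noise k ω) htm (q := fun _ => 1) ht1 (K := fun _ => 0)
      (η := fun _ k _ _ => R k (0 : H)) (fun m => ⟨fun k hk => by omega, fun k hk => by omega⟩)
      (V := fun _ _ _ => ContinuousLinearMap.id ℝ H) (fun _ _ _ => stronglyMeasurable_const)
      (R := fun _ => 1) (fun _ => zero_le_one)
      (fun _ _ _ _ => ContinuousLinearMap.norm_id_le) (r := fun _ => id) (fun _ => monotone_id)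
      (q' := fun _ => 1) (fun _ => le_rfl) herr (lam := ε ^ 2) (by positivity)
    refine hmain.congr fun m => ?_
    congr 1
    ext ω
    simp only [Finset.range_one, Finset.sum_singleton, id, Nat.Ico_succ_singleton, zero_add,
      Finset.range_zero, Finset.sum_empty, sub_zero, ContinuousLinearMap.id_apply, ht, if_true,
      one_ne_zero, if_false]
    have hswap : ‖M (max (u m) s) ω - M (min (u m) s) ω‖ = ‖M (u m) ω - M s ω‖ := by
      rcases le_total (u m) s with hm | hm
      · rw [max_eq_right hm, min_eq_left hm, norm_sub_rev]
      · rw [max_eq_left hm, min_eq_right hm]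
    rw [Set.mem_ofPred_eq, Set.mem_ofPred_eq, hswap, sq_le_sq₀ hε.le (norm_nonneg _)]
  have := tendstoInMeasure_add hD hMt
  simpa using this

end IsSkewNoiseEquation

end SLLB

/-! ### Truncated step processes on uniform grids and their convergence. -/

namespace SLLB

section Truncation

variable {H : Type*} [NormedAddCommGroup H]

/-- The map that sends vectors of norm larger than `n` to zero. -/
noncomputable def truncBall (n : ℕ) (v : H) : H := open Classical in if ‖v‖ ≤ n then v else 0

theorem truncBall_of_le {n : ℕ} {v : H} (h : ‖v‖ ≤ n) : truncBall n v = v := if_pos h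

theorem norm_truncBall_le (n : ℕ) (v : H) : ‖truncBall n v‖ ≤ n := by
  unfold truncBall
  split_ifs with h
  · exact h
  · simp

theorem norm_truncBall_le_norm (n : ℕ) (v : H) : ‖truncBall n v‖ ≤ ‖v‖ := by
  unfold truncBall
  split_ifs with h
  · exact le_rfl
  · simp

theorem stronglyMeasurable_truncBall {Ω : Type*} {m : MeasurableSpace Ω} {f : Ω → H}
    (hf : StronglyMeasurable[m] f) (n : ℕ) : StronglyMeasurable[m] fun ω => truncBall n (f ω) := by
  classical
  have e : (fun ω => truncBall n (f ω)) = {ω | ‖f ω‖ ≤ n}.indicator f := by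
    ext ω
    by_cases h : ‖f ω‖ ≤ n
    · rw [Set.indicator_of_mem (show ω ∈ {ω | ‖f ω‖ ≤ n} from h), truncBall_of_le h]
    · rw [Set.indicator_of_notMem (show ω ∉ {ω | ‖f ω‖ ≤ n} from h), truncBall, if_neg h]
  rw [e]
  exact hf.indicator (hf.norm.measurable measurableSet_Iic)

end Truncation

section Grid

/-- The points of the uniform partition of `[0, τ]` into `q` intervals. -/
noncomputable def uniformGrid (τ : ℝ≥0) (q p : ℕ) : ℝ≥0 := τ * ((min p q : ℕ) : ℝ≥0) / q

theorem uniformGrid_zero (τ : ℝ≥0) (q : ℕ) : uniformGrid τ q 0 = 0 := by simp [uniformGrid]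

theorem uniformGrid_self (τ : ℝ≥0) {q : ℕ} (hq : 0 < q) : uniformGrid τ q q = τ := by
  have : (q : ℝ≥0) ≠ 0 := by positivity
  simp [uniformGrid, this]

theorem monotone_uniformGrid (τ : ℝ≥0) (q : ℕ) : Monotone (uniformGrid τ q) := by
  intro a b hab
  unfold uniformGrid
  gcongr

theorem uniformGrid_le (τ : ℝ≥0) {q : ℕ} (hq : 0 < q) (p : ℕ) : uniformGrid τ q p ≤ τ := by
  have h : uniformGrid τ q p = uniformGrid τ q (min p q) := by simp [uniformGrid]
  rw [h]
  exact (monotone_uniformGrid τ q (min_le_right p q)).trans (uniformGrid_self τ hq).le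

theorem uniformGrid_succ_sub_le (τ : ℝ≥0) (q p : ℕ) :
    (uniformGrid τ q (p + 1) - uniformGrid τ q p : ℝ) ≤ τ / q := by
  unfold uniformGrid
  push_cast
  rw [← sub_div, ← mul_sub]
  gcongr
  have h : min ((p : ℝ) + 1) q ≤ min (p : ℝ) q + 1 := by
    rw [min_add]
    exact min_le_min le_rfl (by linarith)
  nlinarith [τ.2]

theorem exists_mem_Ioc_of_mem {t : ℕ → ℝ≥0} {q : ℕ} {s : ℝ≥0}
    (hs : s ∈ Set.Ioc (t 0) (t q)) : ∃ p < q, s ∈ Set.Ioc (t p) (t (p + 1)) := by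
  classical
  have hex : ∃ m, s ≤ t m := ⟨q, hs.2⟩
  have h0 : Nat.find hex ≠ 0 := fun h => by
    have := Nat.find_spec hex
    rw [h] at this
    exact absurd this (not_le.2 hs.1)
  obtain ⟨p, hp⟩ := Nat.exists_eq_succ_of_ne_zero h0
  refine ⟨p, ?_, ?_, ?_⟩
  · have := Nat.find_min' hex hs.2
    omega
  · exact not_le.1 (Nat.find_min hex (by omega))
  · have := Nat.find_spec hex
    rwa [hp] at this

variable {Ω : Type*} [mΩ : MeasurableSpace Ω] {H : Type*} [NormedAddCommGroup H]

/-- The left-continuous step process that takes the truncated values of `X` at the left ends of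
the intervals of a partition. -/
noncomputable def truncStep (X : ℝ≥0 → Ω → H) (t : ℕ → ℝ≥0) (q n : ℕ) (s : ℝ≥0) (ω : Ω) : H :=
  ∑ p ∈ Finset.range q, (Set.Ioc (t p) (t (p + 1))).indicator
    (fun _ => truncBall n (X (t p) ω)) s

variable {X : ℝ≥0 → Ω → H} {t : ℕ → ℝ≥0} {q : ℕ}

theorem truncStep_of_mem (ht : Monotone t) {p : ℕ} (hp : p < q) {s : ℝ≥0}
    (hs : s ∈ Set.Ioc (t p) (t (p + 1))) (n : ℕ) (ω : Ω) :
    truncStep X t q n s ω = truncBall n (X (t p) ω) := by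
  unfold truncStep
  rw [Finset.sum_eq_single_of_mem p (Finset.mem_range.2 hp), Set.indicator_of_mem hs]
  intro p' _ hne
  rw [Set.indicator_of_notMem]
  intro hs'
  rcases lt_or_gt_of_ne hne with h | h
  · exact absurd (hs'.2.trans (ht (Nat.succ_le_of_lt h))) (not_le.2 hs.1)
  · exact absurd (hs.2.trans (ht (Nat.succ_le_of_lt h))) (not_le.2 hs'.1)

theorem stronglyMeasurable_truncStep (hX : ∀ p, StronglyMeasurable (X (t p))) (n : ℕ) :
    StronglyMeasurable fun z : ℝ≥0 × Ω => truncStep X t q n z.1 z.2 := by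
  refine Finset.stronglyMeasurable_fun_sum _ fun p _ => ?_
  have e : (fun z : ℝ≥0 × Ω => (Set.Ioc (t p) (t (p + 1))).indicator
      (fun _ => truncBall n (X (t p) z.2)) z.1)
      = (Set.Ioc (t p) (t (p + 1)) ×ˢ Set.univ).indicator
        (fun z : ℝ≥0 × Ω => truncBall n (X (t p) z.2)) := by
    ext z
    simp [Set.indicator]
  rw [e]
  exact ((stronglyMeasurable_truncBall (hX p) n).comp_measurable measurable_snd).indicator
    (measurableSet_Ioc.prod MeasurableSet.univ)

theorem norm_truncStep_le (ht : Monotone t) {C : ℝ} {ω : Ω} (hC : ∀ p, ‖X (t p) ω‖ ≤ C) {s : ℝ≥0}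
    (hs : s ∈ Set.Ioc (t 0) (t q)) (n : ℕ) : ‖truncStep X t q n s ω‖ ≤ C := by
  obtain ⟨p, hp, hsp⟩ := exists_mem_Ioc_of_mem hs
  rw [truncStep_of_mem ht hp hsp]
  exact (norm_truncBall_le_norm _ _).trans (hC p)

end Grid

namespace IsSkewNoiseEquation

variable {Ω : Type*} [mΩ : MeasurableSpace Ω] {P : Measure Ω} {𝓕 : Filtration ℝ≥0 mΩ}
  {W : ℕ → ℝ≥0 → Ω → ℝ} {H : Type*} [NormedAddCommGroup H] [InnerProductSpace ℝ H]
  {T : ℝ≥0} {R : ℕ → H →L[ℝ] H} {b X M : ℝ≥0 → Ω → H}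

theorem measurable_norm_prod (h : IsSkewNoiseEquation P 𝓕 T W R b X M) :
    Measurable fun z : Ω × ℝ≥0 => ‖X (min z.2 T) z.1‖ :=
  (h.stronglyMeasurable_prod.comp_measurable measurable_swap).norm.measurable

/-- An essential bound of a path is a bound at each fixed time, up to a null set. -/
theorem norm_le_of_ae_le [IsProbabilityMeasure P] (h : IsSkewNoiseEquation P 𝓕 T W R b X M)
    {t : ℝ≥0} (ht : t ≤ T) : ∀ᵐ ω ∂P, ∀ c : ℕ,
      (∀ᵐ s ∂(leb.restrict (Set.Icc 0 T)), ‖X s ω‖ ≤ c) → ‖X t ω‖ ≤ c := by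
  rw [ae_all_iff]
  intro c
  -- The time zero is separate because positive times are approached from the left.
  rcases eq_zero_or_pos t with rfl | ht0
  · filter_upwards [h.init] with ω hω _
    simp [hω]
  set S : Set (Ω × ℝ≥0) := {z | (c : ℝ) < ‖X (min z.2 T) z.1‖} with hS
  have hSm : MeasurableSet S := measurableSet_lt measurable_const h.measurable_norm_prod
  -- The event that the path is essentially bounded by `c`, in a form whose measurability follows
  -- from Fubini's theorem.
  set A : Set Ω := {ω | (leb.restrict (Set.Icc 0 T)) (Prod.mk ω ⁻¹' S) = 0} with hA
  have hAm : MeasurableSet A := measurable_measure_prodMk_left hSm (measurableSet_singleton 0)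
  have hAiff : ∀ ω, ω ∈ A ↔ ∀ᵐ s ∂(leb.restrict (Set.Icc 0 T)), ‖X s ω‖ ≤ c := by
    intro ω
    have h1 : ω ∈ A ↔ ∀ᵐ s ∂(leb.restrict (Set.Icc 0 T)), ‖X (min s T) ω‖ ≤ c := by
      rw [ae_iff]
      simp only [not_le]
      rfl
    rw [h1]
    refine ⟨fun hh => ?_, fun hh => ?_⟩ <;>
    · filter_upwards [hh, ae_restrict_mem measurableSet_Icc] with s hs hs2
      rw [min_eq_left hs2.2] at *
      exact hs
  have hae : ∀ᵐ ω ∂P, ∀ᵐ s ∂(leb.restrict (Set.Icc 0 T)), ω ∈ A → ‖X (min s T) ω‖ ≤ c := by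
    refine Eventually.of_forall fun ω => ?_
    by_cases hω : ω ∈ A
    · filter_upwards [(hAiff ω).1 hω, ae_restrict_mem measurableSet_Icc] with s hs hs2 _
      rwa [min_eq_left hs2.2]
    · exact Eventually.of_forall fun s hs => absurd hs hω
  have hmeas : MeasurableSet {z : Ω × ℝ≥0 | z.1 ∈ A → ‖X (min z.2 T) z.1‖ ≤ c} := by
    have : {z : Ω × ℝ≥0 | z.1 ∈ A → ‖X (min z.2 T) z.1‖ ≤ c}
        = (Prod.fst ⁻¹' A)ᶜ ∪ {z | ‖X (min z.2 T) z.1‖ ≤ c} := by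
      ext z
      simp only [Set.mem_ofPred_eq, Set.mem_union, Set.mem_compl_iff, Set.mem_preimage]
      tauto
    rw [this]
    exact (measurable_fst hAm).compl.union (measurableSet_le h.measurable_norm_prod measurable_const)
  -- Exchanging the quantifiers: at almost every time the bound holds almost surely on `A`. Such
  -- times accumulate at `t` from the left, and continuity in probability carries the bound over to
  -- `t`.
  have hae2 := (Measure.ae_ae_comm (μ := P) (ν := leb.restrict (Set.Icc 0 T)) hmeas).1 hae
  have hpick : ∀ m : ℕ, ∃ u, u ∈ Set.Ioc (t * (m / (m + 1))) t ∧
      ∀ᵐ ω ∂P, ω ∈ A → ‖X (min u T) ω‖ ≤ c := by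
    intro m
    have hlt : t * (m / (m + 1) : ℝ≥0) < t := by
      have : (m / (m + 1) : ℝ≥0) < 1 := by
        rw [div_lt_one (by positivity)]
        exact lt_add_one _
      calc t * (m / (m + 1) : ℝ≥0) < t * 1 := by gcongr
        _ = t := mul_one t
    have hsub : Set.Ioc (t * (m / (m + 1) : ℝ≥0)) t ⊆ Set.Icc 0 T :=
      fun x hx => ⟨zero_le, hx.2.trans ht⟩
    have h1 := ae_restrict_of_ae_restrict_of_subset hsub hae2
    have h2 := h1.and (ae_restrict_mem measurableSet_Ioc)
    have hne : leb.restrict (Set.Ioc (t * (m / (m + 1) : ℝ≥0)) t) ≠ 0 := by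
      rw [Ne, Measure.restrict_eq_zero, leb_Ioc, ENNReal.ofReal_eq_zero, not_le, sub_pos]
      exact_mod_cast hlt
    have : NeBot (ae (leb.restrict (Set.Ioc (t * (m / (m + 1) : ℝ≥0)) t))) := ae_neBot.2 hne
    obtain ⟨u, hu1, hu2⟩ := h2.exists
    exact ⟨u, hu2, hu1⟩
  choose u hu1 hu2 using hpick
  have huT : ∀ m, u m ≤ T := fun m => (hu1 m).2.trans ht
  have hut : Tendsto u atTop (𝓝 t) := by
    refine tendsto_of_tendsto_of_tendsto_of_le_of_le (g := fun m : ℕ => t * (m / (m + 1) : ℝ≥0))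
      ?_ tendsto_const_nhds (fun m => (hu1 m).1.le) (fun m => (hu1 m).2)
    have h1 : Tendsto (fun m : ℕ => (m / (m + 1) : ℝ≥0)) atTop (𝓝 1) := by
      rw [← NNReal.tendsto_coe]
      push_cast
      exact tendsto_natCast_div_add_atTop (1 : ℝ)
    simpa using h1.const_mul t
  obtain ⟨ns, -, hns⟩ := (h.tendstoInMeasure huT ht hut).exists_seq_tendsto_ae
  filter_upwards [hns, ae_all_iff.2 hu2] with ω h1 h2 h3
  refine le_of_tendsto h1.norm (Eventually.of_forall fun i => ?_)
  have := h2 (ns i) ((hAiff ω).2 h3)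
  rwa [min_eq_left (huT _)] at this

/-- The step processes along refining partitions converge to `X`. -/
theorem exists_subseq_tendsto_truncStep [IsProbabilityMeasure P]
    (h : IsSkewNoiseEquation P 𝓕 T W R b X M) {τ : ℝ≥0} (hτ : τ ≤ T) {q : ℕ → ℕ}
    (hq0 : ∀ n, 0 < q n) (hq : Tendsto q atTop atTop) :
    ∃ ns : ℕ → ℕ, StrictMono ns ∧ ∀ᵐ ω ∂P, ∀ᵐ s ∂(leb.restrict (Set.Ioc 0 τ)),
      Tendsto (fun i => truncStep X (uniformGrid τ (q (ns i))) (q (ns i)) (ns i) s ω) atTop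
        (𝓝 (X s ω)) := by
  have hgm := fun n => monotone_uniformGrid τ (q n)
  -- At a fixed time the step process is the truncated value at the left end of the cell. That point
  -- tends to `s`, and the truncation is eventually inactive because the path is bounded.
  have hpt : ∀ s ∈ Set.Ioc 0 τ, TendstoInMeasure P
      (fun n ω => truncStep X (uniformGrid τ (q n)) (q n) n s ω) atTop (X s) := by
    intro s hs
    have hex : ∀ n, ∃ p < q n,
        s ∈ Set.Ioc (uniformGrid τ (q n) p) (uniformGrid τ (q n) (p + 1)) := fun n =>
      exists_mem_Ioc_of_mem (by rwa [uniformGrid_zero, uniformGrid_self τ (hq0 n)])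
    choose p hp hsp using hex
    set u : ℕ → ℝ≥0 := fun n => uniformGrid τ (q n) (p n) with hu
    have huT : ∀ n, u n ≤ T := fun n => (uniformGrid_le τ (hq0 n) _).trans hτ
    have hus : Tendsto u atTop (𝓝 s) := by
      rw [← NNReal.tendsto_coe]
      have h1 : Tendsto (fun n => (s : ℝ) - τ / q n) atTop (𝓝 s) := by
        have := (tendsto_const_div_atTop_nhds_zero_nat (τ : ℝ)).comp hq
        simpa using this.const_sub (s : ℝ)
      refine tendsto_of_tendsto_of_tendsto_of_le_of_le h1 tendsto_const_nhds (fun n => ?_)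
        (fun n => by exact_mod_cast (hsp n).1.le)
      have h2 := uniformGrid_succ_sub_le τ (q n) (p n)
      have h3 : (s : ℝ) ≤ uniformGrid τ (q n) (p n + 1) := by exact_mod_cast (hsp n).2
      simp only [hu]
      linarith
    have h1 := h.tendstoInMeasure huT (hs.2.trans hτ) hus
    have h2 : TendstoInMeasure P (fun n ω => truncBall n (X (u n) ω) - X (u n) ω) atTop
        (fun _ => 0) := by
      refine tendstoInMeasure_of_tendsto_ae (fun n =>
        ((stronglyMeasurable_truncBall (h.stronglyMeasurable_eval _) n).sub
          (h.stronglyMeasurable_eval _)).aestronglyMeasurable) ?_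
      filter_upwards [ae_all_iff.2 fun n => h.norm_le_of_ae_le (huT n), h.bdd] with ω hω ⟨C, hC⟩
      refine tendsto_const_nhds.congr' ?_
      filter_upwards [eventually_ge_atTop ⌈C⌉₊] with n hn
      rw [truncBall_of_le, sub_self]
      refine (hω n ⌈C⌉₊ ?_).trans (by exact_mod_cast hn)
      filter_upwards [hC] with s hs
      exact hs.trans (Nat.le_ceil C)
    have h3 := tendstoInMeasure_add h2 h1
    simp only [sub_add_cancel, zero_add] at h3
    convert! h3 using 3 with n ω
    exact truncStep_of_mem (hgm n) (hp n) (hsp n) n ω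
  have hm : ∀ n, StronglyMeasurable fun z : Ω × ℝ≥0 =>
      truncStep X (uniformGrid τ (q n)) (q n) n z.2 z.1 := fun n =>
    (stronglyMeasurable_truncStep (fun p => h.stronglyMeasurable_eval _) n).comp_measurable
      measurable_swap
  have hX : StronglyMeasurable fun z : Ω × ℝ≥0 => X (min z.2 T) z.1 :=
    h.stronglyMeasurable_prod.comp_measurable measurable_swap
  -- Convergence in probability at each time gives convergence in measure on the product with time,
  -- by dominated convergence. A subsequence then converges almost everywhere in both variables.
  have hprod : TendstoInMeasure (P.prod (leb.restrict (Set.Ioc 0 τ)))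
      (fun n (z : Ω × ℝ≥0) => truncStep X (uniformGrid τ (q n)) (q n) n z.2 z.1) atTop
      (fun z => X (min z.2 T) z.1) := by
    rw [tendstoInMeasure_iff_norm]
    intro ε hε
    have hS : ∀ n, MeasurableSet {z : Ω × ℝ≥0 | ε ≤
        ‖truncStep X (uniformGrid τ (q n)) (q n) n z.2 z.1 - X (min z.2 T) z.1‖} := fun n =>
      measurableSet_le measurable_const ((hm n).sub hX).norm.measurable
    simp_rw [fun n => Measure.prod_apply_symm (μ := P) (ν := leb.restrict (Set.Ioc 0 τ)) (hS n)]
    have : IsFiniteMeasure (leb.restrict (Set.Ioc 0 τ)) :=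
      ⟨by rw [Measure.restrict_apply_univ, leb_Ioc]; exact ENNReal.ofReal_lt_top⟩
    have := tendsto_lintegral_of_dominated_convergence (μ := leb.restrict (Set.Ioc 0 τ))
      (F := fun n s => P ((fun ω => (ω, s)) ⁻¹' {z : Ω × ℝ≥0 | ε ≤
        ‖truncStep X (uniformGrid τ (q n)) (q n) n z.2 z.1 - X (min z.2 T) z.1‖}))
      (f := fun _ => 0) (fun _ => 1) (fun n => measurable_measure_prodMk_right (hS n))
      (fun n => Eventually.of_forall fun s => prob_le_one)
      (by rw [lintegral_one]; exact measure_ne_top _ _) (by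
        filter_upwards [ae_restrict_mem measurableSet_Ioc] with s hs
        have h1 := hpt s hs
        rw [tendstoInMeasure_iff_norm] at h1
        refine (h1 ε hε).congr fun n => ?_
        congr 1
        ext ω
        simp only [Set.mem_preimage, Set.mem_ofPred_eq]
        rw [min_eq_left (hs.2.trans hτ)])
    simpa using this
  obtain ⟨ns, hns, hlim⟩ := hprod.exists_seq_tendsto_ae
  refine ⟨ns, hns, ?_⟩
  filter_upwards [Measure.ae_ae_of_ae_prod hlim] with ω hω
  filter_upwards [hω, ae_restrict_mem measurableSet_Ioc] with s hs hs2
  rwa [min_eq_left (hs2.2.trans hτ)] at hs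

end IsSkewNoiseEquation

end SLLB

/-! ### Pathwise estimates along a grid and bounds for the frozen coefficients. -/

namespace SLLB

section Deterministic

variable {H : Type*} [NormedAddCommGroup H] [InnerProductSpace ℝ H]

/-- Telescoping of `‖x_{p+1}‖² - ‖x_p‖²`, where the term linear in `S` vanishes by orthogonality.
The squares of `S` survive in the limit while those of `A` and `Z` do not. The parameter `c` of
Young's inequality therefore stays free, so that the coefficient `1 + c` of the former can be
brought down to one at the end. -/
theorem norm_sq_le_of_increments {x A S Z : ℕ → H} {q : ℕ} (h0 : x 0 = 0)
    (hx : ∀ p < q, x (p + 1) - x p = A p + S p + Z p) (hS : ∀ p < q, ⟪x p, S p⟫ = 0)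
    {c : ℝ} (hc : 0 < c) :
    ‖x q‖ ^ 2 ≤ 2 * ∑ p ∈ Finset.range q, ⟪x p, A p⟫ + 2 * ∑ p ∈ Finset.range q, ⟪x p, Z p⟫
      + (1 + c) * ∑ p ∈ Finset.range q, ‖S p‖ ^ 2
      + (1 + 1 / c) * (2 * ∑ p ∈ Finset.range q, ‖A p‖ ^ 2
        + 2 * ∑ p ∈ Finset.range q, ‖Z p‖ ^ 2) := by
  induction q with
  | zero => simp [h0]
  | succ q ih =>
    have ih' := ih (fun p hp => hx p (by omega)) fun p hp => hS p (by omega)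
    have e : x (q + 1) = x q + (S q + (A q + Z q)) := by
      rw [← sub_eq_iff_eq_add', hx q (by omega)]; abel
    have e1 : ‖x (q + 1)‖ ^ 2 = ‖x q‖ ^ 2 + 2 * ⟪x q, A q⟫ + 2 * ⟪x q, Z q⟫
        + ‖S q + (A q + Z q)‖ ^ 2 := by
      rw [e, norm_add_sq_real, inner_add_right, inner_add_right, hS q (by omega)]; ring
    have e2 : ‖S q + (A q + Z q)‖ ^ 2 ≤ (1 + c) * ‖S q‖ ^ 2 + (1 + 1 / c) * ‖A q + Z q‖ ^ 2 := by
      have h1 := norm_add_le (S q) (A q + Z q)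
      have h2 : ‖S q + (A q + Z q)‖ ^ 2 ≤ (‖S q‖ + ‖A q + Z q‖) ^ 2 := by gcongr
      have h3 : 2 * (‖S q‖ * ‖A q + Z q‖) ≤ c * ‖S q‖ ^ 2 + 1 / c * ‖A q + Z q‖ ^ 2 := by
        have h4 : 0 ≤ 1 / c * (c * ‖S q‖ - ‖A q + Z q‖) ^ 2 := by positivity
        have h5 : 1 / c * (c * ‖S q‖ - ‖A q + Z q‖) ^ 2
            = c * ‖S q‖ ^ 2 + 1 / c * ‖A q + Z q‖ ^ 2 - 2 * (‖S q‖ * ‖A q + Z q‖) := by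
          field_simp
          ring
        linarith
      nlinarith
    have e3 : ‖A q + Z q‖ ^ 2 ≤ 2 * ‖A q‖ ^ 2 + 2 * ‖Z q‖ ^ 2 := by
      nlinarith [norm_add_le (A q) (Z q), norm_nonneg (A q + Z q), sq_nonneg (‖A q‖ - ‖Z q‖)]
    have e4 : (1 + 1 / c) * ‖A q + Z q‖ ^ 2 ≤ (1 + 1 / c) * (2 * ‖A q‖ ^ 2 + 2 * ‖Z q‖ ^ 2) := by
      gcongr
    simp only [Finset.sum_range_succ]
    linarith

/-- The squared increments of the primitive of an integrable function are negligible. -/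
theorem tendsto_sum_norm_setIntegral_sq {f : ℝ≥0 → H} {τ : ℝ≥0}
    (hf : IntegrableOn f (Set.Ioc 0 τ) leb) {q : ℕ → ℕ} (hq0 : ∀ n, 0 < q n)
    (hq : Tendsto q atTop atTop) :
    Tendsto (fun n => ∑ p ∈ Finset.range (q n),
      ‖∫ s in Set.Ioc (uniformGrid τ (q n) p) (uniformGrid τ (q n) (p + 1)), f s ∂leb‖ ^ 2)
      atTop (𝓝 0) := by
  set B := ∫ s in Set.Ioc 0 τ, ‖f s‖ ∂leb with hB
  have hB0 : 0 ≤ B := integral_nonneg fun s => norm_nonneg _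
  have hfin : ∫⁻ s, ‖f s‖ₑ ∂(leb.restrict (Set.Ioc 0 τ)) ≠ ∞ := hf.hasFiniteIntegral.ne
  rw [Metric.tendsto_atTop]
  intro ε hε
  -- By absolute continuity the integral of `‖f‖` over each cell of a fine grid is at most `η`, so
  -- the sum of squares is at most `η` times the total integral `B`.
  set η : ℝ := ε / (2 * (B + 1)) with hη
  have hη0 : 0 < η := by positivity
  obtain ⟨δ, hδ, hδ2⟩ := exists_pos_setLIntegral_lt_of_measure_lt hfin
    (show ENNReal.ofReal η ≠ 0 by simpa using hη0)
  have hmesh : Tendsto (fun n => ENNReal.ofReal ((τ : ℝ) / q n)) atTop (𝓝 0) := by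
    have := ENNReal.tendsto_ofReal ((tendsto_const_div_atTop_nhds_zero_nat (τ : ℝ)).comp hq)
    simpa using this
  obtain ⟨N, hN⟩ := eventually_atTop.1 (hmesh.eventually_lt_const hδ)
  refine ⟨N, fun n hn => ?_⟩
  have hgm := monotone_uniformGrid τ (q n)
  have hsub : ∀ p, Set.Ioc (uniformGrid τ (q n) p) (uniformGrid τ (q n) (p + 1)) ⊆ Set.Ioc 0 τ :=
    fun p => Set.Ioc_subset_Ioc zero_le (uniformGrid_le τ (hq0 n) _)
  have hcell : ∀ p,
      ∫ s in Set.Ioc (uniformGrid τ (q n) p) (uniformGrid τ (q n) (p + 1)), ‖f s‖ ∂leb ≤ η := by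
    intro p
    rw [integral_norm_eq_lintegral_enorm (hf.mono_set (hsub p)).aestronglyMeasurable]
    refine ENNReal.toReal_le_of_le_ofReal hη0.le (le_trans (le_of_eq ?_) (hδ2
      (Set.Ioc (uniformGrid τ (q n) p) (uniformGrid τ (q n) (p + 1))) ?_).le)
    · rw [Measure.restrict_restrict measurableSet_Ioc, Set.inter_eq_self_of_subset_left (hsub p)]
    · refine ((Measure.restrict_apply_le _ _).trans ?_).trans_lt (hN n hn)
      rw [leb_Ioc]
      exact ENNReal.ofReal_le_ofReal (uniformGrid_succ_sub_le τ (q n) p)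
  have hle : ∑ p ∈ Finset.range (q n),
      ‖∫ s in Set.Ioc (uniformGrid τ (q n) p) (uniformGrid τ (q n) (p + 1)), f s ∂leb‖ ^ 2
      ≤ η * B := by
    calc _ ≤ ∑ p ∈ Finset.range (q n), η * ∫ s in Set.Ioc (uniformGrid τ (q n) p)
            (uniformGrid τ (q n) (p + 1)), ‖f s‖ ∂leb := by
          refine Finset.sum_le_sum fun p _ => ?_
          have h1 := norm_integral_le_integral_norm (μ := leb.restrict
            (Set.Ioc (uniformGrid τ (q n) p) (uniformGrid τ (q n) (p + 1)))) f
          have h2 := hcell p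
          have h3 := norm_nonneg (∫ s in Set.Ioc (uniformGrid τ (q n) p)
            (uniformGrid τ (q n) (p + 1)), f s ∂leb)
          nlinarith
      _ = η * B := by
          rw [← Finset.mul_sum, Finset.range_eq_Ico,
            setIntegral_Ioc_sum hgm (Nat.zero_le _) (by
              rw [uniformGrid_zero, uniformGrid_self τ (hq0 n)]; exact hf.norm),
            uniformGrid_zero, uniformGrid_self τ (hq0 n)]
  rw [Real.dist_eq, sub_zero, abs_of_nonneg (Finset.sum_nonneg fun p _ => sq_nonneg _)]
  refine hle.trans_lt ?_
  rw [hη, div_mul_eq_mul_div, div_lt_iff₀ (by positivity)]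
  nlinarith

theorem setIntegral_Icc_sub {f : ℝ≥0 → H} {s t τ : ℝ≥0} (hst : s ≤ t) (ht : t ≤ τ)
    (hf : IntegrableOn f (Set.Icc 0 τ) leb) :
    (∫ r in Set.Icc 0 t, f r ∂leb) - ∫ r in Set.Icc 0 s, f r ∂leb = ∫ r in Set.Ioc s t, f r ∂leb := by
  rw [sub_eq_iff_eq_add', ← setIntegral_union, Set.Icc_union_Ioc_eq_Icc zero_le hst]
  · exact Set.disjoint_left.2 fun x hx hx' => absurd hx.2 (not_le.2 hx'.1)
  · exact measurableSet_Ioc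
  · exact hf.mono_set (Set.Icc_subset_Icc_right (hst.trans ht))
  · exact hf.mono_set fun x hx => ⟨zero_le, hx.2.trans ht⟩

variable {R : ℕ → H →L[ℝ] H}

theorem norm_apply_sq_le (R : ℕ → H →L[ℝ] H) (k : ℕ) (v : H) :
    ‖R k v‖ ^ 2 ≤ ‖R k‖ ^ 2 * ‖v‖ ^ 2 := by
  rw [← mul_pow]
  gcongr
  exact (R k).le_opNorm v

theorem summable_norm_apply_sq (hR : Summable fun k => ‖R k‖ ^ 2) (v : H) :
    Summable fun k => ‖R k v‖ ^ 2 :=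
  (hR.mul_right (‖v‖ ^ 2)).of_nonneg_of_le (fun _ => sq_nonneg _) fun k => norm_apply_sq_le R k v

/-- The series converges uniformly on balls, being dominated there by a multiple of `∑ ‖R_k‖²`. -/
theorem continuous_tsum_norm_apply_sq (hR : Summable fun k => ‖R k‖ ^ 2) :
    Continuous fun v => ∑' k, ‖R k v‖ ^ 2 := by
  rw [continuous_iff_continuousAt]
  intro v
  have h := continuousOn_tsum (f := fun k w => ‖R k w‖ ^ 2) (s := Metric.ball (0 : H) (‖v‖ + 1))
    (fun k => by fun_prop) (hR.mul_right ((‖v‖ + 1) ^ 2)) (fun k w hw => by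
      rw [Real.norm_of_nonneg (sq_nonneg _)]
      refine (norm_apply_sq_le R k w).trans ?_
      have : ‖w‖ ≤ ‖v‖ + 1 := (mem_ball_zero_iff.1 hw).le
      gcongr)
  exact h.continuousAt (Metric.isOpen_ball.mem_nhds (by simp))

theorem tsum_norm_apply_sq_le (hR : Summable fun k => ‖R k‖ ^ 2) (v : H) :
    ∑' k, ‖R k v‖ ^ 2 ≤ (∑' k, ‖R k‖ ^ 2) * ‖v‖ ^ 2 := by
  rw [← tsum_mul_right]
  exact (summable_norm_apply_sq hR v).tsum_le_tsum (fun k => norm_apply_sq_le R k v)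
    (hR.mul_right _)

end Deterministic

section StepError

variable {Ω : Type*} [mΩ : MeasurableSpace Ω] {H : Type*} [NormedAddCommGroup H]
  [InnerProductSpace ℝ H]

/-- A bound for the error of step approximations of the noise coefficients. -/
noncomputable def stepError (R : ℕ → H →L[ℝ] H) (X : ℝ≥0 → Ω → H) (t : ℕ → ℝ≥0) (q n : ℕ) (ω : Ω) :
    ℝ≥0∞ :=
  tailSum R 0 * ∫⁻ s in Set.Ioc (t 0) (t q),
      ((1 + ‖truncStep X t q n s ω‖ₑ) * ‖X s ω - truncStep X t q n s ω‖ₑ) ^ 2 ∂leb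
    + tailSum R n * ∫⁻ s in Set.Ioc (t 0) (t q),
      ((1 + ‖truncStep X t q n s ω‖ₑ) * ‖X s ω‖ₑ) ^ 2 ∂leb

/-- The weight `1 + ‖Y‖` covers both applications: the identity, for the sum of squares of the
remainders, and the inner product with the frozen value `Y`, for their weighted sum. -/
theorem weightedError_le_stepError {E : Type*} [NormedAddCommGroup E] [InnerProductSpace ℝ E]
    (R : ℕ → H →L[ℝ] H) (X : ℝ≥0 → Ω → H) {t : ℕ → ℝ≥0} (ht : Monotone t) (q n : ℕ)
    {V : ℕ → Ω → H →L[ℝ] E} {ω : Ω} (hV : ∀ p, ‖V p ω‖ₑ ≤ 1 + ‖truncBall n (X (t p) ω)‖ₑ) :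
    weightedError (fun k s ω => R k (X s ω))
      (truncRows n fun k p ω => R k (truncBall n (X (t p) ω))) V t q ω ≤ stepError R X t q n ω := by
  refine (IsSkewNoiseEquation.weightedError_le R X (fun p ω => truncBall n (X (t p) ω)) V t q n
    ω).trans ?_
  unfold stepError
  rw [← lintegral_Ioc_sum ht (Nat.zero_le q), ← lintegral_Ioc_sum ht (Nat.zero_le q),
    ← Finset.range_eq_Ico]
  refine add_le_add (mul_le_mul_right (Finset.sum_le_sum fun p hp => ?_) _)
    (mul_le_mul_right (Finset.sum_le_sum fun p hp => ?_) _)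
  all_goals
    refine setLIntegral_mono' measurableSet_Ioc fun s hs => ?_
    rw [truncStep_of_mem ht (Finset.mem_range.1 hp) hs]
    gcongr
    exact hV p

end StepError

end SLLB

/-! ### Vanishing of the remainders along the grids. -/

namespace SLLB

instance isFiniteMeasure_leb_Ioc (a b : ℝ≥0) : IsFiniteMeasure (leb.restrict (Set.Ioc a b)) :=
  ⟨by rw [Measure.restrict_apply_univ, leb_Ioc]; exact ENNReal.ofReal_lt_top⟩

namespace IsSkewNoiseEquation

variable {Ω : Type*} [mΩ : MeasurableSpace Ω] {P : Measure Ω} {𝓕 : Filtration ℝ≥0 mΩ}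
  {W : ℕ → ℝ≥0 → Ω → ℝ} {H : Type*} [NormedAddCommGroup H] [InnerProductSpace ℝ H]
  {T : ℝ≥0} {R : ℕ → H →L[ℝ] H} {b X M : ℝ≥0 → Ω → H}

theorem stronglyMeasurable_truncStep_path (h : IsSkewNoiseEquation P 𝓕 T W R b X M) (t : ℕ → ℝ≥0)
    (q n : ℕ) (ω : Ω) : StronglyMeasurable fun s => truncStep X t q n s ω :=
  (stronglyMeasurable_truncStep (fun p => h.stronglyMeasurable_eval (t p)) n).comp_measurable
    (g := fun s => (s, ω)) (by fun_prop)

theorem measurable_stepError (h : IsSkewNoiseEquation P 𝓕 T W R b X M) {t : ℕ → ℝ≥0} {q : ℕ}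
    (htT : t q ≤ T) (n : ℕ) : Measurable (stepError R X t q n) := by
  have e : stepError R X t q n = fun ω => tailSum R 0 * ∫⁻ s in Set.Ioc (t 0) (t q),
      ((1 + ‖truncStep X t q n s ω‖ₑ) * ‖X (min s T) ω - truncStep X t q n s ω‖ₑ) ^ 2 ∂leb
    + tailSum R n * ∫⁻ s in Set.Ioc (t 0) (t q),
      ((1 + ‖truncStep X t q n s ω‖ₑ) * ‖X (min s T) ω‖ₑ) ^ 2 ∂leb := by
    ext ω
    unfold stepError
    congr 2
    all_goals
      refine setLIntegral_congr_fun measurableSet_Ioc fun s hs => ?_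
      rw [min_eq_left (hs.2.trans htT)]
  rw [e]
  have h1 := stronglyMeasurable_truncStep (X := X) (t := t) (q := q)
    (fun p => h.stronglyMeasurable_eval (t p)) n
  have h2 := h.stronglyMeasurable_prod
  have h3 : Measurable fun z : ℝ≥0 × Ω =>
      ((1 + ‖truncStep X t q n z.1 z.2‖ₑ) * ‖X (min z.1 T) z.2 - truncStep X t q n z.1 z.2‖ₑ) ^ 2 :=
    ((measurable_const.add h1.enorm).mul (h2.sub h1).enorm).pow_const 2
  have h4 : Measurable fun z : ℝ≥0 × Ω =>
      ((1 + ‖truncStep X t q n z.1 z.2‖ₑ) * ‖X (min z.1 T) z.2‖ₑ) ^ 2 :=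
    ((measurable_const.add h1.enorm).mul h2.enorm).pow_const 2
  exact (h3.lintegral_prod_left'.const_mul _).add (h4.lintegral_prod_left'.const_mul _)

/-- Along a bounded path all integrands have a common bound. The first integral tends to zero by
dominated convergence, and the second stays bounded while its factor, the tail of `∑ ‖R_k‖²`, tends
to zero. -/
theorem tendsto_stepError (h : IsSkewNoiseEquation P 𝓕 T W R b X M) {τ : ℝ≥0} (hτ : τ ≤ T)
    {q ns : ℕ → ℕ} (hq0 : ∀ n, 0 < q n) (hns : Tendsto ns atTop atTop) {ω : Ω} {C : ℝ}
    (hC : ∀ i p, ‖X (uniformGrid τ (q i) p) ω‖ ≤ C)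
    (hC' : ∀ᵐ s ∂(leb.restrict (Set.Ioc 0 τ)), ‖X s ω‖ ≤ C)
    (hlim : ∀ᵐ s ∂(leb.restrict (Set.Ioc 0 τ)),
      Tendsto (fun i => truncStep X (uniformGrid τ (q i)) (q i) (ns i) s ω) atTop (𝓝 (X s ω))) :
    Tendsto (fun i => stepError R X (uniformGrid τ (q i)) (q i) (ns i) ω) atTop (𝓝 0) := by
  have hgm := fun n => monotone_uniformGrid τ (q n)
  have hXm : AEStronglyMeasurable (fun s => X s ω) (leb.restrict (Set.Ioc 0 τ)) :=
    (h.aestronglyMeasurable_path ω).mono_measure (Measure.restrict_mono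
      (show Set.Ioc 0 τ ⊆ Set.Icc 0 T from fun s hs => ⟨zero_le, hs.2.trans hτ⟩) le_rfl)
  have hle : ∀ {v : H}, ‖v‖ ≤ C → ‖v‖ₑ ≤ ENNReal.ofReal C := fun hv => by
    rw [← ofReal_norm]; exact ENNReal.ofReal_le_ofReal hv
  have hstep : ∀ i, ∀ s ∈ Set.Ioc 0 τ,
      ‖truncStep X (uniformGrid τ (q i)) (q i) (ns i) s ω‖ₑ ≤ ENNReal.ofReal C := fun i s hs =>
    hle (norm_truncStep_le (hgm i) (hC i)
      (by rwa [uniformGrid_zero, uniformGrid_self τ (hq0 i)]) (ns i))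
  set B : ℝ≥0∞ := ENNReal.ofReal C with hB
  unfold stepError
  simp_rw [fun i => uniformGrid_self τ (hq0 i), uniformGrid_zero]
  have h1 : Tendsto (fun i => ∫⁻ s in Set.Ioc 0 τ,
      ((1 + ‖truncStep X (uniformGrid τ (q i)) (q i) (ns i) s ω‖ₑ)
        * ‖X s ω - truncStep X (uniformGrid τ (q i)) (q i) (ns i) s ω‖ₑ) ^ 2 ∂leb)
      atTop (𝓝 0) := by
    have := tendsto_lintegral_of_dominated_convergence' (μ := leb.restrict (Set.Ioc 0 τ))
      (F := fun i s => ((1 + ‖truncStep X (uniformGrid τ (q i)) (q i) (ns i) s ω‖ₑ)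
        * ‖X s ω - truncStep X (uniformGrid τ (q i)) (q i) (ns i) s ω‖ₑ) ^ 2) (f := fun _ => 0)
      (fun _ => ((1 + B) * (B + B)) ^ 2) (fun i => by
        have h2 := (h.stronglyMeasurable_truncStep_path (uniformGrid τ (q i)) (q i) (ns i)
          ω).aestronglyMeasurable (μ := leb.restrict (Set.Ioc 0 τ))
        exact ((aemeasurable_const.add h2.enorm).mul (hXm.sub h2).enorm).pow_const 2)
      (fun i => by
        filter_upwards [hC', ae_restrict_mem measurableSet_Ioc] with s hs hs2
        gcongr
        · exact hstep i s hs2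
        · exact (enorm_sub_le).trans (add_le_add (hle hs) (hstep i s hs2)))
      (by rw [lintegral_const]
          exact ENNReal.mul_ne_top (by finiteness) (measure_ne_top _ _))
      (by
        filter_upwards [hlim] with s hs
        have h2 : Tendsto (fun i =>
            1 + ‖truncStep X (uniformGrid τ (q i)) (q i) (ns i) s ω‖ₑ) atTop
            (𝓝 (1 + ‖X s ω‖ₑ)) := hs.enorm.const_add _
        have h3 : Tendsto (fun i =>
            ‖X s ω - truncStep X (uniformGrid τ (q i)) (q i) (ns i) s ω‖ₑ) atTop (𝓝 0) := by
          have := (hs.const_sub (X s ω)).enorm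
          simpa using this
        have h4 := ENNReal.Tendsto.mul h2 (Or.inr ENNReal.zero_ne_top) h3
          (Or.inr (by finiteness))
        rw [mul_zero] at h4
        simpa [Function.comp_def] using ((ENNReal.continuous_pow 2).tendsto 0).comp h4)
    simpa using this
  have h2 : Tendsto (fun i => tailSum R (ns i) * (((1 + B) * B) ^ 2 * leb (Set.Ioc 0 τ)))
      atTop (𝓝 0) := by
    have h3 := ENNReal.Tendsto.mul_const (b := ((1 + B) * B) ^ 2 * leb (Set.Ioc 0 τ))
      (h.tendsto_tailSum.comp hns) (Or.inr (by rw [leb_Ioc]; finiteness))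
    simpa using h3
  have h5 := (ENNReal.Tendsto.const_mul h1 (Or.inr h.tailSum_zero_lt_top.ne)).add h2
  rw [mul_zero, add_zero] at h5
  refine tendsto_of_tendsto_of_tendsto_of_le_of_le tendsto_const_nhds h5 (fun _ => zero_le)
    fun i => ?_
  dsimp only
  gcongr
  rw [← setLIntegral_const]
  refine lintegral_mono_ae ?_
  filter_upwards [hC', ae_restrict_mem measurableSet_Ioc] with s hs hs2
  gcongr
  · exact hstep i s hs2
  · exact hle hs

end IsSkewNoiseEquation

end SLLB

namespace SLLB

section

variable {Ω : Type*} [mΩ : MeasurableSpace Ω] {P : Measure Ω}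

theorem tendstoInMeasure_zero_of_nonneg {f : ℕ → Ω → ℝ} (hf : ∀ i ω, 0 ≤ f i ω)
    (h : ∀ lam : ℝ, 0 < lam → Tendsto (fun i => P {ω | lam ≤ f i ω}) atTop (𝓝 0)) :
    TendstoInMeasure P f atTop (fun _ => 0) := by
  rw [tendstoInMeasure_iff_norm]
  intro ε hε
  simpa only [sub_zero, Real.norm_of_nonneg (hf _ _)] using h ε hε

end

namespace IsSkewNoiseEquation

variable {Ω : Type*} [mΩ : MeasurableSpace Ω] {P : Measure Ω} {𝓕 : Filtration ℝ≥0 mΩ}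
  {W : ℕ → ℝ≥0 → Ω → ℝ} {H : Type*} [NormedAddCommGroup H] [InnerProductSpace ℝ H]
  {T : ℝ≥0} {R : ℕ → H →L[ℝ] H} {b X M : ℝ≥0 → Ω → H}

/-- The noise increment over the `p`-th cell, for truncated and frozen coefficients. -/
noncomputable def frozenNoise (W : ℕ → ℝ≥0 → Ω → ℝ) (R : ℕ → H →L[ℝ] H) (X : ℝ≥0 → Ω → H)
    (t : ℕ → ℝ≥0) (n p : ℕ) (ω : Ω) : H :=
  ∑ k ∈ Finset.range n, (W k (t (p + 1)) ω - W k (t p) ω) • R k (truncBall n (X (t p) ω))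

theorem isBddAdapted_frozen (h : IsSkewNoiseEquation P 𝓕 T W R b X M) (t : ℕ → ℝ≥0) (q n : ℕ) :
    IsBddAdapted 𝓕 t q n (fun k p ω => R k (truncBall n (X (t p) ω))) where
  meas k _ p _ := (R k).continuous.comp_stronglyMeasurable
    (stronglyMeasurable_truncBall (h.progressive.stronglyAdapted (t p)) n)
  bdd k _ _ _ := ⟨‖R k‖ * n, fun _ => ((R k).le_opNorm _).trans
    (mul_le_mul_of_nonneg_left (norm_truncBall_le n _) (norm_nonneg _))⟩

section Limits

variable {τ : ℝ≥0} {q ns : ℕ → ℕ}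

theorem tendsto_measure_stepError [IsProbabilityMeasure P]
    (h : IsSkewNoiseEquation P 𝓕 T W R b X M) (hτ : τ ≤ T) (hq0 : ∀ n, 0 < q n)
    (he : ∀ᵐ ω ∂P, Tendsto (fun i => stepError R X (uniformGrid τ (q i)) (q i) (ns i) ω)
      atTop (𝓝 0)) {E : Type*} [NormedAddCommGroup E] [InnerProductSpace ℝ E]
    {V : ℕ → ℕ → Ω → H →L[ℝ] E}
    (hV : ∀ i p ω, ‖V i p ω‖ₑ ≤ 1 + ‖truncBall (ns i) (X (uniformGrid τ (q i) p) ω)‖ₑ)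
    {δ : ℝ} (hδ : 0 < δ) :
    Tendsto (fun i => P {ω | ENNReal.ofReal δ ≤ weightedError (fun k s ω => R k (X s ω))
      (truncRows (ns i) fun k p ω => R k (truncBall (ns i) (X (uniformGrid τ (q i) p) ω)))
      (V i) (uniformGrid τ (q i)) (q i) ω}) atTop (𝓝 0) := by
  have h1 := tendsto_measure_ge_of_tendsto_ae (P := P)
    (g := fun i => stepError R X (uniformGrid τ (q i)) (q i) (ns i))
    (fun i => (h.measurable_stepError ((uniformGrid_self τ (hq0 i)).trans_le hτ) _).aemeasurable)
    he (show 0 < ENNReal.ofReal δ by simpa using hδ)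
  refine tendsto_of_tendsto_of_tendsto_of_le_of_le tendsto_const_nhds h1 (fun _ => zero_le)
    fun i => measure_mono fun ω hω => ?_
  exact le_trans (show ENNReal.ofReal δ ≤ _ from hω)
    (weightedError_le_stepError R X (monotone_uniformGrid τ (q i)) (q i) (ns i)
      fun p => hV i p ω)

/-- Lenglart's inequality with identity weights and every cell as a block of its own. -/
theorem tendsto_measure_sum_remainder_sq [IsProbabilityMeasure P]
    (h : IsSkewNoiseEquation P 𝓕 T W R b X M) (hτ : τ ≤ T) (hq0 : ∀ n, 0 < q n)
    (he : ∀ᵐ ω ∂P, Tendsto (fun i => stepError R X (uniformGrid τ (q i)) (q i) (ns i) ω)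
      atTop (𝓝 0)) {lam : ℝ} (hlam : 0 < lam) :
    Tendsto (fun i => P {ω | lam ≤ ∑ p ∈ Finset.range (q i),
      ‖M (uniformGrid τ (q i) (p + 1)) ω - M (uniformGrid τ (q i) p) ω
        - frozenNoise W R X (uniformGrid τ (q i)) (ns i) p ω‖ ^ 2}) atTop (𝓝 0) := by
  have := tendsto_measure_of_weightedError h.approx h.wiener
    (fun k ω => h.aestronglyMeasurable_noise k ω) (fun i => monotone_uniformGrid τ (q i)) (q := q)
    (fun i => (uniformGrid_self τ (hq0 i)).trans_le hτ)
    (fun i => h.isBddAdapted_frozen (uniformGrid τ (q i)) (q i) (ns i))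
    (V := fun _ _ _ => ContinuousLinearMap.id ℝ H) (fun _ _ _ => stronglyMeasurable_const)
    (R := fun _ => 1) (fun _ => zero_le_one)
    (fun _ _ _ _ => ContinuousLinearMap.norm_id_le) (r := fun _ => id) (fun _ => monotone_id)
    (q' := q) (fun _ => le_rfl)
    (fun δ hδ => h.tendsto_measure_stepError hτ hq0 he (fun i p ω => by
      refine le_add_right ?_
      rw [← ofReal_norm, ← ENNReal.ofReal_one]
      exact ENNReal.ofReal_le_ofReal ContinuousLinearMap.norm_id_le) hδ) hlam
  simpa only [id, Nat.Ico_succ_singleton, Finset.sum_singleton, ContinuousLinearMap.id_apply,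
    frozenNoise]
    using this

/-- Lenglart's inequality with the functionals `⟨Y_p, ·⟩` as weights and all cells in one block. The
smallness comes from martingale cancellation between the cells, which a cellwise estimate would
lose. -/
theorem tendsto_measure_sum_inner_remainder [IsProbabilityMeasure P]
    (h : IsSkewNoiseEquation P 𝓕 T W R b X M) (hτ : τ ≤ T) (hq0 : ∀ n, 0 < q n)
    (he : ∀ᵐ ω ∂P, Tendsto (fun i => stepError R X (uniformGrid τ (q i)) (q i) (ns i) ω)
      atTop (𝓝 0)) {lam : ℝ} (hlam : 0 < lam) :
    Tendsto (fun i => P {ω | lam ≤ ‖∑ p ∈ Finset.range (q i),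
      ⟪truncBall (ns i) (X (uniformGrid τ (q i) p) ω),
        M (uniformGrid τ (q i) (p + 1)) ω - M (uniformGrid τ (q i) p) ω
        - frozenNoise W R X (uniformGrid τ (q i)) (ns i) p ω⟫‖ ^ 2}) atTop (𝓝 0) := by
  have := tendsto_measure_of_weightedError h.approx h.wiener
    (fun k ω => h.aestronglyMeasurable_noise k ω) (fun i => monotone_uniformGrid τ (q i)) (q := q)
    (fun i => (uniformGrid_self τ (hq0 i)).trans_le hτ)
    (fun i => h.isBddAdapted_frozen (uniformGrid τ (q i)) (q i) (ns i))
    (V := fun i p ω => innerSL ℝ (truncBall (ns i) (X (uniformGrid τ (q i) p) ω)))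
    (fun i p _ => (innerSL ℝ).continuous.comp_stronglyMeasurable
      (stronglyMeasurable_truncBall (h.progressive.stronglyAdapted _) _))
    (R := fun i => ns i) (fun _ => Nat.cast_nonneg _)
    (fun i p _ ω => by rw [innerSL_apply_norm]; exact norm_truncBall_le _ _)
    -- One block, from the cell `0` to the cell `q i`: the statement then concerns the square of a
    -- single sum.
    (r := fun i p => if p = 0 then 0 else q i) (fun i => by
      refine monotone_nat_of_le_succ fun p => ?_
      split_ifs <;> simp_all)
    (q' := fun _ => 1) (fun _ => by simp)
    (fun δ hδ => h.tendsto_measure_stepError hτ hq0 he (fun i p ω => by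
      refine le_add_left ?_
      rw [← ofReal_norm, innerSL_apply_norm, ofReal_norm]) hδ) hlam
  simpa only [Finset.range_one, Finset.sum_singleton, if_true, zero_add, one_ne_zero, if_false,
    ← Finset.range_eq_Ico, innerSL_apply_apply, frozenNoise] using this

/-- With `n` noises and coefficients whose squares are bounded by a multiple of `n²`, the quadratic
variation estimate is of order `n⁴ · (n²)² / q`, which explains the assumption on `n⁸ / q`. -/
theorem tendsto_measure_quadVar_error [IsProbabilityMeasure P]
    (h : IsSkewNoiseEquation P 𝓕 T W R b X M) (hq0 : ∀ n, 0 < q n)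
    (hq : Tendsto (fun i => (ns i : ℝ) ^ 8 / q i) atTop (𝓝 0)) {lam : ℝ} (hlam : 0 < lam) :
    Tendsto (fun i => P {ω | lam ≤ |∑ p ∈ Finset.range (q i),
      (‖frozenNoise W R X (uniformGrid τ (q i)) (ns i) p ω‖ ^ 2
        - (uniformGrid τ (q i) (p + 1) - uniformGrid τ (q i) p) * ∑ k ∈ Finset.range (ns i),
          ‖R k (truncBall (ns i) (X (uniformGrid τ (q i) p) ω))‖ ^ 2)|}) atTop (𝓝 0) := by
  set Rs := ∑' k, ‖R k‖ ^ 2 with hRs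
  have hRs0 : 0 ≤ Rs := tsum_nonneg fun k => sq_nonneg _
  have hC : ∀ i k, k < ns i → ∀ p < q i, ∀ ω,
      ‖R k (truncBall (ns i) (X (uniformGrid τ (q i) p) ω))‖ ^ 2 ≤ Rs * (ns i : ℝ) ^ 2 := by
    intro i k _ p _ ω
    refine (norm_apply_sq_le R k _).trans ?_
    gcongr
    · exact h.summable.le_tsum k fun j _ => sq_nonneg _
    · exact norm_truncBall_le _ _
  have hbound : ∀ i, P {ω | lam ≤ |∑ p ∈ Finset.range (q i),
      (‖frozenNoise W R X (uniformGrid τ (q i)) (ns i) p ω‖ ^ 2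
        - (uniformGrid τ (q i) (p + 1) - uniformGrid τ (q i) p) * ∑ k ∈ Finset.range (ns i),
          ‖R k (truncBall (ns i) (X (uniformGrid τ (q i) p) ω))‖ ^ 2)|}
      ≤ ENNReal.ofReal ((Rs ^ 2 * (2 * fourthMoment + 2) * (τ * τ) / lam ^ 2)
        * ((ns i : ℝ) ^ 8 / q i)) := by
    intro i
    refine ((h.isBddAdapted_frozen (uniformGrid τ (q i)) (q i) (ns i)).measure_quadVar_error_le
      h.wiener (monotone_uniformGrid τ (q i)) (hC i) (fun p _ => uniformGrid_succ_sub_le τ (q i) p)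
      hlam).trans (le_of_eq ?_)
    rw [uniformGrid_self τ (hq0 i), uniformGrid_zero]
    congr 1
    push_cast
    ring
  have hlim := ENNReal.tendsto_ofReal
    (hq.const_mul (Rs ^ 2 * (2 * fourthMoment + 2) * (τ * τ) / lam ^ 2))
  rw [mul_zero, ENNReal.ofReal_zero] at hlim
  exact tendsto_of_tendsto_of_tendsto_of_le_of_le tendsto_const_nhds hlim (fun _ => zero_le) hbound

end Limits

end IsSkewNoiseEquation

end SLLB

/-! ### The energy inequality. -/

namespace SLLB

namespace IsSkewNoiseEquation

variable {Ω : Type*} [mΩ : MeasurableSpace Ω] {P : Measure Ω} {𝓕 : Filtration ℝ≥0 mΩ}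
  {W : ℕ → ℝ≥0 → Ω → ℝ} {H : Type*} [NormedAddCommGroup H] [InnerProductSpace ℝ H]
  {T : ℝ≥0} {R : ℕ → H →L[ℝ] H} {b X M : ℝ≥0 → Ω → H}

theorem inner_frozenNoise (h : IsSkewNoiseEquation P 𝓕 T W R b X M) (t : ℕ → ℝ≥0) (n p : ℕ)
    (ω : Ω) : ⟪truncBall n (X (t p) ω), frozenNoise W R X t n p ω⟫ = 0 := by
  unfold frozenNoise
  rw [inner_sum]
  refine Finset.sum_eq_zero fun k _ => ?_
  rw [inner_smul_right, h.skew, mul_zero]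

/-- On a path whose grid values do not exceed the truncation level, the truncation is invisible, so
the frozen noise is orthogonal to the left value and the telescoping estimate applies. The drift and
noise sums are rewritten as time integrals of the step process, ready for the passage to the limit.
-/
theorem norm_sq_le_of_grid [CompleteSpace H] (h : IsSkewNoiseEquation P 𝓕 T W R b X M) {τ : ℝ≥0} (hτ : τ ≤ T)
    {q n : ℕ} (hq0 : 0 < q) {ω : Ω} (hX0 : X 0 ω = 0)
    (hb : IntegrableOn (fun s => b s ω) (Set.Icc 0 T) leb)
    (heq : ∀ p, X (uniformGrid τ q p) ω
      = ∫ s in Set.Icc 0 (uniformGrid τ q p), b s ω ∂leb + M (uniformGrid τ q p) ω)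
    (hn : ∀ p, ‖X (uniformGrid τ q p) ω‖ ≤ n) {c : ℝ} (hc : 0 < c) :
    ‖X τ ω‖ ^ 2 ≤ 2 * ∫ s in Set.Ioc 0 τ, ⟪truncStep X (uniformGrid τ q) q n s ω, b s ω⟫ ∂leb
      + 2 * ‖∑ p ∈ Finset.range q, ⟪truncBall n (X (uniformGrid τ q p) ω),
        M (uniformGrid τ q (p + 1)) ω - M (uniformGrid τ q p) ω
        - frozenNoise W R X (uniformGrid τ q) n p ω⟫‖
      + (1 + c) * (∫ s in Set.Ioc 0 τ, ∑' k, ‖R k (truncStep X (uniformGrid τ q) q n s ω)‖ ^ 2 ∂leb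
        + |∑ p ∈ Finset.range q, (‖frozenNoise W R X (uniformGrid τ q) n p ω‖ ^ 2
        - (uniformGrid τ q (p + 1) - uniformGrid τ q p) * ∑ k ∈ Finset.range n,
          ‖R k (truncBall n (X (uniformGrid τ q p) ω))‖ ^ 2)|)
      + (1 + 1 / c) * (2 * ∑ p ∈ Finset.range q,
          ‖∫ s in Set.Ioc (uniformGrid τ q p) (uniformGrid τ q (p + 1)), b s ω ∂leb‖ ^ 2
        + 2 * ∑ p ∈ Finset.range q, ‖M (uniformGrid τ q (p + 1)) ω - M (uniformGrid τ q p) ω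
          - frozenNoise W R X (uniformGrid τ q) n p ω‖ ^ 2) := by
  set t := uniformGrid τ q with ht
  have htm : Monotone t := monotone_uniformGrid τ q
  have htτ : ∀ p, t p ≤ τ := uniformGrid_le τ hq0
  have hsub : ∀ p, Set.Ioc (t p) (t (p + 1)) ⊆ Set.Ioc 0 τ := fun p =>
    Set.Ioc_subset_Ioc zero_le (htτ _)
  have hsubT : Set.Ioc 0 τ ⊆ Set.Icc 0 T := fun s hs => ⟨zero_le, hs.2.trans hτ⟩
  have hbτ : IntegrableOn (fun s => b s ω) (Set.Ioc 0 τ) leb := hb.mono_set hsubT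
  have hhat : ∀ p, truncBall n (X (t p) ω) = X (t p) ω := fun p => truncBall_of_le (hn p)
  have key := norm_sq_le_of_increments (q := q) (x := fun p => X (t p) ω)
    (A := fun p => ∫ s in Set.Ioc (t p) (t (p + 1)), b s ω ∂leb)
    (S := fun p => frozenNoise W R X t n p ω)
    (Z := fun p => M (t (p + 1)) ω - M (t p) ω - frozenNoise W R X t n p ω)
    (by simp only [ht, uniformGrid_zero, hX0])
    (fun p _ => by
      rw [← setIntegral_Icc_sub (htm (Nat.le_succ p)) ((htτ _).trans hτ) hb]
      rw [heq, heq]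
      abel)
    (fun p _ => by
      have := h.inner_frozenNoise t n p ω
      rwa [hhat] at this) hc
  have hq : t q = τ := uniformGrid_self τ hq0
  have ht0 : t 0 = 0 := uniformGrid_zero τ q
  rw [hq] at key
  have hYm := (h.stronglyMeasurable_truncStep_path t q n ω).aestronglyMeasurable
    (μ := leb.restrict (Set.Ioc 0 τ))
  have hYb : ∀ s ∈ Set.Ioc 0 τ, ‖truncStep X t q n s ω‖ ≤ n := fun s hs =>
    norm_truncStep_le htm hn (by rwa [ht0, hq]) n
  have hdrift : ∑ p ∈ Finset.range q, ⟪X (t p) ω, ∫ s in Set.Ioc (t p) (t (p + 1)), b s ω ∂leb⟫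
      = ∫ s in Set.Ioc 0 τ, ⟪truncStep X t q n s ω, b s ω⟫ ∂leb := by
    have hint : IntegrableOn (fun s => ⟪truncStep X t q n s ω, b s ω⟫) (Set.Ioc (t 0) (t q)) leb := by
      rw [ht0, hq]
      refine (hbτ.norm.const_mul (n : ℝ)).mono' (hYm.inner hbτ.aestronglyMeasurable) ?_
      filter_upwards [ae_restrict_mem measurableSet_Ioc] with s hs
      refine (norm_inner_le_norm _ _).trans ?_
      gcongr
      exact hYb s hs
    rw [← ht0, ← hq, ← setIntegral_Ioc_sum htm (Nat.zero_le q) hint, Finset.range_eq_Ico]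
    refine Finset.sum_congr rfl fun p hp => ?_
    rw [← integral_inner (hbτ.mono_set (hsub p))]
    refine setIntegral_congr_fun measurableSet_Ioc fun s hs => ?_
    rw [truncStep_of_mem htm (Finset.mem_Ico.1 hp).2 hs, hhat]
  have hnoise : ∑ p ∈ Finset.range q, (t (p + 1) - t p : ℝ) * ∑ k ∈ Finset.range n,
          ‖R k (truncBall n (X (t p) ω))‖ ^ 2
      ≤ ∫ s in Set.Ioc 0 τ, ∑' k, ‖R k (truncStep X t q n s ω)‖ ^ 2 ∂leb := by
    have hint : IntegrableOn (fun s => ∑' k, ‖R k (truncStep X t q n s ω)‖ ^ 2)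
        (Set.Ioc (t 0) (t q)) leb := by
      rw [ht0, hq]
      refine (integrable_const ((∑' k, ‖R k‖ ^ 2) * (n : ℝ) ^ 2)).mono'
        ((continuous_tsum_norm_apply_sq h.summable).comp_aestronglyMeasurable hYm) ?_
      filter_upwards [ae_restrict_mem measurableSet_Ioc] with s hs
      rw [Real.norm_of_nonneg (tsum_nonneg fun k => sq_nonneg _)]
      refine (tsum_norm_apply_sq_le h.summable _).trans ?_
      have := hYb s hs
      have h0 : 0 ≤ ∑' k, ‖R k‖ ^ 2 := tsum_nonneg fun k => sq_nonneg _
      gcongr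
    rw [← ht0, ← hq, ← setIntegral_Ioc_sum htm (Nat.zero_le q) hint, Finset.range_eq_Ico]
    refine Finset.sum_le_sum fun p hp => ?_
    have e : ∫ s in Set.Ioc (t p) (t (p + 1)), ∑' k, ‖R k (truncStep X t q n s ω)‖ ^ 2 ∂leb
        = (t (p + 1) - t p) * ∑' k, ‖R k (truncBall n (X (t p) ω))‖ ^ 2 := by
      rw [setIntegral_congr_fun (g := fun _ => ∑' k, ‖R k (truncBall n (X (t p) ω))‖ ^ 2)
        measurableSet_Ioc fun s hs => by
          dsimp only
          rw [truncStep_of_mem htm (Finset.mem_Ico.1 hp).2 hs]]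
      rw [setIntegral_const, smul_eq_mul, measureReal_def, leb_Ioc, ENNReal.toReal_ofReal]
      exact sub_nonneg.2 (htm (Nat.le_succ p))
    rw [e]
    refine mul_le_mul_of_nonneg_left ?_ (sub_nonneg.2 (htm (Nat.le_succ p)))
    exact (summable_norm_apply_sq h.summable _).sum_le_tsum _ fun k _ => sq_nonneg _
  have hS : ∑ p ∈ Finset.range q, ‖frozenNoise W R X t n p ω‖ ^ 2
      ≤ ∫ s in Set.Ioc 0 τ, ∑' k, ‖R k (truncStep X t q n s ω)‖ ^ 2 ∂leb
        + |∑ p ∈ Finset.range q, (‖frozenNoise W R X t n p ω‖ ^ 2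
        - (t (p + 1) - t p) * ∑ k ∈ Finset.range n, ‖R k (truncBall n (X (t p) ω))‖ ^ 2)| := by
    have h1 := le_abs_self (∑ p ∈ Finset.range q, (‖frozenNoise W R X t n p ω‖ ^ 2
        - (t (p + 1) - t p : ℝ) * ∑ k ∈ Finset.range n, ‖R k (truncBall n (X (t p) ω))‖ ^ 2))
    have h2 : ∑ p ∈ Finset.range q, (‖frozenNoise W R X t n p ω‖ ^ 2
        - (t (p + 1) - t p : ℝ) * ∑ k ∈ Finset.range n, ‖R k (truncBall n (X (t p) ω))‖ ^ 2)
        = ∑ p ∈ Finset.range q, ‖frozenNoise W R X t n p ω‖ ^ 2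
          - ∑ p ∈ Finset.range q, (t (p + 1) - t p : ℝ) * ∑ k ∈ Finset.range n,
            ‖R k (truncBall n (X (t p) ω))‖ ^ 2 := Finset.sum_sub_distrib ..
    linarith
  have hZ : ∑ p ∈ Finset.range q, ⟪X (t p) ω, M (t (p + 1)) ω - M (t p) ω
      - frozenNoise W R X t n p ω⟫
      ≤ ‖∑ p ∈ Finset.range q, ⟪truncBall n (X (t p) ω), M (t (p + 1)) ω - M (t p) ω
        - frozenNoise W R X t n p ω⟫‖ := by
    simp_rw [hhat]
    exact Real.le_norm_self _
  rw [hdrift] at key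
  have h1c : 0 < 1 + c := by linarith
  have := mul_le_mul_of_nonneg_left hS h1c.le
  linarith

end IsSkewNoiseEquation

end SLLB

namespace SLLB

theorem le_add_of_forall_pos {x a b : ℝ} (h : ∀ c : ℝ, 0 < c → x ≤ a + (1 + c) * b) :
    x ≤ a + b := by
  refine le_of_forall_pos_le_add fun ε hε => ?_
  have hb : 0 < |b| + 1 := by positivity
  have h1 := h (ε / (|b| + 1)) (by positivity)
  have h2 : ε / (|b| + 1) * b ≤ ε := by
    rw [div_mul_eq_mul_div, div_le_iff₀ hb]
    nlinarith [le_abs_self b]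
  nlinarith

namespace IsSkewNoiseEquation

variable {Ω : Type*} [mΩ : MeasurableSpace Ω] {P : Measure Ω} {𝓕 : Filtration ℝ≥0 mΩ}
  {W : ℕ → ℝ≥0 → Ω → ℝ} {H : Type*} [NormedAddCommGroup H] [InnerProductSpace ℝ H]
  {T : ℝ≥0} {R : ℕ → H →L[ℝ] H} {b X M : ℝ≥0 → Ω → H}

theorem tendsto_setIntegral_inner_truncStep (h : IsSkewNoiseEquation P 𝓕 T W R b X M) {τ : ℝ≥0}
    {q ns : ℕ → ℕ} (hq0 : ∀ n, 0 < q n) {ω : Ω} {C : ℝ}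
    (hb : IntegrableOn (fun s => b s ω) (Set.Ioc 0 τ) leb)
    (hC : ∀ i p, ‖X (uniformGrid τ (q i) p) ω‖ ≤ C)
    (hlim : ∀ᵐ s ∂(leb.restrict (Set.Ioc 0 τ)),
      Tendsto (fun i => truncStep X (uniformGrid τ (q i)) (q i) (ns i) s ω) atTop (𝓝 (X s ω))) :
    Tendsto (fun i => ∫ s in Set.Ioc 0 τ,
      ⟪truncStep X (uniformGrid τ (q i)) (q i) (ns i) s ω, b s ω⟫ ∂leb) atTop
      (𝓝 (∫ s in Set.Ioc 0 τ, ⟪X s ω, b s ω⟫ ∂leb)) := by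
  refine tendsto_integral_of_dominated_convergence (fun s => C * ‖b s ω‖) (fun i =>
    (h.stronglyMeasurable_truncStep_path _ _ _ ω).aestronglyMeasurable.inner
      hb.aestronglyMeasurable) (hb.norm.const_mul C) (fun i => ?_) ?_
  · filter_upwards [ae_restrict_mem measurableSet_Ioc] with s hs
    refine (norm_inner_le_norm _ _).trans ?_
    gcongr
    exact norm_truncStep_le (monotone_uniformGrid τ (q i)) (hC i)
      (by rwa [uniformGrid_zero, uniformGrid_self τ (hq0 i)]) _
  · filter_upwards [hlim] with s hs
    exact hs.inner tendsto_const_nhds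

theorem tendsto_setIntegral_tsum_truncStep (h : IsSkewNoiseEquation P 𝓕 T W R b X M) {τ : ℝ≥0}
    {q ns : ℕ → ℕ} (hq0 : ∀ n, 0 < q n) {ω : Ω} {C : ℝ}
    (hC : ∀ i p, ‖X (uniformGrid τ (q i) p) ω‖ ≤ C)
    (hlim : ∀ᵐ s ∂(leb.restrict (Set.Ioc 0 τ)),
      Tendsto (fun i => truncStep X (uniformGrid τ (q i)) (q i) (ns i) s ω) atTop (𝓝 (X s ω))) :
    Tendsto (fun i => ∫ s in Set.Ioc 0 τ,
      ∑' k, ‖R k (truncStep X (uniformGrid τ (q i)) (q i) (ns i) s ω)‖ ^ 2 ∂leb) atTop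
      (𝓝 (∫ s in Set.Ioc 0 τ, ∑' k, ‖R k (X s ω)‖ ^ 2 ∂leb)) := by
  refine tendsto_integral_of_dominated_convergence (fun s => (∑' k, ‖R k‖ ^ 2) * C ^ 2) (fun i =>
    (continuous_tsum_norm_apply_sq h.summable).comp_aestronglyMeasurable
    (h.stronglyMeasurable_truncStep_path _ _ _ ω).aestronglyMeasurable)
    (integrable_const _) (fun i => ?_) ?_
  · filter_upwards [ae_restrict_mem measurableSet_Ioc] with s hs
    rw [Real.norm_of_nonneg (tsum_nonneg fun k => sq_nonneg _)]
    refine (tsum_norm_apply_sq_le h.summable _).trans ?_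
    have h0 : 0 ≤ ∑' k, ‖R k‖ ^ 2 := tsum_nonneg fun k => sq_nonneg _
    gcongr
    exact norm_truncStep_le (monotone_uniformGrid τ (q i)) (hC i)
      (by rwa [uniformGrid_zero, uniformGrid_self τ (hq0 i)]) _
  · filter_upwards [hlim] with s hs
    exact ((continuous_tsum_norm_apply_sq h.summable).tendsto _).comp hs

/-- The energy inequality: the Itô correction of the squared norm. -/
theorem norm_sq_le [IsProbabilityMeasure P] [CompleteSpace H]
    (h : IsSkewNoiseEquation P 𝓕 T W R b X M) {τ : ℝ≥0} (hτ : τ ≤ T) :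
    ∀ᵐ ω ∂P, ‖X τ ω‖ ^ 2 ≤ 2 * ∫ s in Set.Ioc 0 τ, ⟪X s ω, b s ω⟫ ∂leb
      + ∫ s in Set.Ioc 0 τ, ∑' k, ‖R k (X s ω)‖ ^ 2 ∂leb := by
  -- The number of cells is coupled to the truncation level `n`: the exponent nine beats the `n⁸` of
  -- the quadratic variation error.
  have hN : Tendsto (fun n : ℕ => (n + 1) ^ 9) atTop atTop :=
    tendsto_atTop_mono (fun n => by
      calc n ≤ n + 1 := n.le_succ
        _ = (n + 1) ^ 1 := (pow_one _).symm
        _ ≤ (n + 1) ^ 9 := Nat.pow_le_pow_right (by omega) (by omega)) tendsto_id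
  obtain ⟨ns, hns, hlim⟩ := h.exists_subseq_tendsto_truncStep hτ
    (q := fun n => (n + 1) ^ 9) (fun n => by positivity) hN
  set q : ℕ → ℕ := fun i => (ns i + 1) ^ 9 with hqdef
  have hq0 : ∀ i, 0 < q i := fun i => by positivity
  have hq : Tendsto q atTop atTop := hN.comp hns.tendsto_atTop
  have hgT : ∀ i p, uniformGrid τ (q i) p ≤ T := fun i p => (uniformGrid_le τ (hq0 i) p).trans hτ
  have hbd : ∀ᵐ ω ∂P, ∃ C : ℕ, (∀ i p, ‖X (uniformGrid τ (q i) p) ω‖ ≤ C) ∧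
      ∀ᵐ s ∂(leb.restrict (Set.Ioc 0 τ)), ‖X s ω‖ ≤ C := by
    filter_upwards [h.bdd, ae_all_iff.2 fun i => ae_all_iff.2 fun p =>
      h.norm_le_of_ae_le (hgT i p)] with ω ⟨C, hC⟩ hω
    have hC' : ∀ᵐ s ∂(leb.restrict (Set.Icc 0 T)), ‖X s ω‖ ≤ ⌈C⌉₊ := by
      filter_upwards [hC] with s hs
      exact hs.trans (Nat.le_ceil C)
    exact ⟨⌈C⌉₊, fun i p => hω i p _ hC', ae_restrict_of_ae_restrict_of_subset
      (show Set.Ioc 0 τ ⊆ Set.Icc 0 T from fun s hs => ⟨zero_le, hs.2.trans hτ⟩) hC'⟩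
  have he : ∀ᵐ ω ∂P, Tendsto (fun i => stepError R X (uniformGrid τ (q i)) (q i) (ns i) ω)
      atTop (𝓝 0) := by
    filter_upwards [hbd, hlim] with ω ⟨C, hC, hC'⟩ hω
    exact h.tendsto_stepError hτ hq0 hns.tendsto_atTop hC hC' hω
  have hqv : Tendsto (fun i => (ns i : ℝ) ^ 8 / q i) atTop (𝓝 0) := by
    have h1 : Tendsto (fun i => (1 : ℝ) / (ns i + 1)) atTop (𝓝 0) :=
      tendsto_one_div_add_atTop_nhds_zero_nat.comp hns.tendsto_atTop
    refine tendsto_of_tendsto_of_tendsto_of_le_of_le tendsto_const_nhds h1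
      (fun i => by positivity) fun i => ?_
    simp only [hqdef]
    push_cast
    rw [div_le_div_iff₀ (by positivity) (by positivity), one_mul]
    calc (ns i : ℝ) ^ 8 * (ns i + 1) ≤ (ns i + 1 : ℝ) ^ 8 * (ns i + 1) := by gcongr; linarith
      _ = (ns i + 1 : ℝ) ^ 9 := by ring
  have hm1 := tendstoInMeasure_zero_of_nonneg (fun i ω => Finset.sum_nonneg fun p _ => sq_nonneg _)
    fun lam hlam => h.tendsto_measure_sum_remainder_sq hτ hq0 he hlam
  have hm2 := tendstoInMeasure_zero_of_nonneg (fun i ω => sq_nonneg _)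
    fun lam hlam => h.tendsto_measure_sum_inner_remainder hτ hq0 he hlam
  have hm3 := tendstoInMeasure_zero_of_nonneg (fun i ω => abs_nonneg _)
    fun lam hlam => h.tendsto_measure_quadVar_error (τ := τ) hq0 hqv hlam
  -- The three remainders vanish only in probability. Nested subsequences make all of them vanish
  -- almost surely along the same indices.
  obtain ⟨j1, hj1, hl1⟩ := hm1.exists_seq_tendsto_ae
  obtain ⟨j2, hj2, hl2⟩ := (hm2.comp hj1.tendsto_atTop).exists_seq_tendsto_ae
  obtain ⟨j3, hj3, hl3⟩ := (hm3.comp (hj1.comp hj2).tendsto_atTop).exists_seq_tendsto_ae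
  set j : ℕ → ℕ := (j1 ∘ j2) ∘ j3 with hj
  have hjt : Tendsto j atTop atTop := ((hj1.comp hj2).comp hj3).tendsto_atTop
  filter_upwards [hbd, hlim, hl1, hl2, hl3, h.init, h.drift,
    ae_all_iff.2 fun i => ae_all_iff.2 fun p => h.eq _ (hgT i p)] with
    ω ⟨C, hC, hC'⟩ hω hω1 hω2 hω3 hX0 hdrift heq
  have hω1' := hω1.comp (hj2.comp hj3).tendsto_atTop
  have hω2' := hω2.comp hj3.tendsto_atTop
  have hbτ : IntegrableOn (fun s => b s ω) (Set.Ioc 0 τ) leb :=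
    hdrift.mono_set fun s hs => ⟨zero_le, hs.2.trans hτ⟩
  -- First the grid is refined for fixed `c`, which eliminates the terms with the factor `1 + 1 /
  -- c`. Only afterwards does `c` tend to zero.
  refine le_add_of_forall_pos fun c hc => ?_
  have l1 := (h.tendsto_setIntegral_inner_truncStep hq0 hbτ hC hω).comp hjt
  have l2 := (h.tendsto_setIntegral_tsum_truncStep hq0 hC hω).comp hjt
  have l3 := (tendsto_sum_norm_setIntegral_sq hbτ hq0 hq).comp hjt
  have l4 := hω2'.sqrt
  simp only [Function.comp_def, Real.sqrt_zero, Real.sqrt_sq (norm_nonneg _)] at l4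
  have lim := (((l1.const_mul 2).add (l4.const_mul 2)).add ((l2.add hω3).const_mul (1 + c))).add
    (((l3.const_mul 2).add (hω1'.const_mul 2)).const_mul (1 + 1 / c))
  simp only [mul_zero, add_zero] at lim
  refine ge_of_tendsto lim ?_
  -- Once the truncation level exceeds the bound of the path, the inequality on the grid is
  -- available.
  filter_upwards [(hns.tendsto_atTop.comp hjt).eventually_ge_atTop C] with i hi
  have hi' : (C : ℝ) ≤ ns (j i) := by exact_mod_cast hi
  exact h.norm_sq_le_of_grid hτ (hq0 (j i)) hX0 hdrift (heq (j i))
    (fun p => (hC (j i) p).trans hi') hc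

end IsSkewNoiseEquation

end SLLB

/-! ### Gronwall's argument and vanishing of the solution. -/

namespace SLLB

/-- A Gronwall argument for inequalities that hold almost everywhere. -/
theorem setIntegral_mul_eq_zero_of_le {T : ℝ≥0} {g y : ℝ≥0 → ℝ} (hg0 : ∀ s, 0 ≤ g s)
    (hg : IntegrableOn g (Set.Ioc 0 T) leb) (hy0 : ∀ s, 0 ≤ y s)
    (hgy : IntegrableOn (fun s => g s * y s) (Set.Ioc 0 T) leb)
    (h : ∀ᵐ s ∂(leb.restrict (Set.Ioc 0 T)), y s ≤ ∫ r in Set.Ioc 0 s, g r * y r ∂leb) :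
    ∫ s in Set.Ioc 0 T, g s * y s ∂leb = 0 := by
  -- Used to find a partition such that the integral of `g` over every cell is smaller than one.
  have hlim := tendsto_sum_norm_setIntegral_sq hg (q := fun n => n + 1) (fun n => n.succ_pos)
    (tendsto_add_atTop_nat 1)
  obtain ⟨n, hn⟩ := (hlim.eventually_lt_const one_pos).exists
  set t := uniformGrid T (n + 1) with ht
  have htm : Monotone t := monotone_uniformGrid T (n + 1)
  have htT : ∀ p, t p ≤ T := uniformGrid_le T n.succ_pos
  have hpos : ∀ r, 0 ≤ g r * y r := fun r => mul_nonneg (hg0 r) (hy0 r)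
  set Y : ℝ≥0 → ℝ := fun s => ∫ r in Set.Ioc 0 s, g r * y r ∂leb with hY
  have hYmono : ∀ s s', s ≤ s' → s' ≤ T → Y s ≤ Y s' := fun s s' hs hs' =>
    setIntegral_mono_set (hgy.mono_set (Set.Ioc_subset_Ioc_right hs'))
      (Eventually.of_forall hpos) (Set.Ioc_subset_Ioc_right hs).eventuallyLE
  have hY0 : ∀ s, 0 ≤ Y s := fun s => integral_nonneg hpos
  have key : ∀ p ≤ n + 1, Y (t p) = 0 := by
    intro p
    induction p with
    | zero => simp [hY, ht, uniformGrid_zero]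
    | succ p ih =>
      intro hp
      have ih := ih (by omega)
      have hsub : Set.Ioc (t p) (t (p + 1)) ⊆ Set.Ioc 0 T := Set.Ioc_subset_Ioc zero_le (htT _)
      have hsplit : Y (t (p + 1)) = Y (t p) + ∫ r in Set.Ioc (t p) (t (p + 1)), g r * y r ∂leb := by
        rw [hY]
        dsimp only
        rw [← setIntegral_union, Set.Ioc_union_Ioc_eq_Ioc zero_le (htm p.le_succ)]
        · exact Set.disjoint_left.2 fun x hx hx' => absurd hx.2 (not_le.2 hx'.1)
        · exact measurableSet_Ioc
        · exact hgy.mono_set (Set.Ioc_subset_Ioc_right (htT p))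
        · exact hgy.mono_set hsub
      have hI : ∫ r in Set.Ioc (t p) (t (p + 1)), g r ∂leb < 1 := by
        have h1 : ‖∫ r in Set.Ioc (t p) (t (p + 1)), g r ∂leb‖ ^ 2 < 1 :=
          (Finset.single_le_sum (f := fun p => ‖∫ r in Set.Ioc (t p) (t (p + 1)), g r ∂leb‖ ^ 2)
            (fun p _ => sq_nonneg _) (Finset.mem_range.2 (by omega))).trans_lt hn
        have h2 := (sq_lt_one_iff₀ (norm_nonneg _)).1 h1
        exact (Real.le_norm_self _).trans_lt h2
      -- On the cell `y ≤ Y(s) ≤ Y(t_{p+1})`. As `Y(t_p) = 0`, this gives `Y(t_{p+1}) ≤ θ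
      -- Y(t_{p+1})` with `θ < 1`.
      have hle : ∫ r in Set.Ioc (t p) (t (p + 1)), g r * y r ∂leb
          ≤ (∫ r in Set.Ioc (t p) (t (p + 1)), g r ∂leb) * Y (t (p + 1)) := by
        rw [← integral_mul_const]
        refine integral_mono_ae (hgy.mono_set hsub) ((hg.mono_set hsub).mul_const _) ?_
        filter_upwards [ae_restrict_of_ae_restrict_of_subset hsub h,
          ae_restrict_mem measurableSet_Ioc] with s hs hs2
        exact mul_le_mul_of_nonneg_left (hs.trans (hYmono s _ hs2.2 (htT _))) (hg0 s)
      have h0 := hY0 (t (p + 1))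
      have hI0 : 0 ≤ ∫ r in Set.Ioc (t p) (t (p + 1)), g r ∂leb := integral_nonneg hg0
      nlinarith
  have := key (n + 1) le_rfl
  rwa [ht, uniformGrid_self T n.succ_pos] at this

theorem tendsto_setIntegral_Ioc {E : Type*} [NormedAddCommGroup E] [NormedSpace ℝ E]
    {T : ℝ≥0} {f : ℝ≥0 → E} (hf : IntegrableOn f (Set.Icc 0 T) leb) {u : ℕ → ℝ≥0}
    (hu : ∀ m, u m ≤ T) {s : ℝ≥0} (hs : s ≤ T) (hus : Tendsto u atTop (𝓝 s)) :
    Tendsto (fun m => ∫ r in Set.Ioc 0 (u m), f r ∂leb) atTop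
      (𝓝 (∫ r in Set.Ioc 0 s, f r ∂leb)) := by
  simpa only [integral_Icc_eq_integral_Ioc] using tendsto_setIntegral_Icc hf hu hs hus

namespace IsSkewNoiseEquation

variable {Ω : Type*} [mΩ : MeasurableSpace Ω] {P : Measure Ω} {𝓕 : Filtration ℝ≥0 mΩ}
  {W : ℕ → ℝ≥0 → Ω → ℝ} {H : Type*} [NormedAddCommGroup H] [InnerProductSpace ℝ H]
  {T : ℝ≥0} {R : ℕ → H →L[ℝ] H} {b X M : ℝ≥0 → Ω → H}

/-- If the energy production is controlled by an integrable multiple of the squared norm, then the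
solution vanishes. -/
theorem eq_zero [IsProbabilityMeasure P] [CompleteSpace H]
    (h : IsSkewNoiseEquation P 𝓕 T W R b X M)
    (hg : ∀ᵐ ω ∂P, ∃ g : ℝ≥0 → ℝ, (∀ s, 0 ≤ g s) ∧ IntegrableOn g (Set.Icc 0 T) leb ∧
      ∀ᵐ s ∂(leb.restrict (Set.Icc 0 T)),
        2 * ⟪X s ω, b s ω⟫ + ∑' k, ‖R k (X s ω)‖ ^ 2 ≤ g s * ‖X s ω‖ ^ 2) :
    (∀ᵐ ω ∂P, ∀ᵐ s ∂(leb.restrict (Set.Icc 0 T)), X s ω = 0) ∧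
      ∀ t ≤ T, ∀ᵐ ω ∂P, X t ω = 0 := by
  have hsub : Set.Ioc 0 T ⊆ Set.Icc 0 T := Set.Ioc_subset_Icc_self
  -- the integrated inequality at fixed times
  have henergy : ∀ᵐ ω ∂P, ∃ g : ℝ≥0 → ℝ, (∀ s, 0 ≤ g s) ∧ IntegrableOn g (Set.Icc 0 T) leb ∧
      IntegrableOn (fun s => g s * ‖X s ω‖ ^ 2) (Set.Icc 0 T) leb ∧
      ∀ t ≤ T, ‖X t ω‖ ^ 2 ≤ 2 * ∫ s in Set.Ioc 0 t, ⟪X s ω, b s ω⟫ ∂leb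
        + ∫ s in Set.Ioc 0 t, ∑' k, ‖R k (X s ω)‖ ^ 2 ∂leb →
        ‖X t ω‖ ^ 2 ≤ ∫ s in Set.Ioc 0 t, g s * ‖X s ω‖ ^ 2 ∂leb := by
    filter_upwards [hg, h.bdd, h.drift] with ω ⟨g, hg0, hgi, hgle⟩ ⟨C, hC⟩ hb
    have hXm := h.aestronglyMeasurable_path ω
    have hgX : IntegrableOn (fun s => g s * ‖X s ω‖ ^ 2) (Set.Icc 0 T) leb := by
      refine (hgi.mul_const (C ^ 2)).mono' (hgi.aestronglyMeasurable.mul (hXm.norm.pow 2)) ?_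
      filter_upwards [hC] with s hs
      rw [Real.norm_of_nonneg (mul_nonneg (hg0 s) (sq_nonneg _))]
      exact mul_le_mul_of_nonneg_left (by gcongr) (hg0 s)
    have hi1 : IntegrableOn (fun s => ⟪X s ω, b s ω⟫) (Set.Icc 0 T) leb := by
      refine (hb.norm.const_mul C).mono' (hXm.inner hb.aestronglyMeasurable) ?_
      filter_upwards [hC] with s hs
      refine (norm_inner_le_norm _ _).trans ?_
      gcongr
    have hi2 : IntegrableOn (fun s => ∑' k, ‖R k (X s ω)‖ ^ 2) (Set.Icc 0 T) leb := by
      refine (integrable_const ((∑' k, ‖R k‖ ^ 2) * C ^ 2)).mono'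
        ((continuous_tsum_norm_apply_sq h.summable).comp_aestronglyMeasurable hXm) ?_
      filter_upwards [hC] with s hs
      rw [Real.norm_of_nonneg (tsum_nonneg fun k => sq_nonneg _)]
      refine (tsum_norm_apply_sq_le h.summable _).trans ?_
      have h0 : 0 ≤ ∑' k, ‖R k‖ ^ 2 := tsum_nonneg fun k => sq_nonneg _
      gcongr
    refine ⟨g, hg0, hgi, hgX, fun t ht hle => hle.trans ?_⟩
    have hst : Set.Ioc 0 t ⊆ Set.Icc 0 T := fun s hs => ⟨zero_le, hs.2.trans ht⟩
    rw [← integral_const_mul, ← integral_add ((hi1.mono_set hst).const_mul 2) (hi2.mono_set hst)]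
    refine integral_mono_ae (((hi1.mono_set hst).const_mul 2).add (hi2.mono_set hst))
      (hgX.mono_set hst) (ae_restrict_of_ae_restrict_of_subset hst hgle)
  -- The energy inequality holds almost surely at each fixed time, so simultaneously at the
  -- countably many grid points. The converging step processes extend it to almost every time of a
  -- fixed path.
  obtain ⟨ns, hns, hlim⟩ := h.exists_subseq_tendsto_truncStep le_rfl (q := fun n => n + 1)
    (fun n => n.succ_pos) (tendsto_add_atTop_nat 1)
  set q : ℕ → ℕ := fun i => ns i + 1 with hqdef
  have hq0 : ∀ i, 0 < q i := fun i => Nat.succ_pos _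
  have hgT : ∀ i p, uniformGrid T (q i) p ≤ T := fun i p => uniformGrid_le T (hq0 i) p
  have hzero : ∀ᵐ ω ∂P, ∃ g : ℝ≥0 → ℝ, (∀ s, 0 ≤ g s) ∧
      IntegrableOn (fun s => g s * ‖X s ω‖ ^ 2) (Set.Icc 0 T) leb ∧
      ∫ s in Set.Ioc 0 T, g s * ‖X s ω‖ ^ 2 ∂leb = 0 ∧
      (∀ᵐ s ∂(leb.restrict (Set.Ioc 0 T)),
        ‖X s ω‖ ^ 2 ≤ ∫ r in Set.Ioc 0 s, g r * ‖X r ω‖ ^ 2 ∂leb) ∧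
      ∀ t ≤ T, ‖X t ω‖ ^ 2 ≤ 2 * ∫ s in Set.Ioc 0 t, ⟪X s ω, b s ω⟫ ∂leb
        + ∫ s in Set.Ioc 0 t, ∑' k, ‖R k (X s ω)‖ ^ 2 ∂leb →
        ‖X t ω‖ ^ 2 ≤ ∫ s in Set.Ioc 0 t, g s * ‖X s ω‖ ^ 2 ∂leb := by
    filter_upwards [henergy, hlim, h.bdd, ae_all_iff.2 fun i => ae_all_iff.2 fun p =>
      h.norm_le_of_ae_le (hgT i p), ae_all_iff.2 fun i => ae_all_iff.2 fun p =>
      h.norm_sq_le (hgT i p)] with ω ⟨g, hg0, hgi, hgX, hen⟩ hω ⟨C, hC⟩ hb hgrid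
    have hae : ∀ᵐ s ∂(leb.restrict (Set.Ioc 0 T)),
        ‖X s ω‖ ^ 2 ≤ ∫ r in Set.Ioc 0 s, g r * ‖X r ω‖ ^ 2 ∂leb := by
      filter_upwards [hω, ae_restrict_mem measurableSet_Ioc] with s hs hsT
      have hex : ∀ i, ∃ p < q i,
          s ∈ Set.Ioc (uniformGrid T (q i) p) (uniformGrid T (q i) (p + 1)) := fun i =>
        exists_mem_Ioc_of_mem (by rwa [uniformGrid_zero, uniformGrid_self T (hq0 i)])
      choose p hp hsp using hex
      have hus : Tendsto (fun i => uniformGrid T (q i) (p i)) atTop (𝓝 s) := by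
        rw [← NNReal.tendsto_coe]
        have h1 : Tendsto (fun i => (s : ℝ) - T / q i) atTop (𝓝 s) := by
          have := (tendsto_const_div_atTop_nhds_zero_nat (T : ℝ)).comp
            ((tendsto_add_atTop_nat 1).comp hns.tendsto_atTop)
          simpa [hqdef, Function.comp_def] using this.const_sub (s : ℝ)
        refine tendsto_of_tendsto_of_tendsto_of_le_of_le h1 tendsto_const_nhds (fun i => ?_)
          (fun i => by exact_mod_cast (hsp i).1.le)
        have h2 := uniformGrid_succ_sub_le T (q i) (p i)
        have h3 : (s : ℝ) ≤ uniformGrid T (q i) (p i + 1) := by exact_mod_cast (hsp i).2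
        dsimp only
        linarith
      -- The values at the left grid points converge to `X s` on the left side, and the primitive on
      -- the right side is continuous in time.
      refine le_of_tendsto_of_tendsto (hs.norm.pow 2)
        (tendsto_setIntegral_Ioc hgX (fun i => hgT i (p i)) hsT.2 hus) ?_
      filter_upwards [hns.tendsto_atTop.eventually_ge_atTop ⌈C⌉₊] with i hi
      rw [truncStep_of_mem (monotone_uniformGrid T (q i)) (hp i) (hsp i), truncBall_of_le]
      · exact hen _ (hgT i _) (hgrid i _)
      · refine (hb i (p i) ⌈C⌉₊ ?_).trans (by exact_mod_cast hi)
        filter_upwards [hC] with r hr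
        exact hr.trans (Nat.le_ceil C)
    exact ⟨g, hg0, hgX, setIntegral_mul_eq_zero_of_le hg0 (hgi.mono_set hsub) (fun s => sq_nonneg _)
      (hgX.mono_set hsub) hae, hae, hen⟩
  have hmono : ∀ (ω : Ω) (g : ℝ≥0 → ℝ), (∀ s, 0 ≤ g s) →
      IntegrableOn (fun s => g s * ‖X s ω‖ ^ 2) (Set.Icc 0 T) leb →
      ∫ s in Set.Ioc 0 T, g s * ‖X s ω‖ ^ 2 ∂leb = 0 → ∀ t ≤ T,
      ‖X t ω‖ ^ 2 ≤ ∫ s in Set.Ioc 0 t, g s * ‖X s ω‖ ^ 2 ∂leb → X t ω = 0 := by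
    intro ω g hg0 hgX hz t ht hle
    have h1 : ∫ s in Set.Ioc 0 t, g s * ‖X s ω‖ ^ 2 ∂leb
        ≤ ∫ s in Set.Ioc 0 T, g s * ‖X s ω‖ ^ 2 ∂leb :=
      setIntegral_mono_set (hgX.mono_set hsub)
        (Eventually.of_forall fun s => mul_nonneg (hg0 s) (sq_nonneg _))
        (Set.Ioc_subset_Ioc_right ht).eventuallyLE
    have h2 : ‖X t ω‖ ^ 2 = 0 := le_antisymm (by linarith) (sq_nonneg _)
    simpa using h2
  constructor
  · filter_upwards [hzero] with ω ⟨g, hg0, hgX, hz, hae, _⟩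
    rw [← Measure.restrict_congr_set (μ := leb) (Ioc_ae_eq_Icc (a := 0) (b := T))]
    filter_upwards [hae, ae_restrict_mem measurableSet_Ioc] with s hs hsT
    exact hmono ω g hg0 hgX hz s hsT.2 hs
  · intro t ht
    filter_upwards [hzero, h.norm_sq_le ht] with ω ⟨g, hg0, hgX, hz, _, hen⟩ hle
    exact hmono ω g hg0 hgX hz t ht (hen t ht hle)

end IsSkewNoiseEquation

end SLLB

/-! ### Weak derivatives on almost every segment. -/

namespace SLLB

section Shear

variable {d : ℕ}

/-- This makes functions of `x + r v` jointly measurable and integrable in `(r, x)` without any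
choice of coordinates. -/
theorem measurePreserving_shear (v : Space d) (ν : Measure ℝ) [SFinite ν] :
    MeasurePreserving (fun p : ℝ × Space d => (p.1, p.2 + p.1 • v)) (ν.prod volume)
      (ν.prod volume) :=
  (MeasurePreserving.id ν).skew_product (g := fun r x => x + r • v)
    (by simp only [Function.uncurry_def]; fun_prop)
    (Eventually.of_forall fun r => (measurePreserving_add_right volume (r • v)).map_eq)

/-- Almost every line in a given direction meets a set of full measure in almost every point. -/
theorem ae_ae_add_smul {p : Space d → Prop} (hp : ∀ᵐ x, p x) (v : Space d) :
    ∀ᵐ x : Space d, ∀ᵐ r : ℝ, p (x + r • v) := by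
  obtain ⟨s, hs, hsm, hs0⟩ := exists_measurable_superset_of_null (ae_iff.1 hp)
  have h1 : ∀ᵐ r : ℝ, ∀ᵐ x : Space d, x + r • v ∉ s := Eventually.of_forall fun r =>
    (measurePreserving_add_right volume (r • v)).quasiMeasurePreserving.ae
      (measure_eq_zero_iff_ae_notMem.1 hs0)
  have hm : MeasurableSet {z : ℝ × Space d | z.2 + z.1 • v ∉ s} :=
    (hsm.preimage (by fun_prop : Measurable fun z : ℝ × Space d => z.2 + z.1 • v)).compl
  filter_upwards [(Measure.ae_ae_comm hm).1 h1] with x hx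
  filter_upwards [hx] with r hr
  by_contra hcon
  exact hr (hs hcon)

end Shear

/-- `g` is the weak derivative of `f` in the direction `v` on `D`, both being integrable on `D`. -/
structure WeakDeriv {d : ℕ} (D : Opens (Space d)) (v : Space d) (f g : Space d → ℝ) : Prop where
  integrableOn : IntegrableOn f D
  integrableOn_deriv : IntegrableOn g D
  eq : ∀ φ : 𝓓(D, ℝ), ∫ x in (D : Set (Space d)), fderiv ℝ φ x v * f x
    = -∫ x in (D : Set (Space d)), φ x * g x

namespace WeakDeriv

variable {d : ℕ} {D : Opens (Space d)} {v : Space d} {f g : Space d → ℝ}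

theorem integrable_indicator (h : WeakDeriv D v f g) :
    Integrable ((D : Set (Space d)).indicator f) :=
  (integrable_indicator_iff D.isOpen.measurableSet).2 h.integrableOn

theorem integrable_indicator_deriv (h : WeakDeriv D v f g) :
    Integrable ((D : Set (Space d)).indicator g) :=
  (integrable_indicator_iff D.isOpen.measurableSet).2 h.integrableOn_deriv

theorem integral_fderiv_mul (h : WeakDeriv D v f g) {ψ : Space d → ℝ} (hψ : ContDiff ℝ (⊤ : ℕ∞) ψ)
    (hc : HasCompactSupport ψ) (hs : tsupport ψ ⊆ D) :
    ∫ x, fderiv ℝ ψ x v * (D : Set (Space d)).indicator f x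
      = -∫ x, ψ x * (D : Set (Space d)).indicator g x := by
  have := h.eq ⟨ψ, hψ, hc, hs⟩
  rw [← integral_indicator D.isOpen.measurableSet, ← integral_indicator D.isOpen.measurableSet]
    at this
  simp only [Set.indicator_mul_right] at this
  exact this

/-- The set of the points from which a segment of direction `v` can be drawn in `D` is open. -/
theorem isOpen_segment (D : Opens (Space d)) (v : Space d) (a : ℝ) :
    IsOpen {x : Space d | ∀ r ∈ Set.Icc 0 a, x + r • v ∈ D} := by
  rw [isOpen_iff_mem_nhds]
  intro x hx
  refine isCompact_Icc.eventually_forall_of_forall_eventually (P := fun x (r : ℝ) => x + r • v ∈ D)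
    fun r hr => ?_
  have : Continuous fun z : Space d × ℝ => z.1 + z.2 • v := by fun_prop
  exact this.continuousAt.eventually (D.isOpen.mem_nhds (hx r hr))

theorem hasDerivAt_shift {ψ : Space d → ℝ} (hψ : ContDiff ℝ (⊤ : ℕ∞) ψ) (v y : Space d)
    (α β r : ℝ) : HasDerivAt (fun r : ℝ => (α + β * r) * ψ (y - r • v))
      (β * ψ (y - r • v) - (α + β * r) * fderiv ℝ ψ (y - r • v) v) r := by
  have h1 : HasDerivAt (fun r : ℝ => y - r • v) (-v) r := by
    simpa using ((hasDerivAt_id r).smul_const v).const_sub y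
  have h2 : HasDerivAt (fun r : ℝ => ψ (y - r • v)) (fderiv ℝ ψ (y - r • v) (-v)) r :=
    ((hψ.differentiable (by simp)) (y - r • v)).hasFDerivAt.comp_hasDerivAt r h1
  have h3 : HasDerivAt (fun r : ℝ => α + β * r) β r := by
    simpa using ((hasDerivAt_id r).const_mul β).const_add α
  convert! h3.mul h2 using 1
  rw [map_neg]
  ring

theorem hasCompactSupport_fderiv_apply {ψ : Space d → ℝ} (hc : HasCompactSupport ψ) (v : Space d) :
    HasCompactSupport fun x => fderiv ℝ ψ x v :=
  (hc.fderiv (𝕜 := ℝ)).comp_left (g := fun L : Space d →L[ℝ] ℝ => L v) (by simp)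

theorem continuous_fderiv_apply {ψ : Space d → ℝ} (hψ : ContDiff ℝ (⊤ : ℕ∞) ψ) (v : Space d) :
    Continuous fun x => fderiv ℝ ψ x v :=
  (hψ.continuous_fderiv (by simp)).clm_apply continuous_const

theorem exists_norm_le_of_compactSupport {ψ : Space d → ℝ} (hψ : Continuous ψ)
    (hc : HasCompactSupport ψ) : ∃ C : ℝ, 0 ≤ C ∧ ∀ x, ‖ψ x‖ ≤ C := by
  obtain ⟨C, hC⟩ := hc.exists_bound_of_continuous hψ
  exact ⟨C, (norm_nonneg _).trans (hC 0), hC⟩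

/-- A weighted fundamental theorem of calculus on almost every segment of direction `v`. -/
theorem ae_segment (h : WeakDeriv D v f g) (α β : ℝ) {a : ℝ} (ha : 0 ≤ a) :
    ∀ᵐ x : Space d, (∀ r ∈ Set.Icc 0 a, x + r • v ∈ D) →
      (α + β * a) * (D : Set (Space d)).indicator f (x + a • v)
        - α * (D : Set (Space d)).indicator f x
      = ∫ r in Set.Icc 0 a, (β * (D : Set (Space d)).indicator f (x + r • v)
          + (α + β * r) * (D : Set (Space d)).indicator g (x + r • v)) := by
  set F := (D : Set (Space d)).indicator f with hF
  set G := (D : Set (Space d)).indicator g with hG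
  have hFi : Integrable F := h.integrable_indicator
  have hGi : Integrable G := h.integrable_indicator_deriv
  set ν : Measure ℝ := volume.restrict (Set.Icc 0 a) with hν
  have hFprod : Integrable (fun z : ℝ × Space d => F z.2) (ν.prod volume) := hFi.comp_snd ν
  have hGprod : Integrable (fun z : ℝ × Space d => G z.2) (ν.prod volume) := hGi.comp_snd ν
  have hae : ∀ᵐ z ∂(ν.prod (volume : Measure (Space d))), z.1 ∈ Set.Icc 0 a :=
    Measure.quasiMeasurePreserving_fst.ae (ae_restrict_mem measurableSet_Icc)
  have hθ : ∀ r ∈ Set.Icc 0 a, ‖α + β * r‖ ≤ |α| + |β| * a := fun r hr => by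
    refine (norm_add_le _ _).trans ?_
    rw [norm_mul, Real.norm_eq_abs, Real.norm_eq_abs, Real.norm_eq_abs, abs_of_nonneg hr.1]
    gcongr
    exact hr.2
  have hkint : Integrable (fun z : ℝ × Space d => β * F z.2 + (α + β * z.1) * G z.2)
      (ν.prod volume) := by
    refine (hFprod.const_mul β).add (hGprod.bdd_mul (c := |α| + |β| * a)
      (by fun_prop : Continuous fun z : ℝ × Space d => α + β * z.1).aestronglyMeasurable ?_)
    filter_upwards [hae] with z hz
    exact hθ z.1 hz
  have hkshear : Integrable (fun z : ℝ × Space d =>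
      β * F (z.2 + z.1 • v) + (α + β * z.1) * G (z.2 + z.1 • v)) (ν.prod volume) :=
    (measurePreserving_shear v ν).integrable_comp_of_integrable hkint
  set Hd : Space d → ℝ := fun x => (α + β * a) * F (x + a • v) - α * F x
    - ∫ r in Set.Icc 0 a, (β * F (x + r • v) + (α + β * r) * G (x + r • v)) with hHd
  have hi1 : Integrable fun x => (α + β * a) * F (x + a • v) :=
    (hFi.comp_add_right (a • v)).const_mul _
  have hi2 : Integrable fun x => α * F x := hFi.const_mul _
  have hi3 : Integrable fun x : Space d =>
      ∫ r in Set.Icc 0 a, (β * F (x + r • v) + (α + β * r) * G (x + r • v)) :=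
    hkshear.integral_prod_right
  have hHi : Integrable Hd := (hi1.sub hi2).sub hi3
  -- The identity is tested against smooth functions supported in the open set of the points from
  -- which the whole segment lies in `D`. Their translates along the segment are then admissible
  -- test functions on `D`.
  have hzero := (isOpen_segment D v a).ae_eq_zero_of_integral_contDiff_smul_eq_zero
    (μ := volume) (hHi.locallyIntegrable.locallyIntegrableOn _) (by
    intro ψ hψ hc hs
    have hψc : Continuous ψ := hψ.continuous
    obtain ⟨C, hC0, hC⟩ := exists_norm_le_of_compactSupport hψc hc
    obtain ⟨C', hC0', hC'⟩ := exists_norm_le_of_compactSupport (continuous_fderiv_apply hψ v)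
      (hasCompactSupport_fderiv_apply hc v)
    have hψm : AEStronglyMeasurable ψ (volume : Measure (Space d)) := hψc.aestronglyMeasurable
    have hb : ∀ {k : Space d → ℝ}, Integrable k → Integrable fun x => ψ x * k x := fun hk =>
      hk.bdd_mul (c := C) hψm (Eventually.of_forall hC)
    -- the shifted test functions
    have hshift : ∀ r ∈ Set.Icc 0 a, ∫ y, ψ (y - r • v) * G y
        = -∫ y, fderiv ℝ ψ (y - r • v) v * F y := by
      intro r hr
      have e1 : (fun y => ψ (y - r • v)) = ψ ∘ (Homeomorph.addRight (-(r • v))) := by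
        ext y; simp [sub_eq_add_neg]
      have hc1 : HasCompactSupport fun y => ψ (y - r • v) := by
        rw [e1]; exact hc.comp_homeomorph _
      have hs1 : tsupport (fun y => ψ (y - r • v)) ⊆ D := by
        rw [e1, tsupport_comp_eq_preimage]
        intro y hy
        have := hs hy r hr
        simpa using this
      have h1 := h.integral_fderiv_mul (hψ.comp (contDiff_id.sub contDiff_const)) hc1 hs1
      have e2 : ∀ y, fderiv ℝ (fun y => ψ (y - r • v)) y v = fderiv ℝ ψ (y - r • v) v := fun y => by
        rw [fderiv_comp_sub]
      simp only [← hF, ← hG, Function.comp_def, id, e2] at h1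
      rw [h1, neg_neg]
    -- Fubini and translation transfer the shift to `ψ`, and the definition of the weak derivative
    -- removes `g`. What appears is the derivative in `r` of `(α + β r) ψ(y - r v)`, tested against
    -- `f`.
    have hI3 : ∫ x, ψ x * ∫ r in Set.Icc 0 a, (β * F (x + r • v) + (α + β * r) * G (x + r • v))
        = ∫ r in Set.Icc 0 a, ∫ y, (β * ψ (y - r • v)
            - (α + β * r) * fderiv ℝ ψ (y - r • v) v) * F y := by
      have hprod : Integrable (Function.uncurry fun (r : ℝ) (x : Space d) =>
          ψ x * (β * F (x + r • v) + (α + β * r) * G (x + r • v))) (ν.prod volume) :=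
        hkshear.bdd_mul (c := C) (by
          exact (by fun_prop : Continuous fun z : ℝ × Space d => ψ z.2).aestronglyMeasurable)
          (Eventually.of_forall fun z => hC z.2)
      simp_rw [← integral_const_mul]
      rw [← integral_integral_swap hprod]
      refine setIntegral_congr_fun measurableSet_Icc fun r hr => ?_
      have e1 : ∫ x, ψ x * (β * F (x + r • v) + (α + β * r) * G (x + r • v))
          = ∫ y, ψ (y - r • v) * (β * F y + (α + β * r) * G y) := by
        rw [← integral_add_right_eq_self (fun y => ψ (y - r • v) * (β * F y + (α + β * r) * G y))
          (r • v)]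
        simp
      have hsm : AEStronglyMeasurable (fun y => ψ (y - r • v)) (volume : Measure (Space d)) :=
        (hψc.comp (by fun_prop)).aestronglyMeasurable
      have j1 : Integrable fun y => ψ (y - r • v) * F y :=
        hFi.bdd_mul (c := C) hsm (Eventually.of_forall fun y => hC _)
      have j2 : Integrable fun y => ψ (y - r • v) * G y :=
        hGi.bdd_mul (c := C) hsm (Eventually.of_forall fun y => hC _)
      have j3 : Integrable fun y => fderiv ℝ ψ (y - r • v) v * F y :=
        hFi.bdd_mul (c := C') ((continuous_fderiv_apply hψ v).comp
          (by fun_prop : Continuous fun y => y - r • v)).aestronglyMeasurable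
          (Eventually.of_forall fun y => hC' _)
      have e2 : (fun y => ψ (y - r • v) * (β * F y + (α + β * r) * G y))
          = fun y => β * (ψ (y - r • v) * F y) + (α + β * r) * (ψ (y - r • v) * G y) := by
        ext y; ring
      have e3 : (fun y => (β * ψ (y - r • v) - (α + β * r) * fderiv ℝ ψ (y - r • v) v) * F y)
          = fun y => β * (ψ (y - r • v) * F y)
            - (α + β * r) * (fderiv ℝ ψ (y - r • v) v * F y) := by
        ext y; ring
      rw [e1, e2, e3, integral_add (j1.const_mul _) (j2.const_mul _),
        integral_sub (j1.const_mul _) (j3.const_mul _), integral_const_mul, integral_const_mul,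
        integral_const_mul, hshift r hr]
      ring
    -- For fixed `y` the integral in `r` is that of an exact derivative, so only the two endpoint
    -- values remain.
    have hFub : ∫ r in Set.Icc 0 a, ∫ y, (β * ψ (y - r • v)
            - (α + β * r) * fderiv ℝ ψ (y - r • v) v) * F y
        = ∫ y, ((α + β * a) * ψ (y - a • v) - α * ψ y) * F y := by
      have hprod : Integrable (Function.uncurry fun (r : ℝ) (y : Space d) =>
          (β * ψ (y - r • v) - (α + β * r) * fderiv ℝ ψ (y - r • v) v) * F y) (ν.prod volume) := by
        refine hFprod.bdd_mul (c := |β| * C + (|α| + |β| * a) * C') ?_ ?_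
        · have c1 : Continuous fun z : ℝ × Space d => fderiv ℝ ψ (z.2 - z.1 • v) v :=
            (continuous_fderiv_apply hψ v).comp (by fun_prop)
          exact (by fun_prop : Continuous fun z : ℝ × Space d =>
            β * ψ (z.2 - z.1 • v) - (α + β * z.1) * fderiv ℝ ψ (z.2 - z.1 • v)
              v).aestronglyMeasurable
        · filter_upwards [hae] with z hz
          refine (norm_sub_le _ _).trans ?_
          rw [norm_mul, norm_mul]
          have := hθ z.1 hz
          have h0 : 0 ≤ |α| + |β| * a := by positivity
          rw [Real.norm_eq_abs β]
          exact add_le_add (mul_le_mul_of_nonneg_left (hC _) (abs_nonneg _))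
            (mul_le_mul this (hC' _) (norm_nonneg _) h0)
      rw [integral_integral_swap hprod]
      refine integral_congr_ae (Eventually.of_forall fun y => ?_)
      dsimp only
      rw [integral_mul_const]
      congr 1
      have hder := fun r => hasDerivAt_shift hψ v y α β r
      have hcont : Continuous fun r : ℝ =>
          β * ψ (y - r • v) - (α + β * r) * fderiv ℝ ψ (y - r • v) v := by
        have c1 : Continuous fun r : ℝ => fderiv ℝ ψ (y - r • v) v :=
          (continuous_fderiv_apply hψ v).comp (by fun_prop)
        fun_prop
      rw [integral_Icc_eq_integral_Ioc, ← intervalIntegral.integral_of_le ha,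
        intervalIntegral.integral_eq_sub_of_hasDerivAt (fun r _ => hder r)
          (hcont.intervalIntegrable _ _)]
      simp
    have hI1 : ∫ x, ψ x * ((α + β * a) * F (x + a • v)) = ∫ y, (α + β * a) * ψ (y - a • v) * F y := by
      rw [← integral_add_right_eq_self (fun y => (α + β * a) * ψ (y - a • v) * F y) (a • v)]
      refine integral_congr_ae (Eventually.of_forall fun y => ?_)
      simp only [add_sub_cancel_right]
      ring
    have j1 : Integrable fun y => (α + β * a) * ψ (y - a • v) * F y := by
      have : Integrable fun y => ψ (y - a • v) * F y :=
        hFi.bdd_mul (c := C) (hψc.comp (by fun_prop)).aestronglyMeasurable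
          (Eventually.of_forall fun y => hC _)
      simpa only [mul_assoc] using this.const_mul (α + β * a)
    have e : ∀ x, ψ x • Hd x = ψ x * ((α + β * a) * F (x + a • v)) - ψ x * (α * F x)
        - ψ x * ∫ r in Set.Icc 0 a, (β * F (x + r • v) + (α + β * r) * G (x + r • v)) := by
      intro x
      simp only [hHd, smul_eq_mul]
      ring
    simp_rw [e]
    have j2 : Integrable fun x => ψ x * ((α + β * a) * F (x + a • v)) - ψ x * (α * F x) :=
      (hb hi1).sub (hb hi2)
    rw [integral_sub j2 (hb hi3), integral_sub (hb hi1) (hb hi2), hI1, hI3,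
      hFub, ← integral_sub j1 (hb hi2)]
    rw [sub_eq_zero]
    refine integral_congr_ae (Eventually.of_forall fun y => ?_)
    dsimp only
    ring)
  filter_upwards [hzero] with x hx hseg
  have := hx hseg
  simp only [hHd] at this
  linarith

end WeakDeriv

end SLLB

/-! ### The product rule by difference quotients. -/

namespace SLLB

namespace WeakDeriv

variable {d : ℕ} {D : Opens (Space d)} {v : Space d}

theorem hasDerivAt_integral_shift {φ k : Space d → ℝ} (hφ : ContDiff ℝ (⊤ : ℕ∞) φ)
    (hc : HasCompactSupport φ) (hk : Integrable k) (v : Space d) :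
    HasDerivAt (fun r : ℝ => ∫ y, φ (y - r • v) * k y) (-∫ y, fderiv ℝ φ y v * k y) 0 := by
  obtain ⟨C, hC0, hC⟩ := exists_norm_le_of_compactSupport hφ.continuous hc
  obtain ⟨C', hC0', hC'⟩ := exists_norm_le_of_compactSupport (continuous_fderiv_apply hφ v)
      (hasCompactSupport_fderiv_apply hc v)
  have key := (hasDerivAt_integral_of_dominated_loc_of_deriv_le (μ := (volume : Measure (Space d)))
    (F := fun (r : ℝ) y => φ (y - r • v) * k y)
    (F' := fun (r : ℝ) y => -fderiv ℝ φ (y - r • v) v * k y) (x₀ := 0) (s := Set.univ)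
    (bound := fun y => C' * ‖k y‖) univ_mem
    (Eventually.of_forall fun r => (hφ.continuous.comp (by fun_prop : Continuous fun y : Space d =>
      y - r • v)).aestronglyMeasurable.mul hk.aestronglyMeasurable)
    (hk.bdd_mul (c := C) (hφ.continuous.comp (by fun_prop : Continuous fun y : Space d =>
      y - (0 : ℝ) • v)).aestronglyMeasurable (Eventually.of_forall fun y => hC _))
    (((continuous_fderiv_apply hφ v).comp (by fun_prop : Continuous fun y : Space d =>
      y - (0 : ℝ) • v)).neg.aestronglyMeasurable.mul hk.aestronglyMeasurable)
    (Eventually.of_forall fun y r _ => by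
      rw [norm_mul, norm_neg]
      exact mul_le_mul_of_nonneg_right (hC' _) (norm_nonneg _))
    (hk.norm.const_mul C')
    (Eventually.of_forall fun y r _ => by
      have := (hasDerivAt_shift hφ v y 1 0 r).mul_const (k y)
      simpa using this)).2
  simpa [integral_neg] using key

theorem tendsto_average {k : ℝ × ℝ → ℝ} (hk : Continuous k) :
    Tendsto (fun s : ℝ => s⁻¹ * ∫ r in Set.Icc 0 s, k (r, s)) (𝓝[>] 0) (𝓝 (k (0, 0))) := by
  rw [Metric.tendsto_nhds]
  intro ε hε
  obtain ⟨δ, hδ, hδ2⟩ := Metric.continuous_iff.1 hk (0, 0) (ε / 2) (half_pos hε)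
  filter_upwards [Ioo_mem_nhdsGT hδ] with s hs
  have hs0 : 0 < s := hs.1
  have hint : IntegrableOn (fun r => k (r, s)) (Set.Icc 0 s) :=
    (by fun_prop : Continuous fun r => k (r, s)).continuousOn.integrableOn_compact isCompact_Icc
  have e : (s⁻¹ * ∫ r in Set.Icc 0 s, k (r, s)) - k (0, 0)
      = s⁻¹ * ∫ r in Set.Icc 0 s, (k (r, s) - k (0, 0)) := by
    rw [integral_sub hint (integrable_const _), setIntegral_const, measureReal_def, Real.volume_Icc,
      sub_zero, ENNReal.toReal_ofReal hs0.le, smul_eq_mul, mul_sub, ← mul_assoc s⁻¹ s,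
      inv_mul_cancel₀ hs0.ne', one_mul]
  rw [Real.dist_eq, e, abs_mul, abs_of_pos (inv_pos.2 hs0)]
  have h1 : ‖∫ r in Set.Icc 0 s, (k (r, s) - k (0, 0))‖ ≤ ε / 2 * volume.real (Set.Icc 0 s) := by
    refine norm_setIntegral_le_of_norm_le_const (by simp) fun r hr => ?_
    have := hδ2 (r, s) (by
      rw [Prod.dist_eq, Real.dist_eq, Real.dist_eq, sub_zero, sub_zero, abs_of_nonneg hr.1,
        abs_of_pos hs0]
      exact max_lt (hr.2.trans_lt hs.2) hs.2)
    rw [Real.dist_eq] at this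
    exact this.le
  rw [measureReal_def, Real.volume_Icc, sub_zero, ENNReal.toReal_ofReal hs0.le] at h1
  calc s⁻¹ * |∫ r in Set.Icc 0 s, (k (r, s) - k (0, 0))| ≤ s⁻¹ * (ε / 2 * s) := by gcongr; exact h1
    _ = ε / 2 := by field_simp
    _ < ε := half_lt_self hε

/-- Continuity of translations in `L²`, the only approximation argument needed for the product rule.
-/
theorem continuous_translate (v : Space d) {F : Space d → ℝ} (hF : MemLp F 2 volume) :
    Continuous fun r : ℝ => (hF.comp_measurePreserving
      (measurePreserving_add_right volume (r • v))).toLp (F ∘ fun x => x + r • v) := by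
  let g : ℝ → C(Space d, Space d) := fun r => ⟨fun x => x + r • v, by fun_prop⟩
  have hg : Continuous g := ContinuousMap.continuous_of_continuous_uncurry _ (by
    simp only [g, Function.uncurry_def, ContinuousMap.coe_mk]; fun_prop)
  exact (continuous_const (y := hF.toLp F)).compMeasurePreservingLp hg
    (fun r => measurePreserving_add_right volume (r • v)) (by simp)

/-- The two shifts are independent variables, because in the product rule one factor stays at the
end of the segment while the other one runs along it. -/
theorem continuous_integral_mul_translate (v : Space d) {φ F G : Space d → ℝ} (hφ : MemLp φ ∞ volume)
    (hF : MemLp F 2 volume) (hG : MemLp G 2 volume) :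
    Continuous fun z : ℝ × ℝ => ∫ x, φ x * F (x + z.2 • v) * G (x + z.1 • v) := by
  have h : Continuous fun z : ℝ × ℝ => (ContinuousLinearMap.mul ℝ ℝ).lpPairing
      (volume : Measure (Space d)) 2 2
      ((ContinuousLinearMap.mul ℝ ℝ).holderL (volume : Measure (Space d)) ∞ 2 2 (hφ.toLp φ)
        ((hF.comp_measurePreserving (measurePreserving_add_right volume (z.2 • v))).toLp
          (F ∘ fun x => x + z.2 • v)))
      ((hG.comp_measurePreserving (measurePreserving_add_right volume (z.1 • v))).toLp
          (G ∘ fun x => x + z.1 • v)) :=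
    ((ContinuousLinearMap.continuous _).comp ((ContinuousLinearMap.continuous _).comp
      ((continuous_translate v hF).comp continuous_snd))).clm_apply
      ((continuous_translate v hG).comp continuous_fst)
  refine h.congr fun z => ?_
  rw [ContinuousLinearMap.lpPairing_eq_integral]
  have h1 := MemLp.coeFn_toLp (hG.comp_measurePreserving
    (measurePreserving_add_right (volume : Measure (Space d)) (z.1 • v)))
  have h2 := MemLp.coeFn_toLp (hF.comp_measurePreserving
    (measurePreserving_add_right (volume : Measure (Space d)) (z.2 • v)))
  have h3 := (ContinuousLinearMap.mul ℝ ℝ).coeFn_holder (r := 2) (hφ.toLp φ)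
    ((hF.comp_measurePreserving (measurePreserving_add_right volume (z.2 • v))).toLp
          (F ∘ fun x => x + z.2 • v))
  refine integral_congr_ae ?_
  filter_upwards [h1, h2, h3, hφ.coeFn_toLp] with x e1 e2 e3 e4
  rw [ContinuousLinearMap.holderL_apply_apply, e3, e1, e2, e4]
  rfl

theorem exists_segment_subset {K : Set (Space d)} (hK : IsCompact K) (hKD : K ⊆ D) (v : Space d) :
    ∃ δ > 0, ∀ x ∈ K, ∀ r ∈ Set.Icc (0 : ℝ) δ, x + r • v ∈ D := by
  have h : ∀ᶠ r in 𝓝 (0 : ℝ), ∀ x ∈ K, x + r • v ∈ D := by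
    refine hK.eventually_forall_of_forall_eventually (P := fun (r : ℝ) x => x + r • v ∈ D)
      fun x hx => ?_
    have : Continuous fun z : ℝ × Space d => z.2 + z.1 • v := by fun_prop
    refine this.continuousAt.eventually (D.isOpen.mem_nhds ?_)
    simpa using hKD hx
  obtain ⟨δ, hδ, hδ2⟩ := Metric.eventually_nhds_iff.1 h
  refine ⟨δ / 2, half_pos hδ, fun x hx r hr => hδ2 ?_ x hx⟩
  rw [Real.dist_eq, sub_zero, abs_of_nonneg hr.1]
  linarith [hr.2]

theorem integrable_prod_mul_translate (v : Space d) {φ F G : Space d → ℝ} (hφ : MemLp φ ∞ volume)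
    (hF : MemLp F 2 volume) (hG : MemLp G 2 volume) (ν : Measure ℝ) [IsFiniteMeasure ν] (s : ℝ) :
    Integrable (Function.uncurry fun (r : ℝ) (x : Space d) =>
      φ x * F (x + s • v) * G (x + r • v)) (ν.prod volume) := by
  have hF' : MemLp (fun x => F (x + s • v)) 2 volume :=
    hF.comp_measurePreserving (measurePreserving_add_right volume (s • v))
  have h1 : MemLp (fun x => φ x * F (x + s • v)) 2 volume := hF'.mul' hφ
  have h2 : MemLp (fun z : ℝ × Space d => G (z.2 + z.1 • v)) 2 (ν.prod volume) :=
    (hG.comp_snd ν).comp_measurePreserving (measurePreserving_shear v ν)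
  exact (h1.comp_snd ν).integrable_mul h2

/-- The product rule. -/
theorem mul {f f' g g' : Space d → ℝ} (hf : WeakDeriv D v f f') (hg : WeakDeriv D v g g')
    (mf : MemLp f 2 (volOn D)) (mf' : MemLp f' 2 (volOn D)) (mg : MemLp g 2 (volOn D))
    (mg' : MemLp g' 2 (volOn D)) :
    WeakDeriv D v (fun x => f x * g x) (fun x => f' x * g x + f x * g' x) := by
  have hDm := D.isOpen.measurableSet
  refine ⟨mf.integrable_mul mg, (mf'.integrable_mul mg).add (mf.integrable_mul mg'), fun φ => ?_⟩
  set F := (D : Set (Space d)).indicator f with hF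
  set F' := (D : Set (Space d)).indicator f' with hF'
  set G := (D : Set (Space d)).indicator g with hG
  set G' := (D : Set (Space d)).indicator g' with hG'
  have nF : MemLp F 2 volume := (memLp_indicator_iff_restrict hDm).2 mf
  have nF' : MemLp F' 2 volume := (memLp_indicator_iff_restrict hDm).2 mf'
  have nG : MemLp G 2 volume := (memLp_indicator_iff_restrict hDm).2 mg
  have nG' : MemLp G' 2 volume := (memLp_indicator_iff_restrict hDm).2 mg'
  have hφ : ContDiff ℝ (⊤ : ℕ∞) φ := φ.contDiff
  have hc : HasCompactSupport φ := φ.hasCompactSupport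
  obtain ⟨C, hC0, hC⟩ := exists_norm_le_of_compactSupport hφ.continuous hc
  have nφ : MemLp φ ∞ volume := memLp_top_of_bound hφ.continuous.aestronglyMeasurable C
    (Eventually.of_forall hC)
  have hFG : Integrable fun y => F y * G y := nF.integrable_mul nG
  obtain ⟨δ, hδ, hseg⟩ := exists_segment_subset hc φ.tsupport_subset v
  -- the difference quotients of the product
  have hquot : ∀ s ∈ Set.Ioo 0 δ, (∫ y, φ (y - s • v) * (F y * G y)) - ∫ y, φ y * (F y * G y)
      = ∫ r in Set.Icc 0 s, ((∫ x, φ x * F (x + s • v) * G' (x + r • v))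
        + ∫ x, φ x * G (x + (0 : ℝ) • v) * F' (x + r • v)) := by
    intro s hs
    -- With constant weight this is the plain fundamental theorem of calculus. It is applied to both
    -- differences in `F(x+sv)(G(x+sv) - G(x)) + G(x)(F(x+sv) - F(x))`.
    have a1 := hf.ae_segment 1 0 hs.1.le
    have a2 := hg.ae_segment 1 0 hs.1.le
    simp only [zero_mul, add_zero, one_mul, zero_add] at a1 a2
    have t1 := integrable_prod_mul_translate v nφ nF nG' (volume.restrict (Set.Icc 0 s)) s
    have t2 := integrable_prod_mul_translate v nφ nG nF' (volume.restrict (Set.Icc 0 s)) 0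
    have i1 : Integrable fun y => φ y * (F y * G y) :=
      hFG.bdd_mul (c := C) hφ.continuous.aestronglyMeasurable (Eventually.of_forall hC)
    have i2 : Integrable fun x => φ x * (F (x + s • v) * G (x + s • v)) :=
      (hFG.comp_add_right (s • v)).bdd_mul (c := C) hφ.continuous.aestronglyMeasurable
        (Eventually.of_forall hC)
    have p1 : IntegrableOn (fun r => ∫ x, φ x * F (x + s • v) * G' (x + r • v)) (Set.Icc 0 s) :=
      t1.integral_prod_left
    have p2 : IntegrableOn (fun r : ℝ => ∫ x, φ x * G (x + (0 : ℝ) • v) * F' (x + r • v))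
      (Set.Icc 0 s) := t2.integral_prod_left
    have p3 : Integrable fun x => ∫ r in Set.Icc 0 s, φ x * F (x + s • v) * G' (x + r • v) :=
      t1.integral_prod_right
    have p4 : Integrable fun x : Space d =>
      ∫ r in Set.Icc 0 s, φ x * G (x + (0 : ℝ) • v) * F' (x + r • v) := t2.integral_prod_right
    rw [integral_add p1 p2, integral_integral_swap t1, integral_integral_swap t2,
      ← integral_add p3 p4,
      ← integral_add_right_eq_self (fun y => φ (y - s • v) * (F y * G y)) (s • v)]
    simp only [add_sub_cancel_right]
    rw [← integral_sub i2 i1]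
    refine integral_congr_ae ?_
    filter_upwards [a1, a2] with x e1 e2
    simp only [integral_const_mul]
    by_cases hx : x ∈ tsupport φ
    · have hsx : ∀ r ∈ Set.Icc 0 s, x + r • v ∈ D := fun r hr =>
        hseg x hx r ⟨hr.1, hr.2.trans hs.2.le⟩
      -- The shift `0 • v` in the second term only serves to give both terms the same form; here it
      -- disappears.
      rw [← e1 hsx, ← e2 hsx, zero_smul, add_zero]
      ring
    · rw [image_eq_zero_of_notMem_tsupport hx]
      simp
  have hcont : Continuous fun z : ℝ × ℝ => (∫ x, φ x * F (x + z.2 • v) * G' (x + z.1 • v))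
      + ∫ x, φ x * G (x + (0 : ℝ) • v) * F' (x + z.1 • v) :=
    (continuous_integral_mul_translate v nφ nF nG').add
      ((continuous_integral_mul_translate v nφ nG nF').comp
        (by fun_prop : Continuous fun z : ℝ × ℝ => (z.1, (0 : ℝ))))
  have lim1 := tendsto_average hcont
  -- The quotient on the left tends to minus the integral of `FG` against the derivative of `φ`, and
  -- the average on the right to its value at zero shifts. Uniqueness of limits is the product rule.
  have lim2 := ((hasDerivAt_iff_tendsto_slope.1 (hasDerivAt_integral_shift hφ hc hFG v)).mono_left
    (nhdsWithin_mono 0 (show Set.Ioi (0 : ℝ) ⊆ {0}ᶜ from fun x hx => ne_of_gt hx)))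
  have lim3 := lim2.congr' (f₂ := fun s : ℝ => s⁻¹ * ∫ r in Set.Icc 0 s,
      ((∫ x, φ x * F (x + s • v) * G' (x + r • v))
        + ∫ x, φ x * G (x + (0 : ℝ) • v) * F' (x + r • v))) (by
    filter_upwards [Ioo_mem_nhdsGT hδ] with s hs
    rw [slope_def_field, ← hquot s hs]
    simp [div_eq_inv_mul])
  have huniq := tendsto_nhds_unique lim3 lim1
  simp only [zero_smul, add_zero] at huniq
  have m1 : MemLp (fun x => φ x * F x) 2 volume := nF.mul' nφ
  have m2 : MemLp (fun x => φ x * G x) 2 volume := nG.mul' nφ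
  have j1 : Integrable fun x => φ x * F x * G' x := m1.integrable_mul nG'
  have j2 : Integrable fun x => φ x * G x * F' x := m2.integrable_mul nF'
  rw [← integral_add j1 j2] at huniq
  rw [← integral_indicator hDm, ← integral_indicator hDm, ← neg_eq_iff_eq_neg]
  convert huniq using 1
  · congr 1
    refine integral_congr_ae (Eventually.of_forall fun x => ?_)
    by_cases hx : x ∈ (D : Set (Space d)) <;> simp [hF, hG, hx]
  · refine integral_congr_ae (Eventually.of_forall fun x => ?_)
    by_cases hx : x ∈ (D : Set (Space d))
    · simp only [hF, hG, hF', hG', Set.indicator_of_mem hx]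
      ring
    · simp [hF, hG, hx]

end WeakDeriv

end SLLB

/-! ### Pointwise bounds by integrals over segments. -/

namespace SLLB

variable {d : ℕ}

theorem sum_smul_coordVec (v : Space d) : ∑ i, v i • (coordVec i : Space d) = v := by
  ext j
  simp [coordVec, Finset.sum_apply, Pi.single_apply]

namespace WeakDeriv

variable {D : Opens (Space d)} {v : Space d} {f g : Space d → ℝ}

/-- Directional derivatives from partial derivatives. -/
theorem of_partials {g : Fin d → Space d → ℝ} (h : ∀ i, WeakDeriv D (coordVec i) f (g i))
    (hf : IntegrableOn f D) (v : Space d) : WeakDeriv D v f (fun x => ∑ i, v i * g i x) := by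
  refine ⟨hf, integrable_finsetSum _ fun i _ => (h i).integrableOn_deriv.const_mul _, fun φ => ?_⟩
  have hφ : ContDiff ℝ (⊤ : ℕ∞) φ := φ.contDiff
  obtain ⟨C, -, hC⟩ := exists_norm_le_of_compactSupport hφ.continuous φ.hasCompactSupport
  have e1 : ∀ x, fderiv ℝ φ x v * f x = ∑ i, v i * (fderiv ℝ φ x (coordVec i) * f x) := fun x => by
    conv_lhs => rw [← sum_smul_coordVec v]
    rw [map_sum, Finset.sum_mul]
    refine Finset.sum_congr rfl fun i _ => ?_
    rw [map_smul, smul_eq_mul, mul_assoc]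
  have e2 : ∀ x, φ x * ∑ i, v i * g i x = ∑ i, v i * (φ x * g i x) := fun x => by
    rw [Finset.mul_sum]
    exact Finset.sum_congr rfl fun i _ => by ring
  have i1 : ∀ i, IntegrableOn (fun x => v i * (fderiv ℝ φ x (coordVec i) * f x)) D := fun i => by
    obtain ⟨C', -, hC'⟩ := exists_norm_le_of_compactSupport (continuous_fderiv_apply hφ (coordVec i))
      (hasCompactSupport_fderiv_apply φ.hasCompactSupport (coordVec i))
    exact (hf.bdd_mul (c := C') (continuous_fderiv_apply hφ _).aestronglyMeasurable
      (Eventually.of_forall hC')).const_mul _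
  have i2 : ∀ i, IntegrableOn (fun x => v i * (φ x * g i x)) D := fun i =>
    ((h i).integrableOn_deriv.bdd_mul (c := C) hφ.continuous.aestronglyMeasurable
      (Eventually.of_forall hC)).const_mul _
  simp_rw [e1, e2]
  rw [integral_finsetSum _ fun i _ => i1 i, integral_finsetSum _ fun i _ => i2 i,
    ← Finset.sum_neg_distrib]
  refine Finset.sum_congr rfl fun i _ => ?_
  rw [integral_const_mul, integral_const_mul, (h i).eq φ]
  ring

/-- The function whose integrals over segments of length `a` bound `f`. -/
noncomputable def stepDensity (D : Opens (Space d)) (a : ℝ) (f g : Space d → ℝ) (x : Space d) :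
    ℝ≥0∞ :=
  ENNReal.ofReal a⁻¹ * ‖(D : Set (Space d)).indicator f x‖ₑ
    + ‖(D : Set (Space d)).indicator g x‖ₑ

/-- The weight `a - r` vanishes at the far end of the segment, so only the value at `x` survives on
the boundary. Dividing by `a` leaves `f / a` and `g` under the integral. -/
theorem enorm_le_lintegral_segment (h : WeakDeriv D v f g) {a : ℝ} (ha : 0 < a) :
    ∀ᵐ x : Space d, (∀ r ∈ Set.Icc 0 a, x + r • v ∈ D) →
      ‖f x‖ₑ ≤ ∫⁻ r in Set.Icc 0 a, stepDensity D a f g (x + r • v) := by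
  filter_upwards [h.ae_segment a (-1) ha.le] with x hx hseg
  have h0 : x ∈ (D : Set (Space d)) := by simpa using hseg 0 ⟨le_rfl, ha.le⟩
  have h1 := hx hseg
  rw [neg_one_mul, add_neg_cancel, zero_mul, zero_sub, Set.indicator_of_mem h0] at h1
  have h2 : ENNReal.ofReal a * ‖f x‖ₑ
      ≤ ∫⁻ r in Set.Icc 0 a, ENNReal.ofReal a * stepDensity D a f g (x + r • v) := by
    have e : ENNReal.ofReal a * ‖f x‖ₑ = ‖-(a * f x)‖ₑ := by
      rw [enorm_neg, enorm_mul, Real.enorm_of_nonneg ha.le]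
    rw [e, h1]
    refine (enorm_integral_le_lintegral_enorm _).trans
      (setLIntegral_mono' measurableSet_Icc fun r hr => ?_)
    refine (enorm_add_le _ _).trans ?_
    rw [enorm_mul, enorm_mul, stepDensity, mul_add, ← mul_assoc, ← ENNReal.ofReal_mul ha.le,
      mul_inv_cancel₀ ha.ne', ENNReal.ofReal_one, enorm_neg, enorm_one]
    gcongr
    rw [← ofReal_norm]
    refine ENNReal.ofReal_le_ofReal ?_
    rw [Real.norm_eq_abs, abs_of_nonneg (by linarith [hr.2])]
    linarith [hr.1]
  rw [lintegral_const_mul' _ _ ENNReal.ofReal_ne_top] at h2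
  exact (ENNReal.mul_le_mul_iff_right (by simpa using ha) ENNReal.ofReal_ne_top).1 h2

end WeakDeriv

/-! ### Cones inside the domain. -/

section Cone

/-- An open set with `C²` boundary contains, locally uniformly, truncated cones with vertices at its
points. -/
theorem exists_cone (hd : 0 < d) {D : Set (Space d)} (hDo : IsOpen D) (hD : HasC2Boundary D)
    {x₀ : Space d} (hx₀ : x₀ ∈ closure D) :
    ∃ e : Space d, ‖e‖ = 1 ∧ ∃ ε > (0 : ℝ), ∃ a > (0 : ℝ), ∃ N ∈ 𝓝 x₀, ∀ x ∈ N, x ∈ D →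
      ∀ α ∈ Set.Icc 0 a, ∀ y : Space d, ‖y‖ ≤ ε * α → x + α • e + y ∈ D := by
  by_cases hin : x₀ ∈ D
  · obtain ⟨ρ, hρ, hball⟩ := Metric.isOpen_iff.1 hDo x₀ hin
    refine ⟨coordVec ⟨0, hd⟩, by simp [coordVec], 1, one_pos, ρ / 4, by positivity,
      Metric.ball x₀ (ρ / 2), Metric.ball_mem_nhds _ (half_pos hρ), fun x hx _ α hα y hy => ?_⟩
    refine hball ?_
    rw [mem_ball_iff_norm] at hx ⊢
    have e : x + α • (coordVec ⟨0, hd⟩ : Space d) + y - x₀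
        = (x - x₀) + (α • (coordVec ⟨0, hd⟩ : Space d) + y) := by abel
    rw [e]
    have h1 : ‖α • (coordVec ⟨0, hd⟩ : Space d)‖ = α := by
      rw [norm_smul, Real.norm_of_nonneg hα.1]; simp [coordVec]
    have h2 := norm_add_le (x - x₀) (α • (coordVec ⟨0, hd⟩ : Space d) + y)
    have h3 := norm_add_le (α • (coordVec ⟨0, hd⟩ : Space d)) y
    linarith [hα.2]
  · obtain ⟨r, hr, e, he, g, hg, hgD⟩ := hD x₀ ⟨hx₀, by rwa [hDo.interior_eq]⟩
    -- Of the boundary regularity only the local Lipschitz continuity of the graph function is used.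
    obtain ⟨K, t, ht, hK⟩ := (hg.of_le (by norm_num : (1 : WithTop ℕ∞) ≤ 2)).contDiffAt
      (x := x₀ - ⟪e, x₀⟫ • e) |>.exists_lipschitzOnWith
    have hPc : Continuous fun x : Space d => x - ⟪e, x⟫ • e := by fun_prop
    obtain ⟨ρ, hρ, hball⟩ := Metric.mem_nhds_iff.1 (Filter.inter_mem
      (Metric.ball_mem_nhds x₀ hr) (hPc.continuousAt.preimage_mem_nhds ht))
    -- Moving by `α e + y` raises the height by at least `α - ‖y‖`, and moves the base point by at
    -- most `2‖y‖`, so the graph rises by at most `2K‖y‖`. Hence `(2K + 1)‖y‖ ≤ α` keeps the point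
    -- above the graph.
    set ε : ℝ := 1 / (2 * K + 1) with hε
    have hK0 : (0 : ℝ) ≤ K := K.2
    have hε0 : 0 < ε := by positivity
    have hε1 : ε ≤ 1 := by
      rw [hε, div_le_one (by positivity)]; linarith
    have hεK : ε * (2 * K + 1) = 1 := by rw [hε]; field_simp
    refine ⟨e, he, ε, hε0, ρ / 4, by positivity, Metric.ball x₀ (ρ / 2),
      Metric.ball_mem_nhds _ (half_pos hρ), fun x hx hxD α hα y hy => ?_⟩
    have hα0 := hα.1
    have hy' : ‖y‖ ≤ α := hy.trans (by nlinarith)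
    have hx1 : x ∈ Metric.ball x₀ ρ := Metric.ball_subset_ball (by linarith) hx
    have hz1 : x + α • e + y ∈ Metric.ball x₀ ρ := by
      rw [mem_ball_iff_norm] at hx ⊢
      have e1 : x + α • e + y - x₀ = (x - x₀) + (α • e + y) := by abel
      rw [e1]
      have h1 : ‖α • e‖ = α := by rw [norm_smul, Real.norm_of_nonneg hα0, he, mul_one]
      have h2 := norm_add_le (x - x₀) (α • e + y)
      have h3 := norm_add_le (α • e) y
      linarith [hα.2]
    have hgx := (hgD x (hball hx1).1).1 hxD
    rw [hgD _ (hball hz1).1]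
    have hlip := hK.dist_le_mul _ (hball hz1).2 _ (hball hx1).2
    beta_reduce at hlip
    rw [Real.dist_eq, dist_eq_norm] at hlip
    have hee : ⟪e, e⟫ = (1 : ℝ) := by rw [real_inner_self_eq_norm_sq, he, one_pow]
    have hin2 : ⟪e, x + α • e + y⟫ = ⟪e, x⟫ + α + ⟪e, y⟫ := by
      rw [inner_add_right, inner_add_right, inner_smul_right, hee, mul_one]
    have hey : |⟪e, y⟫| ≤ ‖y‖ := by
      have := abs_real_inner_le_norm e y
      rwa [he, one_mul] at this
    have hP : ‖x + α • e + y - ⟪e, x + α • e + y⟫ • e - (x - ⟪e, x⟫ • e)‖ ≤ 2 * ‖y‖ := by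
      have e1 : x + α • e + y - ⟪e, x + α • e + y⟫ • e - (x - ⟪e, x⟫ • e) = y - ⟪e, y⟫ • e := by
        rw [hin2]; module
      rw [e1]
      refine (norm_sub_le _ _).trans ?_
      rw [norm_smul, he, mul_one, Real.norm_eq_abs]
      linarith
    have h5 := (abs_le.1 hlip).2
    have h6 : (K : ℝ) * ‖x + α • e + y - ⟪e, x + α • e + y⟫ • e - (x - ⟪e, x⟫ • e)‖
        ≤ K * (2 * ‖y‖) := by gcongr
    have h7 := (abs_le.1 hey).1
    have h8 : (2 * K + 1) * ‖y‖ ≤ α := by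
      calc (2 * K + 1) * ‖y‖ ≤ (2 * K + 1) * (ε * α) := by gcongr
        _ = (ε * (2 * K + 1)) * α := by ring
        _ = α := by rw [hεK, one_mul]
    rw [hin2] at h5 h6 ⊢
    linarith

end Cone

/-! ### Integrals along lines in linear coordinates. -/

section LinearCoordinates

/-- Uniqueness of Haar measure up to a positive finite factor. The value of the factor is
irrelevant. -/
theorem exists_map_volume_eq_smul {E F : Type*} [NormedAddCommGroup E] [NormedSpace ℝ E]
    [FiniteDimensional ℝ E] [MeasureSpace E] [BorelSpace E]
    [(volume : Measure E).IsAddHaarMeasure] [NormedAddCommGroup F] [NormedSpace ℝ F]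
    [FiniteDimensional ℝ F] [MeasureSpace F] [BorelSpace F]
    [(volume : Measure F).IsAddHaarMeasure] (L : E ≃L[ℝ] F) :
    ∃ c : ℝ≥0∞, c ≠ 0 ∧ c ≠ ∞ ∧ Measure.map L volume = c • (volume : Measure F) := by
  have : (Measure.map L (volume : Measure E)).IsAddHaarMeasure := L.isAddHaarMeasure_map volume
  refine ⟨(Measure.addHaarScalarFactor (Measure.map L (volume : Measure E))
    (volume : Measure F) : ℝ≥0∞), ?_, ENNReal.coe_ne_top, ?_⟩
  · simpa using (Measure.addHaarScalarFactor_pos_of_isAddHaarMeasure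
      (Measure.map L (volume : Measure E)) (volume : Measure F)).ne'
  · exact Measure.isAddLeftInvariant_eq_smul (Measure.map L (volume : Measure E))
      (volume : Measure F)

/-- Lebesgue integrals in linear coordinates. -/
theorem exists_lintegral_eq_mul_lintegral_comp {E F : Type*} [NormedAddCommGroup E]
    [NormedSpace ℝ E] [FiniteDimensional ℝ E] [MeasureSpace E] [BorelSpace E]
    [(volume : Measure E).IsAddHaarMeasure] [NormedAddCommGroup F] [NormedSpace ℝ F]
    [FiniteDimensional ℝ F] [MeasureSpace F] [BorelSpace F]
    [(volume : Measure F).IsAddHaarMeasure] (L : E ≃L[ℝ] F) :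
    ∃ c : ℝ≥0∞, c ≠ 0 ∧ c ≠ ∞ ∧ ∀ f : F → ℝ≥0∞, ∫⁻ x, f (L x) = c * ∫⁻ y, f y := by
  obtain ⟨c, h0, hi, hc⟩ := exists_map_volume_eq_smul L
  refine ⟨c, h0, hi, fun f => ?_⟩
  have e := L.toHomeomorph.measurableEmbedding.lintegral_map f (μ := (volume : Measure E))
  change ∫⁻ y, f y ∂(Measure.map L volume) = ∫⁻ x, f (L x) at e
  rw [← e, hc, lintegral_smul_measure, smul_eq_mul]

/-- Integrals along the lines of two transversal directions. -/
theorem exists_lintegral_line_mul_line_le {F : Type*} [NormedAddCommGroup F] [NormedSpace ℝ F]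
    [FiniteDimensional ℝ F] [MeasureSpace F] [BorelSpace F]
    [(volume : Measure F).IsAddHaarMeasure] (L : (ℝ × ℝ) ≃L[ℝ] F) :
    ∃ C : ℝ≥0∞, C ≠ ∞ ∧ ∀ Φ Ψ : F → ℝ≥0∞, Measurable Φ → Measurable Ψ →
      ∫⁻ x, (∫⁻ r : ℝ, Φ (x + r • L (1, 0))) * (∫⁻ r : ℝ, Ψ (x + r • L (0, 1)))
        = C * (∫⁻ x, Φ x) * ∫⁻ x, Ψ x := by
  obtain ⟨c, h0, hi, hc⟩ := exists_lintegral_eq_mul_lintegral_comp L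
  refine ⟨c, hi, fun Φ Ψ hΦ hΨ => ?_⟩
  have hLm : Measurable L := L.continuous.measurable
  have e1 : ∀ p : ℝ × ℝ, ∫⁻ r : ℝ, Φ (L p + r • L (1, 0)) = ∫⁻ r : ℝ, Φ (L (r, p.2)) := fun p => by
    rw [← lintegral_add_left_eq_self (fun r : ℝ => Φ (L (r, p.2))) p.1]
    refine lintegral_congr fun r => ?_
    rw [← map_smul, ← map_add, Prod.smul_mk, smul_zero, smul_eq_mul, mul_one, Prod.add_def,
      add_zero]
  have e2 : ∀ p : ℝ × ℝ, ∫⁻ r : ℝ, Ψ (L p + r • L (0, 1)) = ∫⁻ r : ℝ, Ψ (L (p.1, r)) := fun p => by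
    rw [← lintegral_add_left_eq_self (fun r : ℝ => Ψ (L (p.1, r))) p.2]
    refine lintegral_congr fun r => ?_
    rw [← map_smul, ← map_add, Prod.smul_mk, smul_zero, smul_eq_mul, mul_one, Prod.add_def,
      add_zero]
  have key := hc fun x => (∫⁻ r : ℝ, Φ (x + r • L (1, 0))) * (∫⁻ r : ℝ, Ψ (x + r • L (0, 1)))
  simp_rw [e1, e2] at key
  have m1 : Measurable fun p : ℝ × ℝ => Φ (L p) := hΦ.comp hLm
  have m2 : Measurable fun p : ℝ × ℝ => Ψ (L p) := hΨ.comp hLm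
  -- In the coordinates of `L` the first line integral depends on the second coordinate only, and
  -- vice versa, so the integral of the product factorises. This is the two-dimensional
  -- Gagliardo–Nirenberg argument.
  have s1 : ∫⁻ p : ℝ × ℝ, (∫⁻ r : ℝ, Φ (L (r, p.2))) * ∫⁻ r : ℝ, Ψ (L (p.1, r))
      = (∫⁻ p : ℝ × ℝ, Φ (L p)) * ∫⁻ p : ℝ × ℝ, Ψ (L p) := by
    have mA : Measurable fun t : ℝ => ∫⁻ r : ℝ, Φ (L (r, t)) := m1.lintegral_prod_left
    have mB : Measurable fun s : ℝ => ∫⁻ r : ℝ, Ψ (L (s, r)) := m2.lintegral_prod_right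
    simp_rw [mul_comm (∫⁻ r : ℝ, Φ (L (r, _)))]
    rw [Measure.volume_eq_prod, lintegral_prod_mul mB.aemeasurable mA.aemeasurable,
      lintegral_prod_symm _ m1.aemeasurable, lintegral_prod _ m2.aemeasurable, mul_comm]
  rw [s1, hc, hc, mul_assoc] at key
  have := (ENNReal.mul_right_inj h0 hi).1 key
  rw [← this]
  ring

/-- Two transversal directions sweep out the whole plane, from any starting point. -/
theorem exists_lintegral_plane_eq {F : Type*} [NormedAddCommGroup F] [NormedSpace ℝ F]
    [FiniteDimensional ℝ F] [MeasureSpace F] [BorelSpace F]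
    [(volume : Measure F).IsAddHaarMeasure] (L : (ℝ × ℝ) ≃L[ℝ] F) :
    ∃ C : ℝ≥0∞, C ≠ ∞ ∧ ∀ Φ : F → ℝ≥0∞, Measurable Φ → ∀ x,
      ∫⁻ r : ℝ, ∫⁻ r' : ℝ, Φ (x + r • L (1, 0) + r' • L (0, 1)) = C * ∫⁻ x, Φ x := by
  obtain ⟨c, h0, hi, hc⟩ := exists_lintegral_eq_mul_lintegral_comp L
  refine ⟨c, hi, fun Φ hΦ x => ?_⟩
  rw [← lintegral_add_left_eq_self Φ x, ← hc, Measure.volume_eq_prod, lintegral_prod]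
  · refine lintegral_congr fun r => lintegral_congr fun r' => ?_
    rw [← map_smul, ← map_smul, add_assoc, ← map_add]
    simp
  · exact (hΦ.comp (by fun_prop)).aemeasurable

end LinearCoordinates

end SLLB

/-! ### Sobolev inequalities in dimensions one and two. -/

namespace SLLB

variable {d : ℕ}

/-- `x ↦ |f x| + ∑ i, |g i x|` on `D`, extended by zero. -/
noncomputable def jet (D : Opens (Space d)) (f : Space d → ℝ) (g : Fin d → Space d → ℝ) :
    Space d → ℝ≥0∞ :=
  (D : Set (Space d)).indicator fun x => ‖f x‖ₑ + ∑ i, ‖g i x‖ₑ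

/-- The norm of `W^{1,1}(D)`, for `f` with partial derivatives `g`. -/
noncomputable def wOneNorm (D : Opens (Space d)) (f : Space d → ℝ) (g : Fin d → Space d → ℝ) :
    ℝ≥0∞ :=
  ∫⁻ x, jet D f g x

section Jet

variable {D : Opens (Space d)} {v : Space d} {f : Space d → ℝ} {g : Fin d → Space d → ℝ}

theorem aemeasurable_jet (h : ∀ i, WeakDeriv D (coordVec i) f (g i)) (hf : IntegrableOn f D) :
    AEMeasurable (jet D f g) := by
  have hm := D.isOpen.measurableSet
  refine (aemeasurable_indicator_iff hm).2 (hf.aestronglyMeasurable.enorm.add ?_)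
  exact Finset.aemeasurable_fun_sum _ fun i _ =>
    (h i).integrableOn_deriv.aestronglyMeasurable.enorm

theorem wOneNorm_eq (h : ∀ i, WeakDeriv D (coordVec i) f (g i)) (hf : IntegrableOn f D) :
    wOneNorm D f g = (∫⁻ x in (D : Set (Space d)), ‖f x‖ₑ)
      + ∑ i, ∫⁻ x in (D : Set (Space d)), ‖g i x‖ₑ := by
  rw [wOneNorm, jet, lintegral_indicator D.isOpen.measurableSet,
    lintegral_add_left' hf.aestronglyMeasurable.enorm, lintegral_finsetSum' _ fun i _ =>
      (h i).integrableOn_deriv.aestronglyMeasurable.enorm]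

/-- The derivative in the direction `v` is a combination of the partial derivatives with
coefficients bounded by `‖v‖`, so a single density serves all directions. -/
theorem enorm_le_lintegral_jet (h : ∀ i, WeakDeriv D (coordVec i) f (g i)) (hf : IntegrableOn f D)
    {a : ℝ} (ha : 0 < a) (v : Space d) :
    ∀ᵐ x : Space d, (∀ r ∈ Set.Icc 0 a, x + r • v ∈ D) →
      ‖f x‖ₑ ≤ (ENNReal.ofReal a⁻¹ + ‖v‖ₑ) * ∫⁻ r in Set.Icc 0 a, jet D f g (x + r • v) := by
  filter_upwards [(WeakDeriv.of_partials h hf v).enorm_le_lintegral_segment ha] with x hx hseg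
  refine (hx hseg).trans ?_
  rw [← lintegral_const_mul' _ _ (by finiteness)]
  refine setLIntegral_mono' measurableSet_Icc fun r hr => ?_
  have hD : x + r • v ∈ (D : Set (Space d)) := hseg r hr
  rw [WeakDeriv.stepDensity, jet, Set.indicator_of_mem hD, Set.indicator_of_mem hD,
    Set.indicator_of_mem hD, add_mul]
  gcongr
  · exact le_self_add
  · refine (enorm_sum_le _ _).trans ?_
    refine le_trans ?_ (mul_le_mul_right le_add_self _)
    rw [Finset.mul_sum]
    gcongr with i
    rw [enorm_mul]
    gcongr
    rw [← ofReal_norm, ← ofReal_norm]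
    exact ENNReal.ofReal_le_ofReal (EuclideanSpace.norm_eq v ▸ by
      refine Real.le_sqrt_of_sq_le ?_
      exact Finset.single_le_sum (f := fun i => ‖v i‖ ^ 2) (fun i _ => sq_nonneg _)
        (Finset.mem_univ i))

/-- Jets are only almost everywhere measurable, whereas Fubini in line coordinates asks for
measurable densities. On almost every line the density may be exchanged for a measurable version. -/
theorem ae_lintegral_line_mk {Φ : Space d → ℝ≥0∞} (hΦ : AEMeasurable Φ) (v : Space d) :
    ∀ᵐ x, ∀ s : Set ℝ, ∫⁻ r in s, Φ (x + r • v) = ∫⁻ r in s, hΦ.mk Φ (x + r • v) := by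
  filter_upwards [ae_ae_add_smul hΦ.ae_eq_mk v] with x hx s
  exact lintegral_congr_ae (ae_restrict_of_ae hx)

end Jet

section Coordinates

/-- Take `e` and `e + ε f`, with `f` a unit vector orthogonal to the axis `e` of the cone. A
combination with coefficients `r, r' ≥ 0` is `(r + r') e + r' ε f`, which stays in the cone, and `a`
is halved because `r + r'` must not exceed the height of the cone. -/
theorem exists_transversal_cone {D : Set (Space 2)} (hDo : IsOpen D) (hD : HasC2Boundary D)
    {x₀ : Space 2} (hx₀ : x₀ ∈ closure D) :
    ∃ L : (ℝ × ℝ) ≃L[ℝ] Space 2, ∃ a > (0 : ℝ), ∃ N ∈ 𝓝 x₀, ∀ x ∈ N, x ∈ D →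
      ∀ r ∈ Set.Icc 0 a, ∀ r' ∈ Set.Icc 0 a, x + r • L (1, 0) + r' • L (0, 1) ∈ D := by
  obtain ⟨e, he, ε, hε, a, ha, N, hN, hcone⟩ := exists_cone two_pos hDo hD hx₀
  have he2 : e 0 ^ 2 + e 1 ^ 2 = 1 := by
    have := EuclideanSpace.norm_sq_eq e
    rw [he, Fin.sum_univ_two] at this
    simpa using this.symm
  set f : Space 2 := !₂[-e 1, e 0] with hf
  have hfn : ‖f‖ = 1 := by
    have : ‖f‖ ^ 2 = 1 := by
      rw [EuclideanSpace.norm_sq_eq, Fin.sum_univ_two]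
      simp [hf]
      linarith
    nlinarith [norm_nonneg f]
  let A : (ℝ × ℝ) →ₗ[ℝ] Space 2 :=
    (LinearMap.fst ℝ ℝ ℝ).smulRight e + (LinearMap.snd ℝ ℝ ℝ).smulRight (e + ε • f)
  have hA : ∀ p, A p = p.1 • e + p.2 • (e + ε • f) := fun p => rfl
  have hinj : Function.Injective A := by
    rw [← LinearMap.ker_eq_bot, LinearMap.ker_eq_bot']
    intro p hp
    rw [hA] at hp
    have h0 := congrArg (fun z : Space 2 => z 0) hp
    have h1 := congrArg (fun z : Space 2 => z 1) hp
    simp [hf] at h0 h1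
    have k2 : p.2 * ε = 0 := by
      have : p.2 * ε * (e 0 ^ 2 + e 1 ^ 2) = 0 := by linear_combination e 0 * h1 - e 1 * h0
      rwa [he2, mul_one] at this
    have k2' : p.2 = 0 := (mul_eq_zero.1 k2).resolve_right hε.ne'
    have k1 : p.1 = 0 := by
      have : p.1 * (e 0 ^ 2 + e 1 ^ 2) = 0 := by
        rw [k2'] at h0 h1
        linear_combination e 0 * h0 + e 1 * h1
      rwa [he2, mul_one] at this
    exact Prod.ext k1 k2'
  let L : (ℝ × ℝ) ≃L[ℝ] Space 2 :=
    (LinearEquiv.ofInjectiveOfFinrankEq A hinj (by simp)).toContinuousLinearEquiv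
  have hL : ∀ p, L p = p.1 • e + p.2 • (e + ε • f) := fun p => rfl
  refine ⟨L, a / 2, by positivity, N, hN, fun x hx hxD r hr r' hr' => ?_⟩
  have := hcone x hx hxD (r + r') ⟨by linarith [hr.1, hr'.1], by linarith [hr.2, hr'.2]⟩
    ((r' * ε) • f) (by
      rw [norm_smul, hfn, mul_one, Real.norm_of_nonneg (mul_nonneg hr'.1 hε.le)]
      nlinarith [hr.1])
  convert this using 1
  rw [hL, hL]
  module

theorem exists_line_cone {D : Set (Space 1)} (hDo : IsOpen D) (hD : HasC2Boundary D)
    {x₀ : Space 1} (hx₀ : x₀ ∈ closure D) :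
    ∃ L : ℝ ≃L[ℝ] Space 1, ∃ a > (0 : ℝ), ∃ N ∈ 𝓝 x₀, ∀ x ∈ N, x ∈ D →
      ∀ r ∈ Set.Icc 0 a, x + r • L 1 ∈ D := by
  obtain ⟨e, he, ε, hε, a, ha, N, hN, hcone⟩ := exists_cone one_pos hDo hD hx₀
  have he0 : e ≠ 0 := fun h => by simp [h] at he
  let A : ℝ →ₗ[ℝ] Space 1 := LinearMap.toSpanSingleton ℝ _ e
  have hinj : Function.Injective A := smul_left_injective ℝ he0
  let L : ℝ ≃L[ℝ] Space 1 :=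
    (LinearEquiv.ofInjectiveOfFinrankEq A hinj (by simp)).toContinuousLinearEquiv
  have hL : L 1 = e := one_smul ℝ e
  refine ⟨L, a, ha, N, hN, fun x hx hxD r hr => ?_⟩
  have := hcone x hx hxD r hr 0 (by simpa using mul_nonneg hε.le hr.1)
  rwa [hL, ← add_zero (x + r • e)]

end Coordinates

section Local

/-- The `W^{1,1}` bound for products near a boundary point, in dimension two. -/
theorem exists_local_product_bound_two {D : Opens (Space 2)}
    (hD : HasC2Boundary (D : Set (Space 2))) {x₀ : Space 2} (hx₀ : x₀ ∈ closure (D : Set (Space 2))) :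
    ∃ N ∈ 𝓝 x₀, ∃ C : ℝ≥0∞, C ≠ ∞ ∧ ∀ (φ ψ : Space 2 → ℝ) (φ' ψ' : Fin 2 → Space 2 → ℝ),
      (∀ i, WeakDeriv D (coordVec i) φ (φ' i)) → (∀ i, WeakDeriv D (coordVec i) ψ (ψ' i)) →
      ∫⁻ x in N ∩ D, ‖φ x‖ₑ * ‖ψ x‖ₑ ≤ C * wOneNorm D φ φ' * wOneNorm D ψ ψ' := by
  obtain ⟨L, a, ha, N, hN, hcone⟩ := exists_transversal_cone D.isOpen hD hx₀
  obtain ⟨N', hN'N, hN'o, hxN'⟩ := mem_nhds_iff.1 hN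
  obtain ⟨C, hC, hline⟩ := exists_lintegral_line_mul_line_le L
  set K := (ENNReal.ofReal a⁻¹ + ‖L (1, 0)‖ₑ) * (ENNReal.ofReal a⁻¹ + ‖L (0, 1)‖ₑ) with hK
  have hKf : K ≠ ∞ := by rw [hK]; finiteness
  refine ⟨N', hN'o.mem_nhds hxN', K * C, by finiteness, fun φ ψ φ' ψ' hφ hψ => ?_⟩
  have jφ := aemeasurable_jet hφ (hφ 0).integrableOn
  have jψ := aemeasurable_jet hψ (hψ 0).integrableOn
  -- Each factor is bounded by a line integral in its own direction, so that the integral of the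
  -- product of the bounds splits.
  have key : ∀ᵐ x, x ∈ N' ∩ D → ‖φ x‖ₑ * ‖ψ x‖ₑ ≤ K * ((∫⁻ r : ℝ, jφ.mk _ (x + r • L (1, 0)))
      * ∫⁻ r : ℝ, jψ.mk _ (x + r • L (0, 1))) := by
    filter_upwards [enorm_le_lintegral_jet hφ (hφ 0).integrableOn ha (L (1, 0)),
      enorm_le_lintegral_jet hψ (hψ 0).integrableOn ha (L (0, 1)),
      ae_lintegral_line_mk jφ (L (1, 0)), ae_lintegral_line_mk jψ (L (0, 1))] with x h1 h2 h3 h4 hx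
    have hc := hcone x (hN'N hx.1) hx.2
    have b1 := h1 fun r hr => by simpa using hc r hr 0 ⟨le_rfl, ha.le⟩
    have b2 := h2 fun r hr => by simpa using hc 0 ⟨le_rfl, ha.le⟩ r hr
    rw [h3] at b1
    rw [h4] at b2
    rw [hK, mul_mul_mul_comm]
    exact mul_le_mul' (b1.trans (by gcongr; exact Measure.restrict_le_self))
      (b2.trans (by gcongr; exact Measure.restrict_le_self))
  calc ∫⁻ x in N' ∩ D, ‖φ x‖ₑ * ‖ψ x‖ₑ
      ≤ ∫⁻ x in N' ∩ D, K * ((∫⁻ r : ℝ, jφ.mk _ (x + r • L (1, 0)))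
        * ∫⁻ r : ℝ, jψ.mk _ (x + r • L (0, 1))) :=
        lintegral_mono_ae ((ae_restrict_iff' (hN'o.inter D.isOpen).measurableSet).2 key)
    _ ≤ ∫⁻ x, K * ((∫⁻ r : ℝ, jφ.mk _ (x + r • L (1, 0)))
        * ∫⁻ r : ℝ, jψ.mk _ (x + r • L (0, 1))) := lintegral_mono' Measure.restrict_le_self le_rfl
    _ = K * C * wOneNorm D φ φ' * wOneNorm D ψ ψ' := by
        rw [lintegral_const_mul' _ _ hKf, hline _ _ jφ.measurable_mk jψ.measurable_mk,
          ← lintegral_congr_ae jφ.ae_eq_mk, ← lintegral_congr_ae jψ.ae_eq_mk, wOneNorm, wOneNorm]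
        ring

/-- The embedding of `W^{2,1}` into `L^∞` near a boundary point, in dimension two. -/
theorem exists_local_sup_bound_two {D : Opens (Space 2)}
    (hD : HasC2Boundary (D : Set (Space 2))) {x₀ : Space 2} (hx₀ : x₀ ∈ closure (D : Set (Space 2))) :
    ∃ N ∈ 𝓝 x₀, ∃ C : ℝ≥0∞, C ≠ ∞ ∧ ∀ (f : Space 2 → ℝ) (f' : Fin 2 → Space 2 → ℝ)
      (f'' : Fin 2 → Fin 2 → Space 2 → ℝ),
      (∀ i, WeakDeriv D (coordVec i) f (f' i)) →
      (∀ i j, WeakDeriv D (coordVec j) (f' i) (f'' i j)) →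
      ∀ᵐ x, x ∈ N → x ∈ D →
        ‖f x‖ₑ ≤ C * (wOneNorm D f f' + ∑ i, wOneNorm D (f' i) (f'' i)) := by
  obtain ⟨L, a, ha, N, hN, hcone⟩ := exists_transversal_cone D.isOpen hD hx₀
  obtain ⟨C, hC, hplane⟩ := exists_lintegral_plane_eq L
  set K := (ENNReal.ofReal a⁻¹ + ‖L (1, 0)‖ₑ) with hK
  set K' := (ENNReal.ofReal a⁻¹ + ‖L (0, 1)‖ₑ) with hK'
  have hKf : K ≠ ∞ := by rw [hK]; finiteness
  have hKf' : K' ≠ ∞ := by rw [hK']; finiteness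
  refine ⟨N, hN, K * (K' * C), by finiteness, fun f f' f'' hf hf' => ?_⟩
  have j0 := aemeasurable_jet hf (hf 0).integrableOn
  have j1 := fun i => aemeasurable_jet (hf' i) (hf' i 0).integrableOn
  let Θ : Space 2 → ℝ≥0∞ := fun x => jet D f f' x + ∑ i, jet D (f' i) (f'' i) x
  have hΘ : AEMeasurable Θ := j0.add (Finset.aemeasurable_fun_sum _ fun i _ => j1 i)
  have iΘ : ∫⁻ x, Θ x = wOneNorm D f f' + ∑ i, wOneNorm D (f' i) (f'' i) := by
    rw [lintegral_add_left' j0, lintegral_finsetSum' _ fun i _ => j1 i]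
    rfl
  -- One segment in the second direction bounds the function and its first derivatives together.
  -- Integrating this over a segment in the first direction gives a plane integral of the jets up to
  -- second order.
  have step : ∀ᵐ y, (∀ r ∈ Set.Icc 0 a, y + r • L (0, 1) ∈ D) →
      jet D f f' y ≤ K' * ∫⁻ r : ℝ, hΘ.mk _ (y + r • L (0, 1)) := by
    filter_upwards [enorm_le_lintegral_jet hf (hf 0).integrableOn ha (L (0, 1)),
      ae_all_iff.2 fun i => enorm_le_lintegral_jet (hf' i) (hf' i 0).integrableOn ha (L (0, 1)),
      ae_lintegral_line_mk hΘ (L (0, 1)), ae_ae_add_smul (p := fun y => ∀ i, jet D (f' i) (f'' i) y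
        = (j1 i).mk _ y) (ae_all_iff.2 fun i => (j1 i).ae_eq_mk) (L (0, 1)),
      ae_lintegral_line_mk j0 (L (0, 1)),
      ae_ae_add_smul j0.ae_eq_mk (L (0, 1))] with y h0 h1 h2 h3 h4 h5 hseg
    have hy : y ∈ (D : Set (Space 2)) := by simpa using hseg 0 ⟨le_rfl, ha.le⟩
    have m : ∀ v : Space 2, Measurable fun r : ℝ => y + r • v := fun v => by fun_prop
    have a0 : AEMeasurable (fun r : ℝ => jet D f f' (y + r • L (0, 1)))
        (volume.restrict (Set.Icc 0 a)) :=
      ((j0.measurable_mk.comp (m _)).aemeasurable.congr (h5.mono fun r hr => hr.symm)).restrict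
    have a1 : ∀ i, AEMeasurable (fun r : ℝ => jet D (f' i) (f'' i) (y + r • L (0, 1)))
        (volume.restrict (Set.Icc 0 a)) := fun i =>
      (((j1 i).measurable_mk.comp (m _)).aemeasurable.congr
        (h3.mono fun r hr => (hr i).symm)).restrict
    rw [jet, Set.indicator_of_mem hy]
    calc ‖f y‖ₑ + ∑ i, ‖f' i y‖ₑ
        ≤ K' * (∫⁻ r in Set.Icc 0 a, jet D f f' (y + r • L (0, 1)))
          + ∑ i, K' * ∫⁻ r in Set.Icc 0 a, jet D (f' i) (f'' i) (y + r • L (0, 1)) :=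
          add_le_add (h0 hseg) (Finset.sum_le_sum fun i _ => h1 i hseg)
      _ = K' * ∫⁻ r in Set.Icc 0 a, Θ (y + r • L (0, 1)) := by
          rw [lintegral_add_left' a0, lintegral_finsetSum' _ fun i _ => a1 i, mul_add,
            Finset.mul_sum]
      _ ≤ K' * ∫⁻ r : ℝ, hΘ.mk _ (y + r • L (0, 1)) := by
          rw [h2]
          gcongr
          exact Measure.restrict_le_self
  filter_upwards [enorm_le_lintegral_jet hf (hf 0).integrableOn ha (L (1, 0)),
    ae_ae_add_smul step (L (1, 0))] with x h0 h1 hxN hxD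
  have hc := hcone x hxN hxD
  refine (h0 fun r hr => by simpa using hc r hr 0 ⟨le_rfl, ha.le⟩).trans ?_
  rw [mul_assoc]
  refine mul_le_mul_right ?_ _
  calc ∫⁻ r in Set.Icc 0 a, jet D f f' (x + r • L (1, 0))
      ≤ ∫⁻ r in Set.Icc 0 a, K' * ∫⁻ r' : ℝ, hΘ.mk _ (x + r • L (1, 0) + r' • L (0, 1)) :=
        lintegral_mono_ae ((ae_restrict_iff' measurableSet_Icc).2
          (h1.mono fun r hr hra => hr fun r' hr' => hc r hra r' hr'))
    _ ≤ ∫⁻ r : ℝ, K' * ∫⁻ r' : ℝ, hΘ.mk _ (x + r • L (1, 0) + r' • L (0, 1)) :=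
        lintegral_mono' Measure.restrict_le_self le_rfl
    _ = K' * C * (wOneNorm D f f' + ∑ i, wOneNorm D (f' i) (f'' i)) := by
        rw [lintegral_const_mul' _ _ hKf', hplane _ hΘ.measurable_mk, ← iΘ,
          lintegral_congr_ae hΘ.ae_eq_mk, mul_assoc]

/-- The embedding of `W^{1,1}` into `L^∞` near a boundary point, in dimension one. -/
theorem exists_local_sup_bound_one {D : Opens (Space 1)}
    (hD : HasC2Boundary (D : Set (Space 1))) {x₀ : Space 1} (hx₀ : x₀ ∈ closure (D : Set (Space 1))) :
    ∃ N ∈ 𝓝 x₀, ∃ C : ℝ≥0∞, C ≠ ∞ ∧ ∀ (f : Space 1 → ℝ) (f' : Fin 1 → Space 1 → ℝ),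
      (∀ i, WeakDeriv D (coordVec i) f (f' i)) →
      ∀ᵐ x, x ∈ N → x ∈ D → ‖f x‖ₑ ≤ C * wOneNorm D f f' := by
  obtain ⟨L, a, ha, N, hN, hcone⟩ := exists_line_cone D.isOpen hD hx₀
  obtain ⟨c, h0, hi, hc⟩ := exists_lintegral_eq_mul_lintegral_comp L
  set K := (ENNReal.ofReal a⁻¹ + ‖L 1‖ₑ) with hK
  have hKf : K ≠ ∞ := by rw [hK]; finiteness
  refine ⟨N, hN, K * c, by finiteness, fun f f' hf => ?_⟩
  filter_upwards [enorm_le_lintegral_jet hf (hf 0).integrableOn ha (L 1)] with x h1 hxN hxD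
  refine (h1 (hcone x hxN hxD)).trans ?_
  rw [mul_assoc]
  refine mul_le_mul_right ((lintegral_mono' Measure.restrict_le_self le_rfl).trans_eq ?_) _
  rw [wOneNorm, ← lintegral_add_left_eq_self (jet D f f') x, ← hc]
  refine lintegral_congr fun r => ?_
  rw [← map_smul, smul_eq_mul, mul_one]

end Local

section Global

variable {D : Opens (Space d)}

/-- The embedding of `W^{2,1}(D)` into `L^∞(D)`, in dimensions one and two. -/
theorem exists_sup_bound (hd : d = 1 ∨ d = 2) (hDb : Bornology.IsBounded (D : Set (Space d)))
    (hD : HasC2Boundary (D : Set (Space d))) :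
    ∃ C : ℝ≥0∞, C ≠ ∞ ∧ ∀ (f : Space d → ℝ) (f' : Fin d → Space d → ℝ)
      (f'' : Fin d → Fin d → Space d → ℝ),
      (∀ i, WeakDeriv D (coordVec i) f (f' i)) →
      (∀ i j, WeakDeriv D (coordVec j) (f' i) (f'' i j)) →
      ∀ᵐ x ∂(volOn D),
        ‖f x‖ₑ ≤ C * (wOneNorm D f f' + ∑ i, wOneNorm D (f' i) (f'' i)) := by
  have hloc : ∀ x₀ ∈ closure (D : Set (Space d)), ∃ N ∈ 𝓝 x₀, ∃ C : ℝ≥0∞, C ≠ ∞ ∧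
      ∀ (f : Space d → ℝ) (f' : Fin d → Space d → ℝ) (f'' : Fin d → Fin d → Space d → ℝ),
      (∀ i, WeakDeriv D (coordVec i) f (f' i)) →
      (∀ i j, WeakDeriv D (coordVec j) (f' i) (f'' i j)) →
      ∀ᵐ x, x ∈ N → x ∈ D →
        ‖f x‖ₑ ≤ C * (wOneNorm D f f' + ∑ i, wOneNorm D (f' i) (f'' i)) := by
    intro x₀ hx₀
    rcases hd with rfl | rfl
    · obtain ⟨N, hN, C, hC, h⟩ := exists_local_sup_bound_one hD hx₀
      refine ⟨N, hN, C, hC, fun f f' f'' hf _ => ?_⟩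
      filter_upwards [h f f' hf] with x hx hxN hxD
      exact (hx hxN hxD).trans (mul_le_mul_right le_self_add _)
    · exact exists_local_sup_bound_two hD hx₀
  -- Compactness of the closure globalises the local bound; the constants of finitely many
  -- neighbourhoods are added.
  obtain ⟨C, hC, h⟩ := hDb.isCompact_closure.induction_on (p := fun s => ∃ C : ℝ≥0∞, C ≠ ∞ ∧
      ∀ (f : Space d → ℝ) (f' : Fin d → Space d → ℝ) (f'' : Fin d → Fin d → Space d → ℝ),
      (∀ i, WeakDeriv D (coordVec i) f (f' i)) →
      (∀ i j, WeakDeriv D (coordVec j) (f' i) (f'' i j)) →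
      ∀ᵐ x, x ∈ s → x ∈ D →
        ‖f x‖ₑ ≤ C * (wOneNorm D f f' + ∑ i, wOneNorm D (f' i) (f'' i)))
    ⟨0, by simp, fun _ _ _ _ _ => by simp⟩
    (fun s t hst ⟨C, hC, h⟩ => ⟨C, hC, fun f f' f'' h1 h2 =>
      (h f f' f'' h1 h2).mono fun x hx hxs => hx (hst hxs)⟩)
    (fun s t ⟨C, hC, h⟩ ⟨C', hC', h'⟩ => ⟨C + C', by finiteness, fun f f' f'' h1 h2 => by
      filter_upwards [h f f' f'' h1 h2, h' f f' f'' h1 h2] with x hx hx' hxs hxD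
      rcases hxs with hxs | hxs
      · exact (hx hxs hxD).trans (mul_le_mul_left le_self_add _)
      · exact (hx' hxs hxD).trans (mul_le_mul_left le_add_self _)⟩)
    (fun x hx => by
      obtain ⟨N, hN, C, hC, h⟩ := hloc x hx
      exact ⟨N, mem_nhdsWithin_of_mem_nhds hN, C, hC, h⟩)
  refine ⟨C, hC, fun f f' f'' h1 h2 => ?_⟩
  rw [volOn, ae_restrict_iff' D.isOpen.measurableSet]
  exact (h f f' f'' h1 h2).mono fun x hx hxD => hx (subset_closure hxD) hxD

/-- `∫ |φ ψ|` is bounded by the product of the norms of `W^{1,1}(D)`, in dimensions one and two. -/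
theorem exists_product_bound (hd : d = 1 ∨ d = 2) (hDb : Bornology.IsBounded (D : Set (Space d)))
    (hD : HasC2Boundary (D : Set (Space d))) :
    ∃ C : ℝ≥0∞, C ≠ ∞ ∧ ∀ (φ ψ : Space d → ℝ) (φ' ψ' : Fin d → Space d → ℝ),
      (∀ i, WeakDeriv D (coordVec i) φ (φ' i)) → (∀ i, WeakDeriv D (coordVec i) ψ (ψ' i)) →
      ∫⁻ x in D, ‖φ x‖ₑ * ‖ψ x‖ₑ ≤ C * wOneNorm D φ φ' * wOneNorm D ψ ψ' := by
  have hloc : ∀ x₀ ∈ closure (D : Set (Space d)), ∃ N ∈ 𝓝 x₀, ∃ C : ℝ≥0∞, C ≠ ∞ ∧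
      ∀ (φ ψ : Space d → ℝ) (φ' ψ' : Fin d → Space d → ℝ),
      (∀ i, WeakDeriv D (coordVec i) φ (φ' i)) → (∀ i, WeakDeriv D (coordVec i) ψ (ψ' i)) →
      ∫⁻ x in N ∩ D, ‖φ x‖ₑ * ‖ψ x‖ₑ ≤ C * wOneNorm D φ φ' * wOneNorm D ψ ψ' := by
    intro x₀ hx₀
    rcases hd with rfl | rfl
    · obtain ⟨N, hN, C, hC, h⟩ := exists_local_sup_bound_one hD hx₀
      obtain ⟨N', hN'N, hN'o, hxN'⟩ := mem_nhds_iff.1 hN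
      refine ⟨N', hN'o.mem_nhds hxN', C, hC, fun φ ψ φ' ψ' hφ hψ => ?_⟩
      -- In dimension one a single factor is already bounded by its `W^{1,1}` norm, and the other
      -- one is simply integrated.
      calc ∫⁻ x in N' ∩ D, ‖φ x‖ₑ * ‖ψ x‖ₑ
          ≤ ∫⁻ x in N' ∩ D, C * wOneNorm D φ φ' * ‖ψ x‖ₑ :=
            lintegral_mono_ae ((ae_restrict_iff' (hN'o.inter D.isOpen).measurableSet).2
              ((h φ φ' hφ).mono fun x hx hxm => mul_le_mul_left (hx (hN'N hxm.1) hxm.2) _))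
        _ ≤ ∫⁻ x in D, C * wOneNorm D φ φ' * ‖ψ x‖ₑ := lintegral_mono_set Set.inter_subset_right
        _ = C * wOneNorm D φ φ' * ∫⁻ x in D, ‖ψ x‖ₑ :=
            lintegral_const_mul'' _ (hψ 0).integrableOn.aestronglyMeasurable.enorm
        _ ≤ C * wOneNorm D φ φ' * wOneNorm D ψ ψ' := by
            rw [wOneNorm_eq hψ (hψ 0).integrableOn]
            exact mul_le_mul_right le_self_add _
    · exact exists_local_product_bound_two hD hx₀
  obtain ⟨C, hC, h⟩ := hDb.isCompact_closure.induction_on (p := fun s => ∃ C : ℝ≥0∞, C ≠ ∞ ∧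
      ∀ (φ ψ : Space d → ℝ) (φ' ψ' : Fin d → Space d → ℝ),
      (∀ i, WeakDeriv D (coordVec i) φ (φ' i)) → (∀ i, WeakDeriv D (coordVec i) ψ (ψ' i)) →
      ∫⁻ x in s ∩ D, ‖φ x‖ₑ * ‖ψ x‖ₑ ≤ C * wOneNorm D φ φ' * wOneNorm D ψ ψ')
    ⟨0, by simp, fun _ _ _ _ _ _ => by simp⟩
    (fun s t hst ⟨C, hC, h⟩ => ⟨C, hC, fun φ ψ φ' ψ' h1 h2 =>
      (lintegral_mono_set (Set.inter_subset_inter_left _ hst)).trans (h φ ψ φ' ψ' h1 h2)⟩)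
    (fun s t ⟨C, hC, h⟩ ⟨C', hC', h'⟩ => ⟨C + C', by finiteness, fun φ ψ φ' ψ' h1 h2 => by
      rw [Set.union_inter_distrib_right, add_mul, add_mul]
      exact (lintegral_union_le _ _ _).trans
        (add_le_add (h φ ψ φ' ψ' h1 h2) (h' φ ψ φ' ψ' h1 h2))⟩)
    (fun x hx => by
      obtain ⟨N, hN, C, hC, h⟩ := hloc x hx
      exact ⟨N, mem_nhdsWithin_of_mem_nhds hN, C, hC, h⟩)
  refine ⟨C, hC, fun φ ψ φ' ψ' h1 h2 => ?_⟩
  have := h φ ψ φ' ψ' h1 h2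
  rwa [Set.inter_eq_right.2 subset_closure] at this

end Global

end SLLB

/-! ### Test vectors in `𝕃²` and linear calculus of weak derivatives. -/

namespace SLLB

variable {d : ℕ} {D : Opens (Space d)}

theorem isFiniteMeasure_volOn (hDb : Bornology.IsBounded (D : Set (Space d))) :
    IsFiniteMeasure (volOn D) :=
  ⟨by rw [Measure.restrict_apply_univ]; exact hDb.measure_lt_top⟩

theorem coeFn_toL2 {f : Space d → Spin} (h : MemLp f 2 (volOn D)) : toL2 D f =ᵐ[volOn D] f := by
  rw [toL2, dif_pos h]
  exact h.coeFn_toLp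

/-- The `k`-th coordinate of a spin. -/
noncomputable abbrev spinProj (k : Fin 3) : Spin →L[ℝ] ℝ := EuclideanSpace.proj k

theorem memLp_component {f : Space d → Spin} {p : ℝ≥0∞} {μ : Measure (Space d)} (h : MemLp f p μ)
    (k : Fin 3) : MemLp (fun x => f x k) p μ :=
  (spinProj k).comp_memLp' h

section TestVectors

/-- The element `φ e_k` of `𝕃²`. -/
noncomputable def testVec (D : Opens (Space d)) (φ : Space d → ℝ) (k : Fin 3) : L2 D :=
  toL2 D fun x => φ x • (coordVec k : Spin)

theorem inner_testVec {φ : Space d → ℝ} (hφ : Continuous φ) (hc : HasCompactSupport φ) (k : Fin 3)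
    (f : L2 D) : ⟪testVec D φ k, f⟫ = ∫ x in (D : Set (Space d)), φ x * f x k := by
  have hm : MemLp (fun x => φ x • (coordVec k : Spin)) 2 (volOn D) :=
    (Continuous.memLp_of_hasCompactSupport (hφ.smul continuous_const)
      hc.smul_right).restrict _
  rw [L2.inner_def]
  refine integral_congr_ae ?_
  filter_upwards [coeFn_toL2 hm] with x hx
  rw [testVec, hx, real_inner_smul_left]
  simp [coordVec, EuclideanSpace.inner_single_left]

/-- The test vectors span a dense subspace of `𝕃²`. -/
theorem eq_zero_of_inner_testVec {f : L2 D}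
    (h : ∀ (φ : 𝓓(D, ℝ)) (k : Fin 3), ⟪testVec D φ k, f⟫ = 0) : f = 0 := by
  have hf : LocallyIntegrableOn f (D : Set (Space d)) := by
    have := (Lp.memLp f).locallyIntegrable (by norm_num)
    exact (locallyIntegrableOn_of_locallyIntegrable_restrict this)
  have key : ∀ᵐ x, x ∈ (D : Set (Space d)) → f x = 0 := by
    have hk : ∀ k : Fin 3, ∀ᵐ x, x ∈ (D : Set (Space d)) → f x k = 0 := fun k => by
      refine D.isOpen.ae_eq_zero_of_integral_contDiff_smul_eq_zero
        (f := fun x => f x k) ?_ fun φ hφ hc hs => ?_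
      · exact fun x hx => by
          obtain ⟨s, hs, hi⟩ := hf x hx
          exact ⟨s, hs, (spinProj k).integrable_comp hi⟩
      · have := h ⟨φ, hφ, hc, hs⟩ k
        rw [inner_testVec (TestFunction.continuous _) (TestFunction.hasCompactSupport _)] at this
        rw [← this, setIntegral_eq_integral_of_forall_compl_eq_zero]
        · rfl
        · intro x hx
          have : φ x = 0 := image_eq_zero_of_notMem_tsupport fun hx' => hx (hs hx')
          simp [this]
    filter_upwards [ae_all_iff.2 hk] with x hx hxD
    ext k
    exact hx k hxD
  refine Lp.ext ?_
  have h0 : f =ᵐ[volOn D] fun _ => (0 : Spin) :=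
    (ae_restrict_iff' D.isOpen.measurableSet).2 key
  exact h0.trans (Lp.coeFn_zero _ _ _).symm

theorem topologicalClosure_span_testVec :
    (Submodule.span ℝ (Set.range fun p : 𝓓(D, ℝ) × Fin 3 => testVec D p.1 p.2)).topologicalClosure
      = ⊤ := by
  rw [Submodule.topologicalClosure_eq_top_iff, Submodule.eq_bot_iff]
  intro f hf
  rw [Submodule.mem_orthogonal] at hf
  exact eq_zero_of_inner_testVec fun φ k => hf _ (Submodule.subset_span ⟨(φ, k), rfl⟩)

end TestVectors

section WeakPartial

variable [IsFiniteMeasure (volOn D)]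

theorem isWeakPartial_iff_weakDeriv {i : Fin d} {f g : Space d → Spin} (hf : IntegrableOn f D)
    (hg : IntegrableOn g D) :
    IsWeakPartial D i f g ↔ ∀ k, WeakDeriv D (coordVec i) (fun x => f x k) (fun x => g x k) := by
  let π := fun k : Fin 3 => spinProj k
  have key : ∀ φ : 𝓓(D, ℝ), IntegrableOn (fun x => (fderiv ℝ φ x (coordVec i)) • f x) D
      ∧ IntegrableOn (fun x => φ x • g x) D := fun φ => by
    have hφ : ContDiff ℝ (⊤ : ℕ∞) φ := φ.contDiff
    obtain ⟨C, -, hC⟩ := WeakDeriv.exists_norm_le_of_compactSupport hφ.continuous φ.hasCompactSupport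
    obtain ⟨C', -, hC'⟩ := WeakDeriv.exists_norm_le_of_compactSupport
      (WeakDeriv.continuous_fderiv_apply hφ (coordVec i))
      (WeakDeriv.hasCompactSupport_fderiv_apply φ.hasCompactSupport (coordVec i))
    exact ⟨hf.bdd_smul C'
      (WeakDeriv.continuous_fderiv_apply hφ _).aestronglyMeasurable (Eventually.of_forall hC'),
      hg.bdd_smul C hφ.continuous.aestronglyMeasurable (Eventually.of_forall hC)⟩
  have e1 : ∀ (φ : 𝓓(D, ℝ)) k, (∫ x in (D : Set (Space d)),
      (fderiv ℝ φ x (coordVec i)) • f x) k = ∫ x in (D : Set (Space d)),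
      fderiv ℝ φ x (coordVec i) * f x k := fun φ k =>
    ((π k).integral_comp_comm (key φ).1).symm
  have e2 : ∀ (φ : 𝓓(D, ℝ)) k, (∫ x in (D : Set (Space d)), φ x • g x) k
      = ∫ x in (D : Set (Space d)), φ x * g x k := fun φ k =>
    ((π k).integral_comp_comm (key φ).2).symm
  constructor
  · rintro ⟨-, -, h⟩ k
    refine ⟨(π k).integrable_comp hf, (π k).integrable_comp hg, fun φ => ?_⟩
    rw [← e1, ← e2, h φ]
    rfl
  · intro h
    refine ⟨hf.locallyIntegrableOn, hg.locallyIntegrableOn, fun φ => ?_⟩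
    ext k
    rw [e1, (h k).eq φ, ← e2]
    rfl

theorem integrableOn_coeFn (f : L2 D) : IntegrableOn f (D : Set (Space d)) :=
  (Lp.memLp f).integrable (by norm_num)

/-- Weak differentiability as a family of linear identities against fixed vectors of `𝕃²`.
Uniqueness, linearity and, later, measurability of the derivative are read off from this form. -/
theorem isWeakPartial_iff_inner {i : Fin d} {f g : L2 D} :
    IsWeakPartial D i f g ↔ ∀ (φ : 𝓓(D, ℝ)) (k : Fin 3),
      ⟪testVec D φ k, g⟫ = -⟪testVec D (fun x => fderiv ℝ φ x (coordVec i)) k, f⟫ := by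
  rw [isWeakPartial_iff_weakDeriv (integrableOn_coeFn f) (integrableOn_coeFn g)]
  have e : ∀ (φ : 𝓓(D, ℝ)) (k : Fin 3),
      ⟪testVec D (fun x => fderiv ℝ φ x (coordVec i)) k, f⟫
        = ∫ x in (D : Set (Space d)), fderiv ℝ φ x (coordVec i) * f x k := fun φ k =>
    inner_testVec (WeakDeriv.continuous_fderiv_apply φ.contDiff (coordVec i))
      (WeakDeriv.hasCompactSupport_fderiv_apply φ.hasCompactSupport (coordVec i)) k f
  have e' : ∀ (φ : 𝓓(D, ℝ)) (k : Fin 3), ⟪testVec D φ k, g⟫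
      = ∫ x in (D : Set (Space d)), φ x * g x k := fun φ k =>
    inner_testVec φ.continuous φ.hasCompactSupport k g
  constructor
  · intro h φ k
    rw [e, e', (h k).eq φ, neg_neg]
  · intro h k
    refine ⟨(memLp_component (Lp.memLp f) k).integrable (by norm_num),
      (memLp_component (Lp.memLp g) k).integrable (by norm_num), fun φ => ?_⟩
    rw [← e, ← e', h, neg_neg]

theorem IsWeakPartial.unique {i : Fin d} {f g g' : L2 D} (h : IsWeakPartial D i f g)
    (h' : IsWeakPartial D i f g') : g = g' := by
  rw [isWeakPartial_iff_inner] at h h'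
  rw [← sub_eq_zero]
  refine eq_zero_of_inner_testVec fun φ k => ?_
  rw [inner_sub_right, h, h', sub_self]

theorem IsWeakPartial.weakPartial_eq {i : Fin d} {f g : L2 D} (h : IsWeakPartial D i f g) :
    weakPartial i f = g := by
  have hex : ∃ g : L2 D, IsWeakPartial D i f g := ⟨g, h⟩
  rw [weakPartial, dif_pos hex]
  exact hex.choose_spec.unique h

theorem MemH1.isWeakPartial {f : L2 D} (h : MemH1 f) (i : Fin d) :
    IsWeakPartial D i f (weakPartial i f) := by
  obtain ⟨g, hg⟩ := h i
  rwa [hg.weakPartial_eq]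

theorem IsWeakPartial.sub {i : Fin d} {f g f' g' : L2 D} (h : IsWeakPartial D i f f')
    (h' : IsWeakPartial D i g g') : IsWeakPartial D i (f - g : L2 D) (f' - g' : L2 D) := by
  rw [isWeakPartial_iff_inner] at *
  intro φ k
  rw [inner_sub_right, inner_sub_right, h, h']
  ring

theorem MemH1.sub {f g : L2 D} (hf : MemH1 f) (hg : MemH1 g) : MemH1 (f - g) := fun i =>
  ⟨_, (hf.isWeakPartial i).sub (hg.isWeakPartial i)⟩

theorem weakPartial_sub {f g : L2 D} (hf : MemH1 f) (hg : MemH1 g) (i : Fin d) :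
    weakPartial i (f - g) = weakPartial i f - weakPartial i g :=
  ((hf.isWeakPartial i).sub (hg.isWeakPartial i)).weakPartial_eq

theorem MemH2.sub {f g : L2 D} (hf : MemH2 f) (hg : MemH2 g) : MemH2 (f - g) :=
  ⟨hf.1.sub hg.1, fun i => by
    rw [weakPartial_sub hf.1 hg.1]
    exact (hf.2 i).sub (hg.2 i)⟩

theorem laplacian_sub {f g : L2 D} (hf : MemH2 f) (hg : MemH2 g) :
    laplacian (f - g) = laplacian f - laplacian g := by
  simp only [laplacian]
  rw [← Finset.sum_sub_distrib]
  refine Finset.sum_congr rfl fun i _ => ?_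
  rw [weakPartial_sub hf.1 hg.1, weakPartial_sub (hf.2 i) (hg.2 i)]

theorem SatisfiesNeumann.sub {f g : L2 D} (hf : MemH2 f) (hg : MemH2 g) (nf : SatisfiesNeumann f)
    (ng : SatisfiesNeumann g) : SatisfiesNeumann (f - g) := by
  intro ψ hψ
  rw [laplacian_sub hf hg, inner_sub_left, neg_sub]
  have e1 := nf ψ hψ
  have e2 := ng ψ hψ
  have : ∀ i : Fin d, ⟪weakPartial i (f - g), weakPartial i ψ⟫
      = ⟪weakPartial i f, weakPartial i ψ⟫ - ⟪weakPartial i g, weakPartial i ψ⟫ := fun i => by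
    rw [weakPartial_sub hf.1 hg.1, inner_sub_left]
  simp_rw [this]
  rw [Finset.sum_sub_distrib, e1, e2]
  ring

theorem MemH1.weakDeriv {f : L2 D} (h : MemH1 f) (i : Fin d) (k : Fin 3) :
    WeakDeriv D (coordVec i) (fun x => f x k) (fun x => weakPartial i f x k) :=
  (isWeakPartial_iff_weakDeriv (integrableOn_coeFn f) (integrableOn_coeFn _)).1
    (h.isWeakPartial i) k

end WeakPartial

end SLLB

/-! ### The vector product, the damping term, and the product rule in `𝕃²`. -/

namespace SLLB

section Cross

theorem cross_apply (a b : Spin) (k : Fin 3) :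
    cross a b k = a (k + 1) * b (k + 2) - a (k + 2) * b (k + 1) := by
  fin_cases k <;> simp [cross, crossProduct]

theorem inner_spin (a b : Spin) : ⟪a, b⟫ = a 0 * b 0 + a 1 * b 1 + a 2 * b 2 := by
  simp [PiLp.inner_apply, Fin.sum_univ_three, mul_comm]

theorem norm_sq_spin (a : Spin) : ‖a‖ ^ 2 = a 0 ^ 2 + a 1 ^ 2 + a 2 ^ 2 := by
  rw [EuclideanSpace.norm_sq_eq, Fin.sum_univ_three]
  simp

theorem cross_apply_zero (a b : Spin) : cross a b 0 = a 1 * b 2 - a 2 * b 1 := cross_apply a b 0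

theorem cross_apply_one (a b : Spin) : cross a b 1 = a 2 * b 0 - a 0 * b 2 := cross_apply a b 1

theorem cross_apply_two (a b : Spin) : cross a b 2 = a 0 * b 1 - a 1 * b 0 := cross_apply a b 2

theorem norm_cross_le (a b : Spin) : ‖cross a b‖ ≤ ‖a‖ * ‖b‖ := by
  refine abs_le_of_sq_le_sq' ?_ (by positivity) |>.2
  rw [mul_pow, norm_sq_spin, norm_sq_spin, norm_sq_spin, cross_apply_zero, cross_apply_one,
    cross_apply_two]
  nlinarith [sq_nonneg (a 0 * b 0 + a 1 * b 1 + a 2 * b 2)]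

theorem cross_add_left (a a' b : Spin) : cross (a + a') b = cross a b + cross a' b := by
  ext k; simp only [cross_apply, PiLp.add_apply]; ring

theorem cross_add_right (a b b' : Spin) : cross a (b + b') = cross a b + cross a b' := by
  ext k; simp only [cross_apply, PiLp.add_apply]; ring

theorem cross_sub_left (a a' b : Spin) : cross (a - a') b = cross a b - cross a' b := by
  ext k; simp only [cross_apply, PiLp.sub_apply]; ring

theorem cross_sub_right (a b b' : Spin) : cross a (b - b') = cross a b - cross a b' := by
  ext k; simp only [cross_apply, PiLp.sub_apply]; ring

theorem cross_smul_left (c : ℝ) (a b : Spin) : cross (c • a) b = c • cross a b := by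
  ext k; simp only [cross_apply, PiLp.smul_apply, smul_eq_mul]; ring

theorem cross_smul_right (c : ℝ) (a b : Spin) : cross a (c • b) = c • cross a b := by
  ext k; simp only [cross_apply, PiLp.smul_apply, smul_eq_mul]; ring

theorem cross_self (a : Spin) : cross a a = 0 := by
  ext k; simp only [cross_apply, PiLp.zero_apply]; ring

theorem inner_cross_self_left (a b : Spin) : ⟪a, cross a b⟫ = 0 := by
  rw [inner_spin, cross_apply_zero, cross_apply_one, cross_apply_two]; ring

theorem inner_cross_comm (a b c : Spin) : ⟪a, cross b c⟫ = ⟪cross a b, c⟫ := by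
  simp only [inner_spin, cross_apply_zero, cross_apply_one, cross_apply_two]; ring

/-- The vector product as a bounded bilinear map. -/
noncomputable def crossCLM : Spin →L[ℝ] Spin →L[ℝ] Spin :=
  LinearMap.mkContinuous₂ (LinearMap.mk₂ ℝ cross cross_add_left cross_smul_left cross_add_right
    cross_smul_right) 1 fun a b => by simpa using norm_cross_le a b

theorem aestronglyMeasurable_cross {α : Type*} {m : MeasurableSpace α} {μ : Measure α}
    {f g : α → Spin} (hf : AEStronglyMeasurable f μ) (hg : AEStronglyMeasurable g μ) :
    AEStronglyMeasurable (fun x => cross (f x) (g x)) μ :=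
  crossCLM.aestronglyMeasurable_comp₂ hf hg

/-- The nonlinearity `a ↦ (1 + μ|a|²) a` is monotone. -/
theorem inner_damping_nonneg {μ : ℝ} (hμ : 0 ≤ μ) (a b : Spin) :
    0 ≤ ⟪a - b, (1 + μ * ‖a‖ ^ 2) • a - (1 + μ * ‖b‖ ^ 2) • b⟫ := by
  -- Symmetrisation: `⟨a - b, |a|²a - |b|²b⟩` is half of `(|a|² - |b|²)² + (|a|² + |b|²)|a - b|²`.
  have e : ⟪a - b, (1 + μ * ‖a‖ ^ 2) • a - (1 + μ * ‖b‖ ^ 2) • b⟫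
      = ‖a - b‖ ^ 2 + μ * ((‖a‖ ^ 2 - ‖b‖ ^ 2) ^ 2 / 2
        + (‖a‖ ^ 2 + ‖b‖ ^ 2) * ‖a - b‖ ^ 2 / 2) := by
    rw [norm_sub_sq_real]
    simp only [inner_sub_left, inner_sub_right, inner_smul_right, real_inner_self_eq_norm_sq,
      real_inner_comm a b]
    ring
  rw [e]
  positivity

end Cross

variable {d : ℕ} {D : Opens (Space d)}

section CrossL2

theorem memLp_cross_left {f g : Space d → Spin} {c : ℝ} (hf : AEStronglyMeasurable f (volOn D))
    (hc : ∀ᵐ x ∂(volOn D), ‖f x‖ ≤ c) (hg : MemLp g 2 (volOn D)) :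
    MemLp (fun x => cross (f x) (g x)) 2 (volOn D) := by
  refine hg.of_le_mul (c := c) (aestronglyMeasurable_cross hf hg.1) ?_
  filter_upwards [hc] with x hx
  exact (norm_cross_le _ _).trans (by gcongr)

theorem memLp_cross_right {f g : Space d → Spin} {c : ℝ} (hg : AEStronglyMeasurable g (volOn D))
    (hc : ∀ᵐ x ∂(volOn D), ‖g x‖ ≤ c) (hf : MemLp f 2 (volOn D)) :
    MemLp (fun x => cross (f x) (g x)) 2 (volOn D) := by
  refine hf.of_le_mul (c := c) (aestronglyMeasurable_cross hf.1 hg) ?_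
  filter_upwards [hc] with x hx
  rw [mul_comm c]
  exact (norm_cross_le _ _).trans (by gcongr)

variable {f g : L2 D} {c : ℝ}

theorem coeFn_crossL2_left (hc : ∀ᵐ x ∂(volOn D), ‖f x‖ ≤ c) (g : L2 D) :
    crossL2 f g =ᵐ[volOn D] fun x => cross (f x) (g x) :=
  coeFn_toL2 (memLp_cross_left (Lp.aestronglyMeasurable f) hc (Lp.memLp g))

theorem coeFn_crossL2_right (hc : ∀ᵐ x ∂(volOn D), ‖g x‖ ≤ c) (f : L2 D) :
    crossL2 f g =ᵐ[volOn D] fun x => cross (f x) (g x) :=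
  coeFn_toL2 (memLp_cross_right (Lp.aestronglyMeasurable g) hc (Lp.memLp f))

theorem norm_crossL2_le (hc : ∀ᵐ x ∂(volOn D), ‖f x‖ ≤ c) (g : L2 D) :
    ‖crossL2 f g‖ ≤ c * ‖g‖ := by
  refine Lp.norm_le_mul_norm_of_ae_le_mul ?_
  filter_upwards [coeFn_crossL2_left hc g, hc] with x hx hxc
  rw [hx]
  exact (norm_cross_le _ _).trans (by gcongr)

theorem coeFn_dampingL2 (μ : ℝ) (hc : ∀ᵐ x ∂(volOn D), ‖f x‖ ≤ c) :
    dampingL2 μ f =ᵐ[volOn D] fun x => (1 + μ * ‖f x‖ ^ 2) • f x := by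
  refine coeFn_toL2 ((Lp.memLp f).of_le_mul (c := 1 + |μ| * c ^ 2) ?_ ?_)
  · exact (aestronglyMeasurable_const.add (((Lp.aestronglyMeasurable f).norm.pow 2).const_mul
      μ)).smul (Lp.aestronglyMeasurable f)
  · filter_upwards [hc] with x hx
    rw [norm_smul]
    gcongr
    refine (norm_add_le _ _).trans ?_
    rw [norm_one, norm_mul, norm_pow, norm_norm, Real.norm_eq_abs]
    gcongr

theorem norm_dampingL2_le {μ : ℝ} (hμ : 0 ≤ μ) (hc : ∀ᵐ x ∂(volOn D), ‖f x‖ ≤ c) :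
    ‖dampingL2 μ f‖ ≤ (1 + μ * c ^ 2) * ‖f‖ := by
  refine Lp.norm_le_mul_norm_of_ae_le_mul ?_
  filter_upwards [coeFn_dampingL2 μ hc, hc] with x hx hxc
  rw [hx, norm_smul, Real.norm_of_nonneg (by positivity)]
  gcongr

theorem inner_dampingL2_nonneg {μ : ℝ} (hμ : 0 ≤ μ) {c' : ℝ} (hf : ∀ᵐ x ∂(volOn D), ‖f x‖ ≤ c)
    (hg : ∀ᵐ x ∂(volOn D), ‖g x‖ ≤ c') :
    0 ≤ ⟪f - g, dampingL2 μ f - dampingL2 μ g⟫ := by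
  rw [L2.inner_def]
  refine integral_nonneg_of_ae ?_
  filter_upwards [Lp.coeFn_sub f g, Lp.coeFn_sub (dampingL2 μ f) (dampingL2 μ g),
    coeFn_dampingL2 μ hf, coeFn_dampingL2 μ hg] with x h1 h2 h3 h4
  rw [h1, h2, Pi.sub_apply, Pi.sub_apply, h3, h4]
  exact inner_damping_nonneg hμ _ _

/-- No boundedness is needed: if the pointwise product is not square integrable, its representative
is zero and the identity persists. -/
theorem inner_crossL2_self_left (f g : L2 D) : ⟪f, crossL2 f g⟫ = 0 := by
  by_cases h : MemLp (fun x => cross (f x) (g x)) 2 (volOn D)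
  · rw [L2.inner_def]
    refine integral_eq_zero_of_ae ?_
    filter_upwards [coeFn_toL2 h] with x hx
    rw [crossL2, hx]
    exact inner_cross_self_left _ _
  · rw [crossL2, toL2, dif_neg h, inner_zero_right]

/-- The cyclic symmetry of the triple product. The bounds guarantee that both products are the
genuine pointwise ones. -/
theorem inner_crossL2_comm {f' : L2 D} {c' : ℝ} (hf : ∀ᵐ x ∂(volOn D), ‖f x‖ ≤ c)
    (hf' : ∀ᵐ x ∂(volOn D), ‖f' x‖ ≤ c') (g : L2 D) :
    ⟪f, crossL2 f' g⟫ = ⟪crossL2 f f', g⟫ := by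
  rw [L2.inner_def, L2.inner_def]
  refine integral_congr_ae ?_
  filter_upwards [coeFn_crossL2_left hf' g, coeFn_crossL2_left hf f'] with x h1 h2
  rw [h1, h2]
  exact inner_cross_comm _ _ _

end CrossL2

section ProductRule

theorem WeakDeriv.congr {v : Space d} {f g f' g' : Space d → ℝ} (h : WeakDeriv D v f g)
    (hf : f =ᵐ[volOn D] f') (hg : g =ᵐ[volOn D] g') : WeakDeriv D v f' g' := by
  refine ⟨h.integrableOn.congr hf, h.integrableOn_deriv.congr hg, fun φ => ?_⟩
  have e1 : ∫ x in (D : Set (Space d)), fderiv ℝ φ x v * f' x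
      = ∫ x in (D : Set (Space d)), fderiv ℝ φ x v * f x :=
    integral_congr_ae (hf.mono fun x hx => by simp only [hx])
  have e2 : ∫ x in (D : Set (Space d)), φ x * g' x = ∫ x in (D : Set (Space d)), φ x * g x :=
    integral_congr_ae (hg.mono fun x hx => by simp only [hx])
  rw [e1, e2, h.eq]

theorem WeakDeriv.sub {v : Space d} {f g f' g' : Space d → ℝ} (h : WeakDeriv D v f f')
    (h' : WeakDeriv D v g g') :
    WeakDeriv D v (fun x => f x - g x) (fun x => f' x - g' x) := by
  refine ⟨h.integrableOn.sub h'.integrableOn, h.integrableOn_deriv.sub h'.integrableOn_deriv,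
    fun φ => ?_⟩
  have hφ : ContDiff ℝ (⊤ : ℕ∞) φ := φ.contDiff
  obtain ⟨C, -, hC⟩ := exists_norm_le_of_compactSupport hφ.continuous φ.hasCompactSupport
  obtain ⟨C', -, hC'⟩ := exists_norm_le_of_compactSupport (continuous_fderiv_apply hφ v)
    (hasCompactSupport_fderiv_apply φ.hasCompactSupport v)
  have i1 : ∀ {u : Space d → ℝ}, IntegrableOn u D →
      IntegrableOn (fun x => fderiv ℝ φ x v * u x) D := fun hu =>
    hu.bdd_mul (c := C') (continuous_fderiv_apply hφ _).aestronglyMeasurable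
      (Eventually.of_forall hC')
  have i2 : ∀ {u : Space d → ℝ}, IntegrableOn u D → IntegrableOn (fun x => φ x * u x) D :=
    fun hu => hu.bdd_mul (c := C) hφ.continuous.aestronglyMeasurable (Eventually.of_forall hC)
  simp_rw [mul_sub]
  rw [integral_sub (i1 h.integrableOn) (i1 h'.integrableOn),
    integral_sub (i2 h.integrableOn_deriv) (i2 h'.integrableOn_deriv), h.eq, h'.eq]
  ring

/-- The product rule for the vector product of bounded functions of `ℍ¹`. -/
theorem isWeakPartial_crossL2 [IsFiniteMeasure (volOn D)] {f g : L2 D} {c c' : ℝ} (hf : MemH1 f)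
    (hg : MemH1 g) (hfc : ∀ᵐ x ∂(volOn D), ‖f x‖ ≤ c) (hgc : ∀ᵐ x ∂(volOn D), ‖g x‖ ≤ c')
    (i : Fin d) :
    IsWeakPartial D i (crossL2 f g)
      (crossL2 (weakPartial i f) g + crossL2 f (weakPartial i g) : L2 D) := by
  rw [isWeakPartial_iff_weakDeriv (integrableOn_coeFn _) (integrableOn_coeFn _)]
  intro k
  have m : ∀ (u : L2 D) (k : Fin 3), MemLp (fun x => u x k) 2 (volOn D) := fun u k =>
    memLp_component (Lp.memLp u) k
  have p := fun k l => (hf.weakDeriv i k).mul (hg.weakDeriv i l) (m _ _) (m _ _) (m _ _) (m _ _)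
  refine ((p (k + 1) (k + 2)).sub (p (k + 2) (k + 1))).congr ?_ ?_
  · filter_upwards [coeFn_crossL2_left hfc g] with x hx
    rw [hx, cross_apply]
  · filter_upwards [coeFn_crossL2_right hgc (weakPartial i f),
      coeFn_crossL2_left hfc (weakPartial i g),
      Lp.coeFn_add (crossL2 (weakPartial i f) g) (crossL2 f (weakPartial i g))] with x h1 h2 h3
    rw [h3, Pi.add_apply, h1, h2, PiLp.add_apply, cross_apply, cross_apply]
    ring

end ProductRule

/-! ### The `ℍ²` embedding and the multiplicative inequality. -/

section Norms

theorem norm_le_h1Norm (f : L2 D) : ‖f‖ ≤ h1Norm f :=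
  Real.le_sqrt_of_sq_le (le_add_of_nonneg_right (Finset.sum_nonneg fun _ _ => sq_nonneg _))

theorem norm_weakPartial_le_h1Norm (f : L2 D) (i : Fin d) : ‖weakPartial i f‖ ≤ h1Norm f :=
  Real.le_sqrt_of_sq_le ((Finset.single_le_sum (f := fun i => ‖weakPartial i f‖ ^ 2)
    (fun _ _ => sq_nonneg _) (Finset.mem_univ i)).trans (le_add_of_nonneg_left (sq_nonneg _)))

theorem h1Norm_le_h2Norm (f : L2 D) : h1Norm f ≤ h2Norm f :=
  Real.sqrt_le_sqrt (le_add_of_nonneg_right (Finset.sum_nonneg fun _ _ =>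
    Finset.sum_nonneg fun _ _ => sq_nonneg _))

theorem norm_weakPartial₂_le_h2Norm (f : L2 D) (i j : Fin d) :
    ‖weakPartial j (weakPartial i f)‖ ≤ h2Norm f := by
  refine Real.le_sqrt_of_sq_le (le_trans ?_ (le_add_of_nonneg_left
    (add_nonneg (sq_nonneg _) (Finset.sum_nonneg fun _ _ => sq_nonneg _))))
  refine (Finset.single_le_sum (f := fun j => ‖weakPartial j (weakPartial i f)‖ ^ 2)
    (fun _ _ => sq_nonneg _) (Finset.mem_univ j)).trans ?_
  exact Finset.single_le_sum (f := fun i => ∑ j, ‖weakPartial j (weakPartial i f)‖ ^ 2)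
    (fun _ _ => Finset.sum_nonneg fun _ _ => sq_nonneg _) (Finset.mem_univ i)

theorem h2Norm_nonneg (f : L2 D) : 0 ≤ h2Norm f := Real.sqrt_nonneg _

theorem norm_laplacian_le (f : L2 D) : ‖laplacian f‖ ≤ d * h2Norm f := by
  refine (norm_sum_le _ _).trans ((Finset.sum_le_card_nsmul _ _ (h2Norm f)
    fun i _ => norm_weakPartial₂_le_h2Norm f i i).trans_eq ?_)
  simp

theorem lintegral_enorm_mul_le (f g : L2 D) :
    ∫⁻ x in (D : Set (Space d)), ‖f x‖ₑ * ‖g x‖ₑ ≤ ‖f‖ₑ * ‖g‖ₑ := by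
  rw [Lp.enorm_def, Lp.enorm_def,
    eLpNorm_eq_lintegral_rpow_enorm_toReal two_ne_zero ENNReal.ofNat_ne_top,
    eLpNorm_eq_lintegral_rpow_enorm_toReal two_ne_zero ENNReal.ofNat_ne_top]
  exact ENNReal.lintegral_mul_le_Lp_mul_Lq _ (by simpa using Real.HolderConjugate.two_two)
    (Lp.aestronglyMeasurable f).enorm (Lp.aestronglyMeasurable g).enorm

theorem enorm_component_le (a : Spin) (k : Fin 3) : ‖a k‖ₑ ≤ ‖a‖ₑ := by
  rw [← ofReal_norm, ← ofReal_norm]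
  exact ENNReal.ofReal_le_ofReal (PiLp.norm_apply_le a k)

theorem enorm_sq_eq_sum (a : Spin) : ‖a‖ₑ ^ 2 = ∑ k, ‖a k * a k‖ₑ := by
  rw [← ofReal_norm, ← ENNReal.ofReal_pow (norm_nonneg _), EuclideanSpace.norm_sq_eq,
    ENNReal.ofReal_sum_of_nonneg fun k _ => sq_nonneg _]
  refine Finset.sum_congr rfl fun k _ => ?_
  rw [← ofReal_norm, norm_mul, sq]

/-- The factor `‖f‖² + 2 ∑ᵢ ‖f‖ ‖∂ᵢf‖` of the multiplicative inequality. -/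
noncomputable def gnFactor (f : L2 D) : ℝ := ‖f‖ ^ 2 + 2 * ∑ i : Fin d, ‖f‖ * ‖weakPartial i f‖

theorem gnFactor_nonneg (f : L2 D) : 0 ≤ gnFactor f :=
  add_nonneg (sq_nonneg _) (mul_nonneg zero_le_two (Finset.sum_nonneg fun i _ => by positivity))

variable [IsFiniteMeasure (volOn D)]

theorem wOneNorm_component_le {f : L2 D} (hf : MemH1 f) (k : Fin 3) {M : ℝ} (h0 : ‖f‖ ≤ M)
    (h1 : ∀ i, ‖weakPartial i f‖ ≤ M) :
    wOneNorm D (fun x => f x k) (fun i x => weakPartial i f x k)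
      ≤ (1 + d) * (volOn D Set.univ ^ (1 / 2 : ℝ)) * ENNReal.ofReal M := by
  have key : ∀ u : L2 D, ‖u‖ ≤ M → ∫⁻ x in (D : Set (Space d)), ‖u x k‖ₑ
      ≤ (volOn D Set.univ ^ (1 / 2 : ℝ)) * ENNReal.ofReal M := fun u hu => by
    calc ∫⁻ x in (D : Set (Space d)), ‖u x k‖ₑ ≤ ∫⁻ x in (D : Set (Space d)), ‖u x‖ₑ :=
          lintegral_mono fun x => enorm_component_le _ _
      _ = eLpNorm u 1 (volOn D) := eLpNorm_one_eq_lintegral_enorm.symm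
      _ ≤ eLpNorm u 2 (volOn D) * volOn D Set.univ ^ (1 / (1 : ℝ≥0∞).toReal
            - 1 / (2 : ℝ≥0∞).toReal) :=
          eLpNorm_le_eLpNorm_mul_rpow_measure_univ one_le_two (Lp.aestronglyMeasurable u)
      _ ≤ ENNReal.ofReal M * volOn D Set.univ ^ (1 / 2 : ℝ) := by
          rw [← Lp.enorm_def, ← ofReal_norm]
          norm_num
          gcongr
          rw [← ofReal_norm]
          exact ENNReal.ofReal_le_ofReal hu
      _ = _ := mul_comm _ _
  rw [wOneNorm_eq (fun i => hf.weakDeriv i k)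
    ((memLp_component (Lp.memLp f) k).integrable (by norm_num)), add_mul, add_mul, one_mul]
  refine add_le_add (key _ h0) ((Finset.sum_le_card_nsmul _ _ _ fun i _ => key _ (h1 i)).trans_eq ?_)
  simp [mul_assoc]

/-- The embedding of `ℍ²` into the bounded functions. -/
theorem exists_norm_le_h2Norm (hd : d = 1 ∨ d = 2) (hDb : Bornology.IsBounded (D : Set (Space d)))
    (hD : HasC2Boundary (D : Set (Space d))) :
    ∃ C : ℝ, 0 ≤ C ∧ ∀ f : L2 D, MemH2 f → ∀ᵐ x ∂(volOn D), ‖f x‖ ≤ C * h2Norm f := by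
  obtain ⟨C, hC, h⟩ := exists_sup_bound hd hDb hD
  set V := (1 + d) * (volOn D Set.univ ^ (1 / 2 : ℝ)) with hV
  have hVf : V ≠ ∞ := by
    have := measure_ne_top (volOn D) Set.univ
    rw [hV]
    finiteness
  -- One `W^{1,1}` norm for the function and `d` for its first derivatives. Each of them is at most
  -- `V` times the `ℍ²` norm, by Hölder's inequality on the bounded domain.
  set K := C * ((1 + d) * V) with hK
  have hKf : K ≠ ∞ := by
    have : (1 + d : ℝ≥0∞) ≠ ∞ := by finiteness
    rw [hK]
    finiteness
  refine ⟨3 * K.toReal, by positivity, fun f hf => ?_⟩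
  have b : ∀ k : Fin 3, ∀ᵐ x ∂(volOn D), ‖f x k‖ ≤ K.toReal * h2Norm f := fun k => by
    filter_upwards [h (fun x => f x k) (fun i x => weakPartial i f x k)
      (fun i j x => weakPartial j (weakPartial i f) x k) (fun i => hf.1.weakDeriv i k)
      (fun i j => (hf.2 i).weakDeriv j k)] with x hx
    have hle : ‖f x k‖ₑ ≤ K * ENNReal.ofReal (h2Norm f) := by
      refine hx.trans ?_
      rw [hK, mul_assoc, mul_assoc]
      refine mul_le_mul_right ?_ _
      rw [add_mul, one_mul]
      refine add_le_add (wOneNorm_component_le hf.1 k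
        ((norm_le_h1Norm f).trans (h1Norm_le_h2Norm f))
        fun i => (norm_weakPartial_le_h1Norm f i).trans (h1Norm_le_h2Norm f)) ?_
      refine (Finset.sum_le_card_nsmul _ _ _ fun i _ => wOneNorm_component_le (hf.2 i) k
        ((norm_weakPartial_le_h1Norm f i).trans (h1Norm_le_h2Norm f))
        fun j => norm_weakPartial₂_le_h2Norm f i j).trans_eq ?_
      rw [← hV, Finset.card_univ, Fintype.card_fin, nsmul_eq_mul]
    rw [← ofReal_norm, ← ENNReal.ofReal_toReal hKf,
      ← ENNReal.ofReal_mul ENNReal.toReal_nonneg] at hle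
    exact (ENNReal.ofReal_le_ofReal_iff (mul_nonneg ENNReal.toReal_nonneg (h2Norm_nonneg f))).1 hle
  filter_upwards [ae_all_iff.2 b] with x hx
  conv_lhs => rw [← sum_smul_coordVec (f x)]
  refine (norm_sum_le _ _).trans
    ((Finset.sum_le_card_nsmul _ _ (K.toReal * h2Norm f) fun k _ => ?_).trans_eq ?_)
  · rw [norm_smul]
    simpa [coordVec] using hx k
  · simp [mul_assoc]

/-- By the product rule the derivative of `f_k²` is `2 f_k ∂ᵢf_k`, and Cauchy–Schwarz bounds every
term by a product of `𝕃²` norms. -/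
theorem wOneNorm_sq_le {f : L2 D} (hf : MemH1 f) (k : Fin 3) :
    wOneNorm D (fun x => f x k * f x k)
      (fun i x => weakPartial i f x k * f x k + f x k * weakPartial i f x k)
      ≤ ENNReal.ofReal (gnFactor f) := by
  have m : ∀ (u : L2 D) (k : Fin 3), MemLp (fun x => u x k) 2 (volOn D) := fun u k =>
    memLp_component (Lp.memLp u) k
  have hw := fun i => (hf.weakDeriv i k).mul (hf.weakDeriv i k) (m _ _) (m _ _) (m _ _) (m _ _)
  have hp : ∀ u v : L2 D, ∫⁻ x in (D : Set (Space d)), ‖u x k * v x k‖ₑ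
      ≤ ENNReal.ofReal (‖u‖ * ‖v‖) := fun u v => by
    rw [ENNReal.ofReal_mul (norm_nonneg _), ofReal_norm, ofReal_norm]
    refine (lintegral_mono fun x => ?_).trans (lintegral_enorm_mul_le u v)
    rw [enorm_mul]
    exact mul_le_mul' (enorm_component_le _ _) (enorm_component_le _ _)
  rw [wOneNorm_eq hw ((m f k).integrable_mul (m f k)), gnFactor,
    ENNReal.ofReal_add (sq_nonneg _) (mul_nonneg zero_le_two (Finset.sum_nonneg fun i _ => by
      positivity)), Finset.mul_sum, ENNReal.ofReal_sum_of_nonneg fun i _ =>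
      mul_nonneg zero_le_two (mul_nonneg (norm_nonneg _) (norm_nonneg _))]
  refine add_le_add (by simpa [sq] using hp f f) (Finset.sum_le_sum fun i _ => ?_)
  calc ∫⁻ x in (D : Set (Space d)), ‖weakPartial i f x k * f x k + f x k * weakPartial i f x k‖ₑ
      = ∫⁻ x in (D : Set (Space d)), 2 * ‖f x k * weakPartial i f x k‖ₑ := by
        refine lintegral_congr fun x => ?_
        rw [mul_comm (weakPartial i f x k), ← two_mul, enorm_mul]
        congr 1
        simp [enorm_eq_nnnorm]
    _ = 2 * ∫⁻ x in (D : Set (Space d)), ‖f x k * weakPartial i f x k‖ₑ :=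
        lintegral_const_mul' _ _ (by simp)
    _ ≤ 2 * ENNReal.ofReal (‖f‖ * ‖weakPartial i f‖) := mul_le_mul_right (hp _ _) _
    _ = _ := by rw [ENNReal.ofReal_mul zero_le_two, ENNReal.ofReal_ofNat]

/-- The multiplicative inequality for vector products of functions of `ℍ¹`. -/
theorem exists_norm_crossL2_sq_le (hd : d = 1 ∨ d = 2)
    (hDb : Bornology.IsBounded (D : Set (Space d))) (hD : HasC2Boundary (D : Set (Space d))) :
    ∃ C : ℝ, 0 ≤ C ∧ ∀ f g : L2 D, MemH1 f → MemH1 g →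
      ‖crossL2 f g‖ ^ 2 ≤ C * gnFactor f * gnFactor g := by
  obtain ⟨C, hC, h⟩ := exists_product_bound hd hDb hD
  refine ⟨9 * C.toReal, by positivity, fun f g hf hg => ?_⟩
  have n1 := gnFactor_nonneg f
  have n2 := gnFactor_nonneg g
  by_cases hm : MemLp (fun x => cross (f x) (g x)) 2 (volOn D)
  swap
  · rw [crossL2, toL2, dif_neg hm, norm_zero, zero_pow two_ne_zero]
    positivity
  have m : ∀ (u : L2 D) (k : Fin 3), MemLp (fun x => u x k) 2 (volOn D) := fun u k =>
    memLp_component (Lp.memLp u) k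
  have hle : ENNReal.ofReal (‖crossL2 f g‖ ^ 2)
      ≤ ENNReal.ofReal (9 * C.toReal * gnFactor f * gnFactor g) := by
    have e1 : ENNReal.ofReal (‖crossL2 f g‖ ^ 2)
        = ∫⁻ x in (D : Set (Space d)), ‖crossL2 f g x‖ₑ ^ 2 := by
      rw [ENNReal.ofReal_pow (norm_nonneg _), ofReal_norm, Lp.enorm_def]
      have := eLpNorm_nnreal_pow_eq_lintegral (μ := volOn D) (f := crossL2 f g) (p := 2)
        (by norm_num)
      simpa using this
    have e2 : ∀ x, ‖f x‖ₑ ^ 2 * ‖g x‖ₑ ^ 2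
        = ∑ k, ∑ l, ‖f x k * f x k‖ₑ * ‖g x l * g x l‖ₑ := fun x => by
      rw [enorm_sq_eq_sum, enorm_sq_eq_sum, Finset.sum_mul_sum]
    have me : ∀ (u : L2 D) k, AEMeasurable (fun x => ‖u x k * u x k‖ₑ) (volOn D) := fun u k =>
      ((m u k).1.mul (m u k).1).enorm
    -- `|f × g|² ≤ |f|²|g|² = ∑ f_k² g_l²`, and the bound for products of `W^{1,1}` functions is
    -- applied to the nine pairs `f_k², g_l²`.
    calc ENNReal.ofReal (‖crossL2 f g‖ ^ 2)
        ≤ ∫⁻ x in (D : Set (Space d)), ‖f x‖ₑ ^ 2 * ‖g x‖ₑ ^ 2 := by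
          rw [e1]
          refine lintegral_mono_ae ?_
          filter_upwards [coeFn_toL2 hm] with x hx
          rw [crossL2, hx, ← mul_pow]
          gcongr
          rw [← ofReal_norm, ← ofReal_norm, ← ofReal_norm, ← ENNReal.ofReal_mul (norm_nonneg _)]
          exact ENNReal.ofReal_le_ofReal (norm_cross_le _ _)
      _ = ∑ k, ∑ l, ∫⁻ x in (D : Set (Space d)), ‖f x k * f x k‖ₑ * ‖g x l * g x l‖ₑ := by
          simp_rw [e2]
          have mm : ∀ k l, AEMeasurable
              (fun x => ‖f x k * f x k‖ₑ * ‖g x l * g x l‖ₑ) (volOn D) := fun k l =>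
            (me f k).mul (me g l)
          rw [lintegral_finsetSum' _ fun k _ => Finset.aemeasurable_fun_sum _ fun l _ => mm k l]
          exact Finset.sum_congr rfl fun k _ => lintegral_finsetSum' _ fun l _ => mm k l
      _ ≤ ∑ _k : Fin 3, ∑ _l : Fin 3,
            C * ENNReal.ofReal (gnFactor f) * ENNReal.ofReal (gnFactor g) := by
          refine Finset.sum_le_sum fun k _ => Finset.sum_le_sum fun l _ => ?_
          refine (h (fun x => f x k * f x k) (fun x => g x l * g x l) _ _
            (fun i => (hf.weakDeriv i k).mul (hf.weakDeriv i k) (m _ _) (m _ _) (m _ _) (m _ _))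
            (fun i => (hg.weakDeriv i l).mul (hg.weakDeriv i l) (m _ _) (m _ _) (m _ _)
              (m _ _))).trans ?_
          gcongr
          · exact wOneNorm_sq_le hf k
          · exact wOneNorm_sq_le hg l
      _ = ENNReal.ofReal (9 * C.toReal * gnFactor f * gnFactor g) := by
          rw [ENNReal.ofReal_mul (by positivity), ENNReal.ofReal_mul (by positivity),
            ENNReal.ofReal_mul (by positivity), ENNReal.ofReal_toReal hC]
          simp only [Finset.sum_const, Finset.card_univ, Fintype.card_fin, nsmul_eq_mul,
            ENNReal.ofReal_ofNat]
          push_cast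
          ring
  exact (ENNReal.ofReal_le_ofReal_iff (by positivity)).1 hle

end Norms

end SLLB

/-! ### The energy estimate for the drift. -/

namespace SLLB

variable {d : ℕ} {D : Opens (Space d)}

/-- The deterministic part of the equation. -/
noncomputable def llbDrift (κ₁ κ₂ γ μ : ℝ) (u : L2 D) : L2 D :=
  κ₁ • laplacian u + γ • crossL2 u (laplacian u) - κ₂ • dampingL2 μ u

theorem crossL2_sub_crossL2 {u v p q : L2 D} {c c' : ℝ} (hu : ∀ᵐ x ∂(volOn D), ‖u x‖ ≤ c)
    (hv : ∀ᵐ x ∂(volOn D), ‖v x‖ ≤ c') :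
    crossL2 u p - crossL2 v q = crossL2 (u - v) p + crossL2 v (p - q) := by
  have hw : ∀ᵐ x ∂(volOn D), ‖(u - v : L2 D) x‖ ≤ c + c' := by
    filter_upwards [hu, hv, Lp.coeFn_sub u v] with x h1 h2 h3
    rw [h3]
    exact (norm_sub_le _ _).trans (add_le_add h1 h2)
  refine Lp.ext ?_
  filter_upwards [coeFn_crossL2_left hu p, coeFn_crossL2_left hv q, coeFn_crossL2_left hw p,
    coeFn_crossL2_left hv (p - q), Lp.coeFn_sub u v, Lp.coeFn_sub p q,
    Lp.coeFn_sub (crossL2 u p) (crossL2 v q),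
    Lp.coeFn_add (crossL2 (u - v) p) (crossL2 v (p - q))] with x h1 h2 h3 h4 h5 h6 h7 h8
  rw [h7, h8, Pi.sub_apply, Pi.add_apply, h1, h2, h3, h4, h5, h6, Pi.sub_apply, Pi.sub_apply,
    cross_sub_left, cross_sub_right]
  abel

/-- The growth rate in the energy estimate, apart from a constant factor. -/
noncomputable def gradFactor (v : L2 D) : ℝ := ∑ i : Fin d, gnFactor (weakPartial i v)

theorem gradFactor_nonneg (v : L2 D) : 0 ≤ gradFactor v :=
  Finset.sum_nonneg fun _ _ => gnFactor_nonneg _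

/-- The energy estimate for the difference of two solutions. -/
theorem exists_inner_drift_le (hd : d = 1 ∨ d = 2) (hDb : Bornology.IsBounded (D : Set (Space d)))
    (hD : HasC2Boundary (D : Set (Space d))) {κ₁ κ₂ γ μ : ℝ} (hκ₁ : 0 < κ₁) (hκ₂ : 0 ≤ κ₂)
    (hγ : 0 ≤ γ) (hμ : 0 ≤ μ) :
    ∃ K : ℝ, 0 ≤ K ∧ ∀ u v : L2 D, MemH2 u → MemH2 v → SatisfiesNeumann u → SatisfiesNeumann v →
      2 * ⟪u - v, llbDrift κ₁ κ₂ γ μ u - llbDrift κ₁ κ₂ γ μ v⟫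
        ≤ (K * gradFactor v + d * (K * gradFactor v) ^ 2 / κ₁) * ‖u - v‖ ^ 2 := by
  have := isFiniteMeasure_volOn hDb
  obtain ⟨C, hC, hb⟩ := exists_norm_le_h2Norm hd hDb hD
  obtain ⟨C₀, hC₀, hmul⟩ := exists_norm_crossL2_sq_le hd hDb hD
  refine ⟨γ ^ 2 / κ₁ * C₀, by positivity, fun u v hu hv nu nv => ?_⟩
  have bu := hb u hu
  have bv := hb v hv
  have hw := hu.sub hv
  have nw := nu.sub hu hv nv
  have bw := hb _ hw
  have lsub := laplacian_sub hu hv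
  set w := u - v with hwdef
  have e1 : llbDrift κ₁ κ₂ γ μ u - llbDrift κ₁ κ₂ γ μ v = κ₁ • laplacian w
      + γ • (crossL2 w (laplacian u) + crossL2 v (laplacian w))
      - κ₂ • (dampingL2 μ u - dampingL2 μ v) := by
    rw [lsub, ← crossL2_sub_crossL2 bu bv, llbDrift, llbDrift]
    module
  have e2 : ⟪w, laplacian w⟫ = -∑ i, ‖weakPartial i w‖ ^ 2 := by
    have := nw w hw.1
    rw [real_inner_comm, ← neg_eq_iff_eq_neg.2 this]
    simp_rw [real_inner_self_eq_norm_sq]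
  have hz : ∀ i, IsWeakPartial D i (crossL2 w v)
      (crossL2 (weakPartial i w) v + crossL2 w (weakPartial i v) : L2 D) :=
    isWeakPartial_crossL2 hw.1 hv.1 bw bv
  -- Cyclic symmetry and the Neumann condition for `w`, tested with `w × v ∈ ℍ¹`. In the product
  -- rule the term `∂ᵢw × v` is orthogonal to `∂ᵢw`, so second derivatives of `w` disappear
  -- altogether.
  have e3 : ⟪w, crossL2 v (laplacian w)⟫
      = -∑ i, ⟪weakPartial i w, crossL2 w (weakPartial i v)⟫ := by
    have := nw (crossL2 w v) fun i => ⟨_, hz i⟩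
    rw [inner_crossL2_comm bw bv, real_inner_comm, ← neg_eq_iff_eq_neg.2 this]
    congr 1
    refine Finset.sum_congr rfl fun i _ => ?_
    rw [(hz i).weakPartial_eq, inner_add_right, inner_crossL2_self_left, zero_add]
  have e4 := inner_dampingL2_nonneg hμ bu bv
  rw [e1, inner_sub_right, inner_add_right, inner_smul_right, inner_smul_right, inner_smul_right,
    inner_add_right, inner_crossL2_self_left, e2, e3, zero_add]
  have e4' : 0 ≤ κ₂ * ⟪w, dampingL2 μ u - dampingL2 μ v⟫ := mul_nonneg hκ₂ e4
  set S := ∑ i, ‖weakPartial i w‖ ^ 2 with hS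
  set Q := gradFactor v with hQ
  set A := γ ^ 2 / κ₁ * C₀ * Q with hA
  have hA0 : 0 ≤ A := mul_nonneg (by positivity) (gradFactor_nonneg v)
  -- Young's inequality spends half of the available dissipation `2κ₁∑‖∂ᵢw‖²`; the rest is bounded
  -- by the multiplicative inequality.
  have h1 : ∀ i, 2 * γ * -⟪weakPartial i w, crossL2 w (weakPartial i v)⟫
      ≤ κ₁ * ‖weakPartial i w‖ ^ 2
        + γ ^ 2 / κ₁ * (C₀ * gnFactor w * gnFactor (weakPartial i v)) := fun i => by
    have i1 := neg_le_of_abs_le (abs_real_inner_le_norm (weakPartial i w)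
      (crossL2 w (weakPartial i v)))
    have i2 := hmul w (weakPartial i v) hw.1 (hv.2 i)
    set a := ‖weakPartial i w‖
    set b := ‖crossL2 w (weakPartial i v)‖
    have i3 : 2 * γ * (a * b) ≤ κ₁ * a ^ 2 + γ ^ 2 / κ₁ * b ^ 2 := by
      have : κ₁ * a ^ 2 + γ ^ 2 / κ₁ * b ^ 2 - 2 * γ * (a * b) = (κ₁ * a - γ * b) ^ 2 / κ₁ := by
        field_simp
        ring
      have h0 : 0 ≤ (κ₁ * a - γ * b) ^ 2 / κ₁ := by positivity
      linarith
    calc 2 * γ * -⟪weakPartial i w, crossL2 w (weakPartial i v)⟫ ≤ 2 * γ * (a * b) := by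
          gcongr
          linarith
      _ ≤ κ₁ * a ^ 2 + γ ^ 2 / κ₁ * b ^ 2 := i3
      _ ≤ _ := by gcongr
  have h2 : 2 * γ * -∑ i, ⟪weakPartial i w, crossL2 w (weakPartial i v)⟫
      ≤ κ₁ * S + A * gnFactor w := by
    rw [← Finset.sum_neg_distrib, Finset.mul_sum]
    refine (Finset.sum_le_sum fun i _ => h1 i).trans_eq ?_
    rw [Finset.sum_add_distrib, ← Finset.mul_sum, ← Finset.mul_sum, ← Finset.mul_sum, hA, hQ,
      gradFactor]
    ring
  -- The factor of `w` still contains `‖w‖‖∂ᵢw‖`. It consumes the other half of the dissipation and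
  -- leaves the quadratic term in `A`.
  have h3 : A * gnFactor w ≤ A * ‖w‖ ^ 2 + (κ₁ * S + d * A ^ 2 / κ₁ * ‖w‖ ^ 2) := by
    have k1 : ∀ i, 2 * A * (‖w‖ * ‖weakPartial i w‖)
        ≤ κ₁ * ‖weakPartial i w‖ ^ 2 + A ^ 2 / κ₁ * ‖w‖ ^ 2 := fun i => by
      have : κ₁ * ‖weakPartial i w‖ ^ 2 + A ^ 2 / κ₁ * ‖w‖ ^ 2
          - 2 * A * (‖w‖ * ‖weakPartial i w‖) = (κ₁ * ‖weakPartial i w‖ - A * ‖w‖) ^ 2 / κ₁ := by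
        field_simp
        ring
      have h0 : 0 ≤ (κ₁ * ‖weakPartial i w‖ - A * ‖w‖) ^ 2 / κ₁ := by positivity
      linarith
    have k2 := Finset.sum_le_sum fun i (_ : i ∈ Finset.univ) => k1 i
    rw [← Finset.mul_sum, Finset.sum_add_distrib, ← Finset.mul_sum _ _ κ₁, Finset.sum_const,
      Finset.card_univ, Fintype.card_fin, nsmul_eq_mul, ← hS] at k2
    calc A * gnFactor w = A * ‖w‖ ^ 2 + 2 * A * ∑ i, ‖w‖ * ‖weakPartial i w‖ := by
          rw [gnFactor]; ring
      _ ≤ A * ‖w‖ ^ 2 + (κ₁ * S + d * (A ^ 2 / κ₁ * ‖w‖ ^ 2)) := by linarith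
      _ = _ := by ring
  calc 2 * (κ₁ * -S + γ * -∑ i, ⟪weakPartial i w, crossL2 w (weakPartial i v)⟫
        - κ₂ * ⟪w, dampingL2 μ u - dampingL2 μ v⟫)
      ≤ -(2 * κ₁ * S) + 2 * γ * -∑ i, ⟪weakPartial i w, crossL2 w (weakPartial i v)⟫ := by
        linarith
    _ ≤ A * ‖w‖ ^ 2 + d * A ^ 2 / κ₁ * ‖w‖ ^ 2 := by linarith
    _ = _ := by ring

end SLLB

/-! ### Measurability of the nonlinear terms. -/

namespace SLLB

section WeakMeasurability

variable {H : Type*} [NormedAddCommGroup H] [InnerProductSpace ℝ H] [CompleteSpace H]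
  [SeparableSpace H] {α : Type*} {m : MeasurableSpace α} {ν : Measure α}

/-- In a separable Hilbert space, weakly measurable functions are strongly measurable. -/
theorem aestronglyMeasurable_of_inner {F : α → H} {s : Set H}
    (hs : (Submodule.span ℝ s).topologicalClosure = ⊤)
    (h : ∀ e ∈ s, AEMeasurable (fun a => ⟪e, F a⟫) ν) : AEStronglyMeasurable F ν := by
  have h1 : ∀ e ∈ Submodule.span ℝ s, AEMeasurable (fun a => ⟪e, F a⟫) ν := fun e he => by
    induction he using Submodule.span_induction with
    | mem x hx => exact h x hx
    | zero => simp
    | add x y _ _ hx hy =>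
      simp_rw [inner_add_left]
      exact hx.add hy
    | smul c x _ hx =>
      simp_rw [real_inner_smul_left]
      exact hx.const_mul c
  have h2 : ∀ e : H, AEMeasurable (fun a => ⟪e, F a⟫) ν := fun e => by
    have he : e ∈ closure (Submodule.span ℝ s : Set H) := by
      rw [← Submodule.topologicalClosure_coe, hs]
      trivial
    obtain ⟨x, hx, hlim⟩ := mem_closure_iff_seq_limit.1 he
    refine aemeasurable_of_tendsto_metrizable_ae' (f := fun n a => ⟪x n, F a⟫)
      (fun n => h1 _ (hx n)) (Eventually.of_forall fun a => ?_)
    exact hlim.inner tendsto_const_nhds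
  -- Projections onto an increasing sequence of finite-dimensional subspaces with dense union: each
  -- is a finite combination of measurable coordinates, and they converge pointwise to the identity.
  let U : ℕ → Submodule ℝ H := fun n => Submodule.span ℝ (denseSeq H '' Set.Iio n)
  have hfd : ∀ n, FiniteDimensional ℝ (U n) := fun n =>
    FiniteDimensional.span_of_finite ℝ ((Set.finite_Iio n).image _)
  have hmono : Monotone U := fun a b hab =>
    Submodule.span_mono (Set.image_mono (Set.Iio_subset_Iio hab))
  have htop : ⊤ ≤ (⨆ n, U n).topologicalClosure := by
    intro x _
    rw [← SetLike.mem_coe, Submodule.topologicalClosure_coe]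
    refine closure_mono ?_ ((denseRange_denseSeq H) x)
    rintro _ ⟨n, rfl⟩
    exact Submodule.mem_iSup_of_mem (n + 1)
      (Submodule.subset_span ⟨n, Set.mem_Iio.2 (Nat.lt_succ_self n), rfl⟩)
  refine aestronglyMeasurable_of_tendsto_ae (u := atTop)
    (f := fun n a => (U n).starProjection (F a)) (fun n => ?_)
    (Eventually.of_forall fun a => Submodule.starProjection_tendsto_self U hmono (F a) htop)
  have e : ∀ a, (U n).starProjection (F a)
      = ∑ i, ⟪(stdOrthonormalBasis ℝ (U n) i : H), F a⟫ • (stdOrthonormalBasis ℝ (U n) i : H) := by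
    intro a
    rw [Submodule.starProjection_apply,
      (stdOrthonormalBasis ℝ (U n)).orthogonalProjectionOnto_apply_eq_sum]
    simp
  simp_rw [e]
  exact Finset.aestronglyMeasurable_fun_sum _ fun i _ =>
    (h2 _).aestronglyMeasurable.smul_const _

end WeakMeasurability

variable {d : ℕ} {D : Opens (Space d)}

/-- The vector product with a bounded field, as an operator of `𝕃²`. -/
theorem exists_crossOperator {η : Space d → Spin} {c : ℝ} (hc0 : 0 ≤ c)
    (hη : AEStronglyMeasurable η (volOn D)) (hc : ∀ᵐ x ∂(volOn D), ‖η x‖ ≤ c) :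
    ∃ B : L2 D →L[ℝ] L2 D, ‖B‖ ≤ c ∧ ∀ v, B v =ᵐ[volOn D] fun x => cross (v x) (η x) := by
  have hv : ∀ v : L2 D, toL2 D (fun x => cross (v x) (η x)) =ᵐ[volOn D]
      fun x => cross (v x) (η x) := fun v =>
    coeFn_toL2 (memLp_cross_right hη hc (Lp.memLp v))
  let A : L2 D →ₗ[ℝ] L2 D :=
    { toFun := fun v => toL2 D fun x => cross (v x) (η x)
      map_add' := fun v w => by
        refine Lp.ext ?_
        filter_upwards [hv v, hv w, hv (v + w), Lp.coeFn_add v w, Lp.coeFn_add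
          (toL2 D fun x => cross (v x) (η x)) (toL2 D fun x => cross (w x) (η x))]
          with x h1 h2 h3 h4 h5
        rw [h5, Pi.add_apply, h1, h2, h3, h4, Pi.add_apply, cross_add_left]
      map_smul' := fun r v => by
        refine Lp.ext ?_
        filter_upwards [hv v, hv (r • v), Lp.coeFn_smul r v, Lp.coeFn_smul r
          (toL2 D fun x => cross (v x) (η x))] with x h1 h2 h3 h4
        rw [RingHom.id_apply, h4, Pi.smul_apply, h1, h2, h3, Pi.smul_apply, cross_smul_left] }
  refine ⟨A.mkContinuous c fun v => ?_, A.mkContinuous_norm_le hc0 _, hv⟩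
  refine Lp.norm_le_mul_norm_of_ae_le_mul ?_
  filter_upwards [hv v, hc] with x h1 h2
  change ‖toL2 D (fun x => cross (v x) (η x)) x‖ ≤ _
  rw [h1, mul_comm]
  exact (norm_cross_le _ _).trans (by gcongr)

theorem coeFn_testVec {φ : Space d → ℝ} (hφ : Continuous φ) (hc : HasCompactSupport φ)
    (k : Fin 3) : testVec D φ k =ᵐ[volOn D] fun x => φ x • (coordVec k : Spin) :=
  coeFn_toL2 ((Continuous.memLp_of_hasCompactSupport (hφ.smul continuous_const)
    hc.smul_right).restrict _)

theorem exists_norm_testVec_le {φ : Space d → ℝ} (hφ : Continuous φ) (hc : HasCompactSupport φ)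
    (k : Fin 3) : ∃ C, 0 ≤ C ∧ ∀ᵐ x ∂(volOn D), ‖testVec D φ k x‖ ≤ C := by
  obtain ⟨C, hC0, hC⟩ := WeakDeriv.exists_norm_le_of_compactSupport hφ hc
  refine ⟨C, hC0, ?_⟩
  filter_upwards [coeFn_testVec hφ hc k] with x hx
  rw [hx, norm_smul]
  simpa [coordVec] using hC x

section Nonlinearities

variable {α : Type*} {m : MeasurableSpace α} {ν : Measure α} {U G : α → L2 D}

theorem aestronglyMeasurable_of_inner_testVec
    (h : ∀ (φ : 𝓓(D, ℝ)) (k : Fin 3), AEMeasurable (fun a => ⟪testVec D φ k, U a⟫) ν) :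
    AEStronglyMeasurable U ν := by
  have : Fact ((2 : ℝ≥0∞) ≠ ∞) := ⟨ENNReal.ofNat_ne_top⟩
  refine aestronglyMeasurable_of_inner topologicalClosure_span_testVec ?_
  rintro _ ⟨p, rfl⟩
  exact h p.1 p.2

/-- The derivative is defined by a choice at each point. Its inner products with test vectors are
nevertheless continuous functionals of `U`, which is enough in a separable space. -/
theorem aestronglyMeasurable_weakPartial [IsFiniteMeasure (volOn D)]
    (hU : AEStronglyMeasurable U ν) (hm : ∀ᵐ a ∂ν, MemH1 (U a)) (i : Fin d) :
    AEStronglyMeasurable (fun a => weakPartial i (U a)) ν := by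
  refine aestronglyMeasurable_of_inner_testVec fun φ k => ?_
  have : AEMeasurable (fun a => -⟪testVec D (fun x => fderiv ℝ φ x (coordVec i)) k, U a⟫) ν :=
    (aestronglyMeasurable_const.inner hU).aemeasurable.neg
  refine this.congr ?_
  filter_upwards [hm] with a ha
  exact (isWeakPartial_iff_inner.1 (ha.isWeakPartial i) φ k).symm

theorem aestronglyMeasurable_laplacian [IsFiniteMeasure (volOn D)]
    (hU : AEStronglyMeasurable U ν) (hm : ∀ᵐ a ∂ν, MemH2 (U a)) :
    AEStronglyMeasurable (fun a => laplacian (U a)) ν :=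
  Finset.aestronglyMeasurable_fun_sum _ fun i _ =>
    aestronglyMeasurable_weakPartial
      (aestronglyMeasurable_weakPartial hU (hm.mono fun _ h => h.1) i) (hm.mono fun _ h => h.2 i) i

/-- Against a bounded test vector the triple product turns the expression into an inner product of
`G` with a bounded linear operator applied to `U`. -/
theorem aestronglyMeasurable_crossL2 (hU : AEStronglyMeasurable U ν)
    (hG : AEStronglyMeasurable G ν)
    (hb : ∀ᵐ a ∂ν, ∃ c : ℝ, ∀ᵐ x ∂(volOn D), ‖U a x‖ ≤ c) :
    AEStronglyMeasurable (fun a => crossL2 (U a) (G a)) ν := by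
  refine aestronglyMeasurable_of_inner_testVec fun φ k => ?_
  obtain ⟨C, hC0, hC⟩ := exists_norm_testVec_le (D := D) φ.continuous φ.hasCompactSupport k
  obtain ⟨B, -, hB⟩ := exists_crossOperator hC0 (Lp.aestronglyMeasurable (testVec D φ k)) hC
  have hBU : AEStronglyMeasurable (fun a => B (U a)) ν :=
    B.continuous.comp_aestronglyMeasurable hU
  refine ((hBU.inner hG).aemeasurable.neg).congr ?_
  filter_upwards [hb] with a ⟨c, hc⟩
  rw [inner_crossL2_comm hC hc, Pi.neg_apply, ← inner_neg_left]
  congr 1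
  refine Lp.ext ?_
  filter_upwards [Lp.coeFn_neg (B (U a)), hB (U a), coeFn_crossL2_left hC (U a)] with x h1 h2 h3
  rw [h1, Pi.neg_apply, h2, h3]
  ext j
  simp only [cross_apply, PiLp.neg_apply]
  ring

/-- The cubic map is Lipschitz on balls, and its restriction to a ball has a global Lipschitz
extension, which acts continuously on `𝕃²` by composition. -/
theorem exists_lipschitzWith_eqOn_damping (μ : ℝ) (n : ℕ) :
    ∃ (K : ℝ≥0) (g : Spin → Spin), LipschitzWith K g ∧ g 0 = 0 ∧
      ∀ a, ‖a‖ ≤ n → g a = (1 + μ * ‖a‖ ^ 2) • a := by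
  have hl : LipschitzOnWith (1 + ‖μ‖₊ * (3 * n ^ 2)) (fun a : Spin => (1 + μ * ‖a‖ ^ 2) • a)
      {a | ‖a‖ ≤ n} := by
    refine LipschitzOnWith.of_dist_le_mul fun a ha b hb => ?_
    have ha : ‖a‖ ≤ n := ha
    have hb : ‖b‖ ≤ n := hb
    rw [dist_eq_norm, dist_eq_norm]
    have e : (1 + μ * ‖a‖ ^ 2) • a - (1 + μ * ‖b‖ ^ 2) • b
        = (a - b) + μ • (‖a‖ ^ 2 • (a - b) + ((‖a‖ + ‖b‖) * (‖a‖ - ‖b‖)) • b) := by module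
    rw [e]
    have h1 : ‖‖a‖ ^ 2 • (a - b)‖ ≤ n ^ 2 * ‖a - b‖ := by
      rw [norm_smul, Real.norm_of_nonneg (sq_nonneg _)]
      gcongr
    have h2 : ‖((‖a‖ + ‖b‖) * (‖a‖ - ‖b‖)) • b‖ ≤ (2 * n ^ 2) * ‖a - b‖ := by
      rw [norm_smul, norm_mul, Real.norm_of_nonneg (by positivity : 0 ≤ ‖a‖ + ‖b‖)]
      calc (‖a‖ + ‖b‖) * ‖‖a‖ - ‖b‖‖ * ‖b‖ ≤ (n + n) * ‖a - b‖ * n := by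
            gcongr
            exact abs_norm_sub_norm_le a b
        _ = _ := by ring
    calc ‖(a - b) + μ • (‖a‖ ^ 2 • (a - b) + ((‖a‖ + ‖b‖) * (‖a‖ - ‖b‖)) • b)‖
        ≤ ‖a - b‖ + ‖μ‖ * (n ^ 2 * ‖a - b‖ + (2 * n ^ 2) * ‖a - b‖) := by
          refine (norm_add_le _ _).trans ?_
          rw [norm_smul]
          gcongr
          exact (norm_add_le _ _).trans (add_le_add h1 h2)
      _ = _ := by
          push_cast
          ring
  obtain ⟨g, hg, he⟩ := hl.extend_finite_dimension
  refine ⟨_, g, hg, ?_, fun a ha => (he ha).symm⟩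
  have h0 : (0 : Spin) ∈ {a : Spin | ‖a‖ ≤ n} := by simp
  rw [← he h0]
  exact smul_zero _

/-- For a bounded function the Lipschitz substitutes eventually agree with the damping, so the
latter is a pointwise limit of continuous functions of `U`. -/
theorem aestronglyMeasurable_dampingL2 (μ : ℝ) (hU : AEStronglyMeasurable U ν)
    (hb : ∀ᵐ a ∂ν, ∃ c : ℝ, ∀ᵐ x ∂(volOn D), ‖U a x‖ ≤ c) :
    AEStronglyMeasurable (fun a => dampingL2 μ (U a)) ν := by
  choose K g hg h0 he using exists_lipschitzWith_eqOn_damping μ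
  refine aestronglyMeasurable_of_tendsto_ae (u := atTop)
    (f := fun n a => (hg n).compLp (h0 n) (U a)) (fun n =>
      ((hg n).continuous_compLp (h0 n)).comp_aestronglyMeasurable hU) ?_
  filter_upwards [hb] with a ⟨c, hc⟩
  obtain ⟨n₀, hn₀⟩ := exists_nat_ge c
  refine tendsto_const_nhds.congr' ?_
  filter_upwards [eventually_ge_atTop n₀] with n hn
  refine Lp.ext ?_
  filter_upwards [coeFn_dampingL2 μ hc, (hg n).coeFn_compLp (h0 n) (U a), hc] with x h1 h2 h3
  rw [h1, h2, Function.comp_apply, he n _ (h3.trans (hn₀.trans (by exact_mod_cast hn)))]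

end Nonlinearities

end SLLB

/-! ### Integrability along paths in `L^∞(ℍ¹) ∩ L²(ℍ²)`. -/

namespace SLLB

variable {d : ℕ} {D : Opens (Space d)} {α : Type*} {m : MeasurableSpace α} {ν : Measure α}

/-- `U` belongs to `L^∞(ℍ¹) ∩ L²(ℍ²)`. -/
structure IsStrongPath (ν : Measure α) (U : α → L2 D) : Prop where
  aestronglyMeasurable : AEStronglyMeasurable U ν
  bdd : ∃ C : ℝ, ∀ᵐ a ∂ν, h1Norm (U a) ≤ C
  memH2 : ∀ᵐ a ∂ν, MemH2 (U a)
  lintegral_lt_top : ∫⁻ a, ENNReal.ofReal (h2Norm (U a)) ^ 2 ∂ν < ∞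

namespace IsStrongPath

variable {U : α → L2 D} [IsFiniteMeasure (volOn D)]

theorem aestronglyMeasurable_weakPartial (h : IsStrongPath ν U) (i : Fin d) :
    AEStronglyMeasurable (fun a => weakPartial i (U a)) ν :=
  SLLB.aestronglyMeasurable_weakPartial h.1 (h.memH2.mono fun _ h => h.1) i

theorem aestronglyMeasurable_weakPartial₂ (h : IsStrongPath ν U) (i j : Fin d) :
    AEStronglyMeasurable (fun a => weakPartial j (weakPartial i (U a))) ν :=
  SLLB.aestronglyMeasurable_weakPartial (h.aestronglyMeasurable_weakPartial i)
    (h.memH2.mono fun _ h => h.2 i) j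

theorem memLp_h2Norm (h : IsStrongPath ν U) : MemLp (fun a => h2Norm (U a)) 2 ν := by
  have hm : AEMeasurable (fun a => h2Norm (U a)) ν := by
    refine AEMeasurable.sqrt ?_
    refine ((h.1.norm.aemeasurable.pow_const 2).add
      (Finset.aemeasurable_fun_sum _ fun i _ =>
        (h.aestronglyMeasurable_weakPartial i).norm.aemeasurable.pow_const 2)).add
      (Finset.aemeasurable_fun_sum _ fun i _ => Finset.aemeasurable_fun_sum _ fun j _ =>
        (h.aestronglyMeasurable_weakPartial₂ i j).norm.aemeasurable.pow_const 2)
  refine (memLp_two_iff_integrable_sq hm.aestronglyMeasurable).2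
    ⟨(hm.pow_const 2).aestronglyMeasurable, ?_⟩
  refine lt_of_eq_of_lt (lintegral_congr fun a => ?_) h.lintegral_lt_top
  rw [enorm_pow, Real.enorm_of_nonneg (h2Norm_nonneg _)]

theorem ae_bdd (hd : d = 1 ∨ d = 2) (hDb : Bornology.IsBounded (D : Set (Space d)))
    (hD : HasC2Boundary (D : Set (Space d))) (h : IsStrongPath ν U) :
    ∀ᵐ a ∂ν, ∃ c : ℝ, ∀ᵐ x ∂(volOn D), ‖U a x‖ ≤ c := by
  obtain ⟨C, hC, hb⟩ := exists_norm_le_h2Norm hd hDb hD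
  exact h.memH2.mono fun a ha => ⟨_, hb _ ha⟩

variable [IsFiniteMeasure ν]

theorem integrable_laplacian (h : IsStrongPath ν U) : Integrable (fun a => laplacian (U a)) ν := by
  refine ((h.memLp_h2Norm.integrable one_le_two).const_mul d).mono'
    (aestronglyMeasurable_laplacian h.1 h.memH2) (Eventually.of_forall fun a => ?_)
  exact norm_laplacian_le _

/-- The `ℍ²` norm bounds the first factor pointwise and the second one in `𝕃²`, so the product is
dominated by the square of a function in `L²` of time. -/
theorem integrable_crossL2_laplacian (hd : d = 1 ∨ d = 2)
    (hDb : Bornology.IsBounded (D : Set (Space d)))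
    (hD : HasC2Boundary (D : Set (Space d))) (h : IsStrongPath ν U) :
    Integrable (fun a => crossL2 (U a) (laplacian (U a))) ν := by
  obtain ⟨C, hC, hb⟩ := exists_norm_le_h2Norm hd hDb hD
  refine (h.memLp_h2Norm.integrable_sq.const_mul (C * d)).mono' (aestronglyMeasurable_crossL2 h.1
    (aestronglyMeasurable_laplacian h.1 h.memH2) (h.ae_bdd hd hDb hD)) ?_
  filter_upwards [h.memH2] with a ha
  have h0 := h2Norm_nonneg (U a)
  calc ‖crossL2 (U a) (laplacian (U a))‖ ≤ C * h2Norm (U a) * ‖laplacian (U a)‖ :=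
        norm_crossL2_le (hb _ ha) _
    _ ≤ C * h2Norm (U a) * (d * h2Norm (U a)) := by
        gcongr
        exact norm_laplacian_le _
    _ = _ := by ring

theorem integrable_dampingL2 (hd : d = 1 ∨ d = 2) (hDb : Bornology.IsBounded (D : Set (Space d)))
    (hD : HasC2Boundary (D : Set (Space d))) (h : IsStrongPath ν U) {μ : ℝ} (hμ : 0 ≤ μ) :
    Integrable (fun a => dampingL2 μ (U a)) ν := by
  obtain ⟨C, hC, hb⟩ := exists_norm_le_h2Norm hd hDb hD
  obtain ⟨M, hM⟩ := h.bdd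
  have hi : Integrable (fun a => (1 + μ * C ^ 2 * h2Norm (U a) ^ 2) * M) ν :=
    ((integrable_const (1 : ℝ)).add (h.memLp_h2Norm.integrable_sq.const_mul (μ * C ^ 2))).mul_const M
  refine hi.mono' (aestronglyMeasurable_dampingL2 μ h.1 (h.ae_bdd hd hDb hD)) ?_
  filter_upwards [h.memH2, hM] with a ha hMa
  have h0 := h2Norm_nonneg (U a)
  calc ‖dampingL2 μ (U a)‖ ≤ (1 + μ * (C * h2Norm (U a)) ^ 2) * ‖U a‖ :=
        norm_dampingL2_le hμ (hb _ ha)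
    _ ≤ (1 + μ * (C * h2Norm (U a)) ^ 2) * M := by
        gcongr
        exact (norm_le_h1Norm _).trans hMa
    _ = _ := by ring

theorem integrable_llbDrift (hd : d = 1 ∨ d = 2) (hDb : Bornology.IsBounded (D : Set (Space d)))
    (hD : HasC2Boundary (D : Set (Space d))) (h : IsStrongPath ν U) {κ₁ κ₂ γ μ : ℝ} (hμ : 0 ≤ μ) :
    Integrable (fun a => llbDrift κ₁ κ₂ γ μ (U a)) ν :=
  ((h.integrable_laplacian.smul κ₁).add
    ((h.integrable_crossL2_laplacian hd hDb hD).smul γ)).sub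
    ((h.integrable_dampingL2 hd hDb hD hμ).smul κ₂)

theorem aestronglyMeasurable_gnFactor (h : IsStrongPath ν U) (i : Fin d) :
    AEStronglyMeasurable (fun a => gnFactor (weakPartial i (U a))) ν := by
  have h1 := (h.aestronglyMeasurable_weakPartial i).norm
  have h2 := fun j => (h.aestronglyMeasurable_weakPartial₂ i j).norm
  exact (h1.pow 2).add ((Finset.aestronglyMeasurable_fun_sum _ fun j _ =>
    h1.mul (h2 j)).const_mul 2)

theorem gradFactor_le {v : L2 D} {M : ℝ} (hM : h1Norm v ≤ M) :
    gradFactor v ≤ d * (M ^ 2 + 2 * (d * (M * h2Norm v))) := by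
  have hM0 : 0 ≤ M := (Real.sqrt_nonneg _).trans hM
  have hle : ∀ i, ‖weakPartial i v‖ ≤ M := fun i => (norm_weakPartial_le_h1Norm v i).trans hM
  have h1 : ∀ i, gnFactor (weakPartial i v) ≤ M ^ 2 + 2 * (d * (M * h2Norm v)) := fun i => by
    have h2 : ∑ j, ‖weakPartial i v‖ * ‖weakPartial j (weakPartial i v)‖
        ≤ d * (M * h2Norm v) := by
      refine (Finset.sum_le_card_nsmul _ _ (M * h2Norm v) fun j _ => ?_).trans_eq (by simp)
      exact mul_le_mul (hle i) (norm_weakPartial₂_le_h2Norm v i j) (norm_nonneg _) hM0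
    have h3 : ‖weakPartial i v‖ ^ 2 ≤ M ^ 2 := pow_le_pow_left₀ (norm_nonneg _) (hle i) 2
    rw [gnFactor]
    linarith
  exact (Finset.sum_le_card_nsmul _ _ _ fun i _ => h1 i).trans_eq (by simp [mul_add])

/-- On a path bounded in `ℍ¹` the factor grows only linearly in the `ℍ²` norm. Its square, which
occurs in the growth rate, is therefore integrable. -/
theorem memLp_gradFactor (h : IsStrongPath ν U) : MemLp (fun a => gradFactor (U a)) 2 ν := by
  obtain ⟨M, hM⟩ := h.bdd
  have hm : AEStronglyMeasurable (fun a => gradFactor (U a)) ν :=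
    Finset.aestronglyMeasurable_fun_sum _ fun i _ => h.aestronglyMeasurable_gnFactor i
  have h1 : MemLp (fun a => 2 * (d * (M * h2Norm (U a)))) 2 ν :=
    ((h.memLp_h2Norm.const_mul M).const_mul (d : ℝ)).const_mul 2
  have h2 : MemLp (fun a => M ^ 2 + 2 * (d * (M * h2Norm (U a)))) 2 ν :=
    (memLp_const (M ^ 2)).add h1
  refine (h2.const_mul (d : ℝ)).of_le hm ?_
  filter_upwards [hM] with a ha
  have hM0 : 0 ≤ M := (Real.sqrt_nonneg _).trans ha
  have h0 := h2Norm_nonneg (U a)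
  rw [Real.norm_of_nonneg (gradFactor_nonneg _), Real.norm_of_nonneg (by positivity)]
  exact gradFactor_le ha

theorem integrable_rate (h : IsStrongPath ν U) (K κ : ℝ) :
    Integrable (fun a => K * gradFactor (U a) + d * (K * gradFactor (U a)) ^ 2 / κ) ν :=
  ((h.memLp_gradFactor.const_mul K).integrable one_le_two).add
    (((h.memLp_gradFactor.const_mul K).integrable_sq.const_mul (d : ℝ)).div_const κ)

end IsStrongPath

end SLLB

/-! ### The equation for the difference of two solutions. -/

namespace SLLB

section

variable {Ω : Type*} [mΩ : MeasurableSpace Ω] {P : Measure Ω} {𝓕 : Filtration ℝ≥0 mΩ} {T : ℝ≥0}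
  {W : ℕ → ℝ≥0 → Ω → ℝ} {H : Type*} [NormedAddCommGroup H] [InnerProductSpace ℝ H]

theorem tendstoInMeasure_neg {f : ℕ → Ω → H} {g : Ω → H} (h : TendstoInMeasure P f atTop g) :
    TendstoInMeasure P (fun n ω => -f n ω) atTop (fun ω => -g ω) := by
  rw [tendstoInMeasure_iff_norm] at h ⊢
  intro ε hε
  refine (h ε hε).congr fun n => ?_
  simp_rw [← neg_sub', norm_neg]

theorem stronglyMeasurable_prod_of_progressive {X : ℝ≥0 → Ω → H} (h : IsStronglyProgressive 𝓕 X)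
    (T : ℝ≥0) : StronglyMeasurable fun p : ℝ≥0 × Ω => X (min p.1 T) p.2 := by
  have h2 : StronglyMeasurable fun p : Set.Iic T × Ω => X p.1 p.2 :=
    (h T).mono (sup_le_sup le_rfl (MeasurableSpace.comap_mono (𝓕.le T)))
  exact h2.comp_measurable (g := fun p : ℝ≥0 × Ω =>
    ((⟨min p.1 T, Set.mem_Iic.2 (min_le_right _ _)⟩ : Set.Iic T), p.2))
    ((Measurable.subtype_mk (by fun_prop)).prodMk measurable_snd)

theorem stronglyMeasurable_stopped {u : ℝ≥0 → Ω → H}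
    (h : IsStronglyProgressive 𝓕 fun t => u (min t T)) :
    StronglyMeasurable fun p : ℝ≥0 × Ω => u (min p.1 T) p.2 := by
  simpa only [min_assoc, min_self] using stronglyMeasurable_prod_of_progressive h T

theorem aestronglyMeasurable_path_of_progressive {u : ℝ≥0 → Ω → H}
    (h : IsStronglyProgressive 𝓕 fun t => u (min t T)) (ω : Ω) :
    AEStronglyMeasurable (fun s => u s ω) (leb.restrict (Set.Icc 0 T)) := by
  refine ((stronglyMeasurable_stopped h).comp_measurable (g := fun s => (s, ω))
    (by fun_prop)).aestronglyMeasurable.congr ?_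
  filter_upwards [ae_restrict_mem measurableSet_Icc] with s hs
  rw [Function.comp_apply, min_eq_left hs.2]

theorem IsItoIntegral.congr {B : ℝ≥0 → Ω → ℝ} {a a' I : ℝ≥0 → Ω → H}
    (h : IsItoIntegral P 𝓕 T B a I) (ha : ∀ s ≤ T, ∀ ω, a s ω = a' s ω) :
    IsItoIntegral P 𝓕 T B a' I := by
  obtain ⟨S, h1, h2⟩ := h
  refine ⟨S, fun ε hε => ?_, h2⟩
  refine (h1 ε hε).congr fun n => ?_
  congr 1
  ext ω
  rw [Set.mem_ofPred_eq, Set.mem_ofPred_eq, setLIntegral_congr_fun measurableSet_Icc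
    fun s hs => by rw [ha s hs.2 ω]]

/-- Skewness evaluated at `v + R v`; this is the identity behind the cancellation of the two
corrections. -/
theorem inner_comp_self_of_skew {R : H →L[ℝ] H} (hR : ∀ v, ⟪v, R v⟫ = 0) (v : H) :
    ⟪v, R (R v)⟫ = -‖R v‖ ^ 2 := by
  have h := hR (v + R v)
  rw [map_add, inner_add_left, inner_add_right, inner_add_right, hR, hR,
    real_inner_self_eq_norm_sq] at h
  linarith

variable [IsProbabilityMeasure P] [CompleteSpace H]

/-- The difference of two solutions of equations with Stratonovich noise of affine coefficients
`G_k` with skew-symmetric linear parts `R_k`. -/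
theorem exists_isSkewNoiseEquation_sub {R : ℕ → H →L[ℝ] H} {G : ℕ → H → H}
    {u₁ u₂ b₁ b₂ N₁ N₂ : ℝ≥0 → Ω → H} {u₀ : H} (hW : IsWienerSequence P 𝓕 W)
    (hsum : Summable fun k => ‖R k‖ ^ 2) (hskew : ∀ k v, ⟪v, R k v⟫ = 0)
    (hG : ∀ k v w, G k v - G k w = R k (v - w))
    (hcor : ∀ k v, stratonovichCorrection (G k) v = (1 / 2 : ℝ) • R k (R k v))
    (hp₁ : IsStronglyProgressive 𝓕 fun t => u₁ (min t T))
    (hp₂ : IsStronglyProgressive 𝓕 fun t => u₂ (min t T))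
    (hN₁ : IsStratonovichSum P 𝓕 T W G (ContinuousLinearMap.id ℝ H) u₁ N₁)
    (hN₂ : IsStratonovichSum P 𝓕 T W G (ContinuousLinearMap.id ℝ H) u₂ N₂)
    (hb₁ : ∀ᵐ ω ∂P, IntegrableOn (fun s => b₁ s ω) (Set.Icc 0 T) leb)
    (hb₂ : ∀ᵐ ω ∂P, IntegrableOn (fun s => b₂ s ω) (Set.Icc 0 T) leb)
    (heq₁ : ∀ t ≤ T, ∀ᵐ ω ∂P, u₁ t ω = u₁ 0 ω + ∫ s in Set.Icc 0 t, b₁ s ω ∂leb + N₁ t ω)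
    (heq₂ : ∀ t ≤ T, ∀ᵐ ω ∂P, u₂ t ω = u₂ 0 ω + ∫ s in Set.Icc 0 t, b₂ s ω ∂leb + N₂ t ω)
    (hbdd₁ : ∀ᵐ ω ∂P, ∃ C : ℝ, ∀ᵐ s ∂(leb.restrict (Set.Icc 0 T)), ‖u₁ s ω‖ ≤ C)
    (hbdd₂ : ∀ᵐ ω ∂P, ∃ C : ℝ, ∀ᵐ s ∂(leb.restrict (Set.Icc 0 T)), ‖u₂ s ω‖ ≤ C)
    (hinit₁ : ∀ᵐ ω ∂P, u₁ 0 ω = u₀) (hinit₂ : ∀ᵐ ω ∂P, u₂ 0 ω = u₀) :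
    ∃ M, IsSkewNoiseEquation P 𝓕 T W R
      (fun s ω => b₁ s ω - b₂ s ω + (1 / 2 : ℝ) • (∑' k, (R k).comp (R k)) (u₁ s ω - u₂ s ω))
      (fun t ω => u₁ (min t T) ω - u₂ (min t T) ω) M := by
  obtain ⟨I₁, hI₁, hs₁⟩ := hN₁
  obtain ⟨I₂, hI₂, hs₂⟩ := hN₂
  set S := ∑' k, (R k).comp (R k) with hS
  have hSsum : Summable fun k => (R k).comp (R k) :=
    Summable.of_norm_bounded hsum fun k => by
      rw [sq]
      exact ContinuousLinearMap.opNorm_comp_le _ _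
  have hp : IsStronglyProgressive 𝓕 fun t ω => u₁ (min t T) ω - u₂ (min t T) ω := hp₁.sub hp₂
  -- The time integral of the difference. Stopping at `T` makes the integrand jointly measurable on
  -- the whole half-line.
  let Y : ℝ≥0 → Ω → H := fun t ω =>
    ∫ s in Set.Icc 0 t, (u₁ (min s T) ω - u₂ (min s T) ω) ∂leb
  have hYm : ∀ t, AEStronglyMeasurable (Y t) P := fun t => by
    have hm : StronglyMeasurable fun p : Ω × ℝ≥0 => u₁ (min p.2 T) p.1 - u₂ (min p.2 T) p.1 :=
      ((stronglyMeasurable_stopped hp₁).sub (stronglyMeasurable_stopped hp₂)).comp_measurable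
        measurable_swap
    exact hm.integral_prod_right.aestronglyMeasurable
  have hbdd : ∀ᵐ ω ∂P, ∃ C : ℝ, ∀ᵐ s ∂(leb.restrict (Set.Icc 0 T)),
      ‖u₁ s ω‖ ≤ C ∧ ‖u₂ s ω‖ ≤ C := by
    filter_upwards [hbdd₁, hbdd₂] with ω ⟨C₁, h₁⟩ ⟨C₂, h₂⟩
    refine ⟨max C₁ C₂, ?_⟩
    filter_upwards [h₁, h₂] with s k₁ k₂
    exact ⟨k₁.trans (le_max_left _ _), k₂.trans (le_max_right _ _)⟩
  have hint : ∀ᵐ ω ∂P, IntegrableOn (fun s => u₁ s ω) (Set.Icc 0 T) leb ∧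
      IntegrableOn (fun s => u₂ s ω) (Set.Icc 0 T) leb := by
    filter_upwards [hbdd] with ω ⟨C, hC⟩
    exact ⟨(integrable_const C).mono' (aestronglyMeasurable_path_of_progressive hp₁ ω)
      (hC.mono fun _ h => h.1), (integrable_const C).mono'
      (aestronglyMeasurable_path_of_progressive hp₂ ω) (hC.mono fun _ h => h.2)⟩
  have hsub : ∀ {t : ℝ≥0}, t ≤ T → Set.Icc 0 t ⊆ Set.Icc 0 T := fun ht => Set.Icc_subset_Icc_right ht
  have hYeq : ∀ t ≤ T, ∀ ω, Y t ω = ∫ s in Set.Icc 0 t, (u₁ s ω - u₂ s ω) ∂leb := fun t ht ω =>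
    setIntegral_congr_fun measurableSet_Icc fun s hs => by
      simp only [min_eq_left (hs.2.trans ht)]
  -- The Stratonovich series converge only as a whole. Subtracting the corrections, whose series
  -- converges in operator norm, isolates the limit of the pure Itô sums.
  let M : ℝ≥0 → Ω → H := fun t ω => N₁ t ω - N₂ t ω - (1 / 2 : ℝ) • S (Y t ω)
  have hM : ∀ t ≤ T, TendstoInMeasure P
      (fun n ω => ∑ k ∈ Finset.range n, (I₁ k t ω - I₂ k t ω)) atTop (M t) := fun t ht => by
    have hY : TendstoInMeasure P
        (fun n ω => -((1 / 2 : ℝ) • (∑ k ∈ Finset.range n, (R k).comp (R k)) (Y t ω))) atTop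
        (fun ω => -((1 / 2 : ℝ) • S (Y t ω))) := by
      refine tendstoInMeasure_of_tendsto_ae (fun n =>
        (((∑ k ∈ Finset.range n, (R k).comp (R k)).continuous.comp_aestronglyMeasurable
          (hYm t)).const_smul (1 / 2 : ℝ)).neg) (Eventually.of_forall fun ω => ?_)
      refine (Tendsto.const_smul ?_ _).neg
      exact (ContinuousLinearMap.apply ℝ H (Y t ω)).continuous.continuousAt.tendsto.comp
        hSsum.hasSum.tendsto_sum_nat
    have hall := tendstoInMeasure_add
      (tendstoInMeasure_add (hs₁ t ht) (tendstoInMeasure_neg (hs₂ t ht))) hY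
    refine TendstoInMeasure.congr (fun n => ?_) ?_ hall
    · filter_upwards [hint] with ω ⟨h₁, h₂⟩
      have e : ∀ (u : ℝ≥0 → Ω → H) k, (∫ s in Set.Icc 0 t, ContinuousLinearMap.id ℝ H
          (stratonovichCorrection (G k) (u s ω)) ∂leb)
          = ∫ s in Set.Icc 0 t, ((1 / 2 : ℝ) • (R k).comp (R k)) (u s ω) ∂leb := fun u k => by
        refine integral_congr_ae (Eventually.of_forall fun s => ?_)
        simp only [ContinuousLinearMap.id_apply, hcor]
        rfl
      have i₁ := h₁.mono_set (hsub ht)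
      have i₂ := h₂.mono_set (hsub ht)
      have eY : ∀ k, (∫ s in Set.Icc 0 t, ContinuousLinearMap.id ℝ H
            (stratonovichCorrection (G k) (u₁ s ω)) ∂leb)
          - (∫ s in Set.Icc 0 t, ContinuousLinearMap.id ℝ H
            (stratonovichCorrection (G k) (u₂ s ω)) ∂leb)
          = (1 / 2 : ℝ) • (R k).comp (R k) (Y t ω) := fun k => by
        rw [e, e, ContinuousLinearMap.integral_comp_comm _ i₁,
          ContinuousLinearMap.integral_comp_comm _ i₂, ← map_sub, ← integral_sub i₁ i₂,
          hYeq t ht]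
        rfl
      rw [sum_apply, Finset.smul_sum, ← sub_eq_add_neg, ← sub_eq_add_neg,
        ← Finset.sum_sub_distrib, ← Finset.sum_sub_distrib]
      refine Finset.sum_congr rfl fun k _ => ?_
      rw [← eY]
      abel
    · refine Eventually.of_forall fun ω => ?_
      simp only [M, sub_eq_add_neg]
  have hGc : ∀ k, Continuous (G k) := fun k => by
    have : G k = fun v => R k v + G k 0 := by
      funext v
      have := hG k v 0
      rw [sub_zero] at this
      rw [← this, sub_add_cancel]
    rw [this]
    exact (R k).continuous.add continuous_const
  refine ⟨M, hW, hsum, hskew, hp, ?_, ?_, ?_, fun t ht => ?_, ?_⟩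
  · have h1 : ∀ k, IsItoIntegral P 𝓕 T (W k) (fun s ω => G k (u₁ (min s T) ω)) (I₁ k) := fun k =>
      (hI₁ k).congr fun s hs ω => by rw [min_eq_left hs]; rfl
    have h2 : ∀ k, IsItoIntegral P 𝓕 T (W k) (fun s ω => G k (u₂ (min s T) ω)) (I₂ k) := fun k =>
      (hI₂ k).congr fun s hs ω => by rw [min_eq_left hs]; rfl
    have := hasSimpleApprox_of_isItoIntegral h1 h2 hM fun k ω =>
      (hGc k).comp_aestronglyMeasurable (((stronglyMeasurable_stopped hp₁).comp_measurable
        (g := fun s => (s, ω)) (by fun_prop)).aestronglyMeasurable)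
    simpa only [hG] using this
  · filter_upwards [hb₁, hb₂, hint] with ω h₁ h₂ ⟨i₁, i₂⟩
    exact (h₁.sub h₂).add ((S.integrable_comp (i₁.sub i₂)).smul (1 / 2 : ℝ))
  · filter_upwards [hinit₁, hinit₂] with ω h₁ h₂
    rw [min_eq_left (zero_le : (0 : ℝ≥0) ≤ T), h₁, h₂, sub_self]
  · filter_upwards [heq₁ t ht, heq₂ t ht, hinit₁, hinit₂, hb₁, hb₂, hint]
      with ω e₁ e₂ n₁ n₂ j₁ j₂ ⟨i₁, i₂⟩
    have j₁' := j₁.mono_set (hsub ht)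
    have j₂' := j₂.mono_set (hsub ht)
    have i' : IntegrableOn (fun s => u₁ s ω - u₂ s ω) (Set.Icc 0 t) leb :=
      (i₁.mono_set (hsub ht)).sub (i₂.mono_set (hsub ht))
    have k1 : IntegrableOn (fun s => b₁ s ω - b₂ s ω) (Set.Icc 0 t) leb := j₁'.sub j₂'
    have k2 : IntegrableOn (fun s => (1 / 2 : ℝ) • S (u₁ s ω - u₂ s ω)) (Set.Icc 0 t) leb :=
      (S.integrable_comp i').smul (1 / 2 : ℝ)
    rw [min_eq_left ht, e₁, e₂, n₁, n₂, integral_add k1 k2, integral_sub j₁' j₂', integral_smul,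
      S.integral_comp_comm i', ← hYeq t ht]
    simp only [M]
    abel
  · filter_upwards [hbdd] with ω ⟨C, hC⟩
    refine ⟨C + C, ?_⟩
    filter_upwards [hC, ae_restrict_mem measurableSet_Icc] with s hs hsT
    rw [min_eq_left hsT.2]
    exact (norm_sub_le _ _).trans (add_le_add hs.1 hs.2)

end

end SLLB

/-! ### Application to the Landau–Lifshitz–Bloch equation. -/

namespace SLLB

variable {d : ℕ} {D : Opens (Space d)}

/-- A finite norm forces a weak partial derivative to exist, since an empty infimum would be
infinite. Its definition includes local integrability of `f`. For `d = 0` there would be no infimum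
to use. -/
theorem aestronglyMeasurable_of_w1InftyNorm_lt_top (hd : 0 < d) {f : Space d → Spin}
    (h : w1InftyNorm D f < ∞) : AEStronglyMeasurable f (volOn D) := by
  have h1 := (ENNReal.sum_lt_top.1 (ENNReal.add_lt_top.1 h).2) ⟨0, hd⟩ (Finset.mem_univ _)
  obtain ⟨g, hg⟩ := iInf_lt_iff.1 h1
  obtain ⟨hw, -⟩ := iInf_lt_iff.1 hg
  exact hw.1.aestronglyMeasurable

theorem ae_norm_le_w1InftyNorm {f : Space d → Spin} (h : w1InftyNorm D f < ∞) :
    ∀ᵐ x ∂(volOn D), ‖f x‖ ≤ (w1InftyNorm D f).toReal := by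
  filter_upwards [ae_le_eLpNormEssSup (f := f) (μ := volOn D)] with x hx
  have h1 : ‖f x‖ₑ ≤ w1InftyNorm D f := hx.trans (by
    rw [w1InftyNorm, eLpNorm_exponent_top]
    exact le_self_add)
  rw [← toReal_enorm]
  exact ENNReal.toReal_mono h.ne h1

/-- The linear part of the noise coefficient. -/
theorem exists_noiseOperator [IsFiniteMeasure (volOn D)] {γ : ℝ} (hγ : 0 ≤ γ) (κ₁ : ℝ)
    {η : Space d → Spin} {c : ℝ} (hc0 : 0 ≤ c) (hη : AEStronglyMeasurable η (volOn D))
    (hc : ∀ᵐ x ∂(volOn D), ‖η x‖ ≤ c) :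
    ∃ R : L2 D →L[ℝ] L2 D, ‖R‖ ≤ γ * c ∧ (∀ v, ⟪v, R v⟫ = 0) ∧
      (∀ v w, noiseL2 γ κ₁ η v - noiseL2 γ κ₁ η w = R (v - w)) ∧
      ∀ v, stratonovichCorrection (noiseL2 γ κ₁ η) v = (1 / 2 : ℝ) • R (R v) := by
  obtain ⟨B, hB, hBv⟩ := exists_crossOperator (D := D) hc0 hη hc
  have hη2 : MemLp η 2 (volOn D) := MemLp.of_bound hη c hc
  have hG : ∀ v, noiseL2 γ κ₁ η v = (γ • B) v + κ₁ • toL2 D η := fun v => by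
    have hm : MemLp (fun x => γ • cross (v x) (η x) + κ₁ • η x) 2 (volOn D) :=
      ((memLp_cross_right hη hc (Lp.memLp v)).const_smul γ).add (hη2.const_smul κ₁)
    refine Lp.ext ?_
    filter_upwards [coeFn_toL2 hm, coeFn_toL2 hη2, hBv v, Lp.coeFn_smul γ (B v),
      Lp.coeFn_smul κ₁ (toL2 D η), Lp.coeFn_add (γ • B v) (κ₁ • toL2 D η)] with x h1 h2 h3 h4 h5 h6
    rw [noiseL2, h1, smul_apply, h6, Pi.add_apply, h4, h5, Pi.smul_apply,
      Pi.smul_apply, h2, h3]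
  -- `η × η = 0`: the additive part `κ₁ η` of the coefficient does not enter the Stratonovich
  -- correction, which becomes linear.
  have hR0 : (γ • B) (toL2 D η) = 0 := by
    rw [smul_apply]
    have : B (toL2 D η) = 0 := by
      refine Lp.ext ?_
      filter_upwards [hBv (toL2 D η), coeFn_toL2 hη2, Lp.coeFn_zero Spin 2 (volOn D)]
        with x h1 h2 h3
      rw [h1, h2, h3, cross_self, Pi.zero_apply]
    rw [this, smul_zero]
  refine ⟨γ • B, ?_, fun v => ?_, fun v w => ?_, fun v => ?_⟩
  · rw [norm_smul, Real.norm_of_nonneg hγ]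
    gcongr
  · rw [smul_apply, inner_smul_right]
    have : ⟪v, B v⟫ = 0 := by
      rw [L2.inner_def]
      refine integral_eq_zero_of_ae ?_
      filter_upwards [hBv v] with x hx
      rw [hx]
      exact inner_cross_self_left _ _
    rw [this, mul_zero]
  · rw [hG, hG, map_sub]
    abel
  · have e : noiseL2 γ κ₁ η = fun v => (γ • B) v + κ₁ • toL2 D η := funext hG
    have hf : fderiv ℝ (noiseL2 γ κ₁ η) v = γ • B := by
      rw [e]
      exact ((γ • B).hasFDerivAt.add_const _).fderiv
    rw [stratonovichCorrection, hf, hG, map_add, map_smul, hR0, smul_zero, add_zero]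

theorem exists_noiseOperators (hd : 0 < d) [IsFiniteMeasure (volOn D)] {γ : ℝ} (hγ : 0 ≤ γ)
    (κ₁ : ℝ) {h : ℕ → Space d → Spin} (hh : ∑' k, w1InftyNorm D (h k) ^ 2 < ∞) :
    ∃ R : ℕ → L2 D →L[ℝ] L2 D, (Summable fun k => ‖R k‖ ^ 2) ∧ (∀ k v, ⟪v, R k v⟫ = 0) ∧
      (∀ k v w, noiseL2 γ κ₁ (h k) v - noiseL2 γ κ₁ (h k) w = R k (v - w)) ∧
      ∀ k v, stratonovichCorrection (noiseL2 γ κ₁ (h k)) v = (1 / 2 : ℝ) • R k (R k v) := by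
  have hk : ∀ k, w1InftyNorm D (h k) < ∞ := fun k => by
    have := ENNReal.lt_top_of_tsum_ne_top hh.ne k
    exact ENNReal.pow_lt_top_iff.1 this |>.resolve_right two_ne_zero
  have := fun k => exists_noiseOperator hγ κ₁ ENNReal.toReal_nonneg
    (aestronglyMeasurable_of_w1InftyNorm_lt_top hd (hk k)) (ae_norm_le_w1InftyNorm (hk k))
  choose R h1 h2 h3 h4 using this
  refine ⟨R, ?_, h2, h3, h4⟩
  have hs : Summable fun k => (γ * (w1InftyNorm D (h k)).toReal) ^ 2 := by
    have := (ENNReal.summable_toReal hh.ne).mul_left (γ ^ 2)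
    refine this.congr fun k => ?_
    rw [ENNReal.toReal_pow, mul_pow]
  exact Summable.of_nonneg_of_le (fun k => sq_nonneg _)
    (fun k => pow_le_pow_left₀ (norm_nonneg _) (h1 k) 2) hs

section Application

variable {Ω : Type*} [mΩ : MeasurableSpace Ω] {P : Measure Ω} [IsProbabilityMeasure P]
  {𝓕 : Filtration ℝ≥0 mΩ} {W : ℕ → ℝ≥0 → Ω → ℝ} {T : ℝ≥0} {κ₁ κ₂ γ μ : ℝ}
  {h : ℕ → Space d → Spin} {u₀ : L2 D}

theorem HasStrongPaths.isStrongPath {u : ℝ≥0 → Ω → L2 D}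
    (hp : IsStronglyProgressive 𝓕 fun t => u (min t T)) (h : HasStrongPaths T P u) :
    ∀ᵐ ω ∂P, IsStrongPath (leb.restrict (Set.Icc 0 T)) fun s => u s ω := by
  filter_upwards [h] with ω ⟨⟨C, h1⟩, h2, h3⟩
  exact ⟨aestronglyMeasurable_path_of_progressive hp ω, ⟨C, h1.mono fun _ h => h.2⟩, h2, h3⟩

/-- The three drift integrals may be merged into one because each integrand is integrable along a
strong path. -/
theorem SatisfiesStrongEquation.eq_add_integral_llbDrift (hd : d = 1 ∨ d = 2)
    (hDb : Bornology.IsBounded (D : Set (Space d))) (hD : HasC2Boundary (D : Set (Space d)))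
    (hμ : 0 ≤ μ) {u : ℝ≥0 → Ω → L2 D}
    (hs : ∀ᵐ ω ∂P, IsStrongPath (leb.restrict (Set.Icc 0 T)) fun s => u s ω)
    (he : SatisfiesStrongEquation T κ₁ κ₂ γ μ h P 𝓕 W u) :
    ∃ N : ℝ≥0 → Ω → L2 D,
      IsStratonovichSum P 𝓕 T W (fun k => noiseL2 γ κ₁ (h k)) (ContinuousLinearMap.id ℝ (L2 D)) u
        N ∧
      ∀ t ≤ T, ∀ᵐ ω ∂P, u t ω
        = u 0 ω + ∫ s in Set.Icc 0 t, llbDrift κ₁ κ₂ γ μ (u s ω) ∂leb + N t ω := by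
  have := isFiniteMeasure_volOn hDb
  obtain ⟨N, hN, heq⟩ := he
  refine ⟨N, hN, fun t ht => ?_⟩
  filter_upwards [heq t ht, hs] with ω h1 h2
  have hsub : Set.Icc 0 t ⊆ Set.Icc 0 T := Set.Icc_subset_Icc_right ht
  have i1 : IntegrableOn (fun s => κ₁ • laplacian (u s ω)) (Set.Icc 0 t) leb :=
    (h2.integrable_laplacian.smul κ₁).mono_measure (Measure.restrict_mono hsub le_rfl)
  have i2 : IntegrableOn (fun s => γ • crossL2 (u s ω) (laplacian (u s ω))) (Set.Icc 0 t) leb :=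
    ((h2.integrable_crossL2_laplacian hd hDb hD).smul γ).mono_measure
      (Measure.restrict_mono hsub le_rfl)
  have i3 : IntegrableOn (fun s => κ₂ • dampingL2 μ (u s ω)) (Set.Icc 0 t) leb :=
    ((h2.integrable_dampingL2 hd hDb hD hμ).smul κ₂).mono_measure
      (Measure.restrict_mono hsub le_rfl)
  have i12 : IntegrableOn (fun s => κ₁ • laplacian (u s ω)
    + γ • crossL2 (u s ω) (laplacian (u s ω))) (Set.Icc 0 t) leb := i1.add i2
  rw [h1]
  simp only [llbDrift]
  rw [integral_sub i12 i3, integral_add i1 i2, integral_smul, integral_smul, integral_smul]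
  abel

theorem IsStrongPath.ae_norm_le {α : Type*} {m : MeasurableSpace α} {ν : Measure α} {U : α → L2 D}
    (h : IsStrongPath ν U) : ∃ C : ℝ, ∀ᵐ a ∂ν, ‖U a‖ ≤ C := by
  obtain ⟨C, hC⟩ := h.bdd
  exact ⟨C, hC.mono fun a ha => (norm_le_h1Norm _).trans ha⟩

/-- Two strong solutions with the same initial datum coincide. -/
theorem eq_of_satisfiesStrongEquation (hd : d = 1 ∨ d = 2)
    (hDb : Bornology.IsBounded (D : Set (Space d))) (hD : HasC2Boundary (D : Set (Space d)))
    (hκ₁ : 0 < κ₁) (hκ₂ : 0 ≤ κ₂) (hγ : 0 ≤ γ) (hμ : 0 ≤ μ)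
    (hh : ∑' k, w1InftyNorm D (h k) ^ 2 < ∞) {u₁ u₂ : ℝ≥0 → Ω → L2 D}
    (hW : IsWienerSequence P 𝓕 W)
    (hp₁ : IsStronglyProgressive 𝓕 fun t => u₁ (min t T))
    (hp₂ : IsStronglyProgressive 𝓕 fun t => u₂ (min t T))
    (hinit₁ : ∀ᵐ ω ∂P, u₁ 0 ω = u₀) (hinit₂ : ∀ᵐ ω ∂P, u₂ 0 ω = u₀)
    (hpath₁ : HasStrongPaths T P u₁) (hpath₂ : HasStrongPaths T P u₂)
    (hN₁ : HasNeumannPaths T P u₁) (hN₂ : HasNeumannPaths T P u₂)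
    (heq₁ : SatisfiesStrongEquation T κ₁ κ₂ γ μ h P 𝓕 W u₁)
    (heq₂ : SatisfiesStrongEquation T κ₁ κ₂ γ μ h P 𝓕 W u₂) :
    (∀ᵐ ω ∂P, ∀ᵐ t ∂(leb.restrict (Set.Icc 0 T)), u₁ t ω = u₂ t ω) ∧
    ∀ t ≤ T, ∀ᵐ ω ∂P, u₁ t ω = u₂ t ω := by
  have := isFiniteMeasure_volOn hDb
  have hd0 : 0 < d := by rcases hd with rfl | rfl <;> norm_num
  obtain ⟨R, hsum, hskew, hG, hcor⟩ := exists_noiseOperators hd0 hγ κ₁ hh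
  have s₁ := hpath₁.isStrongPath hp₁
  have s₂ := hpath₂.isStrongPath hp₂
  obtain ⟨N₁, hS₁, he₁⟩ := heq₁.eq_add_integral_llbDrift hd hDb hD hμ s₁
  obtain ⟨N₂, hS₂, he₂⟩ := heq₂.eq_add_integral_llbDrift hd hDb hD hμ s₂
  obtain ⟨M, hM⟩ := exists_isSkewNoiseEquation_sub hW hsum hskew hG hcor hp₁ hp₂ hS₁ hS₂
    (s₁.mono fun ω hω => hω.integrable_llbDrift hd hDb hD hμ)
    (s₂.mono fun ω hω => hω.integrable_llbDrift hd hDb hD hμ) he₁ he₂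
    (s₁.mono fun ω hω => hω.ae_norm_le) (s₂.mono fun ω hω => hω.ae_norm_le) hinit₁ hinit₂
  obtain ⟨K, hK, hdrift⟩ := exists_inner_drift_le hd hDb hD hκ₁ hκ₂ hγ hμ
  have hSsum : Summable fun k => (R k).comp (R k) :=
    Summable.of_norm_bounded hsum fun k => by
      rw [sq]
      exact ContinuousLinearMap.opNorm_comp_le _ _
  -- The half of the correction in the drift, doubled in the energy balance, is exactly minus the
  -- Itô term `∑ ‖R_k w‖²`.
  have hcorr : ∀ w : L2 D, ⟪w, (∑' k, (R k).comp (R k)) w⟫ = -∑' k, ‖R k w‖ ^ 2 := fun w => by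
    have e1 := ((innerSL ℝ w).comp (ContinuousLinearMap.apply ℝ (L2 D) w)).hasSum hSsum.hasSum
    have e2 := e1.tsum_eq
    rw [← tsum_neg]
    refine Eq.trans e2.symm (tsum_congr fun k => ?_)
    exact inner_comp_self_of_skew (hskew k) w
  obtain ⟨c1, c2⟩ := hM.eq_zero (by
    filter_upwards [s₁, s₂, hN₁, hN₂] with ω p₁ p₂ n₁ n₂
    -- The rate involves only the second solution, whose derivatives remain after integration by
    -- parts.
    refine ⟨fun s => K * gradFactor (u₂ s ω) + d * (K * gradFactor (u₂ s ω)) ^ 2 / κ₁,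
      fun s => ?_, p₂.integrable_rate K κ₁, ?_⟩
    · have := gradFactor_nonneg (u₂ s ω)
      positivity
    · filter_upwards [p₁.memH2, p₂.memH2, n₁, n₂, ae_restrict_mem measurableSet_Icc]
        with s m₁ m₂ q₁ q₂ hs
      rw [min_eq_left hs.2, inner_add_right, inner_smul_right, hcorr]
      have := hdrift _ _ m₁ m₂ q₁ q₂
      linarith)
  constructor
  · filter_upwards [c1] with ω hω
    filter_upwards [hω, ae_restrict_mem measurableSet_Icc] with s hs hsT
    rw [min_eq_left hsT.2] at hs
    exact sub_eq_zero.1 hs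
  · intro t ht
    filter_upwards [c2 t ht] with ω hω
    rw [min_eq_left ht] at hω
    exact sub_eq_zero.1 hω

/-- Modifications of each other with continuous paths are indistinguishable. -/
theorem forall_eq_of_continuousOn {E : Type*} [TopologicalSpace E] [T2Space E] {T : ℝ≥0}
    {u₁ u₂ : ℝ≥0 → Ω → E} (h : ∀ t ≤ T, ∀ᵐ ω ∂P, u₁ t ω = u₂ t ω)
    (h₁ : ∀ᵐ ω ∂P, ContinuousOn (fun t => u₁ t ω) (Set.Icc 0 T))
    (h₂ : ∀ᵐ ω ∂P, ContinuousOn (fun t => u₂ t ω) (Set.Icc 0 T)) :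
    ∀ᵐ ω ∂P, ∀ t ≤ T, u₁ t ω = u₂ t ω := by
  have hq : ∀ᵐ ω ∂P, ∀ n : ℕ, u₁ (min (denseSeq ℝ≥0 n) T) ω = u₂ (min (denseSeq ℝ≥0 n) T) ω :=
    ae_all_iff.2 fun n => h _ (min_le_right _ _)
  filter_upwards [hq, h₁, h₂] with ω hω c₁ c₂ t ht
  have hm : ∀ s : ℝ≥0, min s T ∈ Set.Icc 0 T := fun s => ⟨zero_le, min_le_right _ _⟩
  have hc : ∀ {f : ℝ≥0 → E}, ContinuousOn f (Set.Icc 0 T) → Continuous fun s => f (min s T) :=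
    fun hf => hf.comp_continuous (by fun_prop) hm
  have := (denseRange_denseSeq ℝ≥0).equalizer (hc c₁) (hc c₂) (funext hω)
  have := congrFun this t
  simpa only [min_eq_left ht] using this

end Application

end SLLB

theorem theorem2p3 (d : ℕ) (hd : d = 1 ∨ d = 2) (D : Opens (Space d))
    (hDconn : IsConnected (D : Set (Space d))) (hDbdd : Bornology.IsBounded (D : Set (Space d)))
    (hDC2 : HasC2Boundary (D : Set (Space d)))
    (κ₁ κ₂ γ μ : ℝ) (hκ₁ : 0 < κ₁) (hκ₂ : 0 < κ₂) (hγ : 0 < γ) (hμ : 0 < μ)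
    (h : ℕ → Space d → Spin) (hh : ∑' k, w1InftyNorm D (h k) ^ 2 < ∞)
    (T : ℝ≥0) (hT : 0 < T) (u₀ : L2 D) (hu₀ : MemH1 u₀)
    {Ω : Type*} [mΩ : MeasurableSpace Ω] (P : Measure Ω) [IsProbabilityMeasure P]
    (𝓕 : Filtration ℝ≥0 mΩ) (W : ℕ → ℝ≥0 → Ω → ℝ) (u₁ u₂ : ℝ≥0 → Ω → L2 D)
    (hsol₁ : IsWeakMartingaleSolution T κ₁ κ₂ γ μ h u₀ P 𝓕 W u₁)
    (hsol₂ : IsWeakMartingaleSolution T κ₁ κ₂ γ μ h u₀ P 𝓕 W u₂)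
    (hinit₁ : ∀ᵐ ω ∂P, u₁ 0 ω = u₀) (hinit₂ : ∀ᵐ ω ∂P, u₂ 0 ω = u₀)
    (hpath₁ : HasStrongPaths T P u₁) (hpath₂ : HasStrongPaths T P u₂)
    (hN₁ : HasNeumannPaths T P u₁) (hN₂ : HasNeumannPaths T P u₂)
    (heq₁ : SatisfiesStrongEquation T κ₁ κ₂ γ μ h P 𝓕 W u₁)
    (heq₂ : SatisfiesStrongEquation T κ₁ κ₂ γ μ h P 𝓕 W u₂) :
    (∀ᵐ ω ∂P, ∀ᵐ t ∂(leb.restrict (Set.Icc 0 T)), u₁ t ω = u₂ t ω) ∧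
    (∀ t ≤ T, ∀ᵐ ω ∂P, u₁ t ω = u₂ t ω) ∧
    ((∀ᵐ ω ∂P, ContinuousOn (fun t => u₁ t ω) (Set.Icc 0 T)) →
      (∀ᵐ ω ∂P, ContinuousOn (fun t => u₂ t ω) (Set.Icc 0 T)) →
      ∀ᵐ ω ∂P, ∀ t ≤ T, u₁ t ω = u₂ t ω) := by
  obtain ⟨h₁, h₂⟩ := eq_of_satisfiesStrongEquation hd hDbdd hDC2 hκ₁ hκ₂.le hγ.le hμ.le hh
    hsol₁.wiener hsol₁.progressive hsol₂.progressive hinit₁ hinit₂ hpath₁ hpath₂ hN₁ hN₂ heq₁ heq₂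
  exact ⟨h₁, h₂, forall_eq_of_continuousOn h₂⟩
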